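/- For $g\ge 1$ and $p\ge 0$ let $S_{g,p}$ be the orientable surface of genus $g$ with $p$ punctures (the closed orientable surface $S_g$ of genus $g$ with $p$ points removed), and let $\omega(g,p)=3g+p-4$. A simple closed curve on $S_{g,p}$ is \emph{essential} if it is neither homotopically trivial nor homotopic into a neighborhood of a puncture, and \emph{separating} if its complement in $S_{g,p}$ is disconnected. For essential simple closed curves $\alpha,\beta$ put $i(\alpha,\beta)=\min|x\cap\beta|$, where $x$ ranges over the simple closed curves freely homotopic to $\alpha$; the curves are in \emph{minimal position} if $|\alpha\cap\beta|=i(\alpha,\beta)$. A \emph{filling pair} on $S_{g,p}$ is a pair $(\alpha,\beta)$ of essential simple closed curves in minimal position such that every connected component of $S_{g,p}\setminus(\alpha\cup\beta)$ is an open disk or a once-punctured open disk (an open disk in $S_g$ with one of the $p$ punctures removed). \textbf{Lemma (Separating filling pairs).} There exists a constant $C\ge 0$ such that for every $g\ge 2$ and every $p\in\{0,1\}$ there is a filling pair $(\alpha,\beta)$ on $S_{g,p}$ with both $\alpha$ and $\beta$ separating and $i(\alpha,\beta)\le C\cdot\omega(g,p)$. -/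

import Mathlib

open Set Topology

noncomputable section

namespace SurfaceCurves

/-- The closed unit disk, viewed as a polygon whose sides are arcs of the unit circle. -/
abbrev Disk : Type := Metric.closedBall (0 : ℂ) 1

/-- The point of the unit circle that lies `u` sides along the boundary of the `4g`-gon, starting
at `1` and going counterclockwise. Side number `k` (counted from `0`) is `{boundaryPt g u | k ≤ u ≤ k + 1}`. -/
def boundaryPt (g : ℕ) (u : ℝ) : Disk :=
  ⟨Complex.exp ((2 * Real.pi * (u / (4 * g)) : ℝ) * Complex.I), by
    rw [mem_closedBall_zero_iff, Complex.norm_exp_ofReal_mul_I]⟩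

/-- The side identifications of the `4g`-gon with boundary word
`a₁ b₁ a₁⁻¹ b₁⁻¹ ⋯ a_g b_g a_g⁻¹ b_g⁻¹`: for each `j < g`, side `4j` is glued to side `4j + 2` and
side `4j + 1` is glued to side `4j + 3`, in both cases reversing the boundary direction. -/
def sideGluing (g : ℕ) (z w : Disk) : Prop :=
  ∃ j < g, ∃ e : ℕ, (e = 0 ∨ e = 1) ∧ ∃ s ∈ Icc (0 : ℝ) 1,
    z = boundaryPt g (4 * j + e + s) ∧ w = boundaryPt g (4 * j + e + 2 + (1 - s))

/-- The closed orientable surface of genus `g ≥ 1`: the quotient of the `4g`-gon by the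
equivalence relation generated by its side identifications, with the quotient topology. -/
def ClosedSurface (g : ℕ) : Type := Quot (sideGluing g)

instance (g : ℕ) : TopologicalSpace (ClosedSurface g) :=
  inferInstanceAs (TopologicalSpace (Quot (sideGluing g)))

/-- The `k`-th of `p` distinct points in the interior of the polygon: the real number `k / p`. -/
def interiorPt (p : ℕ) (k : Fin p) : Disk :=
  ⟨(((k : ℕ) / p : ℝ) : ℂ), by
    rw [mem_closedBall_zero_iff, Complex.norm_real, Real.norm_of_nonneg (by positivity)]
    exact div_le_one_of_le₀ (by exact_mod_cast k.2.le) (by positivity)⟩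

/-- The set of the `p` points that are removed from the closed surface of genus `g`. -/
def punctures (g p : ℕ) : Set (ClosedSurface g) :=
  range fun k : Fin p => (Quot.mk (sideGluing g) (interiorPt p k) : ClosedSurface g)

/-- `S_{g,p}`, the orientable surface of genus `g ≥ 1` with `p` punctures. -/
abbrev Surface (g p : ℕ) : Type := {x : ClosedSurface g // x ∉ punctures g p}

/-- The complexity `ω(g,p) = 3g + p - 4` (an integer, without truncation). -/
def complexity (g p : ℕ) : ℤ := 3 * g + p - 4

/-- A closed curve, parametrized by the circle. `ContinuousMap.Homotopic` is free homotopy. -/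
abbrev ClosedCurve (X : Type) [TopologicalSpace X] : Type := C(Circle, X)

/-- A closed curve is simple if its parametrization is injective. -/
def IsSimple {X : Type} [TopologicalSpace X] (a : ClosedCurve X) : Prop :=
  Function.Injective a

/-- A closed curve is homotopic into a neighborhood of a puncture if, for some puncture `q`, it can
be freely homotoped inside `S_{g,p}` into arbitrarily small neighborhoods of `q`. -/
def IsPeripheral {g p : ℕ} (a : ClosedCurve (Surface g p)) : Prop :=
  ∃ q ∈ punctures g p, ∀ W ∈ 𝓝 q, ∃ b : ClosedCurve (Surface g p),
    ContinuousMap.Homotopic a b ∧ ∀ t, (b t : ClosedSurface g) ∈ W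

/-- A closed curve is essential if it is neither homotopically trivial nor homotopic into a
neighborhood of a puncture. -/
def IsEssential {g p : ℕ} (a : ClosedCurve (Surface g p)) : Prop :=
  ¬ ContinuousMap.Nullhomotopic a ∧ ¬ IsPeripheral a

/-- A closed curve is separating if its complement is disconnected. -/
def IsSeparating {X : Type} [TopologicalSpace X] (a : ClosedCurve X) : Prop :=
  ¬ IsPreconnected (range a)ᶜ

/-- The geometric intersection number `i(a,b)`: the minimum of `|x ∩ b|` over all simple closed
curves `x` freely homotopic to `a`. An infimum in `ℕ∞` over a nonempty family is attained. -/
def geomInt {X : Type} [TopologicalSpace X] (a b : ClosedCurve X) : ℕ∞ :=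
  ⨅ (x : ClosedCurve X) (_ : IsSimple x) (_ : ContinuousMap.Homotopic x a),
    (range x ∩ range b).encard

/-- Two curves are in minimal position if `|a ∩ b| = i(a,b)`. -/
def InMinimalPosition {X : Type} [TopologicalSpace X] (a b : ClosedCurve X) : Prop :=
  (range a ∩ range b).encard = geomInt a b

/-- A subset of a space is an open disk if it is homeomorphic to the open unit disk. -/
def IsOpenDisk {X : Type} [TopologicalSpace X] (U : Set X) : Prop :=
  Nonempty (U ≃ₜ Metric.ball (0 : ℂ) 1)

/-- A subset `U` of `S_{g,p}` is a once-punctured disk if adding one of the punctures to it gives an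
open disk in the closed surface. (Being merely homeomorphic to a punctured disk would also admit
annuli that do not surround a puncture.) -/
def IsOncePuncturedDisk {g p : ℕ} (U : Set (Surface g p)) : Prop :=
  ∃ q ∈ punctures g p, IsOpenDisk (insert q ((fun x : Surface g p => (x : ClosedSurface g)) '' U))

/-- `a` and `b` fill `S_{g,p}`: they are in minimal position and each connected component of the
complement of their union is an open disk or a once-punctured disk. -/
def Fills {g p : ℕ} (a b : ClosedCurve (Surface g p)) : Prop :=
  InMinimalPosition a b ∧
    ∀ x ∈ (range a ∪ range b)ᶜ,
      IsOpenDisk (connectedComponentIn (range a ∪ range b)ᶜ x) ∨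
        IsOncePuncturedDisk (connectedComponentIn (range a ∪ range b)ᶜ x)

/-- A filling pair on `S_{g,p}`: two essential simple closed curves that fill. -/
structure IsFillingPair {g p : ℕ} (a b : ClosedCurve (Surface g p)) : Prop where
  simple_left : IsSimple a
  simple_right : IsSimple b
  essential_left : IsEssential a
  essential_right : IsEssential b
  fills : Fills a b

end SurfaceCurves

end

/-! Cut the `4g`-gon by a chord between two corners, with one handle on one side and `g - 1` on the
other. All corners are one point of the surface, the vertex, so the chord closes up to a simple loop
`β`; it separates because no side is glued to a side across the chord. Sweep both halves by segments
from the chord to the sides: a point gets a boundary coordinate `u` and a height `t`, with `t = 0`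
on the chord and `t = 1` on the sides. The curve `α` consists of the `N - 1` segments ("lines") over
the integral points `1, …, N - 1` of the chord, each crossing both halves. The ends of the lines on
the sides are matched by the side gluing, except that in each half one line ends at a corner. Thus
`α` leaves the vertex, crosses the chord `N - 1` times and returns to the vertex, and meets `β` in
`N` points.

Everything is then read off from the positions of the lines.

Separation. The gluing pairs lines whose indices have opposite parity, so the colouring of the gaps
between lines by the parity of their index is compatible with the gluing (`floor_partner`); hence
`α` separates (`lineSet_separates`).

Filling. Every complementary component is an open rectangle. Between two consecutive lines on one
side it is a strip that continues through the opposite side (`isOpenDisk_strip`). Near the vertex,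
the sectors at the corners of one half are glued cyclically into a fan from the chord back to the
chord, and the line through a corner cuts the fan into two rectangles (`isOpenDisk_fan`).

Minimal position and essentiality. A height function together with a circle coordinate maps the
surface to a Klein bottle, covered by `ℝ × S¹` with infinite dihedral deck group (`exists_height`).
Only `β` lies over the half-integers, and `α` lifts to a path of displacement `N` (`exists_lift`).
Any curve freely homotopic to `α` has a lift with the same deck transformation, a translation by
`N`, so by the intermediate value theorem it crosses `β` at least `N` times (`le_geomInt_of_lift`).
The same lift shows that `α` is not null-homotopic. For `β` a second map is used, under which the
boundary of the one-handle half becomes the commutator of two reflections, a nontrivial translation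
(`exists_wrap`). The puncture, if there is one, lies in a complementary disk, so a peripheral curve
would be null-homotopic in the closed surface (`isEssential_restrictCurve`).

Existence of the lines. The two halves give two parity-reversing involutions on `{0, …, N - 1}`,
where `0` stands for the vertex, and the lines form one closed curve exactly when these act
transitively (`exists_alternating`). With two lines on every side of all but one handle of the large
half and a suitable number on the last handle, transitivity follows from an orbit computation that
shifts by blocks of eight and leaves finitely many points (`exists_transitive`). This gives `N ≤ 8g
+ 8`, which is linear in the complexity. -/

noncomputable section

namespace SurfaceCurves

/-! ### Quotients of compact spaces -/

/-- By compactness the saturation of a closed set is the projection of a compact set, so the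
quotient map is closed. Disjoint fibres are then separated by normality, and complements of images
of closed sets are the required neighbourhoods. -/
theorem t2Space_of_isQuotientMap {X Y : Type*} [TopologicalSpace X] [TopologicalSpace Y]
    [CompactSpace X] [T2Space X] {f : X → Y} (hf : IsQuotientMap f)
    (hcl : IsClosed {p : X × X | f p.1 = f p.2}) : T2Space Y := by
  have hclosed : IsClosedMap f := by
    intro C hC
    rw [← hf.isClosed_preimage]
    have : f ⁻¹' (f '' C) = Prod.snd '' ({p : X × X | f p.1 = f p.2} ∩ C ×ˢ univ) := by
      ext x
      constructor
      · rintro ⟨c, hc, h⟩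
        exact ⟨(c, x), ⟨h, hc, trivial⟩, rfl⟩
      · rintro ⟨⟨c, y⟩, ⟨h, hc, -⟩, rfl⟩
        exact ⟨c, hc, h⟩
    rw [this]
    exact ((hcl.inter (hC.prod isClosed_univ)).isCompact.image continuous_snd).isClosed
  have hfib : ∀ y, IsClosed (f ⁻¹' {y}) := by
    intro y
    obtain ⟨x, rfl⟩ := hf.surjective y
    have : IsClosed (f '' {x}) := hclosed _ isClosed_singleton
    rw [image_singleton] at this
    exact this.preimage hf.continuous
  refine ⟨fun y z hyz => ?_⟩
  have hd : Disjoint (f ⁻¹' {y}) (f ⁻¹' {z}) :=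
    Disjoint.preimage f (by simpa using hyz)
  obtain ⟨U, V, hU, hV, hyU, hzV, hUV⟩ := normal_separation
    (hfib y) (hfib z) hd
  refine ⟨(f '' Uᶜ)ᶜ, (f '' Vᶜ)ᶜ, (hclosed _ hU.isClosed_compl).isOpen_compl,
    (hclosed _ hV.isClosed_compl).isOpen_compl, ?_, ?_, ?_⟩
  · rintro ⟨x, hx, h⟩
    exact hx (hyU h)
  · rintro ⟨x, hx, h⟩
    exact hx (hzV h)
  · rw [Set.disjoint_left]
    intro w hw hw'
    obtain ⟨x, rfl⟩ := hf.surjective w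
    have h1 : x ∈ U := by_contra fun h => hw ⟨x, h, rfl⟩
    have h2 : x ∈ V := by_contra fun h => hw' ⟨x, h, rfl⟩
    exact Set.disjoint_left.1 hUV h1 h2

/-! ### Concatenating continuous families -/

theorem continuousOn_ite_le {P X : Type*} [TopologicalSpace P] [TopologicalSpace X]
    {F G : ℝ × P → X} {a b c : ℝ} {S : Set P} [DecidablePred fun x : ℝ × P => x.1 ≤ b]
    (hF : ContinuousOn F (Icc a b ×ˢ S)) (hG : ContinuousOn G (Icc b c ×ˢ S))
    (h : ∀ p ∈ S, F (b, p) = G (b, p)) :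
    ContinuousOn (fun x : ℝ × P => if x.1 ≤ b then F x else G x) (Icc a c ×ˢ S) := by
  refine ContinuousOn.if' ?_ ?_ ?_ ?_
  · rintro ⟨t, p⟩ ⟨⟨ht, hp⟩, hfr⟩
    have htb : t = b := by
      have := frontier_le_subset_eq continuous_fst continuous_const hfr
      exact this
    subst htb
    simp only [le_refl, if_true]
    refine (hF (t, p) ⟨⟨ht.1, le_rfl⟩, hp⟩).mono ?_
    rintro ⟨s, p'⟩ ⟨⟨hs, hp'⟩, hle⟩
    exact ⟨⟨hs.1, hle⟩, hp'⟩
  · rintro ⟨t, p⟩ ⟨⟨ht, hp⟩, hfr⟩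
    have htb : t = b := by
      have := frontier_le_subset_eq continuous_fst continuous_const hfr
      exact this
    subst htb
    simp only [le_refl, if_true]
    rw [h p hp]
    refine (hG (t, p) ⟨⟨le_rfl, ht.2⟩, hp⟩).mono ?_
    rintro ⟨s, p'⟩ ⟨⟨hs, hp'⟩, hle⟩
    exact ⟨⟨(not_le.1 hle).le, hs.2⟩, hp'⟩
  · rintro ⟨t, p⟩ ⟨⟨ht, hp⟩, hcl'⟩
    refine (hF (t, p) ⟨⟨ht.1, hcl'⟩, hp⟩).mono ?_
    rintro ⟨s, p'⟩ ⟨⟨hs, hp'⟩, hle⟩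
    have : s ≤ b := hle
    exact ⟨⟨hs.1, this⟩, hp'⟩
  · rintro ⟨t, p⟩ ⟨⟨ht, hp⟩, hcl'⟩
    refine (hG (t, p) ⟨⟨(not_le.1 hcl').le, ht.2⟩, hp⟩).mono ?_
    rintro ⟨s, p'⟩ ⟨⟨hs, hp'⟩, hle⟩
    have : ¬ s ≤ b := hle
    exact ⟨⟨(not_le.1 this).le, hs.2⟩, hp'⟩

/-- Continuous families over `[0, 1]` that match at the ends can be put side by side. -/
theorem exists_concat {P X : Type*} [TopologicalSpace P] [TopologicalSpace X]
    (f : ℕ → ℝ × P → X) (S : Set P) (n : ℕ)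
    (hf : ∀ k ≤ n, ContinuousOn (f k) (Icc 0 1 ×ˢ S))
    (hglue : ∀ k < n, ∀ p ∈ S, f k (1, p) = f (k + 1) (0, p)) :
    ∃ F : ℝ × P → X, ContinuousOn F (Icc 0 (n + 1 : ℝ) ×ˢ S) ∧
      ∀ k ≤ n, ∀ s ∈ Icc (0 : ℝ) 1, ∀ p ∈ S, F (k + s, p) = f k (s, p) := by
  induction n with
  | zero =>
    refine ⟨f 0, by simpa using hf 0 le_rfl, ?_⟩
    intro k hk s _ p _
    obtain rfl : k = 0 := by omega
    simp
  | succ n ih =>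
    obtain ⟨F, hF, hFk⟩ := ih (fun k hk => hf k (by omega)) (fun k hk => hglue k (by omega))
    classical
    refine ⟨fun x => if x.1 ≤ (n + 1 : ℝ) then F x else f (n + 1) (x.1 - (n + 1), x.2), ?_, ?_⟩
    · refine continuousOn_ite_le (b := (n + 1 : ℝ)) (by simpa using hF)
        (G := fun x => f (n + 1) (x.1 - (n + 1), x.2)) ?_ ?_
      · refine (hf (n + 1) le_rfl).comp (by fun_prop) ?_
        rintro ⟨t, p⟩ ⟨⟨h1, h2⟩, hp⟩
        push_cast at h2
        dsimp only at h1 h2 hp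
        exact ⟨⟨by dsimp only; linarith, by dsimp only; linarith⟩, hp⟩
      · intro p hp
        have h1 := hFk n le_rfl 1 (by simp) p hp
        have h2 := hglue n (by omega) p hp
        rw [h1, h2]
        simp
    · intro k hk s hs p hp
      rcases Nat.lt_or_ge n k with h | h
      · obtain rfl : k = n + 1 := by omega
        push_cast
        by_cases hs0 : (n + 1 + s : ℝ) ≤ n + 1
        · obtain rfl : s = 0 := le_antisymm (by linarith) hs.1
          rw [if_pos hs0]
          have h1 := hFk n le_rfl 1 (by simp) p hp
          have h2 := hglue n (by omega) p hp
          rw [add_zero, h1, h2]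
        · rw [if_neg hs0]
          simp
      · have hle : (k + s : ℝ) ≤ n + 1 := by
          have : (k : ℝ) ≤ n := by exact_mod_cast h
          linarith [hs.2]
        simp only [hle, if_true]
        exact hFk k h s hs p hp

/-! ### Closed curves from paths -/

/-- The point of the circle after `t` full turns. -/
def turn (t : ℝ) : Circle := Circle.exp (2 * Real.pi * t)

theorem continuous_turn : Continuous turn := by
  unfold turn; fun_prop

theorem turn_zero : turn 0 = 1 := by simp [turn]

theorem turn_one : turn 1 = 1 := by simp [turn]

theorem turn_eq_toCircle (t : ℝ) : turn t = AddCircle.toCircle (t : AddCircle (1 : ℝ)) := by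
  rw [AddCircle.toCircle_apply_mk, turn]; congr 1; ring

theorem turn_injOn : InjOn turn (Ioc 0 1) := by
  intro s hs t ht h
  rw [turn_eq_toCircle, turn_eq_toCircle] at h
  have h1 := AddCircle.injective_toCircle one_ne_zero h
  exact (AddCircle.coe_eq_coe_iff_of_mem_Ioc (p := (1 : ℝ)) (a := 0) (by simpa using hs)
    (by simpa using ht)).1 h1

theorem exists_turn_eq (z : Circle) : ∃ t ∈ Ico (0 : ℝ) 1, turn t = z := by
  obtain ⟨w, rfl⟩ := (AddCircle.homeomorphCircle (T := 1) one_ne_zero).surjective z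
  obtain ⟨t, ht, rfl⟩ : ∃ t ∈ Ico (0 : ℝ) 1, (t : AddCircle (1 : ℝ)) = w := by
    have := AddCircle.coe_image_Ico_eq (1 : ℝ) 0
    have hw : w ∈ ((↑) : ℝ → AddCircle (1 : ℝ)) '' Ico 0 (0 + 1) := by rw [this]; trivial
    simpa using hw
  exact ⟨t, ht, by rw [turn_eq_toCircle, AddCircle.homeomorphCircle_apply]⟩

/-- Both curves of the pair are built as paths on an interval whose length counts lines; the
parametrization by `turn` is recorded because the lifts are compared with it later. -/
theorem exists_closedCurve {X : Type} [TopologicalSpace X] {L : ℝ} (hL : 0 < L) {f : ℝ → X}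
    (hf : ContinuousOn f (Icc 0 L)) (h0 : f 0 = f L) :
    ∃ c : ClosedCurve X, (∀ t ∈ Icc (0 : ℝ) 1, c (turn t) = f (L * t)) ∧
      range c = f '' Ico 0 L ∧ (InjOn f (Ico 0 L) → IsSimple c) := by
  have hcont : Continuous (AddCircle.liftIco 1 0 fun t => f (L * t)) := by
    refine AddCircle.liftIco_continuous (by simpa using h0) ?_
    refine hf.comp (by fun_prop) ?_
    intro t ht
    simp only [zero_add, mem_Icc] at ht
    exact ⟨by nlinarith [ht.1], by nlinarith [ht.2]⟩
  let c : ClosedCurve X := ⟨fun z => AddCircle.liftIco 1 0 (fun t => f (L * t))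
    ((AddCircle.homeomorphCircle (T := 1) one_ne_zero).symm z), hcont.comp (by fun_prop)⟩
  have hc : ∀ t : ℝ, c (turn t) = AddCircle.liftIco 1 0 (fun t => f (L * t)) t := by
    intro t
    change AddCircle.liftIco 1 0 (fun t => f (L * t))
      ((AddCircle.homeomorphCircle (T := 1) one_ne_zero).symm (turn t)) = _
    rw [turn_eq_toCircle, ← AddCircle.homeomorphCircle_apply one_ne_zero,
      Homeomorph.symm_apply_apply]
  have hIco : ∀ t ∈ Ico (0 : ℝ) 1, c (turn t) = f (L * t) := by
    intro t ht
    rw [hc, AddCircle.liftIco_zero_coe_apply ht]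
  refine ⟨c, ?_, ?_, ?_⟩
  · intro t ht
    rcases ht.2.eq_or_lt with rfl | h
    · rw [turn_one, ← turn_zero, hIco 0 (by simp)]
      simpa using h0
    · exact hIco t ⟨ht.1, h⟩
  · ext x
    constructor
    · rintro ⟨z, rfl⟩
      obtain ⟨t, ht, rfl⟩ := exists_turn_eq z
      exact ⟨L * t, ⟨by nlinarith [ht.1], by nlinarith [ht.2]⟩, (hIco t ht).symm⟩
    · rintro ⟨t, ht, rfl⟩
      have h1 : t / L ∈ Ico (0 : ℝ) 1 := ⟨div_nonneg ht.1 hL.le, (div_lt_one hL).2 ht.2⟩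
      refine ⟨turn (t / L), ?_⟩
      rw [hIco _ h1]
      congr 1
      field_simp
  · intro hinj z w hzw
    obtain ⟨t, ht, rfl⟩ := exists_turn_eq z
    obtain ⟨s, hs, rfl⟩ := exists_turn_eq w
    rw [hIco t ht, hIco s hs] at hzw
    have := hinj ⟨by nlinarith [ht.1], by nlinarith [ht.2]⟩
      ⟨by nlinarith [hs.1], by nlinarith [hs.2]⟩ hzw
    rw [mul_left_cancel₀ hL.ne' this]

/-! ### Interpolating by an increasing homeomorphism of the line -/

theorem exists_orderIso_stretch (c : ℝ) {s : ℝ} (hs : 0 < s) :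
    ∃ φ : ℝ ≃o ℝ, (∀ x ≤ c, φ x = x) ∧ ∀ x, c ≤ x → φ x = c + s * (x - c) := by
  classical
  let f : ℝ → ℝ := fun x => if x ≤ c then x else c + s * (x - c)
  have h1 : ∀ x ≤ c, f x = x := fun x hx => if_pos hx
  have h2 : ∀ x, c ≤ x → f x = c + s * (x - c) := by
    intro x hx
    rcases hx.eq_or_lt with rfl | h
    · rw [h1 _ le_rfl]; ring
    · exact if_neg (not_le.2 h)
  have hmono : StrictMono f := by
    intro x y hxy
    rcases le_total y c with hy | hy
    · rw [h1 x (hxy.le.trans hy), h1 y hy]; exact hxy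
    · rcases le_total x c with hx | hx
      · rw [h1 x hx, h2 y hy]
        rcases hx.eq_or_lt with rfl | h
        · nlinarith
        · nlinarith [mul_nonneg hs.le (sub_nonneg.2 hy)]
      · rw [h2 x hx, h2 y hy]; nlinarith
  have hsurj : Function.Surjective f := by
    intro y
    rcases le_total y c with hy | hy
    · exact ⟨y, h1 y hy⟩
    · refine ⟨c + (y - c) / s, ?_⟩
      rw [h2 _ (by have := div_nonneg (sub_nonneg.2 hy) hs.le; linarith)]
      field_simp
      ring
  exact ⟨hmono.orderIsoOfSurjective f hsurj, h1, h2⟩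

/-- Induction on the nodes: composing with a stretch that is the identity up to the last node
corrects the next value and disturbs no earlier one. It lets the lines sit over integers on the
chord while their ends are at prescribed places on the sides. -/
theorem exists_orderIso_interpolating (u : ℕ → ℝ) (N : ℕ) (hu : ∀ j < N, u j < u (j + 1)) :
    ∃ E : ℝ ≃o ℝ, ∀ j ≤ N, E j = u j := by
  induction N with
  | zero =>
    refine ⟨OrderIso.addRight (u 0), ?_⟩
    intro j hj
    obtain rfl : j = 0 := by omega
    simp
  | succ N ih =>
    obtain ⟨E, hE⟩ := ih fun j hj => hu j (by omega)
    have hN : u N < E (N + 1) := by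
      rw [← hE N le_rfl]; exact E.strictMono (by simp)
    obtain ⟨φ, h1, h2⟩ := exists_orderIso_stretch (u N)
      (s := (u (N + 1) - u N) / (E (N + 1) - u N))
      (div_pos (sub_pos.2 (hu N (by omega))) (sub_pos.2 hN))
    refine ⟨E.trans φ, ?_⟩
    intro j hj
    rw [OrderIso.trans_apply]
    rcases Nat.lt_or_ge N j with h | h
    · obtain rfl : j = N + 1 := by omega
      push_cast
      rw [h2 _ hN.le]
      have : E (N + 1) - u N ≠ 0 := (sub_pos.2 hN).ne'
      field_simp
      ring
    · rw [hE j h]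
      refine h1 _ ?_
      rw [← hE j h, ← hE N le_rfl]
      exact E.monotone (by exact_mod_cast h)

/-! ### A covering with infinite dihedral deck group -/

/-- The infinite dihedral group acts on `ℝ × S¹` by translations of the line by even integers and
by reflections of the line in integers, the latter combined with the antipodal map. -/
instance : MulAction (DihedralGroup 0) (ℝ × Circle) where
  smul g y := match g with
    | .r i => (y.1 + 2 * ((show ℤ from i) : ℝ), y.2)
    | .sr i => (-y.1 - 2 * ((show ℤ from i) : ℝ), -y.2)
  one_smul y := by
    change (y.1 + 2 * (((0 : ℤ)) : ℝ), y.2) = y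
    simp
  mul_smul g g' y := by
    rcases g with i | i <;> rcases g' with j | j <;> change ℤ at i j
    · change (y.1 + 2 * ((i + j : ℤ) : ℝ), y.2) =
        (y.1 + 2 * (j : ℝ) + 2 * (i : ℝ), y.2)
      ext
      · push_cast; ring
      · rfl
    · change (-y.1 - 2 * ((j - i : ℤ) : ℝ), -y.2) =
        (-y.1 - 2 * (j : ℝ) + 2 * (i : ℝ), -y.2)
      ext
      · push_cast; ring
      · rfl
    · change (-y.1 - 2 * ((i + j : ℤ) : ℝ), -y.2) =
        (-(y.1 + 2 * (j : ℝ)) - 2 * (i : ℝ), -y.2)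
      ext
      · push_cast; ring
      · rfl
    · change (y.1 + 2 * ((j - i : ℤ) : ℝ), y.2) =
        (-(-y.1 - 2 * (j : ℝ)) - 2 * (i : ℝ), - -y.2)
      ext
      · push_cast; ring
      · simp

theorem r_smul (i : ℤ) (y : ℝ × Circle) :
    (DihedralGroup.r i : DihedralGroup 0) • y = (y.1 + 2 * (i : ℝ), y.2) := rfl

theorem sr_smul (i : ℤ) (y : ℝ × Circle) :
    (DihedralGroup.sr i : DihedralGroup 0) • y = (-y.1 - 2 * (i : ℝ), -y.2) := rfl

theorem dihedral_cases (g : DihedralGroup 0) :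
    (∃ i : ℤ, g = DihedralGroup.r i) ∨ ∃ i : ℤ, g = DihedralGroup.sr i := by
  rcases g with i | i
  · exact Or.inl ⟨i, rfl⟩
  · exact Or.inr ⟨i, rfl⟩

/-- The quotient of `ℝ × S¹` by the infinite dihedral group (a Klein bottle). -/
abbrev KleinBottle : Type := MulAction.orbitRel.Quotient (DihedralGroup 0) (ℝ × Circle)

/-- The covering of the Klein bottle by the cylinder. -/
def kleinProj (y : ℝ × Circle) : KleinBottle := Quotient.mk _ y

theorem kleinProj_smul (g : DihedralGroup 0) (y : ℝ × Circle) :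
    kleinProj (g • y) = kleinProj y :=
  Quotient.sound (MulAction.mem_orbit y g)

theorem kleinProj_r {y y' : ℝ × Circle} (i : ℤ) (h1 : y.1 = y'.1 + 2 * i) (h2 : y.2 = y'.2) :
    kleinProj y = kleinProj y' := by
  rw [← kleinProj_smul (DihedralGroup.r i) y', r_smul, ← h1, ← h2]

theorem kleinProj_sr {y y' : ℝ × Circle} (i : ℤ) (h1 : y.1 = -y'.1 - 2 * i) (h2 : y.2 = -y'.2) :
    kleinProj y = kleinProj y' := by
  rw [← kleinProj_smul (DihedralGroup.sr i) y', sr_smul, ← h1, ← h2]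

/-- Reflections of the line have fixed points; the antipodal map on the circle factor makes the
action free, so that ordinary covering theory applies. -/
theorem isQuotientCoveringMap_kleinProj :
    IsQuotientCoveringMap kleinProj (DihedralGroup 0) where
  toIsQuotientMap := isQuotientMap_quotient_mk'
  continuous_const_smul g := by
    rcases dihedral_cases g with ⟨i, rfl⟩ | ⟨i, rfl⟩
    · simp only [r_smul]; fun_prop
    · simp only [sr_smul]; fun_prop
  apply_eq_iff_mem_orbit := Quotient.eq''
  disjoint e := by
    -- A nontrivial translation moves the line by at least `2`, more than the diameter of the ball,
    -- and antipodal points of the circle are at distance `2`, so they cannot both be within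
    -- distance less than `1` of `e.2`.
    refine ⟨Metric.ball e.1 (1 / 2) ×ˢ {z : Circle | ‖(z : ℂ) - e.2‖ < 1}, ?_, ?_⟩
    · refine prod_mem_nhds (Metric.ball_mem_nhds _ (by norm_num)) ?_
      refine IsOpen.mem_nhds ?_ (by simp)
      exact isOpen_lt (by fun_prop) continuous_const
    · rintro g ⟨_, ⟨y, ⟨hy1, hy2⟩, rfl⟩, ⟨hy3, hy4⟩⟩
      rw [Metric.mem_ball, Real.dist_eq, abs_lt] at hy1
      dsimp only at hy3 hy4
      rw [Metric.mem_ball, Real.dist_eq, abs_lt] at hy3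
      rcases dihedral_cases g with ⟨i, rfl⟩ | ⟨i, rfl⟩
      · rw [r_smul] at hy3
        have h1 : ((i : ℤ) : ℝ) < 1 := by linarith [hy1.1, hy3.2]
        have h2 : (-1 : ℝ) < ((i : ℤ) : ℝ) := by linarith [hy1.2, hy3.1]
        have h3 : i < 1 := by exact_mod_cast h1
        have h4 : -1 < i := by exact_mod_cast h2
        obtain rfl : i = 0 := by omega
        exact DihedralGroup.one_def.symm
      · exfalso
        rw [sr_smul] at hy4
        simp only [mem_ofPred_eq, Circle.coe_neg] at hy2 hy4
        have h : ‖((y.2 : ℂ) - e.2) - (-(y.2 : ℂ) - e.2)‖ < 2 := by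
          linarith [norm_sub_le ((y.2 : ℂ) - e.2) (-(y.2 : ℂ) - e.2)]
        have h' : ((y.2 : ℂ) - e.2) - (-(y.2 : ℂ) - e.2) = 2 * y.2 := by ring
        rw [h', norm_mul, Circle.norm_coe] at h
        norm_num at h

theorem continuous_kleinProj : Continuous kleinProj :=
  isQuotientCoveringMap_kleinProj.isCoveringMap.continuous

/-- The deck transformation that a lift of a closed curve determines is shared by a suitable lift
of any freely homotopic closed curve. -/
theorem exists_lift_of_homotopic {f₀ f₁ : ClosedCurve KleinBottle}
    (h : ContinuousMap.Homotopic f₀ f₁) (a : C(unitInterval, ℝ × Circle))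
    (ha : ∀ t : unitInterval, kleinProj (a t) = f₀ (turn t)) :
    ∃ b : C(unitInterval, ℝ × Circle), (∀ t : unitInterval, kleinProj (b t) = f₁ (turn t)) ∧
      ∃ γ : DihedralGroup 0, a 1 = γ • a 0 ∧ b 1 = γ • b 0 := by
  obtain ⟨F⟩ := h
  have cov := isQuotientCoveringMap_kleinProj.isCoveringMap
  let G : C(unitInterval × unitInterval, KleinBottle) :=
    F.toContinuousMap.comp ⟨fun x => (x.1, turn x.2),
      by have := continuous_turn; fun_prop⟩
  have hG0 : ∀ t, G (0, t) = kleinProj (a t) := by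
    intro t
    rw [ha]
    exact F.apply_zero _
  have hG1 : ∀ t, G (1, t) = f₁ (turn t) := fun t => F.apply_one _
  let L := cov.liftHomotopy G a hG0
  have hL : ∀ x, kleinProj (L x) = G x := congr_fun (cov.liftHomotopy_lifts G a hG0)
  have hL0 : ∀ t, L (0, t) = a t := cov.liftHomotopy_zero G a hG0
  have hloop : ∀ s, G (s, 1) = G (s, 0) := by
    intro s
    change F (s, turn ((1 : unitInterval) : ℝ)) = F (s, turn ((0 : unitInterval) : ℝ))
    simp [turn_one, turn_zero]
  have h01 : kleinProj (a 1) = kleinProj (a 0) := by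
    rw [← hG0, ← hG0, hloop]
  obtain ⟨γ, hγ⟩ := isQuotientCoveringMap_kleinProj.apply_eq_iff_mem_orbit.1 h01
  have hγ : γ • a 0 = a 1 := hγ
  have := isQuotientCoveringMap_kleinProj.toContinuousConstSMul
  -- Both sides lift the same path of base points and agree at `s = 0`, so the deck transformation
  -- is constant along the homotopy.
  have hend : (fun s => L (s, 1)) = fun s => γ • L (s, 0) := by
    refine cov.eq_of_comp_eq (by fun_prop) (by fun_prop) ?_ (0 : unitInterval) ?_
    · ext s
      simp only [Function.comp_apply, kleinProj_smul, hL, hloop]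
    · simp only [hL0, hγ]
  refine ⟨⟨fun t => L (1, t), by fun_prop⟩, fun t => ?_, γ, hγ.symm, congr_fun hend 1⟩
  exact (hL _).trans (hG1 t)

/-- A constant loop only has constant lifts, so the common deck transformation fixes a point and is
trivial; then the given lift would close up. -/
theorem not_nullhomotopic_of_lift {X : Type} [TopologicalSpace X] (Φ : C(X, KleinBottle))
    {c : ClosedCurve X} (a : C(unitInterval, ℝ × Circle))
    (ha : ∀ t : unitInterval, kleinProj (a t) = Φ (c (turn t))) (hne : a 1 ≠ a 0) :
    ¬ ContinuousMap.Nullhomotopic c := by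
  rintro ⟨x, hx⟩
  have hx' : ContinuousMap.Homotopic (Φ.comp c) (Φ.comp (ContinuousMap.const Circle x)) :=
    (ContinuousMap.Homotopic.refl Φ).comp hx
  obtain ⟨b, hb, γ, h1, h2⟩ := exists_lift_of_homotopic hx' a ha
  have cov := isQuotientCoveringMap_kleinProj.isCoveringMap
  have hconst : b 1 = b 0 := cov.const_of_comp b.continuous (fun s t => by rw [hb, hb]; rfl) 1 0
  obtain ⟨U, hU, hU'⟩ := isQuotientCoveringMap_kleinProj.disjoint (b 0)
  have hγ : γ = 1 := hU' γ ⟨b 0, ⟨b 0, mem_of_mem_nhds hU, by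
    change γ • b 0 = b 0
    rw [← h2, hconst]⟩, mem_of_mem_nhds hU⟩
  rw [hγ, one_smul] at h1
  exact hne h1

/-- A closed curve whose image in the Klein bottle lifts to a path of displacement `N` meets the
preimage of the half-integers at least `N` times, and so do all freely homotopic simple closed
curves. -/
theorem le_geomInt_of_lift {X : Type} [TopologicalSpace X] (Φ : C(X, KleinBottle))
    {c d : ClosedCurve X} {N : ℕ} (hN : Even N)
    (hd : ∀ x y, Φ x = kleinProj y → (∃ m : ℤ, y.1 = m + 1 / 2) → x ∈ range d)
    (a : C(unitInterval, ℝ × Circle))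
    (ha : ∀ t : unitInterval, kleinProj (a t) = Φ (c (turn t)))
    (ha0 : (a 0).1 = -1 / 2) (ha1 : (a 1).1 = N - 1 / 2) :
    (N : ℕ∞) ≤ geomInt c d := by
  unfold geomInt
  refine le_iInf fun x => le_iInf fun hxs => le_iInf fun hxc => ?_
  have hx' : ContinuousMap.Homotopic (Φ.comp c) (Φ.comp x) :=
    (ContinuousMap.Homotopic.refl Φ).comp hxc.symm
  obtain ⟨b, hb, γ, h1, h2⟩ := exists_lift_of_homotopic hx' a ha
  obtain ⟨M, hM⟩ := hN
  -- The deck transformation takes `-1/2` to `N - 1/2`. A reflection in an integer would force `N`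
  -- to be odd, so it is the translation by `N`.
  have hdisp : (b 1).1 = (b 0).1 + N := by
    rcases dihedral_cases γ with ⟨i, rfl⟩ | ⟨i, rfl⟩
    · rw [r_smul] at h1 h2
      have h3 := congr_arg Prod.fst h1
      have h4 := congr_arg Prod.fst h2
      dsimp only at h3 h4
      rw [h4]
      linarith
    · exfalso
      rw [sr_smul] at h1
      have h3 := congr_arg Prod.fst h1
      dsimp only at h3
      rw [ha0, ha1, hM] at h3
      push_cast at h3
      have h5 : ((M + M : ℤ) : ℝ) = ((1 - 2 * i : ℤ) : ℝ) := by push_cast; linarith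
      have h6 : (M + M : ℤ) = 1 - 2 * i := by exact_mod_cast h5
      omega
  -- With this choice the `N` half-integers from `m + 1/2` to `m + N - 1/2` lie in the half-open
  -- interval from `(b 0).1` (excluded) to `(b 1).1`. Excluding the start keeps the parameters in
  -- `(0, 1]`, where `turn` is injective.
  let m : ℤ := ⌊(b 0).1 + 1 / 2⌋
  have hm1 : (m : ℝ) ≤ (b 0).1 + 1 / 2 := Int.floor_le _
  have hm2 : (b 0).1 + 1 / 2 < m + 1 := Int.lt_floor_add_one _
  have hcross : ∀ i : Fin N, ∃ t : unitInterval, (b t).1 = (m : ℝ) + i + 1 / 2 := by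
    intro i
    have hi : (i : ℝ) + 1 ≤ N := by exact_mod_cast i.2
    have hi0 : (0 : ℝ) ≤ i := by positivity
    have := intermediate_value_univ (0 : unitInterval) 1
      (f := fun t => (b t).1) (by fun_prop)
    exact this ⟨by linarith, by rw [hdisp]; linarith⟩
  choose t ht using hcross
  have ht0 : ∀ i, (t i : ℝ) ∈ Ioc (0 : ℝ) 1 := by
    intro i
    refine ⟨lt_of_le_of_ne (t i).2.1 fun h0 => ?_, (t i).2.2⟩
    have h00 : t i = 0 := Subtype.ext h0.symm
    have h3 := ht i
    rw [h00] at h3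
    have hi0 : (0 : ℝ) ≤ i := by positivity
    linarith
  have htinj : Function.Injective fun i => x (turn (t i)) := by
    intro i j hij
    have h3 := turn_injOn (ht0 i) (ht0 j) (hxs hij)
    have h4 : t i = t j := Subtype.ext h3
    have h5 := ht i
    rw [h4, ht j] at h5
    have h6 : ((j : ℕ) : ℝ) = (i : ℕ) := by linarith
    exact (Fin.ext (by exact_mod_cast h6)).symm
  have hsub : range (fun i => x (turn (t i))) ⊆ range x ∩ range d := by
    rintro _ ⟨i, rfl⟩
    refine ⟨⟨_, rfl⟩, hd _ (b (t i)) (hb (t i)).symm ⟨m + i, ?_⟩⟩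
    rw [ht i]; push_cast; ring
  calc (N : ℕ∞) = (range fun i => x (turn (t i))).encard := by
        rw [← image_univ, htinj.injOn.encard_image]
        simp
    _ ≤ _ := encard_le_encard hsub

/-! ### Sweeping the disk by chords -/

/-- The point of the chord from `e ^ (i a)` to `e ^ (i b)` with affine parameter `s ∈ [-1, 1]`. -/
def chordPt (a b s : ℝ) : ℂ :=
  Complex.exp (((a + b) / 2 : ℝ) * Complex.I) *
    ⟨Real.cos ((b - a) / 2), s * Real.sin ((b - a) / 2)⟩

/-- The affine function that vanishes on the chord from `e ^ (i a)` to `e ^ (i b)`. -/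
def chordSide (a b : ℝ) (z : ℂ) : ℝ :=
  (z * Complex.exp (-(((a + b) / 2 : ℝ) * Complex.I))).re - Real.cos ((b - a) / 2)

theorem chordPt_neg_one (a b : ℝ) : chordPt a b (-1) = Complex.exp ((a : ℝ) * Complex.I) := by
  have h : (⟨Real.cos ((b - a) / 2), -1 * Real.sin ((b - a) / 2)⟩ : ℂ) =
      Complex.exp ((-((b - a) / 2) : ℝ) * Complex.I) := by
    apply Complex.ext
    · rw [Complex.exp_ofReal_mul_I_re]; simp only [Real.cos_neg]
    · rw [Complex.exp_ofReal_mul_I_im]; simp only [Real.sin_neg, neg_mul, one_mul]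
  rw [chordPt, h, ← Complex.exp_add]
  congr 1
  push_cast
  ring

theorem chordPt_one (a b : ℝ) : chordPt a b 1 = Complex.exp ((b : ℝ) * Complex.I) := by
  have h : (⟨Real.cos ((b - a) / 2), 1 * Real.sin ((b - a) / 2)⟩ : ℂ) =
      Complex.exp (((b - a) / 2 : ℝ) * Complex.I) := by
    apply Complex.ext
    · rw [Complex.exp_ofReal_mul_I_re]
    · rw [Complex.exp_ofReal_mul_I_im]; simp only [one_mul]
  rw [chordPt, h, ← Complex.exp_add]
  congr 1
  push_cast
  ring

theorem chordPt_eq_combination (a b s : ℝ) :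
    chordPt a b s = ((1 - s) / 2 : ℝ) * Complex.exp ((a : ℝ) * Complex.I) +
      ((1 + s) / 2 : ℝ) * Complex.exp ((b : ℝ) * Complex.I) := by
  rw [← chordPt_neg_one a b, ← chordPt_one a b, chordPt, chordPt, chordPt]
  have : (⟨Real.cos ((b - a) / 2), s * Real.sin ((b - a) / 2)⟩ : ℂ) =
      ((1 - s) / 2 : ℝ) * ⟨Real.cos ((b - a) / 2), -1 * Real.sin ((b - a) / 2)⟩ +
      ((1 + s) / 2 : ℝ) * ⟨Real.cos ((b - a) / 2), 1 * Real.sin ((b - a) / 2)⟩ := by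
    apply Complex.ext <;> simp <;> ring
  rw [this]
  ring

theorem chordSide_chordPt (a b s : ℝ) : chordSide a b (chordPt a b s) = 0 := by
  rw [chordSide, chordPt, mul_right_comm, ← Complex.exp_add]
  simp

theorem chordSide_exp (a b t : ℝ) :
    chordSide a b (Complex.exp ((t : ℝ) * Complex.I)) =
      Real.cos (t - (a + b) / 2) - Real.cos ((b - a) / 2) := by
  rw [chordSide, ← Complex.exp_add]
  congr 1
  rw [← Complex.exp_ofReal_mul_I_re]
  congr 2
  push_cast
  ring

theorem chordSide_combination (a b r s : ℝ) (z w : ℂ) (h : r + s = 1) :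
    chordSide a b (r * z + s * w) = r * chordSide a b z + s * chordSide a b w := by
  simp only [chordSide, add_mul, mul_assoc, Complex.add_re, Complex.re_ofReal_mul]
  linear_combination Real.cos ((b - a) / 2) * h

theorem chordSide_pos {a b t : ℝ} (hab : b - a ≤ 2 * Real.pi) (h1 : a < t) (h2 : t < b) :
    0 < chordSide a b (Complex.exp ((t : ℝ) * Complex.I)) := by
  rw [chordSide_exp, sub_pos, ← Real.cos_abs (t - (a + b) / 2)]
  refine Real.cos_lt_cos_of_nonneg_of_le_pi (abs_nonneg _) (by linarith) ?_
  rw [abs_lt]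
  constructor <;> linarith

/-- Nested arcs give disjoint chords. -/
theorem chordPt_ne {a b a' b' s s' : ℝ} (hab : b - a ≤ 2 * Real.pi) (h1 : a < a') (h2 : a' ≤ b')
    (h3 : b' < b) (hs : s' ∈ Icc (-1 : ℝ) 1) : chordPt a b s ≠ chordPt a' b' s' := by
  intro h
  have h0 := chordSide_chordPt a b s
  rw [h, chordPt_eq_combination a' b', chordSide_combination _ _ _ _ _ _ (by ring)] at h0
  have p1 := chordSide_pos hab h1 (h2.trans_lt h3)
  have p2 := chordSide_pos hab (h1.trans_le h2) h3
  have q1 : 0 ≤ (1 - s') / 2 := by linarith [hs.2]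
  have q2 : 0 ≤ (1 + s') / 2 := by linarith [hs.1]
  rcases q1.eq_or_lt with h4 | h4
  · have : 0 < (1 + s') / 2 := by linarith
    nlinarith [mul_pos this p2]
  · nlinarith [mul_pos h4 p1, mul_nonneg q2 p2.le]

theorem chordPt_injective {a b s s' : ℝ} (h1 : a < b) (h2 : b - a < 2 * Real.pi)
    (h : chordPt a b s = chordPt a b s') : s = s' := by
  have h3 := mul_left_cancel₀ (Complex.exp_ne_zero _) h
  have h4 := congr_arg Complex.im h3
  dsimp only at h4
  exact mul_right_cancel₀
    (Real.sin_pos_of_pos_of_lt_pi (by linarith) (by linarith)).ne' h4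

theorem norm_chordPt_le (a b : ℝ) {s : ℝ} (hs : s ∈ Icc (-1 : ℝ) 1) : ‖chordPt a b s‖ ≤ 1 := by
  rw [chordPt_eq_combination]
  refine (norm_add_le _ _).trans ?_
  rw [norm_mul, norm_mul, Complex.norm_exp_ofReal_mul_I, Complex.norm_exp_ofReal_mul_I,
    Complex.norm_real, Complex.norm_real, Real.norm_of_nonneg (by linarith [hs.2]),
    Real.norm_of_nonneg (by linarith [hs.1])]
  linarith

theorem norm_chordPt_lt {a b s : ℝ} (h1 : a < b) (h2 : b - a < 2 * Real.pi)
    (hs : s ∈ Ioo (-1 : ℝ) 1) : ‖chordPt a b s‖ < 1 := by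
  rw [chordPt, norm_mul, Complex.norm_exp_ofReal_mul_I, one_mul]
  have hsin : 0 < Real.sin ((b - a) / 2) :=
    Real.sin_pos_of_pos_of_lt_pi (by linarith) (by linarith)
  have : ‖(⟨Real.cos ((b - a) / 2), s * Real.sin ((b - a) / 2)⟩ : ℂ)‖ ^ 2 < 1 := by
    rw [Complex.sq_norm, Complex.normSq_mk]
    have h3 := Real.sin_sq_add_cos_sq ((b - a) / 2)
    have h4 : s ^ 2 < 1 := by nlinarith [hs.1, hs.2]
    nlinarith [mul_pos hsin hsin]
  nlinarith [norm_nonneg (⟨Real.cos ((b - a) / 2), s * Real.sin ((b - a) / 2)⟩ : ℂ)]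

/-- The affine function of the moving chord is nonnegative at `z` when the arc is the full circle
and nonpositive when the arc has shrunk to a point, so by the intermediate value theorem some chord
contains `z`. -/
theorem exists_chordPt_eq {a b : ℝ → ℝ} {L : ℝ} (hL : 0 ≤ L) (ha : Continuous a)
    (hb : Continuous b) (ha0 : a 0 = 0) (hb0 : b 0 = 2 * Real.pi) (hab : a L = b L)
    (hle : ∀ x ∈ Icc 0 L, a x ≤ b x ∧ b x - a x ≤ 2 * Real.pi) {z : ℂ} (hz : ‖z‖ ≤ 1) :
    ∃ x ∈ Icc 0 L, ∃ s ∈ Icc (-1 : ℝ) 1, chordPt (a x) (b x) s = z := by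
  have hcont : Continuous fun x => chordSide (a x) (b x) z := by
    unfold chordSide; fun_prop
  have hre : |z.re| ≤ 1 := (Complex.abs_re_le_norm z).trans hz
  have h0 : 0 ≤ chordSide (a 0) (b 0) z := by
    rw [ha0, hb0, chordSide]
    have h1 : (0 + 2 * Real.pi) / 2 = Real.pi := by ring
    have h2 : (2 * Real.pi - 0) / 2 = Real.pi := by ring
    rw [h1, h2, Complex.exp_neg, Complex.exp_pi_mul_I, Real.cos_pi]
    norm_num
    linarith [(abs_le.1 hre).2]
  have h1 : chordSide (a L) (b L) z ≤ 0 := by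
    rw [hab, chordSide, sub_self, zero_div, Real.cos_zero]
    have : ‖z * Complex.exp (-(((b L + b L) / 2 : ℝ) * Complex.I))‖ ≤ 1 := by
      rw [← neg_mul, ← Complex.ofReal_neg, norm_mul, Complex.norm_exp_ofReal_mul_I, mul_one]
      exact hz
    linarith [(Complex.re_le_norm _).trans this]
  obtain ⟨x, hx, hx0⟩ := intermediate_value_Icc' hL hcont.continuousOn ⟨h1, h0⟩
  refine ⟨x, hx, ?_⟩
  obtain ⟨h2, h3⟩ := hle x hx
  dsimp only at hx0
  set w : ℂ := z * Complex.exp (-(((a x + b x) / 2 : ℝ) * Complex.I)) with hw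
  have hzw : z = Complex.exp (((a x + b x) / 2 : ℝ) * Complex.I) * w := by
    rw [hw, mul_left_comm, ← Complex.exp_add, add_neg_cancel, Complex.exp_zero, mul_one]
  have hwre : w.re = Real.cos ((b x - a x) / 2) := by
    rw [chordSide] at hx0; linarith
  have hwn : w.re ^ 2 + w.im ^ 2 ≤ 1 := by
    have h4 : ‖w‖ ≤ 1 := by
      rw [hzw, norm_mul, Complex.norm_exp_ofReal_mul_I, one_mul] at hz; exact hz
    have h5 := Complex.sq_norm w
    rw [Complex.normSq_apply] at h5
    nlinarith [norm_nonneg w]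
  have hsq := Real.sin_sq_add_cos_sq ((b x - a x) / 2)
  have hsin : 0 ≤ Real.sin ((b x - a x) / 2) :=
    Real.sin_nonneg_of_nonneg_of_le_pi (by linarith) (by linarith)
  rw [hwre] at hwn
  -- If the sine vanishes, the chord is a single point and any parameter works; otherwise the
  -- parameter is determined by the imaginary part.
  rcases hsin.eq_or_lt with h4 | h4
  · refine ⟨0, by simp, ?_⟩
    rw [chordPt, hzw]
    congr 1
    apply Complex.ext
    · exact hwre.symm
    · dsimp only
      rw [← h4] at hsq ⊢
      have : w.im ^ 2 ≤ 0 := by linarith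
      have : w.im = 0 := by nlinarith
      rw [this, mul_zero]
  · have h5 : |w.im| ≤ Real.sin ((b x - a x) / 2) := abs_le_of_sq_le_sq (by linarith) hsin
    refine ⟨w.im / Real.sin ((b x - a x) / 2), ?_, ?_⟩
    · rw [abs_le] at h5
      exact ⟨by rw [le_div_iff₀ h4]; linarith, by rw [div_le_iff₀ h4]; linarith⟩
    · rw [chordPt, hzw]
      congr 1
      apply Complex.ext
      · exact hwre.symm
      · dsimp only
        field_simp

/-! ### Moving the center of the disk -/

/-- A homeomorphism of the disk that fixes the unit circle and moves the center to a given interior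
point. -/
theorem exists_homeomorph_disk {c : ℂ} (hc : ‖c‖ < 1) :
    ∃ D : Disk ≃ₜ Disk, (D ⟨0, by simp⟩ : ℂ) = c ∧ ∀ z : Disk, ‖(z : ℂ)‖ = 1 → D z = z := by
  -- The map is `z ↦ z + (1 - ‖z‖) c`. It is injective because `‖c‖ < 1` makes the correction a
  -- strict contraction; a preimage is found by solving for its norm `r`.
  have hmem : ∀ z : Disk, (z : ℂ) + ((1 - ‖(z : ℂ)‖ : ℝ) : ℂ) * c ∈ Metric.closedBall (0 : ℂ) 1 := by
    intro z
    have hz : ‖(z : ℂ)‖ ≤ 1 := mem_closedBall_zero_iff.1 z.2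
    rw [mem_closedBall_zero_iff]
    refine (norm_add_le _ _).trans ?_
    rw [norm_mul, Complex.norm_real, Real.norm_of_nonneg (by linarith)]
    nlinarith
  let f : Disk → Disk := fun z => ⟨_, hmem z⟩
  have hf : Continuous f := by
    refine Continuous.subtype_mk ?_ _
    fun_prop
  have hinj : Function.Injective f := by
    intro z w h
    have h1 : (z : ℂ) + ((1 - ‖(z : ℂ)‖ : ℝ) : ℂ) * c =
        (w : ℂ) + ((1 - ‖(w : ℂ)‖ : ℝ) : ℂ) * c := congr_arg Subtype.val h
    have h2 : (z : ℂ) - w = ((‖(z : ℂ)‖ - ‖(w : ℂ)‖ : ℝ) : ℂ) * c := by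
      push_cast at h1 ⊢
      linear_combination h1
    have h3 : ‖(z : ℂ) - w‖ ≤ ‖(z : ℂ) - w‖ * ‖c‖ := by
      conv_lhs => rw [h2]
      rw [norm_mul, Complex.norm_real]
      exact mul_le_mul_of_nonneg_right (abs_norm_sub_norm_le _ _) (norm_nonneg _)
    have h4 : ‖(z : ℂ) - w‖ = 0 := by nlinarith [norm_nonneg ((z : ℂ) - w)]
    exact Subtype.ext (sub_eq_zero.1 (norm_eq_zero.1 h4))
  have hsurj : Function.Surjective f := by
    intro w
    have hw : ‖(w : ℂ)‖ ≤ 1 := mem_closedBall_zero_iff.1 w.2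
    obtain ⟨r, hr, hr0⟩ : ∃ r ∈ Icc (0 : ℝ) 1, ‖(w : ℂ) - ((1 - r : ℝ) : ℂ) * c‖ - r = 0 := by
      refine intermediate_value_Icc' zero_le_one (f := fun r : ℝ =>
        ‖(w : ℂ) - ((1 - r : ℝ) : ℂ) * c‖ - r) (by fun_prop) ⟨?_, ?_⟩
      · simpa using hw
      · simp
    have hz : ‖(w : ℂ) - ((1 - r : ℝ) : ℂ) * c‖ = r := by linarith
    refine ⟨⟨(w : ℂ) - ((1 - r : ℝ) : ℂ) * c, by rw [mem_closedBall_zero_iff, hz]; exact hr.2⟩, ?_⟩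
    apply Subtype.ext
    simp only [f]
    rw [hz]
    ring
  refine ⟨Continuous.homeoOfEquivCompactToT2 (f := Equiv.ofBijective f ⟨hinj, hsurj⟩) hf, ?_, ?_⟩
  · change ((f _ : Disk) : ℂ) = c
    simp [f]
  · intro z hz
    apply Subtype.ext
    change ((f z : Disk) : ℂ) = z
    simp [f, hz]

/-! ### Side identifications in the boundary coordinate -/

/-- The side identifications of a polygon with `m` handles, in the boundary coordinate. -/
def Partner (m : ℕ) (u u' : ℝ) : Prop :=
  ∃ j < m, ∃ e : ℕ, e ≤ 1 ∧ ((4 * j + e ≤ u ∧ u ≤ 4 * j + e + 1) ∨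
    (4 * j + e + 2 ≤ u ∧ u ≤ 4 * j + e + 3)) ∧ u + u' = 8 * j + 2 * e + 3

theorem Partner.symm {m : ℕ} {u u' : ℝ} (h : Partner m u u') : Partner m u' u := by
  obtain ⟨j, hj, e, he, h1, h2⟩ := h
  refine ⟨j, hj, e, he, ?_, by linarith⟩
  rcases h1 with ⟨h3, h4⟩ | ⟨h3, h4⟩
  · exact Or.inr ⟨by linarith, by linarith⟩
  · exact Or.inl ⟨by linarith, by linarith⟩

theorem Partner.mem_Icc {m : ℕ} {u u' : ℝ} (h : Partner m u u') : u ∈ Icc (0 : ℝ) (4 * m) := by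
  obtain ⟨j, hj, e, he, h1, -⟩ := h
  have hj' : (j : ℝ) + 1 ≤ m := by exact_mod_cast hj
  have he' : (e : ℝ) ≤ 1 := by exact_mod_cast he
  have h0 : (0 : ℝ) ≤ j := by positivity
  have h0' : (0 : ℝ) ≤ e := by positivity
  rcases h1 with ⟨h3, h4⟩ | ⟨h3, h4⟩ <;> constructor <;> linarith

/-- A non-integral coordinate lies on a single side, identified by its floor, and each side is glued
once. Corners are excluded since they belong to two sides. -/
theorem Partner.eq_of_not_int {m : ℕ} {u a b : ℝ} (hu : ∀ k : ℤ, u ≠ k) (ha : Partner m u a)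
    (hb : Partner m u b) : a = b := by
  have key : ∀ {c}, Partner m u c → ∃ j : ℤ, ∃ e : ℤ, 0 ≤ e ∧ e ≤ 1 ∧
      (⌊u⌋ = 4 * j + e ∨ ⌊u⌋ = 4 * j + e + 2) ∧ u + c = 8 * j + 2 * e + 3 := by
    rintro c ⟨j, hj, e, he, h1, h2⟩
    refine ⟨j, e, by omega, by omega, ?_, by push_cast; linarith⟩
    rcases h1 with ⟨h3, h4⟩ | ⟨h3, h4⟩
    · left
      rw [Int.floor_eq_iff]
      refine ⟨by push_cast; linarith, lt_of_le_of_ne (by push_cast; linarith) ?_⟩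
      have := hu (4 * j + e + 1)
      push_cast at this ⊢
      exact this
    · right
      rw [Int.floor_eq_iff]
      refine ⟨by push_cast; linarith, lt_of_le_of_ne (by push_cast; linarith) ?_⟩
      have := hu (4 * j + e + 3)
      push_cast at this ⊢
      intro h
      apply this
      linarith
  obtain ⟨j, e, h1, h2, h3, h4⟩ := key ha
  obtain ⟨j', e', h1', h2', h3', h4'⟩ := key hb
  obtain ⟨rfl, rfl⟩ : j = j' ∧ e = e' := by omega
  linarith

theorem Partner.int {m : ℕ} {k : ℤ} {u' : ℝ} (h : Partner m k u') : ∃ k' : ℤ, u' = k' := by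
  obtain ⟨j, hj, e, he, -, h2⟩ := h
  exact ⟨8 * j + 2 * e + 3 - k, by push_cast; linarith⟩

theorem Partner.not_int {m : ℕ} {u u' : ℝ} (h : Partner m u u') (hu : ∀ k : ℤ, u ≠ k) :
    ∀ k : ℤ, u' ≠ k := by
  rintro k rfl
  obtain ⟨k', hk'⟩ := h.symm.int
  exact hu k' hk'

theorem exists_partner {m : ℕ} {u : ℝ} (h : u ∈ Ico (0 : ℝ) (4 * m)) : ∃ u', Partner m u u' := by
  have h0 : 0 ≤ u := h.1
  set n := ⌊u⌋₊ with hn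
  have h1 : (n : ℝ) ≤ u := Nat.floor_le h0
  have h2 : u < n + 1 := Nat.lt_floor_add_one u
  have h3 : n < 4 * m := by
    have : (n : ℝ) < (4 * m : ℕ) := by push_cast; linarith [h.2]
    exact_mod_cast this
  rcases Nat.lt_or_ge (n % 4) 2 with h4 | h4
  · refine ⟨_, n / 4, by omega, n % 4, by omega, Or.inl ⟨?_, ?_⟩, add_sub_cancel _ _⟩
    · have : ((4 * (n / 4) + n % 4 : ℕ) : ℝ) = n := by rw [Nat.div_add_mod]
      push_cast at this; linarith
    · have : ((4 * (n / 4) + n % 4 : ℕ) : ℝ) = n := by rw [Nat.div_add_mod]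
      push_cast at this; linarith
  · refine ⟨_, n / 4, by omega, n % 4 - 2, by omega, Or.inr ⟨?_, ?_⟩, add_sub_cancel _ _⟩
    · have : ((4 * (n / 4) + (n % 4 - 2) + 2 : ℕ) : ℝ) = n := by
        congr 1; omega
      push_cast at this; linarith
    · have : ((4 * (n / 4) + (n % 4 - 2) + 2 : ℕ) : ℝ) = n := by
        congr 1; omega
      push_cast at this; linarith

/-- The boundary word is a concatenation of commutators, so cutting it between handles splits the
gluing into two independent ones. -/
theorem partner_add {m m' : ℕ} {u u' : ℝ} :
    Partner (m + m') u u' ↔ Partner m u u' ∨ Partner m' (u - 4 * m) (u' - 4 * m) := by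
  constructor
  · rintro ⟨j, hj, e, he, h1, h2⟩
    rcases Nat.lt_or_ge j m with h | h
    · exact Or.inl ⟨j, h, e, he, h1, h2⟩
    · obtain ⟨i, rfl⟩ := Nat.exists_eq_add_of_le h
      refine Or.inr ⟨i, by omega, e, he, ?_, ?_⟩
      · push_cast at h1
        rcases h1 with ⟨h3, h4⟩ | ⟨h3, h4⟩
        · exact Or.inl ⟨by linarith, by linarith⟩
        · exact Or.inr ⟨by linarith, by linarith⟩
      · push_cast at h2; linarith
  · rintro (⟨j, hj, e, he, h1, h2⟩ | ⟨j, hj, e, he, h1, h2⟩)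
    · exact ⟨j, by omega, e, he, h1, h2⟩
    · refine ⟨m + j, by omega, e, he, ?_, ?_⟩
      · push_cast
        rcases h1 with ⟨h3, h4⟩ | ⟨h3, h4⟩
        · exact Or.inl ⟨by linarith, by linarith⟩
        · exact Or.inr ⟨by linarith, by linarith⟩
      · push_cast; linarith

/-! ### The equivalence relation generated by the side identifications -/

theorem coe_boundaryPt (g : ℕ) (u : ℝ) : (boundaryPt g u : ℂ) = turn (u / (4 * g)) := by
  rw [turn, Circle.coe_exp]; rfl

theorem norm_boundaryPt (g : ℕ) (u : ℝ) : ‖(boundaryPt g u : ℂ)‖ = 1 := by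
  rw [coe_boundaryPt, Circle.norm_coe]

theorem continuous_boundaryPt (g : ℕ) : Continuous (boundaryPt g) := by
  refine Continuous.subtype_mk ?_ _
  fun_prop

theorem boundaryPt_injOn {g : ℕ} (hg : 0 < g) : InjOn (boundaryPt g) (Ioc 0 (4 * g)) := by
  intro u hu w hw h
  have hg' : (0 : ℝ) < 4 * g := by positivity
  have h1 : turn (u / (4 * g)) = turn (w / (4 * g)) := by
    rw [Circle.ext_iff, ← coe_boundaryPt, ← coe_boundaryPt, h]
  have h2 := turn_injOn ⟨div_pos hu.1 hg', (div_le_one hg').2 hu.2⟩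
    ⟨div_pos hw.1 hg', (div_le_one hg').2 hw.2⟩ h1
  field_simp at h2
  linarith

theorem boundaryPt_zero {g : ℕ} (hg : 0 < g) : boundaryPt g 0 = boundaryPt g (4 * g) := by
  apply Subtype.ext
  rw [coe_boundaryPt, coe_boundaryPt, div_self (by positivity), zero_div, turn_zero, turn_one]

theorem boundaryPt_eq_cases {g : ℕ} (hg : 0 < g) {u w : ℝ} (hu : u ∈ Icc (0 : ℝ) (4 * g))
    (hw : w ∈ Icc (0 : ℝ) (4 * g)) (h : boundaryPt g u = boundaryPt g w) :
    u = w ∨ ((∃ k : ℕ, k ≤ 4 * g ∧ u = k) ∧ ∃ k : ℕ, k ≤ 4 * g ∧ w = k) := by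
  have hg' : (0 : ℝ) < 4 * g := by positivity
  have hend : ∀ {x : ℝ}, x ∈ Ioc (0 : ℝ) (4 * g) → boundaryPt g 0 = boundaryPt g x →
      x = 4 * g := by
    intro x hx h0
    rw [boundaryPt_zero hg] at h0
    exact (boundaryPt_injOn hg ⟨hg', le_rfl⟩ hx h0).symm
  rcases hu.1.eq_or_lt with rfl | hu0 <;> rcases hw.1.eq_or_lt with rfl | hw0
  · exact Or.inl rfl
  · exact Or.inr ⟨⟨0, by simp⟩, ⟨4 * g, le_rfl, by push_cast; exact hend ⟨hw0, hw.2⟩ h⟩⟩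
  · exact Or.inr ⟨⟨4 * g, le_rfl, by push_cast; exact hend ⟨hu0, hu.2⟩ h.symm⟩, ⟨0, by simp⟩⟩
  · exact Or.inl (boundaryPt_injOn hg ⟨hu0, hu.2⟩ ⟨hw0, hw.2⟩ h)

/-- Explicit description of the equivalence relation generated by the side identifications. -/
def Glued (g : ℕ) (z w : Disk) : Prop :=
  z = w ∨ ((∃ k : ℕ, k ≤ 4 * g ∧ z = boundaryPt g k) ∧ ∃ k : ℕ, k ≤ 4 * g ∧ w = boundaryPt g k) ∨
    ∃ u u' : ℝ, Partner g u u' ∧ z = boundaryPt g u ∧ w = boundaryPt g u'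

theorem glued_of_partner {g : ℕ} {u u' : ℝ} (h : Partner g u u') :
    Glued g (boundaryPt g u) (boundaryPt g u') := Or.inr (Or.inr ⟨u, u', h, rfl, rfl⟩)

theorem nat_of_int_mem {g : ℕ} {u : ℝ} (hu : u ∈ Icc (0 : ℝ) (4 * g)) {k : ℤ} (hk : u = k) :
    ∃ n : ℕ, n ≤ 4 * g ∧ u = n := by
  have h0 : 0 ≤ k := by have := hu.1; rw [hk] at this; exact_mod_cast this
  lift k to ℕ using h0
  refine ⟨k, ?_, by simpa using hk⟩
  have := hu.2
  rw [hk] at this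
  have h2 : (k : ℝ) ≤ (4 * g : ℕ) := by push_cast; simpa using this
  exact_mod_cast h2

theorem Glued.symm {g : ℕ} {z w : Disk} (h : Glued g z w) : Glued g w z := by
  rcases h with h | h | ⟨u, u', h, h1, h2⟩
  · exact Or.inl h.symm
  · exact Or.inr (Or.inl ⟨h.2, h.1⟩)
  · exact Or.inr (Or.inr ⟨u', u, h.symm, h2, h1⟩)

theorem Glued.corner {g : ℕ} (hg : 0 < g) {z w : Disk} (h : Glued g z w)
    (hz : ∃ k : ℕ, k ≤ 4 * g ∧ z = boundaryPt g k) :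
    ∃ k : ℕ, k ≤ 4 * g ∧ w = boundaryPt g k := by
  rcases h with h | h | ⟨u, u', h, h1, h2⟩
  · rwa [← h]
  · exact h.2
  · obtain ⟨k, hk, hzk⟩ := hz
    have hk' : (k : ℝ) ∈ Icc (0 : ℝ) (4 * g) := ⟨by positivity, by exact_mod_cast hk⟩
    have hint : ∃ i : ℤ, u = i := by
      rcases boundaryPt_eq_cases hg hk' h.mem_Icc (hzk.symm.trans h1) with h3 | ⟨-, i, -, hi⟩
      · exact ⟨k, by rw [← h3]; simp⟩
      · exact ⟨i, by rw [hi]; simp⟩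
    obtain ⟨i, rfl⟩ := hint
    obtain ⟨i', hi'⟩ := h.int
    obtain ⟨n, hn, hn'⟩ := nat_of_int_mem h.symm.mem_Icc hi'
    exact ⟨n, hn, by rw [h2, hn']⟩

/-- If the middle point is a corner, so are the outer ones. Otherwise its partner is unique, and two
successive gluings cancel. -/
theorem Glued.trans {g : ℕ} (hg : 0 < g) {x y z : Disk} (h : Glued g x y) (h' : Glued g y z) :
    Glued g x z := by
  by_cases hc : ∃ k : ℕ, k ≤ 4 * g ∧ y = boundaryPt g k
  · exact Or.inr (Or.inl ⟨h.symm.corner hg hc, h'.corner hg hc⟩)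
  · rcases h with rfl | h | ⟨u, u', hu, h1, h2⟩
    · exact h'
    · exact absurd h.2 hc
    · rcases h' with rfl | h' | ⟨w, w', hw, h1', h2'⟩
      · exact Or.inr (Or.inr ⟨u, u', hu, h1, h2⟩)
      · exact absurd h'.1 hc
      · rcases boundaryPt_eq_cases hg hu.symm.mem_Icc hw.mem_Icc (h2.symm.trans h1') with
          rfl | ⟨⟨k, hk, rfl⟩, -⟩
        · by_cases hint : ∀ k : ℤ, u' ≠ k
          · have := Partner.eq_of_not_int hint hu.symm hw
            left
            rw [h1, h2', this]
          · push Not at hint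
            obtain ⟨k, hk⟩ := hint
            obtain ⟨n, hn, hn'⟩ := nat_of_int_mem hu.symm.mem_Icc hk
            exact absurd ⟨n, hn, by rw [h2, hn']⟩ hc
        · exact absurd ⟨k, hk, h2⟩ hc

theorem mk_eq_of_partner {g : ℕ} {u u' : ℝ} (h : Partner g u u') :
    Quot.mk (sideGluing g) (boundaryPt g u) = Quot.mk (sideGluing g) (boundaryPt g u') := by
  have key : ∀ {a b : ℝ} (j e : ℕ), j < g → e ≤ 1 → 4 * j + e ≤ a → a ≤ 4 * j + e + 1 →
      a + b = 8 * j + 2 * e + 3 → sideGluing g (boundaryPt g a) (boundaryPt g b) := by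
    intro a b j e hj he h1 h2 h3
    refine ⟨j, hj, e, by omega, a - (4 * j + e), ⟨by linarith, by linarith⟩, ?_, ?_⟩
    · congr 1; ring
    · congr 1; linarith
  obtain ⟨j, hj, e, he, ⟨h1, h2⟩ | ⟨h1, h2⟩, h3⟩ := h
  · exact Quot.sound (key j e hj he h1 h2 h3)
  · exact (Quot.sound (key j e hj he (by linarith) (by linarith) (by linarith))).symm

theorem mk_corner {g : ℕ} {k : ℕ} (hk : k ≤ 4 * g) :
    Quot.mk (sideGluing g) (boundaryPt g k) = Quot.mk (sideGluing g) (boundaryPt g 0) := by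
  -- In each handle the ends of the glued sides give `0 ~ 3`, `1 ~ 2`, `1 ~ 4` and `2 ~ 3`, which
  -- connects all five corners.
  have step : ∀ j < g, ∀ r ≤ 4, Quot.mk (sideGluing g) (boundaryPt g (4 * j + r : ℕ)) =
      Quot.mk (sideGluing g) (boundaryPt g (4 * j : ℕ)) := by
    intro j hj r hr
    have h03 : Partner g (4 * j : ℕ) (4 * j + 3 : ℕ) := ⟨j, hj, 0, by omega,
      Or.inl ⟨by push_cast; linarith, by push_cast; linarith⟩, by push_cast; ring⟩
    have h12 : Partner g (4 * j + 1 : ℕ) (4 * j + 2 : ℕ) := ⟨j, hj, 0, by omega,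
      Or.inl ⟨by push_cast; linarith, by push_cast; linarith⟩, by push_cast; ring⟩
    have h14 : Partner g (4 * j + 1 : ℕ) (4 * j + 4 : ℕ) := ⟨j, hj, 1, by omega,
      Or.inl ⟨by push_cast; linarith, by push_cast; linarith⟩, by push_cast; ring⟩
    have h23 : Partner g (4 * j + 2 : ℕ) (4 * j + 3 : ℕ) := ⟨j, hj, 1, by omega,
      Or.inl ⟨by push_cast; linarith, by push_cast; linarith⟩, by push_cast; ring⟩
    have e03 := mk_eq_of_partner h03
    have e12 := mk_eq_of_partner h12
    have e14 := mk_eq_of_partner h14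
    have e23 := mk_eq_of_partner h23
    interval_cases r
    · rfl
    · rw [e12, e23, ← e03]
    · rw [e23, ← e03]
    · rw [← e03]
    · rw [← e14, e12, e23, ← e03]
  have main : ∀ j ≤ g, Quot.mk (sideGluing g) (boundaryPt g (4 * j : ℕ)) =
      Quot.mk (sideGluing g) (boundaryPt g 0) := by
    intro j
    induction j with
    | zero => intro _; simp
    | succ j ih =>
      intro hj
      rw [← ih (by omega), ← step j (by omega) 4 le_rfl]
      rfl
  rcases Nat.lt_or_ge k (4 * g) with h | h
  · rw [← main (k / 4) (by omega), ← step (k / 4) (by omega) (k % 4) (by omega), Nat.div_add_mod]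
  · obtain rfl : k = 4 * g := by omega
    exact main g le_rfl

theorem mk_eq_mk_iff {g : ℕ} (hg : 0 < g) {z w : Disk} :
    Quot.mk (sideGluing g) z = Quot.mk (sideGluing g) w ↔ Glued g z w := by
  constructor
  · intro h
    have h1 := Quot.eqvGen_exact h
    clear h
    induction h1 with
    | rel x y hxy =>
      obtain ⟨j, hj, e, he, s, hs, rfl, rfl⟩ := hxy
      exact glued_of_partner ⟨j, hj, e, by omega,
        Or.inl ⟨by linarith [hs.1], by linarith [hs.2]⟩, by ring⟩
    | refl x => exact Or.inl rfl
    | symm x y _ ih => exact ih.symm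
    | trans x y z _ _ ih1 ih2 => exact ih1.trans hg ih2
  · rintro (h | ⟨⟨k, hk, rfl⟩, k', hk', rfl⟩ | ⟨u, u', h, rfl, rfl⟩)
    · rw [h]
    · rw [mk_corner hk, mk_corner hk']
    · exact mk_eq_of_partner h

/-- The projection of the polygon onto the closed surface. -/
def toSurface (g : ℕ) : Disk → ClosedSurface g := Quot.mk (sideGluing g)

theorem toSurface_eq_iff {g : ℕ} (hg : 0 < g) {z w : Disk} :
    toSurface g z = toSurface g w ↔ Glued g z w := mk_eq_mk_iff hg

theorem isQuotientMap_toSurface (g : ℕ) : IsQuotientMap (toSurface g) := isQuotientMap_quot_mk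

theorem t2Space_closedSurface {g : ℕ} (hg : 0 < g) : T2Space (ClosedSurface g) := by
  refine t2Space_of_isQuotientMap (isQuotientMap_toSurface g) ?_
  have hset : {p : Disk × Disk | toSurface g p.1 = toSurface g p.2} = {p | p.1 = p.2} ∪
      ((boundaryPt g ∘ Nat.cast) '' Iic (4 * g)) ×ˢ ((boundaryPt g ∘ Nat.cast) '' Iic (4 * g)) ∪
      Prod.map (boundaryPt g) (boundaryPt g) '' {p : ℝ × ℝ | Partner g p.1 p.2} := by
    ext ⟨z, w⟩
    change toSurface g z = toSurface g w ↔ _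
    rw [toSurface_eq_iff hg, Glued, ← or_assoc]
    refine or_congr (or_congr Iff.rfl ?_) ?_
    · constructor
      · rintro ⟨⟨k, hk, rfl⟩, k', hk', rfl⟩
        exact ⟨⟨k, hk, rfl⟩, ⟨k', hk', rfl⟩⟩
      · rintro ⟨⟨k, hk, h⟩, ⟨k', hk', h'⟩⟩
        exact ⟨⟨k, hk, h.symm⟩, ⟨k', hk', h'.symm⟩⟩
    · constructor
      · rintro ⟨u, u', h, rfl, rfl⟩
        exact ⟨(u, u'), h, rfl⟩
      · rintro ⟨⟨u, u'⟩, h, h'⟩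
        exact ⟨u, u', h, (congr_arg Prod.fst h').symm, (congr_arg Prod.snd h').symm⟩
  rw [hset]
  -- The relation is the union of the diagonal, a finite set of pairs of corners, and the compact
  -- image of finitely many segments of partners, hence closed.
  have hfin : ((boundaryPt g ∘ Nat.cast) '' Iic (4 * g)).Finite := (finite_Iic _).image _
  refine ((isClosed_eq continuous_fst continuous_snd).union
    (hfin.prod hfin).isClosed).union ?_
  have hP : {p : ℝ × ℝ | Partner g p.1 p.2} = ⋃ j ∈ Iio g, ⋃ e ∈ Iic 1,
      (fun u : ℝ => (u, 8 * (j : ℝ) + 2 * (e : ℕ) + 3 - u)) ''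
        (Icc (4 * j + e : ℝ) (4 * j + e + 1) ∪ Icc (4 * j + e + 2 : ℝ) (4 * j + e + 3)) := by
    ext ⟨u, u'⟩
    simp only [mem_iUnion, mem_image, exists_prop]
    constructor
    · rintro ⟨j, hj, e, he, h1, h2⟩
      exact ⟨j, hj, e, he, u, h1, Prod.ext rfl (by dsimp only at h2 ⊢; linarith)⟩
    · rintro ⟨j, hj, e, he, x, h1, h2⟩
      obtain ⟨rfl, rfl⟩ := Prod.ext_iff.1 h2
      exact ⟨j, hj, e, he, h1, by dsimp only; ring⟩
  have hc : IsCompact {p : ℝ × ℝ | Partner g p.1 p.2} := by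
    rw [hP]
    refine (finite_Iio g).isCompact_biUnion fun j _ => (finite_Iic 1).isCompact_biUnion fun e _ => ?_
    exact (isCompact_Icc.union isCompact_Icc).image (by fun_prop)
  have hcont := continuous_boundaryPt g
  exact (hc.image (hcont.prodMap hcont)).isClosed

/-! ### Coordinates on the surface adapted to a separating loop through the vertex -/

/-- Data for cutting the polygon by a chord into two halves (indexed by `Bool`), with `m b` handles
in the half `b`. The chord is parametrized by `[0, N]`, and `E b` translates its parameter into the
boundary coordinate of the half `b` (for `b = false` the direction is reversed). -/
structure Frame where
  m : Bool → ℕ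
  N : ℕ
  E : Bool → ℝ ≃o ℝ
  m_pos : ∀ b, 0 < m b
  N_pos : 0 < N
  E_zero : ∀ b, E b 0 = 0
  E_N : ∀ b, E b N = 4 * m b

namespace Frame

variable (F : Frame)

/-- The genus. -/
def g : ℕ := F.m true + F.m false

theorem g_pos : 0 < F.g := Nat.add_pos_left (F.m_pos true) _

/-- The domain of the coordinates on the half `b`. -/
def dom (b : Bool) : Set (ℝ × ℝ) := Icc 0 (4 * F.m b : ℝ) ×ˢ Icc 0 1

/-- The parameter on the chord below the boundary coordinate `u`. -/
def chord : Bool → ℝ → ℝ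
  | true, u => (F.E true).symm u
  | false, u => F.N - (F.E false).symm u

/-- The coordinates of the vertex of the polygon. -/
def IsVertex (b : Bool) (p : ℝ × ℝ) : Prop :=
  p.1 = 0 ∨ p.1 = 4 * F.m b ∨ (p.2 = 1 ∧ ∃ k : ℤ, p.1 = k)

/-- Coordinates that describe the same point of the surface. -/
def Rel (b : Bool) (p : ℝ × ℝ) (b' : Bool) (p' : ℝ × ℝ) : Prop :=
  (b = b' ∧ p = p') ∨ (p.2 = 0 ∧ p'.2 = 0 ∧ F.chord b p.1 = F.chord b' p'.1) ∨
    (F.IsVertex b p ∧ F.IsVertex b' p') ∨ (b = b' ∧ p.2 = 1 ∧ p'.2 = 1 ∧ Partner (F.m b) p.1 p'.1)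

theorem continuous_chord (b : Bool) : Continuous (F.chord b) := by
  have h1 := (F.E true).symm.continuous
  have h2 := (F.E false).symm.continuous
  cases b
  · change Continuous fun u => (F.N : ℝ) - (F.E false).symm u
    fun_prop
  · exact h1

theorem chord_injective (b : Bool) : Function.Injective (F.chord b) := by
  cases b
  · intro u w h
    exact (F.E false).symm.injective (sub_right_injective h)
  · exact (F.E true).symm.injective

theorem E_symm_mem {b : Bool} {u : ℝ} (hu : u ∈ Icc 0 (4 * F.m b : ℝ)) :
    (F.E b).symm u ∈ Icc 0 (F.N : ℝ) := by
  constructor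
  · rw [← (F.E b).le_iff_le, F.E_zero, OrderIso.apply_symm_apply]; exact hu.1
  · rw [← (F.E b).le_iff_le, F.E_N, OrderIso.apply_symm_apply]; exact hu.2

theorem chord_mem {b : Bool} {u : ℝ} (hu : u ∈ Icc 0 (4 * F.m b : ℝ)) :
    F.chord b u ∈ Icc 0 (F.N : ℝ) := by
  have h := F.E_symm_mem hu
  cases b
  · exact ⟨sub_nonneg.2 h.2, by simpa [chord] using h.1⟩
  · exact h

theorem chord_eq_end {b : Bool} {u : ℝ} (h : F.chord b u = 0 ∨ F.chord b u = F.N) :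
    u = 0 ∨ u = 4 * F.m b := by
  have h0 : ∀ b, (F.E b).symm u = 0 → u = 0 := by
    intro b hb
    rw [← F.E_zero b, ← hb, OrderIso.apply_symm_apply]
  have hN : ∀ b, (F.E b).symm u = F.N → u = 4 * F.m b := by
    intro b hb
    rw [← F.E_N b, ← hb, OrderIso.apply_symm_apply]
  cases b
  · rcases h with h | h
    · exact Or.inr (hN _ (sub_eq_zero.1 h).symm)
    · exact Or.inl (h0 _ (by simpa [chord] using h))
  · rcases h with h | h
    · exact Or.inl (h0 _ h)
    · exact Or.inr (hN _ h)

theorem chord_zero (b : Bool) : F.chord b 0 = if b then 0 else (F.N : ℝ) := by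
  have h : (F.E b).symm 0 = 0 := by rw [OrderIso.symm_apply_eq, F.E_zero]
  cases b
  · simp [chord, h]
  · simp [chord, h]

theorem chord_end (b : Bool) : F.chord b (4 * F.m b) = if b then (F.N : ℝ) else 0 := by
  have h : (F.E b).symm (4 * F.m b) = F.N := by rw [OrderIso.symm_apply_eq, F.E_N]
  cases b
  · simp [chord, h]
  · simp [chord, h]

/-- The boundary coordinate over the chord parameter `x`. -/
def bdry : Bool → ℝ → ℝ
  | true, x => F.E true x
  | false, x => F.E false (F.N - x)

theorem chord_bdry (b : Bool) (x : ℝ) : F.chord b (F.bdry b x) = x := by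
  cases b <;> simp [chord, bdry]

theorem bdry_chord (b : Bool) (u : ℝ) : F.bdry b (F.chord b u) = u := by
  cases b <;> simp [chord, bdry]

theorem bdry_mem (b : Bool) {x : ℝ} (hx : x ∈ Icc 0 (F.N : ℝ)) :
    F.bdry b x ∈ Icc 0 (4 * F.m b : ℝ) := by
  have key : ∀ {x : ℝ}, x ∈ Icc 0 (F.N : ℝ) → F.E b x ∈ Icc 0 (4 * F.m b : ℝ) := by
    intro x hx
    rw [← F.E_zero b, ← F.E_N b]
    exact ⟨(F.E b).monotone hx.1, (F.E b).monotone hx.2⟩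
  cases b
  · exact key ⟨by linarith [hx.2], by linarith [hx.1]⟩
  · exact key hx

/-- The angle of the endpoint in the first half of the sweeping chord. -/
def angleTop (x : ℝ) : ℝ := 2 * Real.pi * (F.E true x / (4 * F.g))

/-- The angle of the endpoint in the second half of the sweeping chord. -/
def angleBot (x : ℝ) : ℝ := 2 * Real.pi * ((4 * F.m true + F.E false (F.N - x)) / (4 * F.g))

theorem four_g_pos : (0 : ℝ) < 4 * F.g := by
  have := F.g_pos
  positivity

theorem angleTop_strictMono : StrictMono F.angleTop := by
  intro x y h
  have := F.four_g_pos
  have := (F.E true).strictMono h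
  unfold angleTop
  gcongr

theorem angleBot_strictAnti : StrictAnti F.angleBot := by
  intro x y h
  have := F.four_g_pos
  have := (F.E false).strictMono (show (F.N : ℝ) - y < F.N - x by linarith)
  unfold angleBot
  gcongr

theorem continuous_angleTop : Continuous F.angleTop := by
  have := (F.E true).continuous
  unfold angleTop
  fun_prop

theorem continuous_angleBot : Continuous F.angleBot := by
  have := (F.E false).continuous
  unfold angleBot
  fun_prop

theorem angleTop_zero : F.angleTop 0 = 0 := by simp [angleTop, F.E_zero]

theorem angleBot_zero : F.angleBot 0 = 2 * Real.pi := by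
  rw [angleBot, sub_zero, F.E_N, ← mul_add, ← Nat.cast_add]
  change 2 * Real.pi * (4 * (F.g : ℝ) / (4 * F.g)) = _
  rw [div_self F.four_g_pos.ne', mul_one]

theorem angle_N : F.angleTop F.N = F.angleBot F.N := by
  simp [angleTop, angleBot, F.E_zero, F.E_N]

theorem angle_le {x : ℝ} (hx : x ∈ Icc 0 (F.N : ℝ)) : F.angleTop x ≤ F.angleBot x ∧
    F.angleBot x - F.angleTop x ≤ 2 * Real.pi := by
  have h1 := F.angleTop_strictMono.monotone hx.1
  have h2 := F.angleTop_strictMono.monotone hx.2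
  have h3 := F.angleBot_strictAnti.antitone hx.1
  have h4 := F.angleBot_strictAnti.antitone hx.2
  rw [angleTop_zero] at h1
  rw [angleBot_zero] at h3
  have := F.angle_N
  constructor <;> linarith

theorem angle_lt {x : ℝ} (hx : x ∈ Ioo 0 (F.N : ℝ)) : F.angleTop x < F.angleBot x ∧
    F.angleBot x - F.angleTop x < 2 * Real.pi := by
  have h1 := F.angleTop_strictMono hx.1
  have h2 := F.angleTop_strictMono hx.2
  have h3 := F.angleBot_strictAnti hx.1
  have h4 := F.angleBot_strictAnti hx.2
  rw [angleTop_zero] at h1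
  rw [angleBot_zero] at h3
  have := F.angle_N
  constructor <;> linarith

/-- The sweep of the disk by chords. -/
def sweep (x s : ℝ) : ℂ := chordPt (F.angleTop x) (F.angleBot x) s

theorem continuous_sweep : Continuous fun y : ℝ × ℝ => F.sweep y.1 y.2 := by
  have h1 := F.continuous_angleTop
  have h2 := F.continuous_angleBot
  simp only [sweep, chordPt_eq_combination]
  fun_prop

/-- One endpoint angle increases and the other decreases, so the arcs are nested and their chords
disjoint. The only failures of injectivity are the two degenerate chords at the ends of the sweep.
-/
theorem sweep_inj {x x' s s' : ℝ} (hx : x ∈ Icc 0 (F.N : ℝ)) (hx' : x' ∈ Icc 0 (F.N : ℝ))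
    (hs : s ∈ Icc (-1 : ℝ) 1) (hs' : s' ∈ Icc (-1 : ℝ) 1) (h : F.sweep x s = F.sweep x' s') :
    x = x' ∧ (s = s' ∨ x = 0 ∨ x = F.N) := by
  have hne : ∀ {x x' s s' : ℝ}, x ∈ Icc 0 (F.N : ℝ) → x' ∈ Icc 0 (F.N : ℝ) →
      s' ∈ Icc (-1 : ℝ) 1 → x < x' → F.sweep x s ≠ F.sweep x' s' := by
    intro x x' s s' hx hx' hs' hlt
    exact chordPt_ne (F.angle_le hx).2 (F.angleTop_strictMono hlt) (F.angle_le hx').1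
      (F.angleBot_strictAnti hlt) hs'
  have hxx : x = x' := by
    rcases lt_trichotomy x x' with hlt | heq | hlt
    · exact absurd h (hne hx hx' hs' hlt)
    · exact heq
    · exact absurd h.symm (hne hx' hx hs hlt)
  refine ⟨hxx, ?_⟩
  subst hxx
  rcases hx.1.eq_or_lt with h0 | h0
  · exact Or.inr (Or.inl h0.symm)
  rcases hx.2.eq_or_lt with h1 | h1
  · exact Or.inr (Or.inr h1)
  have h2 := F.angle_lt ⟨h0, h1⟩
  exact Or.inl (chordPt_injective h2.1 h2.2 h)

/-- The sign that distinguishes the two halves of a sweeping chord. -/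
def sign (b : Bool) : ℝ := if b then -1 else 1

/-- The point of the disk with given coordinates. -/
def diskPt (b : Bool) (p : ℝ × ℝ) : ℂ := F.sweep (F.chord b p.1) (sign b * p.2)

theorem sign_mul_mem (b : Bool) {t : ℝ} (ht : t ∈ Icc (0 : ℝ) 1) :
    sign b * t ∈ Icc (-1 : ℝ) 1 := by
  cases b
  · simp [sign]; exact ⟨by linarith [ht.1], ht.2⟩
  · simp [sign]; exact ⟨ht.2, by linarith [ht.1]⟩

theorem norm_diskPt_le (b : Bool) {p : ℝ × ℝ} (hp : p ∈ F.dom b) : ‖F.diskPt b p‖ ≤ 1 :=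
  norm_chordPt_le _ _ (sign_mul_mem b hp.2)

theorem continuous_diskPt (b : Bool) : Continuous (F.diskPt b) := by
  have h := F.continuous_chord b
  exact F.continuous_sweep.comp (g := fun y : ℝ × ℝ => F.sweep y.1 y.2)
    (f := fun p : ℝ × ℝ => (F.chord b p.1, sign b * p.2)) (by fun_prop)

theorem exists_diskPt_eq {z : ℂ} (hz : ‖z‖ ≤ 1) : ∃ b, ∃ p ∈ F.dom b, F.diskPt b p = z := by
  obtain ⟨x, hx, s, hs, h⟩ := exists_chordPt_eq (Nat.cast_nonneg F.N) F.continuous_angleTop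
    F.continuous_angleBot F.angleTop_zero F.angleBot_zero F.angle_N (fun x hx => F.angle_le hx) hz
  rcases le_total s 0 with h0 | h0
  · refine ⟨true, (F.bdry true x, -s), ⟨F.bdry_mem _ hx, by linarith, by linarith [hs.1]⟩, ?_⟩
    simp only [diskPt, chord_bdry, sign, sweep]
    simpa using h
  · refine ⟨false, (F.bdry false x, s), ⟨F.bdry_mem _ hx, h0, hs.2⟩, ?_⟩
    simp only [diskPt, chord_bdry, sign, sweep]
    simpa using h

/-- Coordinates related by everything except the identifications of the sides. -/
theorem diskPt_eq_cases {b b' : Bool} {p p' : ℝ × ℝ} (hp : p ∈ F.dom b) (hp' : p' ∈ F.dom b')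
    (h : F.diskPt b p = F.diskPt b' p') : (b = b' ∧ p = p') ∨
      (p.2 = 0 ∧ p'.2 = 0 ∧ F.chord b p.1 = F.chord b' p'.1) ∨
      ((p.1 = 0 ∨ p.1 = 4 * F.m b) ∧ (p'.1 = 0 ∨ p'.1 = 4 * F.m b')) := by
  obtain ⟨h1, h2⟩ := F.sweep_inj (F.chord_mem hp.1) (F.chord_mem hp'.1)
    (sign_mul_mem b hp.2) (sign_mul_mem b' hp'.2) h
  rcases h2 with h2 | h2
  · by_cases hb : b = b'
    · subst hb
      left
      refine ⟨rfl, Prod.ext (F.chord_injective b h1) ?_⟩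
      cases b <;> simpa [sign] using h2
    · right; left
      have := hp.2.1
      have := hp'.2.1
      have h3 : p.2 = 0 ∧ p'.2 = 0 := by
        cases b <;> cases b'
        · exact absurd rfl hb
        · simp only [sign] at h2; norm_num at h2; constructor <;> linarith
        · simp only [sign] at h2; norm_num at h2; constructor <;> linarith
        · exact absurd rfl hb
      exact ⟨h3.1, h3.2, h1⟩
  · right; right
    exact ⟨F.chord_eq_end h2, F.chord_eq_end (by rwa [← h1])⟩

/-- The offset of the boundary coordinate of the half `b` in the boundary of the polygon. -/
def offset (b : Bool) : ℝ := if b then 0 else 4 * F.m true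

theorem diskPt_side (b : Bool) (u : ℝ) :
    F.diskPt b (u, 1) = boundaryPt F.g (F.offset b + u) := by
  cases b
  · simp only [diskPt, sweep, sign, chord, offset]
    norm_num [chordPt_one]
    simp only [angleBot, sub_sub_cancel, OrderIso.apply_symm_apply, boundaryPt]
  · simp only [diskPt, sweep, sign, chord, offset]
    norm_num [chordPt_neg_one]
    simp only [angleTop, OrderIso.apply_symm_apply, boundaryPt]

/-- The sweeping chord is degenerate there, so the whole segment over the end of the boundary
coordinate collapses to a corner. This is why `IsVertex` ignores the height at the two ends. -/
theorem diskPt_zero (b : Bool) (t : ℝ) : F.diskPt b (0, t) = boundaryPt F.g 0 ∨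
    F.diskPt b (0, t) = boundaryPt F.g (4 * F.m true : ℝ) := by
  have key : ∀ s s', F.sweep F.N s = F.sweep F.N s' := by
    intro s s'
    simp [sweep, chordPt, F.angle_N]
  have key0 : ∀ s s', F.sweep 0 s = F.sweep 0 s' := by
    intro s s'
    simp [sweep, chordPt, F.angleTop_zero, F.angleBot_zero]
  have h1 := F.diskPt_side b 0
  cases b
  · right
    have : F.diskPt false (0, t) = F.diskPt false (0, 1) := by
      simp only [diskPt, F.chord_zero]; exact key _ _
    rw [this, h1]; simp [offset]
  · left
    have : F.diskPt true (0, t) = F.diskPt true (0, 1) := by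
      simp only [diskPt, F.chord_zero]; exact key0 _ _
    rw [this, h1]; simp [offset]

theorem diskPt_end (b : Bool) (t : ℝ) : F.diskPt b (4 * F.m b, t) = boundaryPt F.g 0 ∨
    F.diskPt b (4 * F.m b, t) = boundaryPt F.g (4 * F.m true : ℝ) := by
  have h0 : ∀ s : ℝ, F.chord b (4 * F.m b) = F.chord (!b) 0 := by
    intro _
    rw [F.chord_end, F.chord_zero]; cases b <;> rfl
  have h1 : F.diskPt b (4 * F.m b, t) = F.diskPt (!b) (0, -t) := by
    simp only [diskPt, h0 0]
    cases b <;> simp [sign]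
  rw [h1]
  exact F.diskPt_zero _ _

end Frame

/-! ### The gluing relation in the adapted coordinates -/

namespace Frame

variable (F : Frame)

theorem offset_add_mem (b : Bool) {u : ℝ} (hu : u ∈ Icc 0 (4 * F.m b : ℝ)) :
    F.offset b + u ∈ Icc 0 (4 * F.g : ℝ) := by
  have h : (F.g : ℝ) = F.m true + F.m false := by rw [g]; push_cast; ring
  have h1 : (0 : ℝ) ≤ F.m true := by positivity
  have h2 : (0 : ℝ) ≤ F.m false := by positivity
  cases b
  · simp only [offset]
    exact ⟨by simp; linarith [hu.1], by simp; linarith [hu.2]⟩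
  · simp only [offset]
    exact ⟨by simp; linarith [hu.1], by simp; linarith [hu.2]⟩

theorem exists_offset_add {w : ℝ} (hw : w ∈ Icc 0 (4 * F.g : ℝ)) :
    ∃ b, ∃ u ∈ Icc 0 (4 * F.m b : ℝ), w = F.offset b + u := by
  have h : (F.g : ℝ) = F.m true + F.m false := by rw [g]; push_cast; ring
  rcases le_total w (4 * F.m true) with h1 | h1
  · exact ⟨true, w, ⟨hw.1, h1⟩, by simp [offset]⟩
  · exact ⟨false, w - 4 * F.m true, ⟨by linarith, by linarith [hw.2]⟩, by simp [offset]⟩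

theorem offset_int (b : Bool) : ∃ k : ℤ, F.offset b = k := by
  cases b
  · exact ⟨4 * F.m true, by simp [offset]⟩
  · exact ⟨0, by simp [offset]⟩

theorem diskPt_eq_boundaryPt {b b' : Bool} {p : ℝ × ℝ} {u : ℝ} (hp : p ∈ F.dom b)
    (hu : u ∈ Icc 0 (4 * F.m b' : ℝ)) (h : F.diskPt b p = boundaryPt F.g (F.offset b' + u)) :
    (b = b' ∧ p = (u, 1)) ∨
      ((p.1 = 0 ∨ p.1 = 4 * F.m b) ∧ (u = 0 ∨ u = 4 * F.m b')) := by
  rw [← F.diskPt_side b' u] at h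
  rcases F.diskPt_eq_cases hp ⟨hu, by simp, le_rfl⟩ h with h | h | h
  · exact Or.inl h
  · exact absurd h.2.1 one_ne_zero
  · exact Or.inr h

theorem isVertex_of_end {b : Bool} {p : ℝ × ℝ} (h : p.1 = 0 ∨ p.1 = 4 * F.m b) :
    F.IsVertex b p := h.elim Or.inl fun h => Or.inr (Or.inl h)

theorem isVertex_of_diskPt {b : Bool} {p : ℝ × ℝ} (hp : p ∈ F.dom b) {k : ℕ} (hk : k ≤ 4 * F.g)
    (h : F.diskPt b p = boundaryPt F.g k) : F.IsVertex b p := by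
  obtain ⟨b', u, hu, hw⟩ := F.exists_offset_add (w := k) ⟨by positivity, by exact_mod_cast hk⟩
  rw [hw] at h
  rcases F.diskPt_eq_boundaryPt hp hu h with ⟨rfl, rfl⟩ | h'
  · obtain ⟨i, hi⟩ := F.offset_int b
    refine Or.inr (Or.inr ⟨rfl, k - i, ?_⟩)
    push_cast
    rw [← hi]
    linarith
  · exact F.isVertex_of_end h'.1

theorem exists_corner_of_isVertex {b : Bool} {p : ℝ × ℝ} (hp : p ∈ F.dom b)
    (h : F.IsVertex b p) : ∃ k : ℕ, k ≤ 4 * F.g ∧ F.diskPt b p = boundaryPt F.g k := by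
  have hmt : ∀ x : ℂ, (x = boundaryPt F.g 0 ∨ x = boundaryPt F.g (4 * F.m true : ℝ)) →
      ∃ k : ℕ, k ≤ 4 * F.g ∧ x = boundaryPt F.g k := by
    rintro x (h | h)
    · exact ⟨0, by simp, by simpa using h⟩
    · exact ⟨4 * F.m true, by unfold g; omega, by rw [h]; push_cast; rfl⟩
  obtain ⟨u, t⟩ := p
  rcases h with h | h | ⟨h, k, hk⟩
  · dsimp only at h
    subst h
    exact hmt _ (F.diskPt_zero b t)
  · dsimp only at h
    subst h
    exact hmt _ (F.diskPt_end b t)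
  · dsimp only at h hk
    subst h
    obtain ⟨i, hi⟩ := F.offset_int b
    obtain ⟨n, hn, hn'⟩ := nat_of_int_mem (g := F.g) (F.offset_add_mem b hp.1) (k := i + k)
      (by push_cast; rw [← hi, ← hk])
    exact ⟨n, hn, by rw [diskPt_side, ← hn']⟩

theorem partner_offset_iff {b : Bool} {u u' : ℝ} (h : Partner (F.m b) u u') :
    Partner F.g (F.offset b + u) (F.offset b + u') := by
  rw [g, partner_add]
  cases b
  · right
    simpa [offset] using h
  · left
    simpa [offset] using h

theorem exists_partner_offset {w w' : ℝ} (h : Partner F.g w w') :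
    ∃ b u u', w = F.offset b + u ∧ w' = F.offset b + u' ∧ Partner (F.m b) u u' := by
  rw [g, partner_add] at h
  rcases h with h | h
  · exact ⟨true, w, w', by simp [offset], by simp [offset], h⟩
  · exact ⟨false, _, _, by simp [offset], by simp [offset], h⟩

theorem isVertex_of_int {b b' : Bool} {p : ℝ × ℝ} {u : ℝ} (hu : ∃ k : ℤ, u = k)
    (h : (b = b' ∧ p = (u, 1)) ∨
      ((p.1 = 0 ∨ p.1 = 4 * F.m b) ∧ (u = 0 ∨ u = 4 * F.m b'))) : F.IsVertex b p := by
  rcases h with ⟨-, rfl⟩ | h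
  · exact Or.inr (Or.inr ⟨rfl, hu⟩)
  · exact F.isVertex_of_end h.1

theorem int_of_end {b : Bool} {u : ℝ} (h : u = 0 ∨ u = 4 * F.m b) : ∃ k : ℤ, u = k := by
  rcases h with rfl | rfl
  · exact ⟨0, by simp⟩
  · exact ⟨4 * F.m b, by simp⟩

/-- Adapted coordinates on the surface, with the center of the polygon at a prescribed place. -/
theorem exists_chart : ∃ q : Bool → ℝ × ℝ → ClosedSurface F.g,
    (∀ b, Continuous (q b)) ∧ (∀ y, ∃ b, ∃ p ∈ F.dom b, q b p = y) ∧
    (∀ b b', ∀ p ∈ F.dom b, ∀ p' ∈ F.dom b', (q b p = q b' p' ↔ F.Rel b p b' p')) ∧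
    toSurface F.g ⟨0, by simp⟩ = q true (1 / 8, 1 / 2) := by
  have hmt : (1 : ℝ) ≤ F.m true := by exact_mod_cast F.m_pos true
  have hcenter : (1 / 8, 1 / 2) ∈ F.dom true :=
    ⟨⟨by norm_num, by linarith⟩, by norm_num, by norm_num⟩
  have hc : ‖F.diskPt true (1 / 8, 1 / 2)‖ < 1 := by
    have h1 := F.chord_mem hcenter.1
    have h2 : F.chord true (1 / 8) ∈ Ioo 0 (F.N : ℝ) := by
      have h3 : ¬ (F.chord true (1 / 8) = 0 ∨ F.chord true (1 / 8) = F.N) := by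
        intro h
        rcases F.chord_eq_end h with h | h
        · norm_num at h
        · linarith
      push Not at h3
      exact ⟨lt_of_le_of_ne h1.1 h3.1.symm, lt_of_le_of_ne h1.2 h3.2⟩
    have h4 := F.angle_lt h2
    refine norm_chordPt_lt h4.1 h4.2 ?_
    simp only [sign]
    norm_num
  -- The center, where the puncture sits when there is one, is moved to prescribed coordinates. The
  -- homeomorphism fixes the circle, so the side identifications are unaffected.
  obtain ⟨D, hD0, hD1⟩ := exists_homeomorph_disk hc
  -- Retracting the plane onto the rectangle makes the coordinate maps continuous everywhere; only
  -- their values on `F.dom b` matter.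
  let clamp : Bool → ℝ × ℝ → ℝ × ℝ := fun b p =>
    (max 0 (min p.1 (4 * F.m b)), max 0 (min p.2 1))
  have hclamp : ∀ b p, clamp b p ∈ F.dom b := fun b p =>
    ⟨⟨le_max_left _ _, max_le (by positivity) (min_le_right _ _)⟩,
      ⟨le_max_left _ _, max_le zero_le_one (min_le_right _ _)⟩⟩
  have hclamp_id : ∀ b, ∀ p ∈ F.dom b, clamp b p = p := by
    rintro b ⟨u, t⟩ ⟨⟨h1, h2⟩, h3, h4⟩
    dsimp only at h1 h2 h3 h4
    simp only [clamp, min_eq_left h2, max_eq_right h1, min_eq_left h4, max_eq_right h3]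
  let d : Bool → ℝ × ℝ → Disk := fun b p =>
    ⟨F.diskPt b (clamp b p), mem_closedBall_zero_iff.2 (F.norm_diskPt_le b (hclamp b p))⟩
  have hd : ∀ b, ∀ p ∈ F.dom b, (d b p : ℂ) = F.diskPt b p := fun b p hp => by
    simp only [d, hclamp_id b p hp]
  have hdc : ∀ b, Continuous (d b) := by
    intro b
    refine Continuous.subtype_mk ((F.continuous_diskPt b).comp ?_) _
    simp only [clamp]
    fun_prop
  have hfix : ∀ w, D.symm (boundaryPt F.g w) = boundaryPt F.g w := by
    intro w
    rw [Homeomorph.symm_apply_eq, hD1 _ (norm_boundaryPt _ _)]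
  have hsymm : ∀ z w, D.symm z = boundaryPt F.g w → z = boundaryPt F.g w := by
    intro z w h
    rw [Homeomorph.symm_apply_eq, hD1 _ (norm_boundaryPt _ _)] at h
    exact h
  refine ⟨fun b p => toSurface F.g (D.symm (d b p)), ?_, ?_, ?_, ?_⟩
  · intro b
    have := hdc b
    exact (isQuotientMap_toSurface F.g).continuous.comp (D.symm.continuous.comp this)
  · intro y
    obtain ⟨z, rfl⟩ := (isQuotientMap_toSurface F.g).surjective y
    obtain ⟨b, p, hp, h⟩ := F.exists_diskPt_eq (mem_closedBall_zero_iff.1 (D z).2)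
    refine ⟨b, p, hp, ?_⟩
    have : d b p = D z := Subtype.ext ((hd b p hp).trans h)
    dsimp only
    rw [this, Homeomorph.symm_apply_apply]
  · intro b b' p hp p' hp'
    rw [toSurface_eq_iff F.g_pos]
    constructor
    · rintro (h | ⟨⟨k, hk, h1⟩, k', hk', h2⟩ | ⟨w, w', h, h1, h2⟩)
      · have h0 : F.diskPt b p = F.diskPt b' p' := by
          rw [← hd b p hp, ← hd b' p' hp', D.symm.injective h]
        rcases F.diskPt_eq_cases hp hp' h0 with h | h | h
        · exact Or.inl h
        · exact Or.inr (Or.inl h)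
        · exact Or.inr (Or.inr (Or.inl ⟨F.isVertex_of_end h.1, F.isVertex_of_end h.2⟩))
      · refine Or.inr (Or.inr (Or.inl ⟨F.isVertex_of_diskPt hp hk ?_,
          F.isVertex_of_diskPt hp' hk' ?_⟩))
        · rw [← hd b p hp, hsymm _ _ h1]
        · rw [← hd b' p' hp', hsymm _ _ h2]
      · obtain ⟨b₀, u, u', rfl, rfl, hu⟩ := F.exists_partner_offset h
        have e1 : F.diskPt b p = boundaryPt F.g (F.offset b₀ + u) := by
          rw [← hd b p hp, hsymm _ _ h1]
        have e2 : F.diskPt b' p' = boundaryPt F.g (F.offset b₀ + u') := by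
          rw [← hd b' p' hp', hsymm _ _ h2]
        have c1 := F.diskPt_eq_boundaryPt hp hu.mem_Icc e1
        have c2 := F.diskPt_eq_boundaryPt hp' hu.symm.mem_Icc e2
        have hvert : (∃ k : ℤ, u = k) → F.Rel b p b' p' := by
          intro hk
          have hk' : ∃ k : ℤ, u' = k := by
            obtain ⟨k, rfl⟩ := hk
            exact hu.int
          exact Or.inr (Or.inr (Or.inl ⟨F.isVertex_of_int hk c1, F.isVertex_of_int hk' c2⟩))
        rcases c1 with ⟨rfl, rfl⟩ | c1
        · rcases c2 with ⟨rfl, rfl⟩ | c2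
          · exact Or.inr (Or.inr (Or.inr ⟨rfl, rfl, rfl, hu⟩))
          · obtain ⟨k, rfl⟩ := F.int_of_end c2.2
            exact hvert hu.symm.int
        · exact hvert (F.int_of_end c1.2)
    · rintro (⟨rfl, rfl⟩ | ⟨h1, h2, h3⟩ | ⟨h1, h2⟩ | ⟨rfl, h1, h2, h3⟩)
      · exact Or.inl rfl
      · left
        congr 1
        apply Subtype.ext
        rw [hd b p hp, hd b' p' hp', diskPt, diskPt, h1, h2, h3, mul_zero, mul_zero]
      · obtain ⟨k, hk, e1⟩ := F.exists_corner_of_isVertex hp h1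
        obtain ⟨k', hk', e2⟩ := F.exists_corner_of_isVertex hp' h2
        refine Or.inr (Or.inl ⟨⟨k, hk, ?_⟩, k', hk', ?_⟩)
        · rw [← hfix]
          exact congr_arg _ (Subtype.ext ((hd b p hp).trans e1))
        · rw [← hfix]
          exact congr_arg _ (Subtype.ext ((hd b' p' hp').trans e2))
      · refine Or.inr (Or.inr ⟨F.offset b + p.1, F.offset b + p'.1,
          F.partner_offset_iff h3, ?_, ?_⟩)
        · rw [← hfix]
          refine congr_arg _ (Subtype.ext ((hd b p hp).trans ?_))
          rw [← F.diskPt_side, ← h1]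
        · rw [← hfix]
          refine congr_arg _ (Subtype.ext ((hd b p' hp').trans ?_))
          rw [← F.diskPt_side, ← h2]
  · dsimp only
    congr 1
    rw [Homeomorph.eq_symm_apply]
    exact Subtype.ext (hD0.trans (hd true _ hcenter).symm)

end Frame

/-! ### Charts, and maps that descend to the surface -/

namespace Frame

/-- Adapted coordinates on the surface. -/
structure Chart (F : Frame) where
  q : Bool → ℝ × ℝ → ClosedSurface F.g
  continuous_q : ∀ b, Continuous (q b)
  exists_q_eq : ∀ y, ∃ b, ∃ p ∈ F.dom b, q b p = y
  q_eq_iff : ∀ {b b' p p'}, p ∈ F.dom b → p' ∈ F.dom b' → (q b p = q b' p' ↔ F.Rel b p b' p')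

namespace Chart

variable {F : Frame} (Q : F.Chart)

theorem isCompact_dom (F : Frame) (b : Bool) : IsCompact (F.dom b) :=
  isCompact_Icc.prod isCompact_Icc

/-- The two compact rectangles map onto a Hausdorff space, so the surface is their quotient. A map
out of it can be defined in coordinates and checked on `Rel` alone. -/
theorem exists_descent {Y : Type} [TopologicalSpace Y] (f : Bool → ℝ × ℝ → Y)
    (hf : ∀ b, Continuous (f b))
    (hrel : ∀ b b', ∀ p ∈ F.dom b, ∀ p' ∈ F.dom b', F.Rel b p b' p' → f b p = f b' p') :
    ∃ Φ : C(ClosedSurface F.g, Y), ∀ b, ∀ p ∈ F.dom b, Φ (Q.q b p) = f b p := by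
  have hcpt : ∀ b, CompactSpace (F.dom b) := fun b => isCompact_iff_compactSpace.1
    (isCompact_dom F b)
  have hT2 := t2Space_closedSurface F.g_pos
  let π : (Σ b, F.dom b) → ClosedSurface F.g := fun y => Q.q y.1 y.2
  have hπc : Continuous π := continuous_sigma fun b =>
    (Q.continuous_q b).comp continuous_subtype_val
  have hπs : Function.Surjective π := by
    intro y
    obtain ⟨b, p, hp, h⟩ := Q.exists_q_eq y
    exact ⟨⟨b, p, hp⟩, h⟩
  have hπ : IsQuotientMap π := hπc.isClosedMap.isQuotientMap hπc hπs
  let φ : C((Σ b, F.dom b), Y) := ⟨fun y => f y.1 y.2, continuous_sigma fun b =>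
    (hf b).comp continuous_subtype_val⟩
  have hφ : Function.FactorsThrough φ π := by
    rintro ⟨b, p, hp⟩ ⟨b', p', hp'⟩ h
    exact hrel b b' p hp p' hp' ((Q.q_eq_iff hp hp').1 h)
  refine ⟨IsQuotientMap.lift (f := ⟨π, hπc⟩) hπ φ hφ, fun b p hp => ?_⟩
  exact congr_fun (congr_arg DFunLike.coe
    (IsQuotientMap.lift_comp (f := ⟨π, hπc⟩) hπ φ hφ)) ⟨b, p, hp⟩

end Chart

/-! ### Maps to the Klein bottle -/

/-- A zigzag of period `4` with values `0, π, 2π, π` at `0, 1, 2, 3`. -/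
def zigzag (u : ℝ) : ℝ := 2 * Real.arccos (Real.cos (Real.pi * u / 2))

theorem continuous_zigzag : Continuous zigzag := by
  have := Real.continuous_arccos
  unfold zigzag
  fun_prop

theorem zigzag_up (j : ℤ) {u : ℝ} (h1 : 4 * j ≤ u) (h2 : u ≤ 4 * j + 2) :
    zigzag u = Real.pi * (u - 4 * j) := by
  have : Real.cos (Real.pi * u / 2) = Real.cos (Real.pi * (u - 4 * j) / 2) := by
    rw [← Real.cos_add_int_mul_two_pi (Real.pi * (u - 4 * j) / 2) j]
    congr 1
    ring
  have hpi := Real.pi_pos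
  rw [zigzag, this, Real.arccos_cos]
  · ring
  · have : 0 ≤ u - 4 * j := by linarith
    positivity
  · nlinarith

theorem zigzag_down (j : ℤ) {u : ℝ} (h1 : 4 * j + 2 ≤ u) (h2 : u ≤ 4 * j + 4) :
    zigzag u = Real.pi * (4 * j + 4 - u) := by
  have : Real.cos (Real.pi * u / 2) = Real.cos (Real.pi * (4 * j + 4 - u) / 2) := by
    rw [← Real.cos_neg (Real.pi * (4 * j + 4 - u) / 2),
      ← Real.cos_add_int_mul_two_pi (-(Real.pi * (4 * j + 4 - u) / 2)) (j + 1)]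
    congr 1
    push_cast
    ring
  have hpi := Real.pi_pos
  rw [zigzag, this, Real.arccos_cos]
  · ring
  · have : 0 ≤ 4 * j + 4 - u := by linarith
    positivity
  · nlinarith

theorem exp_add_pi (x : ℝ) : Circle.exp (x + Real.pi) = -Circle.exp x := by
  apply Circle.ext
  simp [Circle.coe_exp]

/-- At glued points the zigzag values, on a rising and a falling branch, differ by `π`. The circle
coordinate thus changes by the antipodal map, as the reflections in the deck group require. -/
theorem exp_zigzag_partner {m : ℕ} {u u' : ℝ} (h : Partner m u u') :
    Circle.exp (zigzag u) = -Circle.exp (zigzag u') := by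
  have key : ∀ {u u' : ℝ} {j e : ℕ}, e ≤ 1 → (4 * j + e ≤ u ∧ u ≤ 4 * j + e + 1) →
      u + u' = 8 * j + 2 * e + 3 → Circle.exp (zigzag u) = -Circle.exp (zigzag u') := by
    intro u u' j e he h1 h2
    obtain rfl | rfl : e = 0 ∨ e = 1 := by omega
    · push_cast at h1 h2
      rw [zigzag_up j (by push_cast; linarith) (by push_cast; linarith),
        zigzag_down j (by push_cast; linarith) (by push_cast; linarith)]
      rw [← exp_add_pi, ← Circle.exp_add_two_pi]
      congr 1
      push_cast
      linear_combination Real.pi * h2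
    · push_cast at h1 h2
      rw [zigzag_up j (by push_cast; linarith) (by push_cast; linarith),
        zigzag_down j (by push_cast; linarith) (by push_cast; linarith)]
      rw [← exp_add_pi]
      congr 1
      push_cast
      linear_combination Real.pi * h2
  obtain ⟨j, hj, e, he, h1, h2⟩ := h
  rcases h1 with h1 | h1
  · exact key he h1 h2
  · have := key (u := u') (u' := u) (j := j) he ⟨by linarith, by linarith⟩ (by linarith)
    rw [this, neg_neg]

theorem exp_zigzag_int (k : ℤ) : (Even k ∧ Circle.exp (zigzag k) = 1) ∨
    (Odd k ∧ Circle.exp (zigzag k) = -1) := by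
  have hpi : Circle.exp Real.pi = -1 := by simpa using exp_add_pi 0
  obtain ⟨j, r, h0, h4, rfl⟩ : ∃ j r : ℤ, 0 ≤ r ∧ r < 4 ∧ k = 4 * j + r :=
    ⟨k / 4, k % 4, by omega, by omega, by omega⟩
  have : r = 0 ∨ r = 1 ∨ r = 2 ∨ r = 3 := by omega
  rcases this with rfl | rfl | rfl | rfl
  · left
    refine ⟨⟨2 * j, by ring⟩, ?_⟩
    rw [zigzag_up j (by push_cast; linarith) (by push_cast; linarith)]
    push_cast
    simp
  · right
    refine ⟨⟨2 * j, by ring⟩, ?_⟩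
    rw [zigzag_up j (by push_cast; linarith) (by push_cast; linarith)]
    push_cast
    simpa using hpi
  · left
    refine ⟨⟨2 * j + 1, by ring⟩, ?_⟩
    rw [zigzag_up j (by push_cast; linarith) (by push_cast; linarith)]
    push_cast
    rw [add_sub_cancel_left, mul_comm, Circle.exp_two_pi]
  · right
    refine ⟨⟨2 * j + 1, by ring⟩, ?_⟩
    rw [zigzag_down j (by push_cast; linarith) (by push_cast; linarith)]
    push_cast
    rw [show (4 * (j : ℝ) + 4 - (4 * j + 3)) = 1 by ring, mul_one, hpi]

theorem cos_int (k : ℤ) : (Even k → Real.cos (Real.pi * k) = 1) ∧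
    (Odd k → Real.cos (Real.pi * k) = -1) := by
  constructor
  · rintro ⟨j, rfl⟩
    rw [← Real.cos_zero, ← Real.cos_add_int_mul_two_pi 0 j]
    congr 1
    push_cast
    ring
  · rintro ⟨j, rfl⟩
    rw [← Real.cos_pi, ← Real.cos_add_int_mul_two_pi Real.pi j]
    congr 1
    push_cast
    ring

theorem int_of_cos {u : ℝ} (h : Real.cos (Real.pi * u) = 1 ∨ Real.cos (Real.pi * u) = -1) :
    ∃ k : ℤ, u = k := by
  have hs : Real.sin (Real.pi * u) = 0 := by
    have := Real.sin_sq_add_cos_sq (Real.pi * u)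
    rcases h with h | h <;> rw [h] at this <;> nlinarith
  obtain ⟨k, hk⟩ := Real.sin_eq_zero_iff.1 hs
  exact ⟨k, mul_left_cancel₀ Real.pi_ne_zero (by linarith)⟩

theorem cos_partner {m : ℕ} {u u' : ℝ} (h : Partner m u u') :
    Real.cos (Real.pi * u') = -Real.cos (Real.pi * u) := by
  obtain ⟨j, -, e, -, -, h⟩ := h
  have : Real.pi * u' = (Real.pi - Real.pi * u) + ((4 * j + e + 1 : ℤ) : ℝ) * (2 * Real.pi) := by
    push_cast
    linear_combination Real.pi * h
  rw [this, Real.cos_add_int_mul_two_pi, Real.cos_pi_sub]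

variable (F : Frame)

/-- The first coordinate of a height function in which the chord is the level `1 / 2`. -/
def height (b : Bool) (p : ℝ × ℝ) : ℝ :=
  1 / 2 - p.2 * (1 / 2 - Real.cos (Real.pi * p.1) / 2) -
    min 1 (min p.1 (4 * F.m b - p.1)) * p.2 * (1 - p.2) / 2

/-- The height, reflected on the second half. -/
def cross (b : Bool) (p : ℝ × ℝ) : ℝ := if b then F.height b p else 1 - F.height b p

/-- The map of the coordinate domains to the cylinder. -/
def cyl (b : Bool) (p : ℝ × ℝ) : ℝ × Circle := (F.cross b p, Circle.exp (p.2 * zigzag p.1))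

theorem continuous_cyl (b : Bool) : Continuous (F.cyl b) := by
  have := continuous_zigzag
  unfold cyl cross height
  cases b <;> norm_num <;> refine ⟨?_, ?_⟩ <;> fun_prop

/-- The cosine changes sign across a gluing, so in this half the gluing acts on the cylinder by the
reflection in `0`; in the other half it acts by the reflection in `1`. -/
theorem cyl_partner_true {u u' : ℝ} (h : Partner (F.m true) u u') :
    F.cyl true (u', 1) = (-(F.cyl true (u, 1)).1, -(F.cyl true (u, 1)).2) := by
  have h1 := cos_partner h
  have h2 := exp_zigzag_partner h.symm
  simp only [cyl, cross, height, h1, one_mul, h2]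
  norm_num
  ring

theorem cyl_partner_false {u u' : ℝ} (h : Partner (F.m false) u u') :
    F.cyl false (u', 1) = (2 - (F.cyl false (u, 1)).1, -(F.cyl false (u, 1)).2) := by
  have h1 := cos_partner h
  have h2 := exp_zigzag_partner h.symm
  simp only [cyl, cross, height, h1, one_mul, h2]
  norm_num
  ring

theorem cyl_zero (b : Bool) (u : ℝ) : F.cyl b (u, 0) = (1 / 2, 1) := by
  cases b <;> simp [cyl, cross, height]
  norm_num

theorem cyl_side (b : Bool) (u : ℝ) : F.cyl b (u, 1) =
    (if b then Real.cos (Real.pi * u) / 2 else 1 - Real.cos (Real.pi * u) / 2,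
      Circle.exp (zigzag u)) := by
  cases b <;> simp [cyl, cross, height]

/-- At even corners the height is already `1/2` and the circle coordinate `1`; at odd corners the
reflection of the half carries the value there. At the ends of the boundary coordinate the factor
with the minimum and the zigzag vanish, whatever the height. -/
theorem kleinProj_cyl_vertex {b : Bool} {p : ℝ × ℝ} (h : F.IsVertex b p) :
    kleinProj (F.cyl b p) = kleinProj (1 / 2, 1) := by
  obtain ⟨u, t⟩ := p
  have h0 : ∀ k : ℤ, Even k → min (1 : ℝ) (min k (4 * F.m b - k)) = 0 → zigzag k = 0 →
      F.cyl b (k, t) = (1 / 2, 1) := by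
    intro k hk hmin hz
    have := (cos_int k).1 hk
    cases b <;> simp only [cyl, cross, height, this, hmin, hz] <;> norm_num
  have hm : (0 : ℝ) ≤ 4 * F.m b := by positivity
  rcases h with h | h | ⟨h, k, hk⟩
  · dsimp only at h
    subst h
    have := h0 0 (by simp) (by simp) (by simpa using zigzag_up 0 (u := 0) (by simp) (by simp))
    rw [← this]; simp
  · dsimp only at h
    subst h
    have := h0 (4 * F.m b) ⟨2 * F.m b, by ring⟩ (by push_cast; simp) (by
      rw [zigzag_up (F.m b) (by simp) (by simp)]; simp)
    rw [← this]; simp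
  · dsimp only at h hk
    subst h hk
    rw [cyl_side]
    rcases exp_zigzag_int k with ⟨he, h1⟩ | ⟨he, h1⟩
    · rw [(cos_int k).1 he, h1]
      cases b <;> norm_num
    · rw [(cos_int k).2 he, h1]
      cases b
      · exact kleinProj_sr (-1) (by norm_num) (by simp)
      · exact kleinProj_sr 0 (by norm_num) (by simp)

namespace Chart

variable {F} (Q : F.Chart)

theorem exists_height : ∃ Φ : C(ClosedSurface F.g, KleinBottle),
    ∀ b, ∀ p ∈ F.dom b, Φ (Q.q b p) = kleinProj (F.cyl b p) := by
  refine Q.exists_descent (fun b p => kleinProj (F.cyl b p))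
    (fun b => continuous_kleinProj.comp (F.continuous_cyl b)) ?_
  rintro b b' ⟨u, t⟩ hp ⟨u', t'⟩ hp' (⟨rfl, h⟩ | ⟨h1, h2, h3⟩ | ⟨h1, h2⟩ | ⟨rfl, h1, h2, h3⟩)
  · rw [h]
  · dsimp only at h1 h2
    rw [h1, h2, cyl_zero, cyl_zero]
  · rw [F.kleinProj_cyl_vertex h1, F.kleinProj_cyl_vertex h2]
  · dsimp only at h1 h2 h3
    subst h1 h2
    cases b
    · refine kleinProj_sr (-1) ?_ ?_
      · rw [F.cyl_partner_false h3]; push_cast; ring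
      · rw [F.cyl_partner_false h3]; simp
    · refine kleinProj_sr 0 ?_ ?_
      · rw [F.cyl_partner_true h3]; push_cast; ring
      · rw [F.cyl_partner_true h3]; simp

/-- Off the chord the height is at most `1/2` and at least `-1/2`. The last term of `height` makes
the upper bound strict over the even corners too, where the cosine is `1`, except at the vertex. The
lower bound is attained only for `t = 1` at an odd corner, since twice the excess over `-1/2` is at
least `(1 - t) * (1 - t) + (1 - t)`. -/
theorem mem_of_cross {b : Bool} {p : ℝ × ℝ} (hp : p ∈ F.dom b)
    (h : ∃ m : ℤ, F.cross b p = m + 1 / 2) : p.2 = 0 ∨ F.IsVertex b p := by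
  obtain ⟨u, t⟩ := p
  obtain ⟨⟨hu0, hu1⟩, ht0, ht1⟩ := hp
  dsimp only at hu0 hu1 ht0 ht1 ⊢
  have h' : ∃ m : ℤ, F.height b (u, t) = m + 1 / 2 := by
    obtain ⟨m, hm⟩ := h
    cases b
    · simp only [cross] at hm
      norm_num at hm
      exact ⟨-m, by push_cast; linarith⟩
    · exact ⟨m, by simpa [cross] using hm⟩
  obtain ⟨m, hm⟩ := h'
  simp only [height] at hm
  set ψ := min 1 (min u (4 * F.m b - u)) with hψ
  set C := Real.cos (Real.pi * u) with hC
  have hψ0 : 0 ≤ ψ := le_min zero_le_one (le_min hu0 (by linarith))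
  have hψ1 : ψ ≤ 1 := min_le_left _ _
  have hC1 : C ≤ 1 := Real.cos_le_one _
  have hC0 : -1 ≤ C := Real.neg_one_le_cos _
  by_contra hcon
  rw [not_or] at hcon
  obtain ⟨hcon1, hcon2⟩ := hcon
  have ht : 0 < t := lt_of_le_of_ne ht0 (Ne.symm hcon1)
  have ha : 0 ≤ t * (1 - C) := mul_nonneg ht0 (by linarith)
  have hb : 0 ≤ ψ * t * (1 - t) := mul_nonneg (mul_nonneg hψ0 ht0) (by linarith)
  have hupper : (m : ℝ) ≤ 0 := by linarith
  have hc : ψ * t * (1 - t) ≤ t * (1 - t) := by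
    have : 0 ≤ t * (1 - t) := mul_nonneg ht0 (by linarith)
    nlinarith
  have hd : 0 ≤ (1 - t) * (1 - t) := mul_self_nonneg _
  have hlower : (-1 : ℝ) ≤ m := by nlinarith
  have hm' : m = 0 ∨ m = -1 := by
    have h1 : m ≤ 0 := by exact_mod_cast hupper
    have h2 : -1 ≤ m := by exact_mod_cast hlower
    omega
  rcases hm' with rfl | rfl
  · push_cast at hm
    have h1 : t * (1 - C) = 0 := by linarith
    have h2 : ψ * t * (1 - t) = 0 := by linarith
    have h3 : C = 1 := by
      rcases mul_eq_zero.1 h1 with h | h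
      · exact absurd h ht.ne'
      · linarith
    rcases mul_eq_zero.1 h2 with h | h
    · rcases mul_eq_zero.1 h with h | h
      · have h4 : u = 0 ∨ u = 4 * F.m b := by
          rcases min_eq_iff.1 (hψ ▸ h) with h | h
          · exact absurd h.1 one_ne_zero
          · rcases min_eq_iff.1 h.1 with h | h
            · exact Or.inl h.1
            · exact Or.inr (by linarith [h.1])
        exact hcon2 (F.isVertex_of_end h4)
      · exact absurd h ht.ne'
    · exact hcon2 (Or.inr (Or.inr ⟨by simpa using (by linarith : t = 1), int_of_cos (Or.inl h3)⟩))
  · push_cast at hm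
    have h1 : (1 - t) * (1 - t) ≤ 0 := by nlinarith
    have h2 : t = 1 := by nlinarith
    subst h2
    exact hcon2 (Or.inr (Or.inr ⟨rfl, int_of_cos (Or.inr (by linarith))⟩))

end Chart

/-- The side value of the first coordinate of a second map to the cylinder. -/
def staircase (u : ℝ) : ℝ := -2 * max 0 (min 1 (u - 1)) - 2 * max 0 (min 1 (u - 3))

/-- A map of the coordinate domains to the cylinder that wraps the chord. -/
def wrap (b : Bool) (p : ℝ × ℝ) : ℝ × Circle :=
  ((1 - p.2) * (-4 * F.chord b p.1 / F.N) + p.2 * staircase (if b then p.1 else 4 - p.1),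
    Circle.exp (p.2 * zigzag (if b then p.1 else min p.1 4)))

theorem continuous_wrap (b : Bool) : Continuous (F.wrap b) := by
  have h1 := continuous_zigzag
  have h2 := F.continuous_chord b
  have h3 : Continuous staircase := by unfold staircase; fun_prop
  unfold wrap
  cases b <;> norm_num <;> refine ⟨?_, ?_⟩ <;> fun_prop

theorem staircase_of_le_one {u : ℝ} (h : u ≤ 1) : staircase u = 0 := by
  rw [staircase, min_eq_right (by linarith), max_eq_left (by linarith), min_eq_right (by linarith),
    max_eq_left (by linarith)]
  ring

theorem staircase_of_le_two {u : ℝ} (h : 1 ≤ u) (h' : u ≤ 2) : staircase u = 2 - 2 * u := by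
  rw [staircase, min_eq_right (by linarith), max_eq_right (by linarith),
    min_eq_right (by linarith), max_eq_left (by linarith)]
  ring

theorem staircase_of_le_three {u : ℝ} (h : 2 ≤ u) (h' : u ≤ 3) : staircase u = -2 := by
  rw [staircase, min_eq_left (by linarith), max_eq_right (by linarith),
    min_eq_right (by linarith), max_eq_left (by linarith)]
  ring

theorem staircase_of_le_four {u : ℝ} (h : 3 ≤ u) (h' : u ≤ 4) : staircase u = 4 - 2 * u := by
  rw [staircase, min_eq_left (by linarith), max_eq_right (by linarith),
    min_eq_right (by linarith), max_eq_right (by linarith)]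
  ring

theorem staircase_int (k : ℤ) : ∃ i : ℤ, staircase k = 2 * i :=
  ⟨-max 0 (min 1 (k - 1)) - max 0 (min 1 (k - 3)), by
    rw [staircase]
    push_cast
    ring⟩

/-- The two pairs of sides of a handle are glued by the reflections in `-1` and in `-2`. Their
commutator is a translation by `4` up to sign, which is the total descent of the staircase. -/
theorem staircase_add {u u' : ℝ} (h : u ∈ Icc (0 : ℝ) 1 ∧ u + u' = 3 ∨ u ∈ Icc (1 : ℝ) 2 ∧ u + u' = 5) :
    ∃ i : ℤ, staircase u = -staircase u' - 2 * i := by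
  rcases h with ⟨⟨h0, h1⟩, h⟩ | ⟨⟨h0, h1⟩, h⟩
  · refine ⟨1, ?_⟩
    rw [staircase_of_le_one h1, staircase_of_le_three (by linarith) (by linarith)]
    norm_num
  · refine ⟨2, ?_⟩
    rw [staircase_of_le_two h0 h1, staircase_of_le_four (by linarith) (by linarith)]
    push_cast
    linarith

theorem staircase_partner {u u' : ℝ} (h : Partner 1 u u') :
    (∃ i : ℤ, staircase u = -staircase u' - 2 * i) ∧
      ∃ i : ℤ, staircase (4 - u) = -staircase (4 - u') - 2 * i := by
  have key : ∀ {u u' : ℝ} {e : ℕ}, e ≤ 1 → (e ≤ u ∧ u ≤ e + 1) → u + u' = 2 * e + 3 →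
      (∃ i : ℤ, staircase u = -staircase u' - 2 * i) ∧
      ∃ i : ℤ, staircase (4 - u') = -staircase (4 - u) - 2 * i := by
    intro u u' e he h1 h2
    obtain rfl | rfl : e = 0 ∨ e = 1 := by omega
    · push_cast at h1 h2
      exact ⟨staircase_add (Or.inl ⟨⟨by linarith, by linarith⟩, by linarith⟩),
        staircase_add (Or.inr ⟨⟨by linarith, by linarith⟩, by linarith⟩)⟩
    · push_cast at h1 h2
      exact ⟨staircase_add (Or.inr ⟨⟨by linarith, by linarith⟩, by linarith⟩),
        staircase_add (Or.inl ⟨⟨by linarith, by linarith⟩, by linarith⟩)⟩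
  have flip : ∀ {x y : ℝ}, (∃ i : ℤ, x = -y - 2 * i) → ∃ i : ℤ, y = -x - 2 * i := by
    rintro x y ⟨i, h⟩
    exact ⟨i, by linarith⟩
  obtain ⟨j, hj, e, he, h1, h2⟩ := h
  obtain rfl : j = 0 := by omega
  push_cast at h1 h2
  rcases h1 with h1 | h1
  · have := key he (u := u) (u' := u') ⟨by linarith, by linarith⟩ (by linarith)
    exact ⟨this.1, flip this.2⟩
  · have := key he (u := u') (u' := u) ⟨by linarith, by linarith⟩ (by linarith)
    exact ⟨flip this.1, this.2⟩

theorem wrap_zero (b : Bool) (u : ℝ) : F.wrap b (u, 0) = (-4 * F.chord b u / F.N, 1) := by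
  simp [wrap]

theorem wrap_side (b : Bool) (u : ℝ) : F.wrap b (u, 1) =
    (staircase (if b then u else 4 - u), Circle.exp (zigzag (if b then u else min u 4))) := by
  simp [wrap]

theorem zigzag_zero : zigzag 0 = 0 := by
  simpa using zigzag_up 0 (u := 0) (by simp) (by simp)

theorem zigzag_four : zigzag 4 = 0 := by
  simpa using zigzag_up 1 (u := 4) (by simp) (by norm_num)

theorem kleinProj_wrap_vertex (h1 : F.m true = 1) {b : Bool} {p : ℝ × ℝ} (h : F.IsVertex b p) :
    kleinProj (F.wrap b p) = kleinProj (0, 1) := by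
  obtain ⟨u, t⟩ := p
  have hN : (F.N : ℝ) ≠ 0 := by exact_mod_cast F.N_pos.ne'
  rcases h with h | h | ⟨h, k, hk⟩
  · dsimp only at h
    subst h
    cases b
    · simp only [wrap, F.chord_zero]
      refine kleinProj_r (-2) ?_ ?_
      · norm_num [hN, staircase_of_le_four]
        field_simp
        ring
      · norm_num [zigzag_zero]
    · simp only [wrap, F.chord_zero]
      norm_num [zigzag_zero, staircase_of_le_one]
  · dsimp only at h
    subst h
    cases b
    · have : (1 : ℝ) ≤ F.m false := by exact_mod_cast F.m_pos false
      simp only [wrap, F.chord_end]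
      norm_num
      rw [staircase_of_le_one (by linarith), min_eq_right (by linarith), zigzag_four]
      simp
    · simp only [wrap, F.chord_end]
      rw [h1]
      refine kleinProj_r (-2) ?_ ?_
      · norm_num [hN, staircase_of_le_four]
        field_simp
        ring
      · norm_num [zigzag_four]
  · dsimp only at h hk
    subst h hk
    have key : ∀ i j : ℤ, kleinProj (staircase i, Circle.exp (zigzag j)) = kleinProj (0, 1) := by
      intro i j
      obtain ⟨i', hi'⟩ := staircase_int i
      rcases exp_zigzag_int j with ⟨-, h⟩ | ⟨-, h⟩
      · exact kleinProj_r i' (by simpa using hi') h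
      · exact kleinProj_sr (-i') (by simp [hi']) h
    rw [wrap_side]
    cases b
    · have := key (4 - k) (min k 4)
      push_cast at this
      simpa using this
    · simpa using key k k

theorem kleinProj_wrap_partner (h1 : F.m true = 1) {b : Bool} {u u' : ℝ}
    (h : Partner (F.m b) u u') : kleinProj (F.wrap b (u, 1)) = kleinProj (F.wrap b (u', 1)) := by
  rw [wrap_side, wrap_side]
  cases b
  · have h' := h
    obtain ⟨j, hj, e, he, hu, hs⟩ := h
    -- In the half `false` only the first handle is mapped nontrivially; on the sides of the others
    -- both coordinates are constant.
    rcases Nat.eq_zero_or_pos j with rfl | hj0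
    · have hP : Partner 1 u u' := ⟨0, one_pos, e, he, hu, hs⟩
      obtain ⟨-, i, hi⟩ := staircase_partner hP
      have hu4 := hP.mem_Icc.2
      have hu4' := hP.symm.mem_Icc.2
      norm_num at hu4 hu4'
      refine kleinProj_sr i (by simpa using hi) ?_
      simpa [min_eq_left hu4, min_eq_left hu4'] using exp_zigzag_partner h'
    · have hj1 : (1 : ℝ) ≤ j := by exact_mod_cast hj0
      have he0 : (0 : ℝ) ≤ e := by positivity
      have h4 : 4 ≤ u := by rcases hu with hu | hu <;> linarith
      have h4' : 4 ≤ u' := by rcases hu with hu | hu <;> linarith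
      simp only [Bool.false_eq_true, if_false]
      rw [staircase_of_le_one (by linarith), staircase_of_le_one (by linarith),
        min_eq_right h4, min_eq_right h4']
  · rw [h1] at h
    obtain ⟨⟨i, hi⟩, -⟩ := staircase_partner h
    exact kleinProj_sr i (by simpa using hi) (by simpa using exp_zigzag_partner h)

namespace Chart

variable {F} (Q : F.Chart)

/-- The handle of the half `true` and the first handle of the half `false` are mapped as mirror
images and the remaining handles collapse, so the values prescribed on the chord from the two sides
agree. -/
theorem exists_wrap (hm : F.m true = 1) : ∃ Ψ : C(ClosedSurface F.g, KleinBottle),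
    ∀ b, ∀ p ∈ F.dom b, Ψ (Q.q b p) = kleinProj (F.wrap b p) := by
  refine Q.exists_descent (fun b p => kleinProj (F.wrap b p))
    (fun b => continuous_kleinProj.comp (F.continuous_wrap b)) ?_
  rintro b b' ⟨u, t⟩ hp ⟨u', t'⟩ hp' (⟨rfl, h⟩ | ⟨h1, h2, h3⟩ | ⟨h1, h2⟩ | ⟨rfl, h1, h2, h3⟩)
  · rw [h]
  · dsimp only at h1 h2 h3
    rw [h1, h2, wrap_zero, wrap_zero, h3]
  · rw [F.kleinProj_wrap_vertex hm h1, F.kleinProj_wrap_vertex hm h2]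
  · dsimp only at h1 h2 h3
    subst h1 h2
    exact F.kleinProj_wrap_partner hm h3

/-- The loop along the chord. -/
theorem exists_chordLoop : ∃ H : ClosedCurve (ClosedSurface F.g), IsSimple H ∧
    (∀ t ∈ Icc (0 : ℝ) 1, H (turn t) = Q.q true (F.bdry true (F.N * t), 0)) ∧
    range H = {y | ∃ b, ∃ u, (u, 0) ∈ F.dom b ∧ Q.q b (u, 0) = y} := by
  have hN : (0 : ℝ) < F.N := by exact_mod_cast F.N_pos
  have hbc : Continuous (F.bdry true) := (F.E true).continuous
  have hmem : ∀ x ∈ Icc 0 (F.N : ℝ), (F.bdry true x, 0) ∈ F.dom true := fun x hx =>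
    ⟨F.bdry_mem true hx, le_rfl, zero_le_one⟩
  have hv0 : F.IsVertex true (F.bdry true 0, 0) := Or.inl (F.E_zero true)
  have hvN : F.IsVertex true (F.bdry true F.N, 0) := Or.inr (Or.inl (F.E_N true))
  have hends : Q.q true (F.bdry true 0, 0) = Q.q true (F.bdry true F.N, 0) :=
    (Q.q_eq_iff (hmem _ ⟨le_rfl, hN.le⟩) (hmem _ ⟨hN.le, le_rfl⟩)).2
      (Or.inr (Or.inr (Or.inl ⟨hv0, hvN⟩)))
  obtain ⟨H, h1, h2, h3⟩ := exists_closedCurve hN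
    (f := fun x => Q.q true (F.bdry true x, 0))
    ((Q.continuous_q true).comp (by fun_prop)).continuousOn hends
  refine ⟨H, h3 ?_, h1, ?_⟩
  · intro x hx x' hx' h
    have hnv : ∀ x ∈ Ico 0 (F.N : ℝ), F.IsVertex true (F.bdry true x, 0) → x = 0 := by
      intro x hx hv
      have : F.bdry true x = 0 ∨ F.bdry true x = 4 * F.m true := by
        rcases hv with h | h | h
        · exact Or.inl h
        · exact Or.inr h
        · exact absurd h.1 zero_ne_one
      rcases this with h | h
      · rw [← F.E_zero true] at h
        exact (F.E true).injective h
      · rw [← F.E_N true] at h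
        exact absurd ((F.E true).injective h) hx.2.ne
    have hc : Function.Injective (F.bdry true) := (F.E true).injective
    rcases (Q.q_eq_iff (hmem _ ⟨hx.1, hx.2.le⟩) (hmem _ ⟨hx'.1, hx'.2.le⟩)).1 h with
      h | h | h | h
    · exact hc (congr_arg Prod.fst h.2)
    · simpa [F.chord_bdry] using h.2.2
    · rw [hnv x hx h.1, hnv x' hx' h.2]
    · exact absurd h.2.1 zero_ne_one
  · rw [h2]
    ext y
    constructor
    · rintro ⟨x, hx, rfl⟩
      exact ⟨true, _, hmem x ⟨hx.1, hx.2.le⟩, rfl⟩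
    · rintro ⟨b, u, hu, rfl⟩
      have hx := F.chord_mem hu.1
      have he : Q.q b (u, 0) = Q.q true (F.bdry true (F.chord b u), 0) :=
        (Q.q_eq_iff hu (hmem _ hx)).2 (Or.inr (Or.inl ⟨rfl, rfl, by rw [F.chord_bdry]⟩))
      rcases hx.2.lt_or_eq with h | h
      · exact ⟨_, ⟨hx.1, h⟩, he.symm⟩
      · refine ⟨0, ⟨le_rfl, hN⟩, ?_⟩
        rw [he, h]
        exact hends

/-- The image of the loop lifts to the straight path from `0` to `-4`, which does not close up. -/
theorem not_nullhomotopic_chordLoop (hm : F.m true = 1) {H : ClosedCurve (ClosedSurface F.g)}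
    (hH : ∀ t ∈ Icc (0 : ℝ) 1, H (turn t) = Q.q true (F.bdry true (F.N * t), 0)) :
    ¬ ContinuousMap.Nullhomotopic H := by
  obtain ⟨Ψ, hΨ⟩ := Q.exists_wrap hm
  have hN : (0 : ℝ) < F.N := by exact_mod_cast F.N_pos
  refine not_nullhomotopic_of_lift Ψ ⟨fun t => (-4 * (t : ℝ), 1), by fun_prop⟩ (fun t => ?_) ?_
  · have hx : (F.N * t : ℝ) ∈ Icc 0 (F.N : ℝ) :=
      ⟨mul_nonneg hN.le t.2.1, mul_le_of_le_one_right hN.le t.2.2⟩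
    rw [hH t t.2, hΨ true _ ⟨F.bdry_mem true hx, le_rfl, zero_le_one⟩, wrap_zero, F.chord_bdry]
    change kleinProj (-4 * (t : ℝ), 1) = _
    congr 2
    field_simp
  · intro h
    have := congr_arg Prod.fst h
    norm_num at this

end Chart

end Frame

namespace Frame

/-! ### A second curve transverse to the chord -/

/-- Lines across the two halves over the integral points of the chord, one of which ends at a corner
of the polygon in each half, together with an order `p` of the lines in which consecutive lines are
glued alternately in the second and in the first half. -/
structure Lines (F : Frame) where
  even_N : Even F.N
  quarter : ∀ b, ∀ j : ℕ, 0 < j → j < F.N → F.bdry b j = 4 * F.m b - 3 ∨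
    ∃ k : ℤ, k + 1 / 4 ≤ F.bdry b j ∧ F.bdry b j ≤ k + 3 / 4
  exists_quarter : ∀ b, ∀ k : ℤ, 0 ≤ k → k < 4 * F.m b →
    (∃ j : ℕ, 0 < j ∧ j < F.N ∧ F.bdry b j = k + 1 / 4) ∧
    ∃ j : ℕ, 0 < j ∧ j < F.N ∧ F.bdry b j = k + 3 / 4
  exists_corner : ∀ b, ∃ j : ℕ, 0 < j ∧ j < F.N ∧ F.bdry b j = 4 * F.m b - 3
  exists_partner : ∀ b, ∀ j : ℕ, 0 < j → j < F.N → F.bdry b j ≠ 4 * F.m b - 3 →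
    ∃ j' : ℕ, 0 < j' ∧ j' < F.N ∧ Odd (j + j') ∧ Partner (F.m b) (F.bdry b j) (F.bdry b j')
  p : ℕ → ℕ
  p_mem : ∀ k, 0 < k → k < F.N → 0 < p k ∧ p k < F.N
  p_inj : ∀ k l, 0 < k → k < F.N → 0 < l → l < F.N → p k = p l → k = l
  p_first : F.bdry true (p 1) = 4 * F.m true - 3
  p_last : F.bdry false (p (F.N - 1)) = 4 * F.m false - 3
  p_partner : ∀ b k, (b = true ↔ Even k) → 0 < k → k + 1 < F.N →
    Partner (F.m b) (F.bdry b (p k)) (F.bdry b (p (k + 1)))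

variable (F : Frame)

theorem bdry_injective (b : Bool) : Function.Injective (F.bdry b) := by
  intro x y h
  rw [← F.chord_bdry b x, h, F.chord_bdry]

variable {F}

theorem nat_mem_chord {j : ℕ} (hj : j < F.N) : (j : ℝ) ∈ Icc 0 (F.N : ℝ) :=
  ⟨by positivity, by exact_mod_cast hj.le⟩

theorem bdry_ne_end {b : Bool} {x : ℝ} (h0 : 0 < x) (h1 : x < F.N) :
    F.bdry b x ≠ 0 ∧ F.bdry b x ≠ 4 * F.m b := by
  have h2 : F.chord b (F.bdry b x) = x := F.chord_bdry b x
  constructor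
  · intro h
    rw [h, F.chord_zero] at h2
    cases b
    · simp at h2; linarith
    · simp at h2; linarith
  · intro h
    rw [h, F.chord_end] at h2
    cases b
    · simp at h2; linarith
    · simp at h2; linarith

theorem nat_bdry_ne_end {b : Bool} {j : ℕ} (h0 : 0 < j) (h1 : j < F.N) :
    F.bdry b j ≠ 0 ∧ F.bdry b j ≠ 4 * F.m b :=
  bdry_ne_end (by exact_mod_cast h0) (by exact_mod_cast h1)

namespace Chart

variable (Q : F.Chart)

/-- The points of the curve. -/
def lineSet : Set (ClosedSurface F.g) :=
  {y | ∃ b, ∃ j : ℕ, 0 < j ∧ j < F.N ∧ ∃ t ∈ Icc (0 : ℝ) 1, Q.q b (F.bdry b j, t) = y}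

/-- The line over the point `j` of the chord, from its end in the second half to its end in the
first half. -/
def line (j : ℕ) (σ : ℝ) : ClosedSurface F.g :=
  if σ ≤ 0 then Q.q true (F.bdry true j, -σ) else Q.q false (F.bdry false j, σ)

theorem q_zero_eq (x : ℝ) (hx : x ∈ Icc 0 (F.N : ℝ)) :
    Q.q true (F.bdry true x, 0) = Q.q false (F.bdry false x, 0) :=
  (Q.q_eq_iff ⟨F.bdry_mem _ hx, le_rfl, zero_le_one⟩ ⟨F.bdry_mem _ hx, le_rfl, zero_le_one⟩).2
    (Or.inr (Or.inl ⟨rfl, rfl, by rw [F.chord_bdry, F.chord_bdry]⟩))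

theorem continuous_line {j : ℕ} (hj : j < F.N) :
    Continuous (Q.line j) := by
  have h1 := Q.continuous_q true
  have h2 := Q.continuous_q false
  unfold line
  refine Continuous.if_le (by fun_prop) (by fun_prop) continuous_id continuous_const ?_
  rintro σ rfl
  simpa using Q.q_zero_eq j (nat_mem_chord hj)

/-- The half and the coordinates of a point on a line. -/
theorem line_eq (j : ℕ) {σ : ℝ} (hσ : σ ∈ Icc (-1 : ℝ) 1) :
    ∃ b : Bool, (b = true ↔ σ ≤ 0) ∧ |σ| ∈ Icc (0 : ℝ) 1 ∧
      Q.line j σ = Q.q b (F.bdry b j, |σ|) := by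
  have habs : |σ| ∈ Icc (0 : ℝ) 1 := ⟨abs_nonneg _, abs_le.2 hσ⟩
  by_cases h : σ ≤ 0
  · exact ⟨true, by simp [h], habs, by rw [line, if_pos h, abs_of_nonpos h]⟩
  · exact ⟨false, by simp [h], habs, by
      rw [line, if_neg h, abs_of_pos (not_le.1 h)]⟩

/-- Away from the sides the coordinates on the lines are faithful, since lines over different points
of the chord are disjoint; hence a coincidence occurs only at line ends, through the vertex or
through the side gluing. -/
theorem line_inj {j j' : ℕ} (h0 : 0 < j) (h1 : j < F.N)
    (h0' : 0 < j') (h1' : j' < F.N) {σ σ' : ℝ} (hσ : σ ∈ Icc (-1 : ℝ) 1)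
    (hσ' : σ' ∈ Icc (-1 : ℝ) 1) (h : Q.line j σ = Q.line j' σ') :
    (j = j' ∧ σ = σ') ∨ (|σ| = 1 ∧ |σ'| = 1 ∧
      ((F.IsVertex (σ ≤ 0) (F.bdry (σ ≤ 0) j, 1) ∧ F.IsVertex (σ' ≤ 0) (F.bdry (σ' ≤ 0) j', 1)) ∨
      (σ = σ' ∧ Partner (F.m (σ ≤ 0)) (F.bdry (σ ≤ 0) j) (F.bdry (σ ≤ 0) j')))) := by
  obtain ⟨b, hb, ht, e⟩ := Q.line_eq j hσ
  obtain ⟨b', hb', ht', e'⟩ := Q.line_eq j' hσ'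
  have hbd : b = decide (σ ≤ 0) := by cases b <;> simp_all
  have hbd' : b' = decide (σ' ≤ 0) := by cases b' <;> simp_all
  rw [← hbd, ← hbd']
  have hsig : |σ| = |σ'| → b = b' → σ = σ' := by
    intro h3 h4
    rcases abs_eq_abs.1 h3 with h5 | h5
    · exact h5
    · by_cases h6 : σ ≤ 0
      · have h7 : σ' ≤ 0 := hb'.1 (h4 ▸ hb.2 h6)
        linarith
      · have h7 : ¬ σ' ≤ 0 := fun h7 => h6 (hb.1 (h4 ▸ hb'.2 h7))
        rw [not_le] at h6 h7
        linarith
  rw [e, e'] at h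
  have hnv : ∀ {b j t}, 0 < j → j < F.N → F.IsVertex b (F.bdry b (j : ℕ), t) → t = 1 := by
    intro b j t h0 h1 hv
    have := nat_bdry_ne_end (F := F) (b := b) h0 h1
    rcases hv with h | h | h
    · exact absurd h this.1
    · exact absurd h this.2
    · exact h.1
  rcases (Q.q_eq_iff ⟨F.bdry_mem b (nat_mem_chord h1), ht⟩
    ⟨F.bdry_mem b' (nat_mem_chord h1'), ht'⟩).1 h with ⟨rfl, h⟩ | ⟨h2, h3, h4⟩ | ⟨h2, h3⟩ |
      ⟨rfl, h2, h3, h4⟩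
  · left
    obtain ⟨h2, h3⟩ := Prod.ext_iff.1 h
    exact ⟨by exact_mod_cast F.bdry_injective b h2, hsig h3 rfl⟩
  · left
    dsimp only at h2 h3 h4
    rw [F.chord_bdry, F.chord_bdry] at h4
    exact ⟨by exact_mod_cast h4, by rw [abs_eq_zero.1 h2, abs_eq_zero.1 h3]⟩
  · right
    have e1 := hnv h0 h1 h2
    have e2 := hnv h0' h1' h3
    rw [e1] at h2
    rw [e2] at h3
    exact ⟨e1, e2, Or.inl ⟨h2, h3⟩⟩
  · right
    dsimp only at h2 h3 h4
    exact ⟨h2, h3, Or.inr ⟨hsig (h2.trans h3.symm) rfl, h4⟩⟩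

end Chart

namespace Lines

variable (Λ : F.Lines)

theorem not_int (Λ : F.Lines) {b : Bool} {j : ℕ} (h0 : 0 < j) (h1 : j < F.N)
    (hc : F.bdry b j ≠ 4 * F.m b - 3) (i : ℤ) : F.bdry b j ≠ i := by
  intro hi
  rcases Λ.quarter b j h0 h1 with h | ⟨k, h2, h3⟩
  · exact hc h
  · rw [hi] at h2 h3
    have h4 : (k : ℝ) < i := by linarith
    have h5 : (i : ℝ) < k + 1 := by linarith
    have h6 : k < i := by exact_mod_cast h4
    have h7 : i < k + 1 := by exact_mod_cast h5
    omega

variable (Q : F.Chart)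

/-- An injective self-map of a finite set is onto, so the curve uses every line. -/
theorem p_surj {j : ℕ} (h0 : 0 < j) (h1 : j < F.N) : ∃ k, 0 < k ∧ k < F.N ∧ Λ.p k = j := by
  have hmaps : ∀ k ∈ Finset.Ioo 0 F.N, Λ.p k ∈ Finset.Ioo 0 F.N := by
    intro k hk
    rw [Finset.mem_Ioo] at hk ⊢
    exact Λ.p_mem k hk.1 hk.2
  have hinj : Set.InjOn Λ.p (Finset.Ioo 0 F.N : Finset ℕ) := by
    intro k hk l hl h
    rw [Finset.coe_Ioo] at hk hl
    exact Λ.p_inj k l hk.1 hk.2 hl.1 hl.2 h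
  have := Finset.surjOn_of_injOn_of_card_le Λ.p hmaps hinj le_rfl
  obtain ⟨k, hk, h⟩ := this (show j ∈ ((Finset.Ioo 0 F.N : Finset ℕ) : Set ℕ) by
    rw [Finset.coe_Ioo]; exact ⟨h0, h1⟩)
  rw [Finset.coe_Ioo] at hk
  exact ⟨k, hk.1, hk.2, h⟩

/-- The parameter on the `k`-th line of the curve. -/
def orient (k : ℕ) (s : ℝ) : ℝ := if Even k then 2 * s - 1 else 1 - 2 * s

theorem orient_mem (k : ℕ) {s : ℝ} (hs : s ∈ Icc (0 : ℝ) 1) : orient k s ∈ Icc (-1 : ℝ) 1 := by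
  unfold orient
  split_ifs <;> constructor <;> linarith [hs.1, hs.2]

theorem continuous_orient (k : ℕ) : Continuous (orient k) := by
  unfold orient
  split_ifs <;> fun_prop

theorem orient_injective (k : ℕ) : Function.Injective (orient k) := by
  intro s s' h
  unfold orient at h
  split_ifs at h <;> linarith

theorem orient_surj (k : ℕ) {σ : ℝ} (hσ : σ ∈ Icc (-1 : ℝ) 1) :
    ∃ s ∈ Icc (0 : ℝ) 1, orient k s = σ := by
  by_cases h : Even k
  · exact ⟨(σ + 1) / 2, ⟨by linarith [hσ.1], by linarith [hσ.2]⟩, by rw [orient, if_pos h]; ring⟩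
  · exact ⟨(1 - σ) / 2, ⟨by linarith [hσ.2], by linarith [hσ.1]⟩, by rw [orient, if_neg h]; ring⟩

theorem orient_one (k : ℕ) : orient k 1 = orient (k + 1) 0 := by
  unfold orient
  by_cases h : Even k
  · rw [if_pos h, if_neg (by rw [Nat.even_add_one]; simpa using h)]; norm_num
  · rw [if_neg h, if_pos (by rw [Nat.even_add_one]; simpa using h)]; norm_num

theorem two_le_N (Λ : F.Lines) : 2 ≤ F.N := by
  obtain ⟨M, hM⟩ := Λ.even_N
  have := F.N_pos
  omega

theorem line_glue {k : ℕ} (hk : k + 2 < F.N) :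
    Q.line (Λ.p (k + 1)) (orient k 1) = Q.line (Λ.p (k + 2)) (orient (k + 1) 0) := by
  rw [orient_one]
  have h1 := Λ.p_mem (k + 1) (by omega) (by omega)
  have h2 := Λ.p_mem (k + 2) (by omega) hk
  have key : ∀ b, (b = true ↔ Even (k + 1)) → Q.q b (F.bdry b (Λ.p (k + 1)), 1) =
      Q.q b (F.bdry b (Λ.p (k + 2)), 1) := by
    intro b hb
    refine (Q.q_eq_iff ⟨F.bdry_mem b (nat_mem_chord h1.2), zero_le_one, le_rfl⟩
      ⟨F.bdry_mem b (nat_mem_chord h2.2), zero_le_one, le_rfl⟩).2 ?_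
    exact Or.inr (Or.inr (Or.inr ⟨rfl, rfl, rfl, Λ.p_partner b (k + 1) hb (by omega) (by omega)⟩))
  by_cases h : Even (k + 1)
  · rw [orient, if_pos h, Chart.line, Chart.line]
    norm_num
    exact key true (by simpa using h)
  · rw [orient, if_neg h, Chart.line, Chart.line]
    norm_num
    exact key false (by simpa using h)

/-- The curve that follows the lines. -/
theorem exists_lineLoop : ∃ V : ClosedCurve (ClosedSurface F.g), IsSimple V ∧
    (∀ k, k + 2 ≤ F.N → ∀ s ∈ Icc (0 : ℝ) 1, ∀ t ∈ Icc (0 : ℝ) 1, (F.N - 1) * t = k + s →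
      V (turn t) = Q.line (Λ.p (k + 1)) (orient k s)) ∧
    range V = Q.lineSet := by
  have hN2 := Λ.two_le_N
  have hNr : (2 : ℝ) ≤ F.N := by exact_mod_cast hN2
  obtain ⟨G, hG, hG'⟩ := exists_concat
    (fun k (y : ℝ × Unit) => Q.line (Λ.p (k + 1)) (orient k y.1)) univ (F.N - 2)
    (fun k hk => by
      have h1 := Q.continuous_line (Λ.p_mem (k + 1) (by omega) (by omega)).2
      have h2 := continuous_orient k
      exact (h1.comp (h2.comp continuous_fst)).continuousOn)
    (fun k hk _ _ => Λ.line_glue Q (by omega))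
  have hcast : ((F.N - 2 : ℕ) : ℝ) + 1 = F.N - 1 := by
    rw [Nat.cast_sub hN2]; push_cast; ring
  rw [hcast] at hG
  have hG'' : ∀ k, k + 2 ≤ F.N → ∀ s ∈ Icc (0 : ℝ) 1,
      G (k + s, ()) = Q.line (Λ.p (k + 1)) (orient k s) := fun k hk s hs =>
    hG' k (by omega) s hs () (mem_univ _)
  have hfirst : G (0, ()) = Q.q true (F.bdry true (Λ.p 1), 1) := by
    have := hG'' 0 hN2 0 (by simp)
    simp only [Nat.cast_zero, add_zero, zero_add] at this
    rw [this, orient, if_pos (by simp), Chart.line, if_pos (by norm_num)]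
    norm_num
  have hevenN : Even (F.N - 2) := by
    obtain ⟨M, hM⟩ := Λ.even_N
    exact ⟨M - 1, by omega⟩
  have hlast : G ((F.N : ℝ) - 1, ()) = Q.q false (F.bdry false (Λ.p (F.N - 1)), 1) := by
    have := hG'' (F.N - 2) (by omega) 1 (by simp)
    rw [hcast] at this
    rw [this, orient, if_pos hevenN, Chart.line, if_neg (by norm_num),
      show F.N - 2 + 1 = F.N - 1 by omega]
    norm_num
  -- The first line starts at a corner of one half and the last line ends at a corner of the other;
  -- both are the vertex.
  have hclosed : G (0, ()) = G ((F.N : ℝ) - 1, ()) := by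
    rw [hfirst, hlast]
    have m1 := Λ.p_mem 1 (by omega) (by omega)
    have m2 := Λ.p_mem (F.N - 1) (by omega) (by omega)
    refine (Q.q_eq_iff ⟨F.bdry_mem _ (nat_mem_chord m1.2), zero_le_one, le_rfl⟩
      ⟨F.bdry_mem _ (nat_mem_chord m2.2), zero_le_one, le_rfl⟩).2 (Or.inr (Or.inr (Or.inl ⟨?_, ?_⟩)))
    · exact Or.inr (Or.inr ⟨rfl, 4 * F.m true - 3, by rw [Λ.p_first]; push_cast; ring⟩)
    · exact Or.inr (Or.inr ⟨rfl, 4 * F.m false - 3, by rw [Λ.p_last]; push_cast; ring⟩)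
  have hcut : ∀ x ∈ Ico 0 ((F.N : ℝ) - 1), ∃ k : ℕ, k + 2 ≤ F.N ∧ ∃ s ∈ Ico (0 : ℝ) 1,
      x = k + s := by
    intro x hx
    refine ⟨⌊x⌋₊, ?_, x - ⌊x⌋₊, ⟨by linarith [Nat.floor_le hx.1],
      by linarith [Nat.lt_floor_add_one x]⟩, by ring⟩
    have h1 := Nat.floor_le hx.1
    have h2 : ((⌊x⌋₊ : ℕ) : ℝ) + 1 < F.N := by linarith [hx.2]
    have h3 : ⌊x⌋₊ + 1 < F.N := by exact_mod_cast h2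
    omega
  obtain ⟨V, h1, h2, h3⟩ := exists_closedCurve (L := F.N - 1) (by linarith)
    (f := fun x => G (x, ())) (hG.comp (by fun_prop) (fun x hx => ⟨hx, mem_univ _⟩)) hclosed
  refine ⟨V, h3 ?_, ?_, ?_⟩
  · intro x hx x' hx' h
    obtain ⟨k, hk, s, hs, rfl⟩ := hcut x hx
    obtain ⟨k', hk', s', hs', rfl⟩ := hcut x' hx'
    have hsI : s ∈ Icc (0 : ℝ) 1 := ⟨hs.1, hs.2.le⟩
    have hsI' : s' ∈ Icc (0 : ℝ) 1 := ⟨hs'.1, hs'.2.le⟩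
    dsimp only at h
    rw [hG'' k hk s hsI, hG'' k' hk' s' hsI'] at h
    have m1 := Λ.p_mem (k + 1) (by omega) (by omega)
    have m2 := Λ.p_mem (k' + 1) (by omega) (by omega)
    -- With half-open parameter intervals, only starting points of lines lie on the sides; the sign
    -- tells in which half.
    have hzero : ∀ {k : ℕ} {s : ℝ}, s ∈ Ico (0 : ℝ) 1 → |orient k s| = 1 →
        s = 0 ∧ (orient k s ≤ 0 ↔ Even k) := by
      intro k s hs h
      unfold orient at h ⊢
      by_cases hk : Even k
      · rw [if_pos hk] at h ⊢
        have h0 : s = 0 := by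
          rcases abs_eq (zero_le_one) |>.1 h with h | h <;> linarith [hs.2]
        subst h0
        simp [hk]
      · rw [if_neg hk] at h ⊢
        have h0 : s = 0 := by
          rcases abs_eq (zero_le_one) |>.1 h with h | h <;> linarith [hs.2]
        subst h0
        simp [hk]
    have hcorner : ∀ {k : ℕ}, k + 2 ≤ F.N → ∀ b, (b = true ↔ Even k) →
        F.bdry b (Λ.p (k + 1)) = 4 * F.m b - 3 → k = 0 := by
      intro k hk b hb h
      cases b
      · rw [← Λ.p_last] at h
        have := Λ.p_inj (k + 1) (F.N - 1) (by omega) (by omega) (by omega) (by omega)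
          (by exact_mod_cast F.bdry_injective false h)
        simp only [Bool.false_eq_true, false_iff] at hb
        obtain ⟨M, hM⟩ := Λ.even_N
        exact absurd ⟨M - 1, by omega⟩ hb
      · rw [← Λ.p_first] at h
        have := Λ.p_inj (k + 1) 1 (by omega) (by omega) (by omega) (by omega)
          (by exact_mod_cast F.bdry_injective true h)
        omega
    have hvert : ∀ {k : ℕ}, k + 2 ≤ F.N → ∀ b, (b = true ↔ Even k) →
        F.IsVertex b (F.bdry b (Λ.p (k + 1)), 1) → k = 0 := by
      intro k hk b hb hv
      have hm := Λ.p_mem (k + 1) (by omega) (by omega)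
      by_contra hk0
      have hne := nat_bdry_ne_end (F := F) (b := b) hm.1 hm.2
      rcases hv with h | h | ⟨-, i, h⟩
      · exact hne.1 h
      · exact hne.2 h
      · exact Λ.not_int hm.1 hm.2 (fun hc => hk0 (hcorner hk b hb hc)) i h
    rcases Q.line_inj m1.1 m1.2 m2.1 m2.2 (orient_mem k hsI) (orient_mem k' hsI') h with
      ⟨h4, h5⟩ | ⟨h4, h5, h6⟩
    · have h6 := Λ.p_inj (k + 1) (k' + 1) (by omega) (by omega) (by omega) (by omega) h4
      obtain rfl : k = k' := by omega
      rw [orient_injective k h5]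
    · obtain ⟨rfl, e1⟩ := hzero hs h4
      obtain ⟨rfl, e2⟩ := hzero hs' h5
      rcases h6 with ⟨h6, h7⟩ | ⟨h6, h7⟩
      · rw [hvert hk _ (by simpa using e1) h6, hvert hk' _ (by simpa using e2) h7]
      · have hpar : Even k ↔ Even k' := by rw [← e1, ← e2, h6]
        by_cases hkk : k = k'
        · rw [hkk]
        exfalso
        -- The start of a later line is glued to the end of its predecessor. By uniqueness of
        -- partners the other line would be that predecessor, but consecutive lines start in
        -- different halves.
        have key : ∀ {k k' : ℕ}, k + 2 ≤ F.N → k' + 2 ≤ F.N → (Even k ↔ Even k') → 0 < k →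
            ∀ b, (b = true ↔ Even k) →
            Partner (F.m b) (F.bdry b (Λ.p (k + 1))) (F.bdry b (Λ.p (k' + 1))) → False := by
          intro k k' hk hk' hpar hk0 b hb hP
          have hm := Λ.p_mem (k + 1) (by omega) (by omega)
          have hP' := Λ.p_partner b k hb hk0 (by omega)
          have hnc : F.bdry b (Λ.p (k + 1)) ≠ 4 * F.m b - 3 := fun hc =>
            hk0.ne' (hcorner hk b hb hc)
          have := Partner.eq_of_not_int (Λ.not_int hm.1 hm.2 hnc) hP hP'.symm
          have := Λ.p_inj k (k' + 1) (by omega) (by omega) (by omega) (by omega)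
            (by exact_mod_cast F.bdry_injective b this.symm)
          obtain rfl : k = k' + 1 := by omega
          rw [Nat.even_add_one] at hpar
          tauto
        rcases Nat.eq_zero_or_pos k with rfl | hk0
        · refine key hk' hk hpar.symm (by omega) (orient 0 0 ≤ 0) (by simpa using e1.trans hpar) h7.symm
        · exact key hk hk' hpar hk0 (orient k 0 ≤ 0) (by simpa using e1) h7
  · intro k hk s hs t ht hts
    rw [h1 t ht, hts, hG'' k hk s hs]
  · have hrange : range V = (fun x => G (x, ())) '' Icc 0 ((F.N : ℝ) - 1) := by
      rw [h2]
      apply Subset.antisymm (image_mono Ico_subset_Icc_self)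
      rintro _ ⟨x, hx, rfl⟩
      rcases hx.2.lt_or_eq with h | h
      · exact ⟨x, ⟨hx.1, h⟩, rfl⟩
      · exact ⟨0, ⟨le_rfl, by linarith⟩, by rw [h]; exact hclosed⟩
    rw [h2]
    apply Subset.antisymm
    · rintro _ ⟨x, hx, rfl⟩
      obtain ⟨k, hk, s, hs, rfl⟩ := hcut x hx
      dsimp only
      rw [hG'' k hk s ⟨hs.1, hs.2.le⟩]
      have m1 := Λ.p_mem (k + 1) (by omega) (by omega)
      obtain ⟨b, -, ht, e⟩ := Q.line_eq (Λ.p (k + 1)) (orient_mem k ⟨hs.1, hs.2.le⟩)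
      exact ⟨b, _, m1.1, m1.2, _, ht, e.symm⟩
    · rw [← h2, hrange]
      rintro _ ⟨b, j, h4, h5, t, ht, rfl⟩
      obtain ⟨k, hk0, hk1, rfl⟩ := Λ.p_surj h4 h5
      obtain ⟨k, rfl⟩ : ∃ l, k = l + 1 := ⟨k - 1, by omega⟩
      have hσ : ∃ σ ∈ Icc (-1 : ℝ) 1, Q.line (Λ.p (k + 1)) σ = Q.q b (F.bdry b (Λ.p (k + 1)), t) := by
        cases b
        · refine ⟨t, ⟨by linarith [ht.1], ht.2⟩, ?_⟩
          rw [Chart.line]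
          split_ifs with h6
          · obtain rfl : t = 0 := le_antisymm h6 ht.1
            simpa using Q.q_zero_eq _ (nat_mem_chord h5)
          · rfl
        · refine ⟨-t, ⟨by linarith [ht.2], by linarith [ht.1]⟩, ?_⟩
          rw [Chart.line, if_pos (by linarith [ht.1]), neg_neg]
      obtain ⟨σ, hσ, e⟩ := hσ
      obtain ⟨s, hs, rfl⟩ := orient_surj k hσ
      refine ⟨k + s, ⟨by have := hs.1; positivity, ?_⟩, ?_⟩
      · have : (k : ℝ) + 2 ≤ F.N := by exact_mod_cast hk1
        linarith [hs.2]
      · dsimp only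
        rw [hG'' k hk1 s hs, e]

end Lines

end Frame

/-! ### Intersections of the two curves, and the two sides of the chord -/

namespace Frame

variable {F : Frame}

namespace Chart

variable (Q : F.Chart)

/-- The points of the chord. -/
def chordSet : Set (ClosedSurface F.g) := {y | ∃ b, ∃ u, (u, 0) ∈ F.dom b ∧ Q.q b (u, 0) = y}

theorem vertex_mem_chordSet {b : Bool} {p : ℝ × ℝ} (hp : p ∈ F.dom b) (hv : F.IsVertex b p) :
    Q.q b p ∈ Q.chordSet := by
  have h0 : ((0 : ℝ), (0 : ℝ)) ∈ F.dom true := ⟨⟨le_rfl, by positivity⟩, le_rfl, zero_le_one⟩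
  exact ⟨true, 0, h0, (Q.q_eq_iff h0 hp).2 (Or.inr (Or.inr (Or.inl ⟨Or.inl rfl, hv⟩)))⟩

/-- The deck group preserves the half-integers, so it does not matter which point of the fibre is
used, and `mem_of_cross` applies in coordinates. -/
theorem mem_chordSet_of_half_int {Φ : C(ClosedSurface F.g, KleinBottle)}
    (hΦ : ∀ b, ∀ p ∈ F.dom b, Φ (Q.q b p) = kleinProj (F.cyl b p)) {x : ClosedSurface F.g}
    {y : ℝ × Circle} (h : Φ x = kleinProj y) (hy : ∃ m : ℤ, y.1 = m + 1 / 2) :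
    x ∈ Q.chordSet := by
  obtain ⟨b, p, hp, rfl⟩ := Q.exists_q_eq x
  rw [hΦ b p hp] at h
  obtain ⟨γ, hγ⟩ := isQuotientCoveringMap_kleinProj.apply_eq_iff_mem_orbit.1 h
  have hγ : γ • y = F.cyl b p := hγ
  obtain ⟨m, hm⟩ := hy
  have hc : ∃ m : ℤ, F.cross b p = m + 1 / 2 := by
    have h1 : (F.cyl b p).1 = F.cross b p := rfl
    rcases dihedral_cases γ with ⟨i, rfl⟩ | ⟨i, rfl⟩
    · rw [r_smul] at hγ
      refine ⟨m + 2 * i, ?_⟩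
      rw [← h1, ← hγ, hm]
      push_cast
      ring
    · rw [sr_smul] at hγ
      refine ⟨-m - 2 * i - 1, ?_⟩
      rw [← h1, ← hγ, hm]
      push_cast
      ring
  rcases mem_of_cross hp hc with h0 | h0
  · obtain ⟨u, t⟩ := p
    dsimp only at h0
    subst h0
    exact ⟨b, u, hp, rfl⟩
  · exact Q.vertex_mem_chordSet hp h0

theorem lineSet_inter_chordSet :
    Q.lineSet ∩ Q.chordSet ⊆ (fun j : ℕ => Q.q true (F.bdry true j, 0)) '' Iio F.N := by
  have hmem : ∀ b, ∀ j < F.N, (F.bdry b (j : ℕ), 0) ∈ F.dom b := fun b j hj =>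
    ⟨F.bdry_mem b (nat_mem_chord hj), le_rfl, zero_le_one⟩
  rintro y ⟨⟨b, j, h0, h1, t, ht, rfl⟩, ⟨b', u, hu, h⟩⟩
  have hjt : (F.bdry b (j : ℕ), t) ∈ F.dom b := ⟨F.bdry_mem b (nat_mem_chord h1), ht⟩
  have hvert : F.IsVertex b (F.bdry b j, t) →
      Q.q b (F.bdry b j, t) ∈ (fun j : ℕ => Q.q true (F.bdry true j, 0)) '' Iio F.N := fun hv =>
    ⟨0, F.N_pos, (Q.q_eq_iff (hmem true 0 F.N_pos) hjt).2 (Or.inr (Or.inr (Or.inl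
      ⟨Or.inl (by simpa [bdry] using F.E_zero true), hv⟩)))⟩
  have hzero : t = 0 →
      Q.q b (F.bdry b j, t) ∈ (fun j : ℕ => Q.q true (F.bdry true j, 0)) '' Iio F.N := by
    rintro rfl
    exact ⟨j, h1, (Q.q_eq_iff (hmem true j h1) hjt).2 (Or.inr (Or.inl
      ⟨rfl, rfl, by rw [F.chord_bdry, F.chord_bdry]⟩))⟩
  rcases (Q.q_eq_iff hjt hu).1 h.symm with h | h | h | h
  · exact hzero (Prod.ext_iff.1 h.2).2
  · exact hzero h.1
  · exact hvert h.1
  · exact absurd h.2.2.1 zero_ne_one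

/-- There is one point for each of the `N - 1` lines, and index `0` accounts for the vertex. -/
theorem encard_lineSet_inter_chordSet : (Q.lineSet ∩ Q.chordSet).encard ≤ F.N := by
  refine (encard_le_encard Q.lineSet_inter_chordSet).trans ((encard_image_le _ _).trans ?_)
  rw [← Finset.coe_Iio, encard_coe_eq_coe_finsetCard, Nat.card_Iio]

/-- The chord cuts the surface. -/
theorem chordSet_separates : IsClosed (Q.q true '' F.dom true) ∧ IsClosed (Q.q false '' F.dom false) ∧
    Q.q true '' F.dom true ∪ Q.q false '' F.dom false = univ ∧
    Q.q true '' F.dom true ∩ Q.q false '' F.dom false ⊆ Q.chordSet := by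
  have hT2 := t2Space_closedSurface F.g_pos
  refine ⟨((isCompact_dom F _).image (Q.continuous_q _)).isClosed,
    ((isCompact_dom F _).image (Q.continuous_q _)).isClosed, ?_, ?_⟩
  · refine eq_univ_of_forall fun y => ?_
    obtain ⟨b, p, hp, rfl⟩ := Q.exists_q_eq y
    cases b
    · exact Or.inr ⟨p, hp, rfl⟩
    · exact Or.inl ⟨p, hp, rfl⟩
  · rintro _ ⟨⟨p, hp, rfl⟩, ⟨p', hp', h⟩⟩
    rcases (Q.q_eq_iff hp hp').1 h.symm with h | h | h | h
    · exact absurd h.1 (by simp)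
    · obtain ⟨u, t⟩ := p
      obtain ⟨rfl, -⟩ := h
      exact ⟨true, u, hp, rfl⟩
    · exact Q.vertex_mem_chordSet hp h.1
    · exact absurd h.1 (by simp)

end Chart

/-! ### The lift of the curve of lines to the cylinder -/

namespace Lines

/-- The deck transformation applied to the `k`-th line of the curve. -/
def deck (k : ℕ) (y : ℝ × Circle) : ℝ × Circle :=
  if Even k then (y.1 + k, y.2) else (k + 1 - y.1, -y.2)

theorem kleinProj_deck (k : ℕ) (y : ℝ × Circle) : kleinProj (deck k y) = kleinProj y := by
  unfold deck
  split_ifs with h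
  · obtain ⟨i, rfl⟩ := h
    exact kleinProj_r i (by push_cast; ring) rfl
  · obtain ⟨i, rfl⟩ := Nat.not_even_iff_odd.1 h
    exact kleinProj_sr (-(i + 1)) (by push_cast; ring) rfl

theorem continuous_deck (k : ℕ) : Continuous (deck k) := by
  unfold deck
  split_ifs <;> fun_prop

/-- The line over the point `j` of the chord in the cylinder. -/
def cylLine (F : Frame) (j : ℕ) (σ : ℝ) : ℝ × Circle :=
  if σ ≤ 0 then F.cyl true (F.bdry true j, -σ) else F.cyl false (F.bdry false j, σ)

theorem continuous_cylLine (j : ℕ) : Continuous (cylLine F j) := by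
  have h1 := F.continuous_cyl true
  have h2 := F.continuous_cyl false
  unfold cylLine
  refine Continuous.if_le (by fun_prop) (by fun_prop) continuous_id continuous_const ?_
  rintro σ rfl
  simp [cyl_zero]

theorem kleinProj_cylLine (Q : F.Chart) {Φ : C(ClosedSurface F.g, KleinBottle)}
    (hΦ : ∀ b, ∀ p ∈ F.dom b, Φ (Q.q b p) = kleinProj (F.cyl b p)) {j : ℕ} (hj : j < F.N)
    {σ : ℝ} (hσ : σ ∈ Icc (-1 : ℝ) 1) : kleinProj (cylLine F j σ) = Φ (Q.line j σ) := by
  unfold cylLine Chart.line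
  split_ifs with h
  · rw [hΦ]
    exact ⟨F.bdry_mem _ (nat_mem_chord hj), by linarith, by linarith [hσ.1]⟩
  · rw [hΦ]
    exact ⟨F.bdry_mem _ (nat_mem_chord hj), by linarith, hσ.2⟩

variable (Λ : F.Lines)

/-- Consecutive deck transformations differ by the reflection in `0` or in `1` by which the
corresponding half is glued. With this choice the `k`-th line crosses the chord at level `k + 1/2`.
-/
theorem cylLine_glue {k : ℕ} (hk : k + 2 < F.N) :
    deck k (cylLine F (Λ.p (k + 1)) (orient k 1)) =
      deck (k + 1) (cylLine F (Λ.p (k + 2)) (orient (k + 1) 0)) := by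
  rw [orient_one]
  by_cases h : Even (k + 1)
  · have h' : ¬ Even k := by rwa [Nat.even_add_one] at h
    have := F.cyl_partner_true (Λ.p_partner true (k + 1) (by simpa using h) (by omega) (by omega))
    rw [orient, if_pos h, deck, deck, if_neg h', if_pos h, cylLine, cylLine]
    norm_num
    rw [this]
    exact ⟨by ring, rfl⟩
  · have h' : Even k := by rwa [Nat.even_add_one, not_not] at h
    have := F.cyl_partner_false (Λ.p_partner false (k + 1) (by simpa using h) (by omega) (by omega))
    rw [orient, if_neg h, deck, deck, if_pos h', if_neg h, cylLine, cylLine]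
    norm_num
    rw [this]
    exact ⟨by ring, by simp⟩

theorem cos_corner (m : ℕ) : Real.cos (Real.pi * (4 * m - 3)) = -1 := by
  have := (cos_int (4 * m - 3)).2 ⟨2 * m - 2, by ring⟩
  push_cast at this
  exact this

/-- The lift starts at an odd corner of the half `true`, at level `-1/2`. It ends at an odd corner
of the half `false`, at level `3/2` before the last deck transformation adds `N - 2`. -/
theorem exists_lift (Q : F.Chart) {Φ : C(ClosedSurface F.g, KleinBottle)}
    (hΦ : ∀ b, ∀ p ∈ F.dom b, Φ (Q.q b p) = kleinProj (F.cyl b p))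
    {V : ClosedCurve (ClosedSurface F.g)}
    (hV : ∀ k, k + 2 ≤ F.N → ∀ s ∈ Icc (0 : ℝ) 1, ∀ t ∈ Icc (0 : ℝ) 1, (F.N - 1) * t = k + s →
      V (turn t) = Q.line (Λ.p (k + 1)) (orient k s)) :
    ∃ a : C(unitInterval, ℝ × Circle), (∀ t : unitInterval, kleinProj (a t) = Φ (V (turn t))) ∧
      (a 0).1 = -1 / 2 ∧ (a 1).1 = F.N - 1 / 2 := by
  have hN2 := Λ.two_le_N
  have hNr : (2 : ℝ) ≤ F.N := by exact_mod_cast hN2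
  obtain ⟨G, hG, hG'⟩ := exists_concat
    (fun k (y : ℝ × Unit) => deck k (cylLine F (Λ.p (k + 1)) (orient k y.1))) univ (F.N - 2)
    (fun k _ => by
      have h1 := continuous_cylLine (F := F) (Λ.p (k + 1))
      have h2 := continuous_orient k
      have h3 := continuous_deck k
      exact (h3.comp (h1.comp (h2.comp continuous_fst))).continuousOn)
    (fun k hk _ _ => Λ.cylLine_glue (by omega))
  have hcast : ((F.N - 2 : ℕ) : ℝ) + 1 = F.N - 1 := by
    rw [Nat.cast_sub hN2]; push_cast; ring
  rw [hcast] at hG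
  have hmem : ∀ t : unitInterval, (F.N - 1) * (t : ℝ) ∈ Icc 0 ((F.N : ℝ) - 1) := fun t =>
    ⟨mul_nonneg (by linarith) t.2.1, mul_le_of_le_one_right (by linarith) t.2.2⟩
  have hcont : Continuous fun t : unitInterval => G ((F.N - 1) * t, ()) :=
    hG.comp_continuous (by fun_prop) fun t => ⟨hmem t, mem_univ _⟩
  have hevenN : Even (F.N - 2) := by
    obtain ⟨M, hM⟩ := Λ.even_N
    exact ⟨M - 1, by omega⟩
  refine ⟨⟨_, hcont⟩, fun t => ?_, ?_, ?_⟩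
  · obtain ⟨k, hk, s, hs, hks⟩ : ∃ k : ℕ, k + 2 ≤ F.N ∧ ∃ s ∈ Icc (0 : ℝ) 1,
        (F.N - 1) * (t : ℝ) = k + s := by
      rcases (hmem t).2.lt_or_eq with h | h
      · have h1 := Nat.floor_le (hmem t).1
        have h2 := Nat.lt_floor_add_one ((F.N - 1) * (t : ℝ))
        refine ⟨⌊(F.N - 1) * (t : ℝ)⌋₊, ?_, (F.N - 1) * (t : ℝ) - ⌊(F.N - 1) * (t : ℝ)⌋₊,
          ⟨by linarith, by linarith⟩, by ring⟩
        have h3 : ((⌊(F.N - 1) * (t : ℝ)⌋₊ : ℕ) : ℝ) + 1 < F.N := by linarith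
        have h4 : ⌊(F.N - 1) * (t : ℝ)⌋₊ + 1 < F.N := by exact_mod_cast h3
        omega
      · exact ⟨F.N - 2, by omega, 1, by simp, by rw [h, hcast]⟩
    change kleinProj (G ((F.N - 1) * (t : ℝ), ())) = _
    rw [hV k hk s hs t t.2 hks, hks, hG' k (by omega) s hs () (mem_univ _), kleinProj_deck]
    exact kleinProj_cylLine Q hΦ (Λ.p_mem (k + 1) (by omega) (by omega)).2 (orient_mem k hs)
  · change (G ((F.N - 1) * ((0 : unitInterval) : ℝ), ())).1 = _
    have := hG' 0 (by omega) 0 (by simp) () (mem_univ _)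
    simp only [Nat.cast_zero, add_zero, zero_add] at this
    rw [show ((0 : unitInterval) : ℝ) = 0 from rfl, mul_zero, this, orient, if_pos (by simp), deck, if_pos (by simp),
      cylLine, if_pos (by norm_num), Λ.p_first]
    norm_num [cyl_side, cos_corner]
  · change (G ((F.N - 1) * ((1 : unitInterval) : ℝ), ())).1 = _
    have := hG' (F.N - 2) le_rfl 1 (by simp) () (mem_univ _)
    rw [hcast] at this
    rw [show ((1 : unitInterval) : ℝ) = 1 from rfl, mul_one, this, orient, if_pos hevenN, deck, if_pos hevenN,
      cylLine, if_neg (by norm_num), show F.N - 2 + 1 = F.N - 1 by omega, Λ.p_last,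
      Nat.cast_sub hN2]
    norm_num [cyl_side, cos_corner]
    ring

/-! ### The curve of lines cuts the surface -/

/-- A side is glued as a whole by one reflection, so the sum of the coordinates of partners is
constant along it. -/
theorem _root_.SurfaceCurves.Partner.of_side {m : ℕ} {u u' v : ℝ} {K : ℤ} (h : Partner m u u')
    (hu : u ∈ Ioo (K : ℝ) (K + 1)) (hv : v ∈ Icc (K : ℝ) (K + 1)) : Partner m v (u + u' - v) := by
  obtain ⟨j, hj, e, he, h1, h2⟩ := h
  refine ⟨j, hj, e, he, ?_, by linarith⟩
  have key : ∀ n : ℤ, (n : ℝ) ≤ u → u ≤ n + 1 → K = n := by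
    intro n h3 h4
    have h5 : (n : ℝ) < K + 1 := by linarith [hu.2]
    have h6 : (K : ℝ) < n + 1 := by linarith [hu.1]
    have h5 : n < K + 1 := by exact_mod_cast h5
    have h6 : K < n + 1 := by exact_mod_cast h6
    omega
  rcases h1 with ⟨h3, h4⟩ | ⟨h3, h4⟩
  · have := key (4 * j + e) (by push_cast; linarith) (by push_cast; linarith)
    rw [this] at hv
    push_cast at hv
    exact Or.inl ⟨hv.1, hv.2⟩
  · have := key (4 * j + e + 2) (by push_cast; linarith) (by push_cast; linarith)
    rw [this] at hv
    push_cast at hv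
    exact Or.inr ⟨hv.1, by linarith [hv.2]⟩

theorem not_int_of_mem_Ioo {u : ℝ} {K : ℤ} (hu : u ∈ Ioo (K : ℝ) (K + 1)) (k : ℤ) : u ≠ k := by
  rintro rfl
  have h1 : K < k := by exact_mod_cast hu.1
  have h2 : k < K + 1 := by exact_mod_cast hu.2
  omega

/-- The partner of a coordinate lies in the corresponding gap between the lines. -/
theorem floor_partner_aux {m N : ℕ} {E : ℝ ≃o ℝ} (h0 : E 0 = 0) (hN : E N = 4 * m)
    (hq : ∀ k : ℤ, 0 ≤ k → k < 4 * m → (∃ j : ℕ, 0 < j ∧ j < N ∧ E j = k + 1 / 4) ∧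
      ∃ j : ℕ, 0 < j ∧ j < N ∧ E j = k + 3 / 4)
    (hp : ∀ j : ℕ, 0 < j → j < N → (∀ k : ℤ, E j ≠ k) →
      ∃ j' : ℕ, 0 < j' ∧ j' < N ∧ Odd (j + j') ∧ Partner m (E j) (E j'))
    {u u' : ℝ} (hu : ∀ k : ℤ, u ≠ k) (h : Partner m u u') (hl : ∀ j : ℕ, E j ≠ u)
    (hl' : ∀ j : ℕ, E j ≠ u') : Even ⌊E.symm u⌋ ↔ Even ⌊E.symm u'⌋ := by
  set K : ℤ := ⌊u⌋ with hK
  have hKu : u ∈ Ioo (K : ℝ) (K + 1) :=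
    ⟨lt_of_le_of_ne (Int.floor_le u) (hu K).symm, Int.lt_floor_add_one u⟩
  have hmem := h.mem_Icc
  have hmem' := h.symm.mem_Icc
  have hK0 : 0 ≤ K := Int.floor_nonneg.2 hmem.1
  have hKm : K < 4 * m := by
    have h1 : (K : ℝ) < 4 * m := hKu.1.trans_le hmem.2
    exact_mod_cast h1
  obtain ⟨⟨j₁, -, hj₁N, hj₁⟩, j₂, -, hj₂N, hj₂⟩ := hq K hK0 hKm
  have hfl : ∀ {w : ℝ} {n : ℕ}, E n < w → w < E (n + 1) → ⌊E.symm w⌋ = (n : ℤ) := by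
    intro w n h1 h2
    rw [Int.floor_eq_iff]
    exact ⟨by exact_mod_cast (E.lt_symm_apply.2 h1).le, by exact_mod_cast E.symm_apply_lt.2 h2⟩
  obtain ⟨n, hn1, hn2⟩ : ∃ n : ℕ, E n < u ∧ u < E (n + 1) := by
    have h0 : 0 ≤ E.symm u := by
      rw [E.le_symm_apply, h0]
      exact hmem.1
    refine ⟨⌊E.symm u⌋₊, lt_of_le_of_ne (E.le_symm_apply.1 (Nat.floor_le h0)) (hl _), ?_⟩
    exact E.symm_apply_lt.1 (Nat.lt_floor_add_one _)
  rw [hfl hn1 hn2]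
  have hlt : ∀ {i j : ℕ}, E i < E j ↔ i < j := by
    intro i j
    rw [E.lt_iff_lt, Nat.cast_lt]
  have hcast : ∀ i : ℕ, E ((i : ℝ) + 1) = E ((i + 1 : ℕ) : ℝ) := fun i => by push_cast; rfl
  -- no line between a coordinate and an adjacent line on the partner side
  have hno : ∀ {i l : ℕ}, E i ∈ Ioo (K : ℝ) (K + 1) → 0 < l → l < N →
      ((u < u + u' - E l ∧ u + u' - E l < E i) ∨ (E i < u + u' - E l ∧ u + u' - E l < u)) →
      ∃ l' : ℕ, E l' = u + u' - E l := by
    intro i l hi hl0 hlN hbet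
    have hw : u + u' - E l ∈ Ioo (K : ℝ) (K + 1) := by
      rcases hbet with ⟨h1, h2⟩ | ⟨h1, h2⟩
      · exact ⟨hKu.1.trans h1, h2.trans hi.2⟩
      · exact ⟨hi.1.trans h1, h2.trans hKu.2⟩
    have hP := (h.of_side hKu ⟨hw.1.le, hw.2.le⟩).symm
    rw [sub_sub_cancel] at hP
    have hPi := hP.symm.not_int (not_int_of_mem_Ioo hw)
    obtain ⟨l', -, -, -, hP'⟩ := hp l hl0 hlN hPi
    exact ⟨l', Partner.eq_of_not_int hPi hP' hP⟩
  have hpart : ∀ {i : ℕ}, 0 < i → i < N → E i ∈ Ioo (K : ℝ) (K + 1) →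
      ∃ i' : ℕ, 0 < i' ∧ i' < N ∧ Odd (i + i') ∧ E i' = u + u' - E i := by
    intro i hi0 hiN hi
    obtain ⟨i', h1, h2, h3, h4⟩ := hp i hi0 hiN (not_int_of_mem_Ioo hi)
    exact ⟨i', h1, h2, h3, Partner.eq_of_not_int (not_int_of_mem_Ioo hi) h4
      (h.of_side hKu ⟨hi.1.le, hi.2.le⟩)⟩
  have hparity : ∀ {a b : ℕ}, (Even a ↔ Even b) → (Even (a : ℤ) ↔ Even (b : ℤ)) := by
    intro a b h
    simpa [Int.even_coe_nat] using h
  -- Each side carries lines at `1/4` and `3/4`, so the gap of `u` is bounded by a line interior to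
  -- the same side: the upper one if `u` is below the line at `3/4`, and the lower one otherwise.
  -- The partner of that line bounds the gap of `u'`, since a line strictly between would reflect to
  -- a line inside the gap of `u`. The parities then match because paired lines have indices of odd
  -- sum.
  rcases lt_or_ge u (K + 3 / 4) with h3 | h3
  · have hnj : n + 1 ≤ j₂ := by
      have : E n < E j₂ := by rw [hj₂]; exact hn1.trans h3
      exact hlt.1 this
    have hi : E ((n + 1 : ℕ) : ℝ) ∈ Ioo (K : ℝ) (K + 1) := by
      refine ⟨hKu.1.trans (by rw [← hcast]; exact hn2), ?_⟩
      have : E ((n + 1 : ℕ) : ℝ) ≤ E j₂ := E.monotone (by exact_mod_cast hnj)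
      rw [hj₂] at this
      linarith
    obtain ⟨i', hi0, hiN, hodd, hi'⟩ := hpart (Nat.succ_pos n) (by omega) hi
    rw [hcast] at hn2
    have h4 : E i' < u' := by linarith
    have h5 : u' < E ((i' + 1 : ℕ) : ℝ) := by
      by_contra hcon
      have h6 : E ((i' + 1 : ℕ) : ℝ) < u' := lt_of_le_of_ne (not_lt.1 hcon) (hl' _)
      have h7 : i' + 1 < N := hlt.1 (by rw [hN]; exact h6.trans_le hmem'.2)
      have h8 : E i' < E ((i' + 1 : ℕ) : ℝ) := hlt.2 (Nat.lt_succ_self _)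
      obtain ⟨l', hl2⟩ := hno hi (Nat.succ_pos i') h7 (Or.inl ⟨by linarith, by linarith⟩)
      have h9 : n < l' := hlt.1 (by linarith)
      have h10 : l' < n + 1 := hlt.1 (by linarith)
      omega
    rw [hfl h4 (by rw [hcast]; exact h5)]
    apply hparity
    rw [Nat.odd_iff] at hodd
    rw [Nat.even_iff, Nat.even_iff]
    omega
  · have hnj : j₁ ≤ n := by
      have : E j₁ < E ((n + 1 : ℕ) : ℝ) := by rw [hj₁, ← hcast]; linarith
      exact Nat.lt_succ_iff.1 (hlt.1 this)
    have hi : E n ∈ Ioo (K : ℝ) (K + 1) := by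
      refine ⟨?_, hn1.trans hKu.2⟩
      have : E j₁ ≤ E n := E.monotone (by exact_mod_cast hnj)
      rw [hj₁] at this
      linarith
    have hn0 : 0 < n := by
      have : (0 : ℝ) < E n := by
        have : (0 : ℝ) ≤ K := by exact_mod_cast hK0
        linarith [hi.1]
      rw [← h0, ← Nat.cast_zero] at this
      exact hlt.1 this
    have hnN : n < N := hlt.1 (by rw [hN]; exact hn1.trans_le hmem.2)
    obtain ⟨i', hi0, hiN, hodd, hi'⟩ := hpart hn0 hnN hi
    obtain ⟨i', rfl⟩ : ∃ k, i' = k + 1 := ⟨i' - 1, by omega⟩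
    rw [hcast] at hn2
    have h4 : u' < E ((i' + 1 : ℕ) : ℝ) := by linarith
    have h5 : E i' < u' := by
      by_contra hcon
      have h6 : u' < E i' := lt_of_le_of_ne (not_lt.1 hcon) (hl' _).symm
      have h8 : E i' < E ((i' + 1 : ℕ) : ℝ) := hlt.2 (Nat.lt_succ_self _)
      have h7 : 0 < i' := by
        have : E ((0 : ℕ) : ℝ) < E i' := by
          rw [Nat.cast_zero, h0]
          exact hmem'.1.trans_lt h6
        exact hlt.1 this
      obtain ⟨l', hl2⟩ := hno hi h7 (by omega) (Or.inr ⟨by linarith, by linarith⟩)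
      have h9 : n < l' := hlt.1 (by linarith)
      have h10 : l' < n + 1 := hlt.1 (by linarith)
      omega
    rw [hfl h5 (by rw [hcast]; exact h4)]
    apply hparity
    rw [Nat.odd_iff] at hodd
    rw [Nat.even_iff, Nat.even_iff]
    omega

/-- In the half `false` the chord runs against the boundary coordinate, which replaces the gap `n`
by `N - 1 - n`. As `N` is even this flips both parities, and the equivalence survives. -/
theorem floor_partner (Λ : F.Lines) {b : Bool} {u u' : ℝ} (hu : ∀ k : ℤ, u ≠ k) (h : Partner (F.m b) u u')
    (hl : ∀ j : ℕ, F.chord b u ≠ j) (hl' : ∀ j : ℕ, F.chord b u' ≠ j) :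
    Even ⌊F.chord b u⌋ ↔ Even ⌊F.chord b u'⌋ := by
  have hne : ∀ {b : Bool} {j : ℕ}, (∀ k : ℤ, F.bdry b j ≠ k) → F.bdry b j ≠ 4 * F.m b - 3 := by
    intro b j h1 h2
    exact h1 (4 * F.m b - 3) (by rw [h2]; push_cast; ring)
  cases b
  · have hb : ∀ j : ℕ, j ≤ F.N → F.bdry false j = F.E false ((F.N - j : ℕ) : ℝ) := by
      intro j hj
      rw [Nat.cast_sub hj]
      rfl
    have hb' : ∀ j : ℕ, j ≤ F.N → F.bdry false ((F.N - j : ℕ) : ℝ) = F.E false j := by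
      intro j hj
      rw [hb _ (Nat.sub_le _ _), Nat.sub_sub_self hj]
    have hlN : ∀ {u : ℝ}, u ∈ Icc 0 (4 * F.m false : ℝ) → (∀ j : ℕ, F.chord false u ≠ j) →
        ∀ j : ℕ, F.E false j ≠ u := by
      intro u hu hl j h3
      have h4 : j ≤ F.N := by
        have : F.E false j ≤ F.E false F.N := by rw [h3, F.E_N]; exact hu.2
        exact_mod_cast (F.E false).le_iff_le.1 this
      apply hl (F.N - j)
      rw [← h3, ← hb' j h4, F.chord_bdry]
    have hl1 := hlN h.mem_Icc hl
    have hl2 := hlN h.symm.mem_Icc hl'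
    have key := floor_partner_aux (F.E_zero false) (F.E_N false) (fun k hk hk' => by
        obtain ⟨⟨j, h1, h2, h3⟩, j', h4, h5, h6⟩ := Λ.exists_quarter false k hk hk'
        exact ⟨⟨F.N - j, by omega, by omega, by rw [← hb j h2.le, h3]⟩,
          F.N - j', by omega, by omega, by rw [← hb j' h5.le, h6]⟩)
      (fun j hj hjN hi => by
        rw [← hb' j hjN.le] at hi ⊢
        obtain ⟨j', h1, h2, h3, h4⟩ := Λ.exists_partner false (F.N - j) (by omega) (by omega) (hne hi)
        refine ⟨F.N - j', by omega, by omega, ?_, by rwa [← hb j' h2.le]⟩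
        obtain ⟨M, hM⟩ := Λ.even_N
        rw [Nat.odd_iff] at h3 ⊢
        omega) hu h hl1 hl2
    have hpar : ∀ {u : ℝ}, (∀ j : ℕ, F.chord false u ≠ j) → u ∈ Icc 0 (4 * F.m false : ℝ) →
        (Even ⌊F.chord false u⌋ ↔ ¬ Even ⌊(F.E false).symm u⌋) := by
      intro u hl hu
      have hE := F.E_symm_mem hu
      set y := (F.E false).symm u with hy
      have hfl : ⌊F.chord false u⌋ = F.N - 1 - ⌊y⌋ := by
        have h1 := Int.floor_le y
        have h2 := Int.lt_floor_add_one y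
        rw [Int.floor_eq_iff]
        change ((_ : ℤ) : ℝ) ≤ F.N - y ∧ F.N - y < _
        push_cast
        refine ⟨by linarith, ?_⟩
        have h3 : (⌊y⌋ : ℝ) ≠ y := by
          intro h3
          have h4 : 0 ≤ ⌊y⌋ := Int.floor_nonneg.2 hE.1
          have h5 : ⌊y⌋ ≤ F.N := by
            have : (⌊y⌋ : ℝ) ≤ F.N := by rw [h3]; exact hE.2
            exact_mod_cast this
          apply hl (F.N - ⌊y⌋).toNat
          have h6 : (((F.N - ⌊y⌋).toNat : ℤ) : ℝ) = ((F.N - ⌊y⌋ : ℤ) : ℝ) := by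
            rw [Int.toNat_of_nonneg (by omega)]
          push_cast at h6
          rw [h6, h3]
          rfl
        linarith [lt_of_le_of_ne h1 h3]
      rw [hfl]
      obtain ⟨M, hM⟩ := Λ.even_N
      rw [hM, Int.even_iff, Int.even_iff]
      push_cast
      omega
    rw [hpar hl h.mem_Icc, hpar hl' h.symm.mem_Icc, key]
  · have hlN : ∀ {u : ℝ}, (∀ j : ℕ, F.chord true u ≠ j) → ∀ j : ℕ, F.E true j ≠ u := by
      intro u hl j h3
      apply hl j
      rw [← h3]
      exact (F.E true).symm_apply_apply _
    exact floor_partner_aux (F.E_zero true) (F.E_N true) (Λ.exists_quarter true)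
      (fun j hj hjN hi => Λ.exists_partner true j hj hjN (hne hi)) hu h (hlN hl) (hlN hl')

theorem not_mem_lineSet (Λ : F.Lines) (Q : F.Chart) {b : Bool} {p : ℝ × ℝ} (hp : p ∈ F.dom b)
    (hv : ¬ F.IsVertex b p) (hl : ∀ j : ℕ, F.chord b p.1 ≠ j) : Q.q b p ∉ Q.lineSet := by
  rintro ⟨b', j, h0, h1, t, ht, h⟩
  have hjt : (F.bdry b' (j : ℕ), t) ∈ F.dom b' := ⟨F.bdry_mem b' (nat_mem_chord h1), ht⟩
  rcases (Q.q_eq_iff hjt hp).1 h with h | h | h | h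
  · obtain ⟨rfl, rfl⟩ := h
    exact hl j (F.chord_bdry _ _)
  · exact hl j (by rw [← h.2.2, F.chord_bdry])
  · exact hv h.2
  · obtain ⟨rfl, h2, h3, h4⟩ := h
    dsimp only at h2 h4
    by_cases hc : F.bdry b' j = 4 * F.m b' - 3
    · rw [hc, show (4 * F.m b' - 3 : ℝ) = ((4 * F.m b' - 3 : ℤ) : ℝ) by push_cast; ring] at h4
      exact hv (Or.inr (Or.inr ⟨h3, h4.int⟩))
    · obtain ⟨j', h5, h6, h7, h8⟩ := Λ.exists_partner b' j h0 h1 hc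
      have := Partner.eq_of_not_int (Λ.not_int h0 h1 hc) h4 h8
      exact hl j' (by rw [this, F.chord_bdry])

theorem mem_lineSet (Λ : F.Lines) (Q : F.Chart) {b : Bool} {p : ℝ × ℝ} (hp : p ∈ F.dom b)
    (hl : F.IsVertex b p ∨ ∃ j : ℕ, F.chord b p.1 = j) : Q.q b p ∈ Q.lineSet := by
  have hvert : F.IsVertex b p → Q.q b p ∈ Q.lineSet := by
    intro hv
    obtain ⟨j, h0, h1, hj⟩ := Λ.exists_corner true
    refine ⟨true, j, h0, h1, 1, by simp, (Q.q_eq_iff ⟨F.bdry_mem _ (nat_mem_chord h1), by simp⟩ hp).2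
      (Or.inr (Or.inr (Or.inl ⟨Or.inr (Or.inr ⟨rfl, 4 * F.m true - 3, ?_⟩), hv⟩)))⟩
    rw [hj]
    push_cast
    ring
  rcases hl with hv | ⟨j, hj⟩
  · exact hvert hv
  · have h1 := F.chord_mem hp.1
    by_cases h0 : j = 0 ∨ j = F.N
    · refine hvert (F.isVertex_of_end (F.chord_eq_end ?_))
      rw [hj]
      rcases h0 with rfl | rfl
      · simp
      · simp
    · rw [hj] at h1
      have h2 : j ≤ F.N := by exact_mod_cast h1.2
      refine ⟨b, j, by omega, by omega, p.2, hp.2, ?_⟩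
      rw [← hj, F.bdry_chord]

/-- The two closed sets are the unions of the closed gaps of even and of odd index. They agree
across the chord because both halves use the chord parameter, and across the sides by
`floor_partner`; so they meet only on lines. -/
theorem lineSet_separates (Λ : F.Lines) (Q : F.Chart) : ∃ C : Bool → Set (ClosedSurface F.g),
    (∀ e, IsClosed (C e)) ∧ C true ∪ C false = univ ∧ C true ∩ C false ⊆ Q.lineSet ∧
    (∀ t ∈ Ioo (0 : ℝ) 1, Q.q true (F.bdry true (1 / 2), t) ∈ C true \ Q.lineSet ∧
      Q.q true (F.bdry true (3 / 2), t) ∈ C false \ Q.lineSet) := by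
  have hT2 := t2Space_closedSurface F.g_pos
  have hN2 : (2 : ℝ) ≤ F.N := by exact_mod_cast Λ.two_le_N
  let J : Bool → Set ℝ := fun e => ⋃ k ∈ Finset.range F.N,
    if (e = true ↔ Even k) then Icc (k : ℝ) (k + 1) else ∅
  have hJ : ∀ e, IsClosed (J e) := by
    intro e
    refine Set.Finite.isClosed_biUnion (Finset.finite_toSet _) fun k _ => ?_
    split_ifs
    · exact isClosed_Icc
    · exact isClosed_empty
  have hJmem : ∀ {e : Bool} {x : ℝ}, x ∈ J e ↔ ∃ k : ℕ, k < F.N ∧ (e = true ↔ Even k) ∧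
      x ∈ Icc (k : ℝ) (k + 1) := by
    intro e x
    simp only [J, mem_iUnion, Finset.mem_range]
    constructor
    · rintro ⟨k, hk, h⟩
      split_ifs at h with h1
      · exact ⟨k, hk, h1, h⟩
      · exact h.elim
    · rintro ⟨k, hk, h1, h⟩
      exact ⟨k, hk, by rwa [if_pos h1]⟩
  have hJfl : ∀ {e : Bool} {x : ℝ}, x ∈ J e → (∀ j : ℕ, x ≠ j) → (e = true ↔ Even ⌊x⌋) := by
    intro e x hx hj
    obtain ⟨k, -, h1, h2⟩ := hJmem.1 hx
    have : ⌊x⌋ = (k : ℤ) := by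
      rw [Int.floor_eq_iff]
      refine ⟨by exact_mod_cast h2.1, lt_of_le_of_ne (by exact_mod_cast h2.2) ?_⟩
      have := hj (k + 1)
      push_cast at this ⊢
      exact this
    rw [h1, this, Int.even_coe_nat]
  let D : Bool → Bool → Set (ℝ × ℝ) := fun e b => F.dom b ∩ {p | F.chord b p.1 ∈ J e}
  have hD : ∀ e b, IsCompact (D e b) := fun e b => (Chart.isCompact_dom F b).inter_right
    ((hJ e).preimage ((F.continuous_chord b).comp continuous_fst))
  refine ⟨fun e => Q.q true '' D e true ∪ Q.q false '' D e false, fun e =>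
    (((hD e true).image (Q.continuous_q true)).union
      ((hD e false).image (Q.continuous_q false))).isClosed, ?_, ?_, ?_⟩
  · refine eq_univ_of_forall fun y => ?_
    obtain ⟨b, p, hp, rfl⟩ := Q.exists_q_eq y
    have hx := F.chord_mem hp.1
    have : ∃ e, F.chord b p.1 ∈ J e := by
      rcases hx.2.lt_or_eq with h | h
      · refine ⟨decide (Even ⌊F.chord b p.1⌋₊), hJmem.2 ⟨⌊F.chord b p.1⌋₊, ?_, by simp,
          Nat.floor_le hx.1, (Nat.lt_floor_add_one _).le⟩⟩
        exact (Nat.floor_lt hx.1).2 h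
      · have := Λ.two_le_N
        refine ⟨decide (Even (F.N - 1)), hJmem.2 ⟨F.N - 1, by omega, by simp, ?_⟩⟩
        rw [h, Nat.cast_sub (by omega)]
        constructor <;> simp
    obtain ⟨e, he⟩ := this
    have hmem : Q.q b p ∈ Q.q true '' D e true ∪ Q.q false '' D e false := by
      cases b
      · exact Or.inr ⟨p, ⟨hp, he⟩, rfl⟩
      · exact Or.inl ⟨p, ⟨hp, he⟩, rfl⟩
    cases e
    · exact Or.inr hmem
    · exact Or.inl hmem
  · have hmem : ∀ {e y}, y ∈ Q.q true '' D e true ∪ Q.q false '' D e false →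
        ∃ b, ∃ p ∈ D e b, Q.q b p = y := by
      rintro e y (⟨p, hp, h⟩ | ⟨p, hp, h⟩)
      · exact ⟨true, p, hp, h⟩
      · exact ⟨false, p, hp, h⟩
    rintro y ⟨h1, h2⟩
    obtain ⟨b, p, ⟨hp, hpJ⟩, rfl⟩ := hmem h1
    obtain ⟨b', p', ⟨hp', hpJ'⟩, h⟩ := hmem h2
    by_contra hcon
    have hnl : ∀ {b p}, p ∈ F.dom b → Q.q b p ∉ Q.lineSet →
        ¬ F.IsVertex b p ∧ ∀ j : ℕ, F.chord b p.1 ≠ j := by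
      intro b p hp h
      exact ⟨fun h1 => h (Λ.mem_lineSet Q hp (Or.inl h1)),
        fun j h1 => h (Λ.mem_lineSet Q hp (Or.inr ⟨j, h1⟩))⟩
    have hq := hnl hp hcon
    have hq' := hnl hp' (by rwa [h])
    have e1 := hJfl hpJ hq.2
    have e2 := hJfl hpJ' hq'.2
    have : Even ⌊F.chord b p.1⌋ ↔ Even ⌊F.chord b' p'.1⌋ := by
      rcases (Q.q_eq_iff hp hp').1 h.symm with h | h | h | h
      · rw [h.2, h.1]
      · rw [h.2.2]
      · exact absurd h.1 hq.1
      · obtain ⟨rfl, h3, h4, h5⟩ := h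
        refine Λ.floor_partner (fun k hk => hq.1 (Or.inr (Or.inr ⟨h3, k, hk⟩))) h5 hq.2 hq'.2
    simp at e1 e2
    rw [← Int.not_even_iff_odd] at e2
    exact e2 (this.1 e1)
  · intro t ht
    have key : ∀ k : ℕ, k < F.N → ∀ e : Bool, (e = true ↔ Even k) →
        Q.q true (F.bdry true (k + 1 / 2), t) ∈
          (Q.q true '' D e true ∪ Q.q false '' D e false) \ Q.lineSet := by
      intro k hk e he
      have hk' : (k : ℝ) + 1 ≤ F.N := by exact_mod_cast hk
      have hx : (k : ℝ) + 1 / 2 ∈ Icc 0 (F.N : ℝ) := ⟨by positivity, by linarith⟩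
      have hp : (F.bdry true (k + 1 / 2), t) ∈ F.dom true := ⟨F.bdry_mem _ hx, ht.1.le, ht.2.le⟩
      refine ⟨Or.inl ⟨_, ⟨hp, ?_⟩, rfl⟩, Λ.not_mem_lineSet Q hp ?_ ?_⟩
      · change F.chord true (F.bdry true (k + 1 / 2)) ∈ J e
        rw [F.chord_bdry]
        exact hJmem.2 ⟨k, hk, he, by linarith, by linarith⟩
      · have hne := bdry_ne_end (F := F) (b := true) (x := k + 1 / 2) (by positivity) (by linarith)
        rintro (h | h | h)
        · exact hne.1 h
        · exact hne.2 h
        · exact ht.2.ne h.1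
      · intro j
        rw [F.chord_bdry]
        intro h
        have h1 : ((2 * k + 1 : ℕ) : ℝ) = ((2 * j : ℕ) : ℝ) := by push_cast; linarith
        have h2 : 2 * k + 1 = 2 * j := by exact_mod_cast h1
        omega
    have hN := Λ.two_le_N
    refine ⟨?_, ?_⟩
    · simpa using key 0 (by omega) true (by simp)
    · have := key 1 (by omega) false (by simp)
      norm_num at this ⊢
      exact this

end Lines

end Frame

/-! ### Complementary disks -/

theorem nonempty_rect_homeomorph {x₀ x₁ y₀ y₁ : ℝ} (hx : x₀ < x₁) (hy : y₀ < y₁) :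
    Nonempty ((Ioo x₀ x₁ ×ˢ Ioo y₀ y₁ : Set (ℝ × ℝ)) ≃ₜ Metric.ball (0 : ℂ) 1) := by
  have hs : Complex.equivRealProdCLM ⁻¹' (Ioo x₀ x₁ ×ˢ Ioo y₀ y₁) = Ioo x₀ x₁ ×ℂ Ioo y₀ y₁ := rfl
  set s : Set ℂ := Ioo x₀ x₁ ×ℂ Ioo y₀ y₁ with hsd
  have hopen : IsOpen s := isOpen_Ioo.reProdIm isOpen_Ioo
  have hconv : Convex ℝ s := by
    have := ((convex_Ioo x₀ x₁).prod (convex_Ioo y₀ y₁)).linear_preimage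
      (Complex.equivRealProdCLM.toLinearEquiv.toLinearMap)
    exact this
  obtain ⟨h, h1, -, -⟩ := exists_homeomorph_image_interior_closure_frontier_eq_unitBall (s := s)
    hconv (by
      rw [hopen.interior_eq]
      exact ⟨⟨(x₀ + x₁) / 2, (y₀ + y₁) / 2⟩, ⟨⟨by linarith, by linarith⟩, ⟨by linarith, by linarith⟩⟩⟩)
    ((Metric.isBounded_Ioo _ _).reProdIm (Metric.isBounded_Ioo _ _))
  rw [hopen.interior_eq] at h1
  have e1 : (Ioo x₀ x₁ ×ˢ Ioo y₀ y₁ : Set (ℝ × ℝ)) ≃ₜ s :=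
    (Complex.equivRealProdCLM.toHomeomorph.sets (by rw [← hs]; rfl)).symm
  exact ⟨e1.trans (h.sets (by rw [← h1, h.injective.preimage_image]))⟩

/-- `W` is an open disk and a component of the complement of `A`. -/
structure IsDiskComponent {X : Type} [TopologicalSpace X] (A W : Set X) : Prop where
  isOpen : IsOpen W
  isOpenDisk : IsOpenDisk W
  component_eq : ∀ y ∈ W, connectedComponentIn Aᶜ y = W

/-- The image of the interior of a rectangle under a map that sends the boundary into `A` is a
complementary component of `A` and an open disk. -/
theorem isOpenDisk_of_rect {X : Type} [TopologicalSpace X] [T2Space X] {A W : Set X}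
    (hW : IsOpen W) (hAW : Disjoint A W) {x₀ x₁ y₀ y₁ : ℝ} (hx : x₀ < x₁) (hy : y₀ < y₁)
    {f : ℝ × ℝ → X} (hf : ContinuousOn f (Icc x₀ x₁ ×ˢ Icc y₀ y₁))
    (hinj : InjOn f (Ioo x₀ x₁ ×ˢ Ioo y₀ y₁))
    (hbd : ∀ z ∈ Icc x₀ x₁ ×ˢ Icc y₀ y₁, z ∉ Ioo x₀ x₁ ×ˢ Ioo y₀ y₁ → f z ∈ A)
    (himg : f '' (Ioo x₀ x₁ ×ˢ Ioo y₀ y₁) = W) :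
    IsDiskComponent A W := by
  set K : Set (ℝ × ℝ) := Icc x₀ x₁ ×ˢ Icc y₀ y₁ with hK
  set I : Set (ℝ × ℝ) := Ioo x₀ x₁ ×ˢ Ioo y₀ y₁ with hI
  have hKc : IsCompact K := isCompact_Icc.prod isCompact_Icc
  have hIK : I ⊆ K := prod_mono Ioo_subset_Icc_self Ioo_subset_Icc_self
  have hpre : ∀ z ∈ K, (f z ∈ W ↔ z ∈ I) := by
    intro z hz
    constructor
    · intro h
      by_contra hcon
      exact (disjoint_left.1 hAW) (hbd z hz hcon) h
    · intro h
      rw [← himg]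
      exact ⟨z, h, rfl⟩
  refine ⟨hW, ?_, ?_⟩
  · have : CompactSpace K := isCompact_iff_compactSpace.1 hKc
    let φ : K → X := K.domRestrict f
    have hφ : Continuous φ := hf.domRestrict
    -- The boundary goes into `A`, so the open rectangle is exactly the preimage of `W`. A
    -- restriction of a closed map to a full preimage is closed, and a continuous closed bijection
    -- is a homeomorphism.
    have hcl := hφ.isClosedMap.restrictPreimage W
    let e : φ ⁻¹' W ≃ₜ W := (Equiv.ofBijective (W.restrictPreimage φ) (by
      constructor
      · rintro ⟨⟨z, hz⟩, h⟩ ⟨⟨z', hz'⟩, h'⟩ heq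
        have h1 := hinj ((hpre z hz).1 h) ((hpre z' hz').1 h') (congr_arg Subtype.val heq)
        subst h1
        rfl
      · rintro ⟨y, hy⟩
        have hy' := hy
        rw [← himg] at hy'
        obtain ⟨z, hz, rfl⟩ := hy'
        exact ⟨⟨⟨z, hIK hz⟩, hy⟩, rfl⟩)).toHomeomorphOfContinuousClosed
      (hφ.restrictPreimage) hcl
    let e' : φ ⁻¹' W ≃ₜ I :=
      { toFun := fun z => ⟨z.1.1, (hpre _ z.1.2).1 z.2⟩
        invFun := fun z => ⟨⟨z.1, hIK z.2⟩, (hpre _ (hIK z.2)).2 z.2⟩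
        left_inv := fun z => rfl
        right_inv := fun z => rfl
        continuous_toFun := by fun_prop
        continuous_invFun := by fun_prop }
    obtain ⟨e''⟩ := nonempty_rect_homeomorph hx hy
    exact ⟨e.symm.trans (e'.trans e'')⟩
  · intro y hy
    have hWA : W ⊆ Aᶜ := fun z hz hA => (disjoint_left.1 hAW) hA hz
    have hWc : IsPreconnected W := by
      rw [← himg]
      exact (isPreconnected_Ioo.prod isPreconnected_Ioo).image f (hf.mono hIK)
    refine Subset.antisymm ?_ (hWc.subset_connectedComponentIn hy hWA)
    -- Points of the compact image outside `W` lie in `A`, so `W` is open and closed in the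
    -- complement of `A`.
    have hcl : closure W ⊆ f '' K := by
      refine closure_minimal ?_ (hKc.image_of_continuousOn hf).isClosed
      rw [← himg]
      exact image_mono hIK
    refine IsPreconnected.subset_left_of_subset_union hW isClosed_closure.isOpen_compl
      (disjoint_compl_right.mono_left subset_closure) (v := (closure W)ᶜ) ?_
      ⟨y, mem_connectedComponentIn (hWA hy), hy⟩ isPreconnected_connectedComponentIn
    intro z hz
    have hzA := connectedComponentIn_subset _ _ hz
    by_cases h : z ∈ closure W
    · left
      obtain ⟨w, hw, rfl⟩ := hcl h
      by_cases hwI : w ∈ I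
      · rw [← himg]
        exact ⟨w, hwI, rfl⟩
      · exact absurd (hbd w hw hwI) hzA
    · exact Or.inr h

/-! ### Faces as sets of coordinates closed under the gluing -/

namespace Frame

variable {F : Frame}

/-- The points over a set of boundary coordinates. -/
def Chart.faceSet (Q : F.Chart) (b : Bool) (R : Set ℝ) : Set (ClosedSurface F.g) :=
  {y | ∃ u ∈ R, ∃ t ∈ Ioc (0 : ℝ) 1, (t < 1 ∨ ∀ k : ℤ, u ≠ k) ∧ Q.q b (u, t) = y}

namespace Lines

variable (Λ : F.Lines) (Q : F.Chart)

/-- A set of boundary coordinates that avoids the lines and is invariant under side pairings. -/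
structure IsRegion (b : Bool) (R : Set ℝ) : Prop where
  isOpen : IsOpen R
  subset : R ⊆ Ioo 0 (4 * F.m b : ℝ)
  not_line : ∀ u ∈ R, ∀ j : ℕ, F.chord b u ≠ j
  partner : ∀ u ∈ R, (∀ k : ℤ, u ≠ k) → ∀ u', Partner (F.m b) u u' → u' ∈ R

variable {b : Bool} {R : Set ℝ}

theorem not_isVertex {u t : ℝ} (hu : u ∈ Ioo 0 (4 * F.m b : ℝ)) (h : t < 1 ∨ ∀ k : ℤ, u ≠ k) :
    ¬ F.IsVertex b (u, t) := by
  rintro (h1 | h1 | ⟨h1, k, h2⟩)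
  · exact hu.1.ne' h1
  · exact hu.2.ne h1
  · rcases h with h | h
    · exact h.ne h1
    · exact h k h2

/-- The coordinate set is open in the half and saturated: it avoids the chord and the vertex and
contains the partners of its points. Its complement in the surface is therefore a union of two
compact images. -/
theorem isOpen_faceSet (hR : IsRegion (F := F) b R) : IsOpen (Q.faceSet b R) := by
  have hT2 := t2Space_closedSurface F.g_pos
  let G : Set (ℝ × ℝ) := {p | p.1 ∈ R ∧ 0 < p.2 ∧ (p.2 < 1 ∨ ∀ k : ℤ, p.1 ≠ k)}
  have hG : IsOpen G := by
    have h1 : IsClosed (range ((↑) : ℤ → ℝ)) := Int.isClosedEmbedding_coe_real.isClosed_range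
    have h2 : G = Prod.fst ⁻¹' R ∩ (Prod.snd ⁻¹' Ioi 0 ∩
        (Prod.snd ⁻¹' Iio 1 ∪ Prod.fst ⁻¹' (range ((↑) : ℤ → ℝ))ᶜ)) := by
      ext p
      simp [G, eq_comm]
    rw [h2]
    exact (hR.isOpen.preimage continuous_fst).inter ((isOpen_Ioi.preimage continuous_snd).inter
      ((isOpen_Iio.preimage continuous_snd).union (h1.isOpen_compl.preimage continuous_fst)))
  have hC : IsClosed (Q.q b '' (F.dom b \ G) ∪ Q.q (!b) '' F.dom (!b)) :=
    ((((Chart.isCompact_dom F b).diff hG).image (Q.continuous_q b)).union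
      ((Chart.isCompact_dom F _).image (Q.continuous_q _))).isClosed
  have key : ∀ b' p', p' ∈ F.dom b' → Q.q b' p' ∈ Q.faceSet b R → b' = b ∧ p' ∈ G := by
    rintro b' p' hp' ⟨u, hu, t, ht, h, heq⟩
    have hu' := hR.subset hu
    have hp : (u, t) ∈ F.dom b := ⟨⟨hu'.1.le, hu'.2.le⟩, ht.1.le, ht.2⟩
    rcases (Q.q_eq_iff hp hp').1 heq with h1 | h1 | h1 | h1
    · obtain ⟨rfl, rfl⟩ := h1
      exact ⟨rfl, hu, ht.1, h⟩
    · exact absurd h1.1 ht.1.ne'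
    · exact absurd h1.1 (not_isVertex hu' h)
    · obtain ⟨rfl, h2, h3, h4⟩ := h1
      dsimp only at h2 h4
      have hni : ∀ k : ℤ, u ≠ k := h.resolve_left (by rw [h2]; exact lt_irrefl _)
      exact ⟨rfl, hR.partner u hu hni _ h4, by rw [h3]; exact one_pos,
        Or.inr (h4.not_int hni)⟩
  have : Q.faceSet b R = (Q.q b '' (F.dom b \ G) ∪ Q.q (!b) '' F.dom (!b))ᶜ := by
    ext y
    constructor
    · rintro hy (⟨p, hp, rfl⟩ | ⟨p, hp, rfl⟩)
      · exact hp.2 (key b p hp.1 hy).2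
      · have := (key _ p hp hy).1
        cases b <;> simp at this
    · intro hy
      obtain ⟨b', p, hp, rfl⟩ := Q.exists_q_eq y
      rw [mem_compl_iff, mem_union, not_or] at hy
      have hb : b' = b := by
        by_contra hb
        have : b' = !b := by cases b <;> cases b' <;> simp_all
        subst this
        exact hy.2 ⟨p, hp, rfl⟩
      subst hb
      have hpG : p ∈ G := by
        by_contra hG
        exact hy.1 ⟨p, ⟨hp, hG⟩, rfl⟩
      exact ⟨p.1, hpG.1, p.2, ⟨hpG.2.1, hp.2.2⟩, hpG.2.2, rfl⟩
  rw [this]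
  exact hC.isOpen_compl

theorem disjoint_faceSet (Λ : F.Lines) (hR : IsRegion (F := F) b R) :
    Disjoint (Q.lineSet ∪ Q.chordSet) (Q.faceSet b R) := by
  rw [disjoint_left]
  rintro y hy ⟨u, hu, t, ht, h, rfl⟩
  have hu' := hR.subset hu
  have hp : (u, t) ∈ F.dom b := ⟨⟨hu'.1.le, hu'.2.le⟩, ht.1.le, ht.2⟩
  rcases hy with hy | ⟨b', u', hu'', heq⟩
  · exact Λ.not_mem_lineSet Q hp (not_isVertex hu' h) (hR.not_line u hu) hy
  · rcases (Q.q_eq_iff hp hu'').1 heq.symm with h1 | h1 | h1 | h1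
    · exact ht.1.ne' (Prod.ext_iff.1 h1.2).2
    · exact ht.1.ne' h1.1
    · exact not_isVertex hu' h h1.1
    · exact zero_ne_one h1.2.2.1

theorem isOpenDisk_faceSet (Λ : F.Lines) (hR : IsRegion (F := F) b R) {x₀ x₁ y₀ y₁ : ℝ} (hx : x₀ < x₁)
    (hy : y₀ < y₁) {f : ℝ × ℝ → ClosedSurface F.g}
    (hf : ContinuousOn f (Icc x₀ x₁ ×ˢ Icc y₀ y₁)) (hinj : InjOn f (Ioo x₀ x₁ ×ˢ Ioo y₀ y₁))
    (hbd : ∀ z ∈ Icc x₀ x₁ ×ˢ Icc y₀ y₁, z ∉ Ioo x₀ x₁ ×ˢ Ioo y₀ y₁ →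
      f z ∈ Q.lineSet ∪ Q.chordSet)
    (himg : f '' (Ioo x₀ x₁ ×ˢ Ioo y₀ y₁) = Q.faceSet b R) :
    IsDiskComponent (Q.lineSet ∪ Q.chordSet) (Q.faceSet b R) := by
  have hT2 := t2Space_closedSurface F.g_pos
  exact isOpenDisk_of_rect (isOpen_faceSet Q hR) (Λ.disjoint_faceSet Q hR) hx hy hf hinj hbd himg

include Λ in
theorem line_partner {u u' : ℝ} (hu : ∀ k : ℤ, u ≠ k) (h : Partner (F.m b) u u')
    (hj : ∃ j : ℕ, F.chord b u = j) : ∃ j : ℕ, F.chord b u' = j := by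
  obtain ⟨j, hj⟩ := hj
  have hm := F.chord_mem h.mem_Icc
  have hne : ¬ (F.chord b u = 0 ∨ F.chord b u = F.N) := by
    intro h1
    obtain ⟨k, hk⟩ := F.int_of_end (F.chord_eq_end h1)
    exact hu k hk
  rw [hj] at hm hne
  rw [not_or] at hne
  have h0 : 0 < j := Nat.pos_of_ne_zero fun h => hne.1 (by rw [h]; simp)
  have h1 : j < F.N := lt_of_le_of_ne (by exact_mod_cast hm.2) fun h => hne.2 (by rw [h])
  have hbu : F.bdry b j = u := by rw [← hj, F.bdry_chord]
  obtain ⟨j', -, -, -, h2⟩ := Λ.exists_partner b j h0 h1 (by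
    rw [hbu]
    intro h3
    exact hu (4 * F.m b - 3) (by rw [h3]; push_cast; ring))
  rw [hbu] at h2
  exact ⟨j', by rw [Partner.eq_of_not_int hu h h2, F.chord_bdry]⟩

theorem _root_.SurfaceCurves.Partner.one_le_abs {m : ℕ} {u u' : ℝ} (h : Partner m u u') :
    1 ≤ |u - u'| := by
  obtain ⟨j, -, e, -, h1 | h1, h2⟩ := h
  · exact le_abs.2 (Or.inr (by linarith))
  · exact le_abs.2 (Or.inl (by linarith))

end Lines

end Frame

/-! ### Strips between consecutive lines -/

namespace Frame

variable {F : Frame}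

namespace Lines

variable (Q : F.Chart) {b : Bool}

theorem chord_monotone_or (b : Bool) : StrictMono (F.chord b) ∨ StrictAnti (F.chord b) := by
  cases b
  · right
    intro u v h
    have := (F.E false).symm.strictMono h
    change (F.N : ℝ) - (F.E false).symm v < F.N - (F.E false).symm u
    linarith
  · exact Or.inl (F.E true).symm.strictMono

/-- The strip between two consecutive lines on a side, continued through the opposite side. -/
theorem isOpenDisk_strip (Λ : F.Lines) {K : ℤ} {a a' κ : ℝ} (ha : (K : ℝ) < a) (haa : a < a') (ha' : a' < K + 1)
    (hj : ∃ j : ℕ, F.chord b a = j) (hj' : ∃ j : ℕ, F.chord b a' = j)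
    (hno : ∀ u ∈ Ioo a a', ∀ j : ℕ, F.chord b u ≠ j)
    (hκ : ∀ u ∈ Icc a a', Partner (F.m b) u (κ - u)) :
    let R := Ioo a a' ∪ Ioo (κ - a') (κ - a)
    IsDiskComponent (Q.lineSet ∪ Q.chordSet) (Q.faceSet b R) := by
  intro R
  have hni : ∀ u ∈ Icc a a', ∀ k : ℤ, u ≠ k := fun u hu =>
    not_int_of_mem_Ioo ⟨ha.trans_le hu.1, hu.2.trans_lt ha'⟩
  have hni' : ∀ u ∈ Icc a a', ∀ k : ℤ, κ - u ≠ k := fun u hu => (hκ u hu).not_int (hni u hu)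
  have hIoo : ∀ {w}, w ∈ Icc 0 (4 * F.m b : ℝ) → (∀ k : ℤ, w ≠ k) → w ∈ Ioo 0 (4 * F.m b : ℝ) := by
    intro w hw hn
    refine ⟨lt_of_le_of_ne hw.1 fun h => hn 0 (by simp [← h]), lt_of_le_of_ne hw.2 fun h =>
      hn (4 * F.m b) (by rw [h]; push_cast; rfl)⟩
  have hm : ∀ u ∈ Icc a a', u ∈ Ioo 0 (4 * F.m b : ℝ) := fun u hu =>
    hIoo (hκ u hu).mem_Icc (hni u hu)
  have hm' : ∀ u ∈ Icc a a', κ - u ∈ Ioo 0 (4 * F.m b : ℝ) := fun u hu =>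
    hIoo (hκ u hu).symm.mem_Icc (hni' u hu)
  have hline : ∀ u ∈ Icc a a', (u = a ∨ u = a') → (∃ j : ℕ, F.chord b u = j) ∧
      ∃ j : ℕ, F.chord b (κ - u) = j := by
    intro u hu h
    have h1 : ∃ j : ℕ, F.chord b u = j := by rcases h with rfl | rfl <;> assumption
    exact ⟨h1, Λ.line_partner (hni u hu) (hκ u hu) h1⟩
  -- Partners are at distance at least `1`, while the strip lies inside one side.
  have hfar : ∀ u ∈ Icc a a', ∀ u' ∈ Icc a a', ¬ Partner (F.m b) u u' := by
    intro u hu u' hu' h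
    have h1 := h.one_le_abs
    rcases le_abs.1 h1 with h2 | h2 <;> linarith [hu.1, hu.2, hu'.1, hu'.2]
  have hsub : ∀ {u}, u ∈ Ioo a a' → u ∈ Icc a a' := fun h => Ioo_subset_Icc_self h
  have hreg : IsRegion (F := F) b R := by
    refine ⟨isOpen_Ioo.union isOpen_Ioo, ?_, ?_, ?_⟩
    · rintro u (hu | hu)
      · exact hm u (hsub hu)
      · have := hm' (κ - u) (hsub ⟨by linarith [hu.2], by linarith [hu.1]⟩)
        rwa [sub_sub_cancel] at this
    · rintro u (hu | hu) j hj
      · exact hno u hu j hj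
      · have hu' : κ - u ∈ Ioo a a' := ⟨by linarith [hu.2], by linarith [hu.1]⟩
        have hP := hκ _ (hsub hu')
        rw [sub_sub_cancel] at hP
        obtain ⟨i, hi⟩ := Λ.line_partner (hP.not_int (hni _ (hsub hu'))) hP.symm ⟨j, hj⟩
        exact hno _ hu' i hi
    · rintro u (hu | hu) hn u' h
      · right
        rw [Partner.eq_of_not_int hn h (hκ u (hsub hu))]
        exact ⟨by linarith [hu.2], by linarith [hu.1]⟩
      · left
        have hu' : κ - u ∈ Ioo a a' := ⟨by linarith [hu.2], by linarith [hu.1]⟩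
        have hP := hκ _ (hsub hu')
        rw [sub_sub_cancel] at hP
        rw [Partner.eq_of_not_int hn h hP.symm]
        exact hu'
  classical
  -- The rectangle runs from the chord up to the side, crosses it at `x.1 = 1`, and descends on the
  -- opposite side back to the chord.
  let f : ℝ × ℝ → ClosedSurface F.g := fun x =>
    if x.1 ≤ 1 then Q.q b (x.2, x.1) else Q.q b (κ - x.2, 2 - x.1)
  have hd : ∀ u ∈ Icc a a', ∀ t ∈ Icc (0 : ℝ) 1, (u, t) ∈ F.dom b := fun u hu t ht =>
    ⟨⟨(hm u hu).1.le, (hm u hu).2.le⟩, ht⟩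
  have hd' : ∀ u ∈ Icc a a', ∀ t ∈ Icc (0 : ℝ) 1, (κ - u, t) ∈ F.dom b := fun u hu t ht =>
    ⟨⟨(hm' u hu).1.le, (hm' u hu).2.le⟩, ht⟩
  have hmid : ∀ u ∈ Icc a a', Q.q b (u, 1) = Q.q b (κ - u, 1) := fun u hu =>
    (Q.q_eq_iff (hd u hu 1 (by simp)) (hd' u hu 1 (by simp))).2
      (Or.inr (Or.inr (Or.inr ⟨rfl, rfl, rfl, hκ u hu⟩)))
  have hqc := Q.continuous_q b
  have hf : ContinuousOn f (Icc 0 2 ×ˢ Icc a a') := by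
    refine continuousOn_ite_le (by fun_prop) (by fun_prop) fun u hu => ?_
    rw [hmid u hu]
    norm_num
  -- coordinates of a point in the interior of the rectangle
  have hrep : ∀ x ∈ Ioo (0 : ℝ) 2 ×ˢ Ioo a a', ∃ w t, f x = Q.q b (w, t) ∧ t ∈ Ioc (0 : ℝ) 1 ∧
      ((x.1 ≤ 1 ∧ w = x.2 ∧ t = x.1) ∨ (1 < x.1 ∧ w = κ - x.2 ∧ t = 2 - x.1)) := by
    intro x hx
    by_cases h : x.1 ≤ 1
    · exact ⟨x.2, x.1, if_pos h, ⟨hx.1.1, h⟩, Or.inl ⟨h, rfl, rfl⟩⟩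
    · exact ⟨κ - x.2, 2 - x.1, if_neg h, ⟨by linarith [hx.1.2], by linarith⟩,
        Or.inr ⟨not_le.1 h, rfl, rfl⟩⟩
  refine Λ.isOpenDisk_faceSet Q hreg two_pos haa hf ?_ ?_ ?_
  · intro x hx x' hx' heq
    obtain ⟨w, t, e, ht, hw⟩ := hrep x hx
    obtain ⟨w', t', e', ht', hw'⟩ := hrep x' hx'
    have hxs := hsub hx.2
    have hxs' := hsub hx'.2
    have hwd : ∀ {x : ℝ × ℝ} {w t : ℝ}, x ∈ Ioo (0 : ℝ) 2 ×ˢ Ioo a a' → t ∈ Ioc (0 : ℝ) 1 →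
        ((x.1 ≤ 1 ∧ w = x.2 ∧ t = x.1) ∨ (1 < x.1 ∧ w = κ - x.2 ∧ t = 2 - x.1)) →
        (w, t) ∈ F.dom b ∧ w ∈ Ioo 0 (4 * F.m b : ℝ) ∧ ∀ k : ℤ, w ≠ k := by
      rintro x w t hx ht (⟨-, rfl, -⟩ | ⟨-, rfl, -⟩)
      · exact ⟨hd _ (hsub hx.2) _ ⟨ht.1.le, ht.2⟩, hm _ (hsub hx.2), hni _ (hsub hx.2)⟩
      · exact ⟨hd' _ (hsub hx.2) _ ⟨ht.1.le, ht.2⟩, hm' _ (hsub hx.2), hni' _ (hsub hx.2)⟩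
    obtain ⟨d1, d2, d3⟩ := hwd hx ht hw
    obtain ⟨d1', d2', d3'⟩ := hwd hx' ht' hw'
    rw [e, e'] at heq
    rcases (Q.q_eq_iff d1 d1').1 heq with h | h | h | h
    · obtain ⟨rfl, rfl⟩ := Prod.ext_iff.1 h.2
      rcases hw with ⟨h1, h2, h3⟩ | ⟨h1, h2, h3⟩ <;> rcases hw' with ⟨h4, h5, h6⟩ | ⟨h4, h5, h6⟩
      · exact Prod.ext (h3.symm.trans h6) (h2.symm.trans h5)
      · refine absurd (hκ _ hxs') ?_
        have : κ - x'.2 = x.2 := h5.symm.trans h2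
        rw [this]
        exact hfar _ hxs' _ hxs
      · refine absurd (hκ _ hxs) ?_
        have : κ - x.2 = x'.2 := h2.symm.trans h5
        rw [this]
        exact hfar _ hxs _ hxs'
      · exact Prod.ext (by linarith) (by linarith)
    · exact absurd h.1 ht.1.ne'
    · exact absurd h.1 (not_isVertex d2 (Or.inr d3))
    · obtain ⟨-, h1, h2, h3⟩ := h
      dsimp only at h1 h2 h3
      rcases hw with ⟨h4, h5, h6⟩ | ⟨h4, h5, h6⟩
      · rcases hw' with ⟨h7, h8, h9⟩ | ⟨h7, h8, h9⟩
        · rw [h5, h8] at h3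
          exact absurd h3 (hfar _ hxs _ hxs')
        · linarith
      · linarith
  · intro x hx hx'
    by_cases h2 : x.2 = a ∨ x.2 = a'
    · left
      obtain ⟨l1, l2⟩ := hline x.2 hx.2 h2
      by_cases h : x.1 ≤ 1
      · rw [show f x = _ from if_pos h]
        exact Λ.mem_lineSet Q (hd _ hx.2 _ ⟨hx.1.1, h⟩) (Or.inr l1)
      · rw [show f x = _ from if_neg h]
        exact Λ.mem_lineSet Q (hd' _ hx.2 _ ⟨by linarith [hx.1.2], by linarith⟩) (Or.inr l2)
    · right
      rw [not_or] at h2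
      have h3 : x.1 = 0 ∨ x.1 = 2 := by
        by_contra hcon
        rw [not_or] at hcon
        exact hx' ⟨⟨lt_of_le_of_ne hx.1.1 (Ne.symm hcon.1), lt_of_le_of_ne hx.1.2 hcon.2⟩,
          lt_of_le_of_ne hx.2.1 (Ne.symm h2.1), lt_of_le_of_ne hx.2.2 h2.2⟩
      rcases h3 with h3 | h3
      · refine ⟨b, x.2, hd _ hx.2 _ (by simp), ?_⟩
        rw [show f x = _ from if_pos (by rw [h3]; exact zero_le_one), h3]
      · refine ⟨b, κ - x.2, hd' _ hx.2 _ (by simp), ?_⟩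
        rw [show f x = _ from if_neg (by rw [h3]; norm_num), h3, sub_self]
  · ext y
    constructor
    · rintro ⟨x, hx, rfl⟩
      obtain ⟨w, t, e, ht, hw⟩ := hrep x hx
      rw [e]
      have hxs := hsub hx.2
      rcases hw with ⟨-, rfl, -⟩ | ⟨-, rfl, -⟩
      · exact ⟨x.2, Or.inl hx.2, t, ht, Or.inr (hni _ hxs), rfl⟩
      · exact ⟨κ - x.2, Or.inr ⟨by linarith [hx.2.2], by linarith [hx.2.1]⟩, t, ht,
          Or.inr (hni' _ hxs), rfl⟩
    · rintro ⟨u, hu | hu, t, ht, -, rfl⟩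
      · exact ⟨(t, u), ⟨⟨ht.1, by linarith [ht.2]⟩, hu⟩, if_pos ht.2⟩
      · have hu' : κ - u ∈ Ioo a a' := ⟨by linarith [hu.2], by linarith [hu.1]⟩
        refine ⟨(2 - t, κ - u), ⟨⟨by linarith [ht.2], by linarith [ht.1]⟩, hu'⟩, ?_⟩
        rcases ht.2.lt_or_eq with h | h
        · rw [show f _ = _ from if_neg (by dsimp only; linarith)]
          dsimp only
          rw [sub_sub_cancel, sub_sub_cancel]
        · subst h
          rw [show f _ = _ from if_pos (by norm_num)]
          have := hmid _ (hsub hu')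
          rw [sub_sub_cancel] at this
          rw [← this]
          norm_num

/-- The strip that contains a given coordinate. -/
theorem exists_strip (Λ : F.Lines) {K : ℤ} {u : ℝ} (hK0 : 0 ≤ K) (hK1 : K < 4 * F.m b)
    (hu : u ∈ Ioo ((K : ℝ) + 1 / 4) (K + 3 / 4)) (hl : ∀ j : ℕ, F.chord b u ≠ j) :
    ∃ R : Set ℝ, u ∈ R ∧ IsDiskComponent (Q.lineSet ∪ Q.chordSet) (Q.faceSet b R) := by
  obtain ⟨⟨j₁, h10, h11, hj₁⟩, j₂, h20, h21, hj₂⟩ := Λ.exists_quarter b K hK0 hK1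
  have hK0r : (0 : ℝ) ≤ K := by exact_mod_cast hK0
  have hK1r : (K : ℝ) + 1 ≤ 4 * F.m b := by exact_mod_cast hK1
  have humem : u ∈ Icc 0 (4 * F.m b : ℝ) := ⟨by linarith [hu.1], by linarith [hu.2]⟩
  set x := F.chord b u with hx
  have hx0 := (F.chord_mem humem).1
  set n := ⌊x⌋₊ with hn
  have hn1 : (n : ℝ) < x := lt_of_le_of_ne (Nat.floor_le hx0) (hl n).symm
  have hn2 : x < n + 1 := Nat.lt_floor_add_one x
  have hc1 : F.chord b (K + 1 / 4) = j₁ := by rw [← hj₁, F.chord_bdry]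
  have hc2 : F.chord b (K + 3 / 4) = j₂ := by rw [← hj₂, F.chord_bdry]
  have hnat : ∀ {j : ℕ}, (j : ℝ) < x → (j : ℝ) ≤ n := by
    intro j h
    have : (j : ℝ) < n + 1 := h.trans hn2
    have : j < n + 1 := by exact_mod_cast this
    exact_mod_cast Nat.lt_succ_iff.1 this
  have hnat' : ∀ {j : ℕ}, x < (j : ℝ) → (n : ℝ) + 1 ≤ j := by
    intro j h
    have : (n : ℝ) < j := hn1.trans h
    have : n < j := by exact_mod_cast this
    exact_mod_cast this
  obtain ⟨κ, hκ⟩ : ∃ κ, Partner (F.m b) u (κ - u) := by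
    obtain ⟨u', hu'⟩ := SurfaceCurves.exists_partner (m := F.m b) (u := u) ⟨humem.1, by linarith [hu.2]⟩
    exact ⟨u + u', by simpa using hu'⟩
  have hside : ∀ v ∈ Icc (K : ℝ) (K + 1), Partner (F.m b) v (κ - v) := by
    intro v hv
    have := hκ.of_side (K := K) ⟨by linarith [hu.1], by linarith [hu.2]⟩ hv
    simpa using this
  -- Common part of the two orientations: in the half `false` the chord parameter decreases with
  -- `u`, so the lines `n` and `n + 1` bound the gap in the opposite order.
  have hgap : ∀ a a', (K : ℝ) + 1 / 4 ≤ a → a < u → u < a' → a' ≤ K + 3 / 4 →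
      (∃ j : ℕ, F.chord b a = j) → (∃ j : ℕ, F.chord b a' = j) →
      (∀ v ∈ Ioo a a', (n : ℝ) < F.chord b v ∧ F.chord b v < n + 1) →
      ∃ R : Set ℝ, u ∈ R ∧ IsDiskComponent (Q.lineSet ∪ Q.chordSet) (Q.faceSet b R) := by
    intro a a' h1 h2 h3 h4 h5 h6 h7
    refine ⟨_, Or.inl ⟨h2, h3⟩, Λ.isOpenDisk_strip Q (K := K) (a := a) (a' := a') (κ := κ)
      (by linarith) (h2.trans h3) (by linarith) h5 h6 ?_ ?_⟩
    · intro v hv j hj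
      have := h7 v hv
      rw [hj] at this
      have h8 : n < j := by exact_mod_cast this.1
      have h9 : j < n + 1 := by exact_mod_cast this.2
      omega
    · exact fun v hv => hside v ⟨by linarith [hv.1], by linarith [hv.2]⟩
  have hbn : F.chord b (F.bdry b n) = n := F.chord_bdry b _
  have hbn' : F.chord b (F.bdry b (n + 1)) = n + 1 := F.chord_bdry b _
  have hbn'' : ∃ j : ℕ, F.chord b (F.bdry b (n + 1)) = j := ⟨n + 1, by rw [hbn']; push_cast; rfl⟩
  rcases chord_monotone_or (F := F) b with hmono | hanti
  · refine hgap (F.bdry b n) (F.bdry b (n + 1)) ?_ ?_ ?_ ?_ ⟨n, hbn⟩ hbn'' ?_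
    · rw [← hmono.le_iff_le, hbn, hc1]
      exact hnat (by rw [← hc1]; exact hmono hu.1)
    · rw [← hmono.lt_iff_lt, hbn]
      exact hn1
    · rw [← hmono.lt_iff_lt, hbn']
      exact hn2
    · rw [← hmono.le_iff_le, hbn', hc2]
      exact hnat' (by rw [← hc2]; exact hmono hu.2)
    · intro v hv
      have h1 := hmono hv.1
      have h2 := hmono hv.2
      rw [hbn] at h1
      rw [hbn'] at h2
      exact ⟨h1, h2⟩
  · refine hgap (F.bdry b (n + 1)) (F.bdry b n) ?_ ?_ ?_ ?_ hbn'' ⟨n, hbn⟩ ?_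
    · rw [← hanti.le_iff_ge, hbn', hc1]
      exact hnat' (by rw [← hc1]; exact hanti hu.1)
    · rw [← hanti.lt_iff_gt, hbn']
      exact hn2
    · rw [← hanti.lt_iff_gt, hbn]
      exact hn1
    · rw [← hanti.le_iff_ge, hbn, hc2]
      exact hnat (by rw [← hc2]; exact hanti hu.2)
    · intro v hv
      have h1 := hanti hv.1
      have h2 := hanti hv.2
      rw [hbn'] at h1
      rw [hbn] at h2
      exact ⟨h2, h1⟩

end Lines

end Frame

/-! ### The star of the vertex -/

/-- The corners of a half in the order in which they occur around the vertex. -/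
def cornerAt (k : ℕ) : ℕ := if k % 4 = 0 then k else 4 * (k / 4) + (4 - k % 4)

theorem cornerAt_cornerAt (k : ℕ) : cornerAt (cornerAt k) = k := by
  unfold cornerAt
  split_ifs <;> omega

theorem cornerAt_injective : Function.Injective cornerAt :=
  Function.LeftInverse.injective cornerAt_cornerAt

theorem cornerAt_le {k m : ℕ} (h : k ≤ 4 * m) : cornerAt k ≤ 4 * m := by
  unfold cornerAt
  split_ifs <;> omega

theorem cornerAt_mid {k m : ℕ} (h0 : 0 < k) (h : k < 4 * m) :
    0 < cornerAt k ∧ cornerAt k < 4 * m := by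
  unfold cornerAt
  split_ifs <;> omega

theorem cornerAt_zero : cornerAt 0 = 0 := rfl

theorem cornerAt_end (m : ℕ) : cornerAt (4 * m) = 4 * m := by
  unfold cornerAt
  rw [if_pos (by omega)]

theorem cornerAt_special {m : ℕ} (hm : 0 < m) : cornerAt (4 * m - 1) = 4 * m - 3 := by
  unfold cornerAt
  rw [if_neg (by omega)]
  omega

/-- Crossing the side after one corner leads into the side before the next corner around the vertex.
In each handle the order is `0, 3, 2, 1, 4`. -/
theorem partner_corner {m k : ℕ} (hk : k < 4 * m) {s : ℝ} (hs : s ∈ Icc (0 : ℝ) 1) :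
    Partner m (cornerAt k + s) (cornerAt (k + 1) - s) := by
  obtain ⟨j, r, hr, rfl⟩ : ∃ j r, r < 4 ∧ k = 4 * j + r := ⟨k / 4, k % 4, by omega, by omega⟩
  have hj : j < m := by omega
  have hc : ∀ n c : ℕ, cornerAt n = c → (cornerAt n : ℝ) = c := fun n c h => by rw [h]
  obtain rfl | rfl | rfl | rfl : r = 0 ∨ r = 1 ∨ r = 2 ∨ r = 3 := by omega
  · rw [hc (4 * j + 0) (4 * j) (by unfold cornerAt; split_ifs <;> omega),
      hc (4 * j + 0 + 1) (4 * j + 3) (by unfold cornerAt; split_ifs <;> omega)]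
    push_cast
    exact ⟨j, hj, 0, by omega, Or.inl (by push_cast; constructor <;> linarith [hs.1, hs.2]),
      by push_cast; ring⟩
  · rw [hc (4 * j + 1) (4 * j + 3) (by unfold cornerAt; split_ifs <;> omega),
      hc (4 * j + 1 + 1) (4 * j + 2) (by unfold cornerAt; split_ifs <;> omega)]
    push_cast
    exact ⟨j, hj, 1, by omega, Or.inr (by push_cast; constructor <;> linarith [hs.1, hs.2]),
      by push_cast; ring⟩
  · rw [hc (4 * j + 2) (4 * j + 2) (by unfold cornerAt; split_ifs <;> omega),
      hc (4 * j + 2 + 1) (4 * j + 1) (by unfold cornerAt; split_ifs <;> omega)]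
    push_cast
    exact ⟨j, hj, 0, by omega, Or.inr (by push_cast; constructor <;> linarith [hs.1, hs.2]),
      by push_cast; ring⟩
  · rw [hc (4 * j + 3) (4 * j + 1) (by unfold cornerAt; split_ifs <;> omega),
      hc (4 * j + 3 + 1) (4 * j + 4) (by unfold cornerAt; split_ifs <;> omega)]
    push_cast
    exact ⟨j, hj, 1, by omega, Or.inl (by push_cast; constructor <;> linarith [hs.1, hs.2]),
      by push_cast; ring⟩

/-- The horizontal coordinate along the boundary of a half square. -/
def fanX (φ : ℝ) : ℝ := max (-1 / 4) (min (1 / 4) (φ - 1 / 2))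

/-- The vertical coordinate along the boundary of a half square. -/
def fanY (φ : ℝ) : ℝ := min 1 (min (4 * φ) (4 - 4 * φ))

theorem fan_cases {φ : ℝ} (hφ : φ ∈ Icc (0 : ℝ) 1) :
    (φ ≤ 1 / 4 ∧ fanX φ = -1 / 4 ∧ fanY φ = 4 * φ) ∨
    (1 / 4 ≤ φ ∧ φ ≤ 3 / 4 ∧ fanX φ = φ - 1 / 2 ∧ fanY φ = 1) ∨
    (3 / 4 ≤ φ ∧ fanX φ = 1 / 4 ∧ fanY φ = 4 - 4 * φ) := by
  obtain ⟨h0, h1⟩ := hφ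
  unfold fanX fanY
  rcases le_total φ (1 / 4) with h | h
  · left
    refine ⟨h, ?_, ?_⟩
    · rw [min_eq_right (by linarith), max_eq_left (by linarith)]
    · rw [min_eq_left (a := 4 * φ) (by linarith), min_eq_right (by linarith)]
  · rcases le_total φ (3 / 4) with h' | h'
    · refine Or.inr (Or.inl ⟨h, h', ?_, ?_⟩)
      · rw [min_eq_right (by linarith), max_eq_right (by linarith)]
      · rw [min_eq_left]
        exact le_min (by linarith) (by linarith)
    · refine Or.inr (Or.inr ⟨h', ?_, ?_⟩)
      · rw [min_eq_left (by linarith), max_eq_right (by norm_num)]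
      · rw [min_eq_right (a := 4 * φ) (by linarith), min_eq_right (by linarith)]

theorem fanX_mem (φ : ℝ) : fanX φ ∈ Icc (-1 / 4 : ℝ) (1 / 4) :=
  ⟨le_max_left _ _, max_le (by norm_num) (min_le_left _ _)⟩

theorem fanY_mem {φ : ℝ} (hφ : φ ∈ Icc (0 : ℝ) 1) : fanY φ ∈ Icc (0 : ℝ) 1 :=
  ⟨le_min zero_le_one (le_min (by linarith [hφ.1]) (by linarith [hφ.2])), min_le_left _ _⟩

theorem fan_max {φ : ℝ} (hφ : φ ∈ Icc (0 : ℝ) 1) : max (4 * |fanX φ|) (fanY φ) = 1 := by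
  rcases fan_cases hφ with ⟨h1, h2, h3⟩ | ⟨h1, h2, h3, h4⟩ | ⟨h1, h2, h3⟩
  · rw [h2, h3, max_eq_left] <;> rw [show |(-1 / 4 : ℝ)| = 1 / 4 by norm_num [abs_of_nonneg]]
    · norm_num
    · linarith
  · rw [h3, h4, max_eq_right]
    have : |φ - 1 / 2| ≤ 1 / 4 := abs_le.2 ⟨by linarith, by linarith⟩
    linarith
  · rw [h2, h3, max_eq_left] <;> rw [show |(1 / 4 : ℝ)| = 1 / 4 by norm_num [abs_of_nonneg]]
    · norm_num
    · linarith

/-- The radius is recovered as the maximum of `4 |x|` and `y`, which is `1` along the boundary of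
the half square. -/
theorem fan_inj {φ φ' ρ ρ' : ℝ} (hφ : φ ∈ Icc (0 : ℝ) 1) (hφ' : φ' ∈ Icc (0 : ℝ) 1)
    (hρ : 0 < ρ) (hρ' : 0 < ρ') (hX : ρ * fanX φ = ρ' * fanX φ') (hY : ρ * fanY φ = ρ' * fanY φ') :
    φ = φ' ∧ ρ = ρ' := by
  have key : ∀ {φ ρ : ℝ}, φ ∈ Icc (0 : ℝ) 1 → 0 < ρ →
      max (4 * |ρ * fanX φ|) (ρ * fanY φ) = ρ := by
    intro φ ρ hφ hρ
    rw [abs_mul, abs_of_pos hρ, show 4 * (ρ * |fanX φ|) = ρ * (4 * |fanX φ|) by ring,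
      ← mul_max_of_nonneg _ _ hρ.le, fan_max hφ, mul_one]
  have h1 := key hφ hρ
  rw [hX, hY, key hφ' hρ'] at h1
  subst h1
  have hX' := mul_left_cancel₀ hρ.ne' hX
  have hY' := mul_left_cancel₀ hρ.ne' hY
  refine ⟨?_, rfl⟩
  rcases fan_cases hφ with ⟨h1, h2, h3⟩ | ⟨h1, h2, h3, h4⟩ | ⟨h1, h2, h3⟩ <;>
  rcases fan_cases hφ' with ⟨h1', h2', h3'⟩ | ⟨h1', h2', h3', h4'⟩ | ⟨h1', h2', h3'⟩ <;> linarith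

theorem fan_surj {x y : ℝ} (hx : |x| < 1 / 4) (hy : y ∈ Ico (0 : ℝ) 1) (h : x ≠ 0 ∨ y ≠ 0) :
    ∃ φ ∈ Icc (0 : ℝ) 1, ∃ ρ ∈ Ioo (0 : ℝ) 1, ρ * fanX φ = x ∧ ρ * fanY φ = y := by
  -- The ray through the point leaves the half square either through its top or through one of its
  -- vertical sides; the angle is solved for in each case.
  rcases le_total (4 * |x|) y with h1 | h1
  · have hy0 : 0 < y := by
      refine lt_of_le_of_ne hy.1 fun h0 => ?_
      rcases h with h | h
      · have := abs_pos.2 h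
        linarith
      · exact h h0.symm
    obtain ⟨h2, h3⟩ := abs_le.1 (show |x| ≤ y / 4 by linarith)
    have h4 : -(1 / 4) ≤ x / y := by rw [le_div_iff₀ hy0]; linarith
    have h5 : x / y ≤ 1 / 4 := by rw [div_le_iff₀ hy0]; linarith
    have hφ : 1 / 2 + x / y ∈ Icc (0 : ℝ) 1 := ⟨by linarith, by linarith⟩
    refine ⟨1 / 2 + x / y, hφ, y, ⟨hy0, hy.2⟩, ?_, ?_⟩
    · have : fanX (1 / 2 + x / y) = x / y := by
        unfold fanX
        rw [min_eq_right (by linarith), max_eq_right (by linarith)]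
        ring
      rw [this]
      field_simp
    · have : fanY (1 / 2 + x / y) = 1 := by
        unfold fanY
        rw [min_eq_left]
        exact le_min (by linarith) (by linarith)
      rw [this, mul_one]
  · have hx0 : x ≠ 0 := by
      rintro rfl
      rw [abs_zero, mul_zero] at h1
      rcases h with h | h
      · exact h rfl
      · exact h (le_antisymm h1 hy.1)
    have hρ0 : 0 < 4 * |x| := by have := abs_pos.2 hx0; linarith
    have hr0 : 0 ≤ y / (4 * |x|) := div_nonneg hy.1 hρ0.le
    have hr1 : y / (4 * |x|) ≤ 1 := (div_le_one hρ0).2 h1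
    rcases lt_or_gt_of_ne hx0 with hneg | hpos
    · have hφ : y / (4 * |x|) / 4 ∈ Icc (0 : ℝ) 1 := ⟨by linarith, by linarith⟩
      refine ⟨y / (4 * |x|) / 4, hφ, 4 * |x|, ⟨hρ0, by linarith⟩, ?_, ?_⟩
      · have : fanX (y / (4 * |x|) / 4) = -1 / 4 := by
          unfold fanX
          rw [min_eq_right (by linarith), max_eq_left (by linarith)]
        rw [this, abs_of_neg hneg]
        ring
      · have : fanY (y / (4 * |x|) / 4) = y / (4 * |x|) := by
          unfold fanY
          rw [min_eq_left (a := 4 * (y / (4 * |x|) / 4)) (by linarith), min_eq_right (by linarith)]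
          ring
        rw [this]
        field_simp
    · have hφ : 1 - y / (4 * |x|) / 4 ∈ Icc (0 : ℝ) 1 := ⟨by linarith, by linarith⟩
      refine ⟨1 - y / (4 * |x|) / 4, hφ, 4 * |x|, ⟨hρ0, by linarith⟩, ?_, ?_⟩
      · have : fanX (1 - y / (4 * |x|) / 4) = 1 / 4 := by
          unfold fanX
          rw [min_eq_left (by linarith), max_eq_right (by norm_num)]
        rw [this, abs_of_pos hpos]
        ring
      · have : fanY (1 - y / (4 * |x|) / 4) = y / (4 * |x|) := by
          unfold fanY
          rw [min_eq_right (a := 4 * (1 - y / (4 * |x|) / 4)) (by linarith),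
            min_eq_right (by linarith)]
          ring
        rw [this]
        field_simp

/-- The coordinates of the points of the `k`-th sector around the vertex. -/
def fanPt (m k : ℕ) (φ ρ : ℝ) : ℝ × ℝ :=
  if k = 0 then (ρ / 4, φ) else if k = 4 * m then (4 * m - ρ / 4, 1 - φ)
  else (cornerAt k + ρ * fanX φ, 1 - ρ * fanY φ)

theorem continuous_fanPt (m k : ℕ) : Continuous fun x : ℝ × ℝ => fanPt m k x.1 x.2 := by
  unfold fanPt fanX fanY
  split_ifs <;> fun_prop

theorem fanPt_one {m k : ℕ} (hk : k < 4 * m) (ρ : ℝ) :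
    fanPt m k 1 ρ = (cornerAt k + ρ / 4, 1) := by
  unfold fanPt
  split_ifs with h h'
  · subst h
    simp [cornerAt_zero]
  · omega
  · rcases fan_cases (φ := 1) (by simp) with h | h | h
    · norm_num at h
    · norm_num at h
    · rw [h.2.1, h.2.2]
      norm_num
      ring

theorem fanPt_zero {m k : ℕ} (hk0 : 0 < k) (ρ : ℝ) :
    fanPt m k 0 ρ = (cornerAt k - ρ / 4, 1) := by
  unfold fanPt
  split_ifs with h h'
  · omega
  · subst h'
    simp [cornerAt_end]
  · rcases fan_cases (φ := 0) (by simp) with h | h | h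
    · rw [h.2.1, h.2.2]
      norm_num
      ring
    · norm_num at h
    · norm_num at h

/-- Facts on the points of the open sectors. -/
theorem fanPt_mem {m k : ℕ} (hm : 0 < m) (hk : k ≤ 4 * m) {φ ρ : ℝ} (hφ : φ ∈ Icc (0 : ℝ) 1)
    (hρ : ρ ∈ Ioo (0 : ℝ) 1) (h0 : k = 0 → 0 < φ) (h1 : k = 4 * m → φ < 1) :
    (fanPt m k φ ρ).1 ∈ Ioo (0 : ℝ) (4 * m) ∧ |(fanPt m k φ ρ).1 - cornerAt k| < 1 / 4 ∧
      (fanPt m k φ ρ).2 ∈ Ioc (0 : ℝ) 1 ∧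
      ((fanPt m k φ ρ).2 < 1 ∨ (fanPt m k φ ρ).1 ≠ cornerAt k) := by
  have hm1 : (1 : ℝ) ≤ m := by exact_mod_cast hm
  obtain ⟨hρ0, hρ1⟩ := hρ
  unfold fanPt
  split_ifs with h h'
  · subst h
    rw [cornerAt_zero]
    refine ⟨⟨by dsimp only; linarith, by dsimp only; linarith⟩, ?_, ⟨h0 rfl, hφ.2⟩, Or.inr ?_⟩
    · rw [abs_lt]
      constructor <;> norm_num <;> linarith
    · norm_num
      exact hρ0.ne'
  · subst h'
    rw [cornerAt_end]
    refine ⟨⟨by dsimp only; linarith, by dsimp only; linarith⟩, ?_,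
      ⟨by dsimp only; linarith [h1 rfl], by dsimp only; linarith [hφ.1]⟩, Or.inr ?_⟩
    · rw [abs_lt]
      constructor <;> norm_num <;> linarith
    · push_cast
      intro hcon
      linarith
  · obtain ⟨hc0, hcm⟩ := cornerAt_mid (Nat.pos_of_ne_zero h) (lt_of_le_of_ne hk h')
    have hc0r : (1 : ℝ) ≤ cornerAt k := by exact_mod_cast hc0
    have hcmr : (cornerAt k : ℝ) + 1 ≤ 4 * m := by exact_mod_cast hcm
    obtain ⟨hX0, hX1⟩ := fanX_mem φ
    obtain ⟨hY0, hY1⟩ := fanY_mem hφ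
    have hb1 : -1 / 4 < ρ * fanX φ := by nlinarith
    have hb2 : ρ * fanX φ < 1 / 4 := by nlinarith
    have hb3 : 0 ≤ ρ * fanY φ := by positivity
    have hb4 : ρ * fanY φ < 1 := by nlinarith
    refine ⟨⟨by dsimp only; linarith, by dsimp only; linarith⟩, ?_,
      ⟨by dsimp only; linarith, by dsimp only; linarith⟩, ?_⟩
    · rw [add_sub_cancel_left, abs_lt]
      constructor <;> linarith
    · dsimp only
      rcases fan_cases hφ with h | h | h
      · right
        rw [h.2.1]
        intro hcon
        linarith
      · left
        rw [h.2.2.2]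
        linarith
      · right
        rw [h.2.1]
        intro hcon
        linarith

theorem fanPt_inj {m k : ℕ} {φ φ' ρ ρ' : ℝ} (hφ : φ ∈ Icc (0 : ℝ) 1)
    (hφ' : φ' ∈ Icc (0 : ℝ) 1) (hρ : 0 < ρ) (hρ' : 0 < ρ')
    (h : fanPt m k φ ρ = fanPt m k φ' ρ') : φ = φ' ∧ ρ = ρ' := by
  unfold fanPt at h
  split_ifs at h with h1 h2
  · obtain ⟨h3, h4⟩ := Prod.ext_iff.1 h
    dsimp only at h3 h4
    exact ⟨h4, by linarith⟩
  · obtain ⟨h3, h4⟩ := Prod.ext_iff.1 h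
    dsimp only at h3 h4
    exact ⟨by linarith, by linarith⟩
  · obtain ⟨h3, h4⟩ := Prod.ext_iff.1 h
    dsimp only at h3 h4
    exact fan_inj hφ hφ' hρ hρ' (by linarith) (by linarith)

theorem fanPt_surj {m k : ℕ} (hm : 0 < m) (hk : k ≤ 4 * m) {u t : ℝ} (hu : u ∈ Ioo (0 : ℝ) (4 * m))
    (huk : |u - cornerAt k| < 1 / 4) (ht : t ∈ Ioc (0 : ℝ) 1) (h : t < 1 ∨ u ≠ cornerAt k) :
    ∃ φ ∈ Icc (0 : ℝ) 1, ∃ ρ ∈ Ioo (0 : ℝ) 1, (k = 0 → 0 < φ) ∧ (k = 4 * m → φ < 1) ∧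
      fanPt m k φ ρ = (u, t) := by
  obtain ⟨h1, h2⟩ := abs_lt.1 huk
  unfold fanPt
  by_cases hk0 : k = 0
  · subst hk0
    rw [cornerAt_zero] at h1 h2
    norm_num at h1 h2
    refine ⟨t, ⟨ht.1.le, ht.2⟩, 4 * u, ⟨by linarith [hu.1], by linarith⟩, fun _ => ht.1,
      fun h => by omega, ?_⟩
    rw [if_pos rfl]
    exact Prod.ext (by dsimp only; ring) rfl
  · by_cases hk4 : k = 4 * m
    · subst hk4
      rw [cornerAt_end] at h1 h2
      push_cast at h1 h2
      refine ⟨1 - t, ⟨by linarith [ht.2], by linarith [ht.1]⟩, 4 * (4 * m - u),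
        ⟨by linarith [hu.2], by linarith⟩, fun h => by omega, fun _ => by linarith [ht.1], ?_⟩
      rw [if_neg hk0, if_pos rfl]
      exact Prod.ext (by dsimp only; ring) (by dsimp only; ring)
    · obtain ⟨φ, hφ, ρ, hρ, hX, hY⟩ := fan_surj (x := u - cornerAt k) (y := 1 - t) huk
        ⟨by linarith [ht.2], by linarith [ht.1]⟩ (by
          rcases h with h | h
          · exact Or.inr (by linarith [h] : (1 - t) > 0).ne'
          · exact Or.inl (sub_ne_zero.2 h))
      refine ⟨φ, hφ, ρ, hρ, fun h => absurd h hk0, fun h => absurd h hk4, ?_⟩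
      rw [if_neg hk0, if_neg hk4, hX, hY]
      exact Prod.ext (by dsimp only; ring) (by dsimp only; ring)

/-- The line through the corner `4m - 3` is the ray at angle `1/2` of the sector with index `4m -
1`. It cuts the fan at total angle `4m - 1/2`. -/
theorem fanPt_special {m : ℕ} (hm : 0 < m) {φ ρ : ℝ} (hφ : φ ∈ Icc (0 : ℝ) 1)
    (hρ : 0 < ρ) : (φ < 1 / 2 ↔ (fanPt m (4 * m - 1) φ ρ).1 < 4 * m - 3) ∧
      (1 / 2 < φ ↔ 4 * m - 3 < (fanPt m (4 * m - 1) φ ρ).1) := by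
  unfold fanPt
  rw [if_neg (by omega), if_neg (by omega), cornerAt_special hm, Nat.cast_sub (by omega)]
  push_cast
  have h0 : fanX φ < 0 ↔ φ < 1 / 2 := by
    rcases fan_cases hφ with ⟨h1, h2, h3⟩ | ⟨h1, h2, h3, h4⟩ | ⟨h1, h2, h3⟩
    · rw [h2]; constructor <;> intro <;> linarith
    · rw [h3]; constructor <;> intro <;> linarith
    · rw [h2]; constructor <;> intro <;> linarith
  have h1 : 0 < fanX φ ↔ 1 / 2 < φ := by
    rcases fan_cases hφ with ⟨h1, h2, h3⟩ | ⟨h1, h2, h3, h4⟩ | ⟨h1, h2, h3⟩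
    · rw [h2]; constructor <;> intro <;> linarith
    · rw [h3]; constructor <;> intro <;> linarith
    · rw [h2]; constructor <;> intro <;> linarith
  have h2 : ρ * fanX φ < 0 ↔ fanX φ < 0 := by
    rw [← not_le, ← not_le, mul_nonneg_iff_of_pos_left hρ]
  rw [← h0, ← h1, ← mul_pos_iff_of_pos_left hρ (b := fanX φ), ← h2]
  constructor <;> constructor <;> intro <;> linarith

/-! ### The fan of sectors around the vertex on the surface -/

namespace Frame

variable {F : Frame}

namespace Chart

variable (Q : F.Chart) (b : Bool)

/-- The polar coordinates around the vertex in the half `b`. -/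
theorem exists_fan : ∃ f : ℝ × ℝ → ClosedSurface F.g,
    ContinuousOn f (Icc 0 (4 * F.m b + 1 : ℝ) ×ˢ Icc 0 1) ∧
    ∀ k ≤ 4 * F.m b, ∀ φ ∈ Icc (0 : ℝ) 1, ∀ ρ ∈ Icc (0 : ℝ) 1,
      f (k + φ, ρ) = Q.q b (fanPt (F.m b) k φ ρ) := by
  obtain ⟨f, hf, hf'⟩ := exists_concat (fun k x => Q.q b (fanPt (F.m b) k x.1 x.2)) (Icc 0 1)
    (4 * F.m b) (fun k _ => ((Q.continuous_q b).comp (continuous_fanPt _ k)).continuousOn) (by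
      intro k hk ρ hρ
      dsimp only
      rw [fanPt_one hk, fanPt_zero (Nat.succ_pos k)]
      have hP := partner_corner hk (s := ρ / 4) ⟨by linarith [hρ.1], by linarith [hρ.2]⟩
      exact (Q.q_eq_iff ⟨hP.mem_Icc, by simp⟩ ⟨hP.symm.mem_Icc, by simp⟩).2
        (Or.inr (Or.inr (Or.inr ⟨rfl, rfl, rfl, hP⟩))))
  exact ⟨f, by exact_mod_cast hf, hf'⟩

end Chart

namespace Lines

variable (Q : F.Chart) {b : Bool}

/-- The coordinates near the corners. -/
def starSet (F : Frame) (b : Bool) : Set ℝ :=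
  {u | u ∈ Ioo 0 (4 * F.m b : ℝ) ∧ ∃ K : ℤ, |u - K| < 1 / 4}

/-- The coordinates near the corners on one side of the line through a corner. -/
def shortSet (F : Frame) (b : Bool) : Set ℝ :=
  Ioo (4 * F.m b - 3 : ℝ) (4 * F.m b - 3 + 1 / 4) ∪ Ioo (4 * F.m b - 1 / 4 : ℝ) (4 * F.m b)

/-- The coordinates near the corners on the other side of the line through a corner. -/
def longSet (F : Frame) (b : Bool) : Set ℝ :=
  starSet F b \ (Icc (4 * F.m b - 3 : ℝ) (4 * F.m b - 3 + 1 / 4) ∪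
    Icc (4 * F.m b - 1 / 4 : ℝ) (4 * F.m b))

theorem one_le_m (F : Frame) (b : Bool) : (1 : ℝ) ≤ F.m b := by exact_mod_cast F.m_pos b

theorem shortSet_subset : shortSet F b ⊆ starSet F b := by
  have hm := one_le_m F b
  rintro u (hu | hu)
  · refine ⟨⟨by linarith [hu.1], by linarith [hu.2]⟩, 4 * F.m b - 3, ?_⟩
    rw [abs_lt]
    push_cast
    constructor <;> linarith [hu.1, hu.2]
  · refine ⟨⟨by linarith [hu.1], by linarith [hu.2]⟩, 4 * F.m b, ?_⟩
    rw [abs_lt]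
    push_cast
    constructor <;> linarith [hu.1, hu.2]

theorem isOpen_starSet : IsOpen (starSet F b) := by
  have : starSet F b = Ioo 0 (4 * F.m b : ℝ) ∩ ⋃ K : ℤ, Metric.ball (K : ℝ) (1 / 4) := by
    ext u
    simp [starSet, Real.dist_eq]
  rw [this]
  exact isOpen_Ioo.inter (isOpen_iUnion fun K => Metric.isOpen_ball)

/-- All lines other than the one at the corner stay at distance at least `1/4` from the integers. -/
theorem starSet_line (Λ : F.Lines) {u : ℝ} (hu : u ∈ starSet F b) {j : ℕ} (hj : F.chord b u = j) :
    u = 4 * F.m b - 3 := by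
  obtain ⟨hu, K, hK⟩ := hu
  have hm := F.chord_mem (b := b) ⟨hu.1.le, hu.2.le⟩
  have hne : ¬ (F.chord b u = 0 ∨ F.chord b u = F.N) := by
    intro h1
    rcases F.chord_eq_end h1 with h | h
    · exact hu.1.ne' h
    · exact hu.2.ne h
  rw [hj] at hm hne
  rw [not_or] at hne
  have h0 : 0 < j := Nat.pos_of_ne_zero fun h => hne.1 (by rw [h]; simp)
  have h1 : j < F.N := lt_of_le_of_ne (by exact_mod_cast hm.2) fun h => hne.2 (by rw [h])
  have hbu : F.bdry b j = u := by rw [← hj, F.bdry_chord]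
  rcases Λ.quarter b j h0 h1 with h | ⟨k, h2, h3⟩
  · rw [← hbu, h]
  · rw [hbu] at h2 h3
    obtain ⟨h4, h5⟩ := abs_lt.1 hK
    have h6 : (k : ℝ) < K := by linarith
    have h7 : (K : ℝ) < k + 1 := by linarith
    have h6 : k < K := by exact_mod_cast h6
    have h7 : K < k + 1 := by exact_mod_cast h7
    omega

theorem starSet_partner {u u' : ℝ} (hu : u ∈ starSet F b) (hn : ∀ k : ℤ, u ≠ k)
    (h : Partner (F.m b) u u') : u' ∈ starSet F b := by
  have hm' := h.symm.mem_Icc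
  have hn' := h.not_int hn
  refine ⟨⟨lt_of_le_of_ne hm'.1 fun h => hn' 0 (by simp [← h]), lt_of_le_of_ne hm'.2 fun h =>
      hn' (4 * F.m b) (by rw [h]; push_cast; rfl)⟩, ?_⟩
  obtain ⟨-, K, hK⟩ := hu
  obtain ⟨j, -, e, -, -, h2⟩ := h
  refine ⟨8 * j + 2 * e + 3 - K, ?_⟩
  have : u' - ((8 * j + 2 * e + 3 - K : ℤ) : ℝ) = -(u - K) := by push_cast; linarith
  rw [this, abs_neg]
  exact hK

theorem partner_special (F : Frame) (b : Bool) {u : ℝ}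
    (hu : u ∈ Icc (4 * F.m b - 3 : ℝ) (4 * F.m b - 2)) :
    Partner (F.m b) u (8 * F.m b - 3 - u) := by
  have hm := F.m_pos b
  refine ⟨F.m b - 1, by omega, 1, le_rfl, Or.inl ?_, ?_⟩
  · rw [Nat.cast_sub (by omega)]
    push_cast
    constructor <;> linarith [hu.1, hu.2]
  · rw [Nat.cast_sub (by omega)]
    push_cast
    ring

/-- The side after the corner `4m - 3` is glued to the last side, so the right half of that corner
is glued to the neighbourhood of the end `4m` and to nothing else. -/
theorem isRegion_shortSet (Λ : F.Lines) : IsRegion (F := F) b (shortSet F b) := by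
  refine ⟨isOpen_Ioo.union isOpen_Ioo, fun u hu => (shortSet_subset hu).1, ?_, ?_⟩
  · intro u hu j hj
    have h1 := starSet_line Λ (shortSet_subset hu) hj
    have hm := one_le_m F b
    rcases hu with hu | hu
    · exact hu.1.ne' h1
    · linarith [hu.1]
  · intro u hu hn u' h
    rcases hu with hu | hu
    · right
      rw [Partner.eq_of_not_int hn h (partner_special F b ⟨hu.1.le, by linarith [hu.2]⟩)]
      exact ⟨by linarith [hu.2], by linarith [hu.1]⟩
    · left
      have := partner_special F b (u := 8 * F.m b - 3 - u) ⟨by linarith [hu.2], by linarith [hu.1]⟩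
      rw [sub_sub_cancel] at this
      rw [Partner.eq_of_not_int hn h this.symm]
      exact ⟨by linarith [hu.2], by linarith [hu.1]⟩

theorem isRegion_longSet (Λ : F.Lines) : IsRegion (F := F) b (longSet F b) := by
  refine ⟨isOpen_starSet.sdiff (isClosed_Icc.union isClosed_Icc), fun u hu => hu.1.1, ?_, ?_⟩
  · intro u hu j hj
    have h1 := starSet_line Λ hu.1 hj
    exact hu.2 (Or.inl ⟨h1.ge, by linarith⟩)
  · intro u hu hn u' h
    refine ⟨starSet_partner hu.1 hn h, fun hu' => hu.2 ?_⟩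
    have hn' := h.not_int hn
    rcases hu' with hu' | hu'
    · right
      rw [Partner.eq_of_not_int hn' h.symm (partner_special F b ⟨hu'.1, by linarith [hu'.2]⟩)]
      exact ⟨by linarith [hu'.2], by linarith [hu'.1]⟩
    · left
      have := partner_special F b (u := 8 * F.m b - 3 - u')
        ⟨by linarith [hu'.2], by linarith [hu'.1]⟩
      rw [sub_sub_cancel] at this
      rw [Partner.eq_of_not_int hn' h.symm this.symm]
      exact ⟨by linarith [hu'.2], by linarith [hu'.1]⟩

/-- A coordinate near a corner determines its sector. -/
theorem exists_sector {u : ℝ} (hu : u ∈ starSet F b) :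
    ∃ k ≤ 4 * F.m b, |u - cornerAt k| < 1 / 4 := by
  obtain ⟨hu, K, hK⟩ := hu
  obtain ⟨h1, h2⟩ := abs_lt.1 hK
  have h3 : (-1 : ℝ) < K := by linarith [hu.1]
  have h4 : (K : ℝ) < 4 * F.m b + 1 := by linarith [hu.2]
  have h3 : -1 < K := by exact_mod_cast h3
  have h4 : K < 4 * F.m b + 1 := by exact_mod_cast h4
  obtain ⟨n, rfl⟩ := Int.eq_ofNat_of_zero_le (show 0 ≤ K by omega)
  refine ⟨cornerAt n, cornerAt_le (by omega), ?_⟩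
  rw [cornerAt_cornerAt]
  exact_mod_cast hK

theorem sector_unique {u : ℝ} {k k' : ℕ} (h : |u - cornerAt k| < 1 / 4)
    (h' : |u - cornerAt k'| < 1 / 4) : k = k' := by
  obtain ⟨h1, h2⟩ := abs_lt.1 h
  obtain ⟨h3, h4⟩ := abs_lt.1 h'
  apply cornerAt_injective
  have h5 : (cornerAt k : ℝ) < cornerAt k' + 1 := by linarith
  have h6 : (cornerAt k' : ℝ) < cornerAt k + 1 := by linarith
  have h5 : cornerAt k < cornerAt k' + 1 := by exact_mod_cast h5
  have h6 : cornerAt k' < cornerAt k + 1 := by exact_mod_cast h6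
  omega

/-- This translates the two regions into ranges of the total angle `k + φ`: beyond and before the
line through the special corner. -/
theorem sector_of_short {u : ℝ} {k : ℕ} (hk : k ≤ 4 * F.m b) (hu : u ∈ starSet F b)
    (h : |u - cornerAt k| < 1 / 4) :
    (u ∈ shortSet F b ↔ (k = 4 * F.m b ∨ (k = 4 * F.m b - 1 ∧ 4 * F.m b - 3 < u))) ∧
    (u ∈ longSet F b ↔ (k < 4 * F.m b - 1 ∨ (k = 4 * F.m b - 1 ∧ u < 4 * F.m b - 3))) := by
  have hm := F.m_pos b
  have hm1 := one_le_m F b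
  have hc : (cornerAt (4 * F.m b - 1) : ℝ) = 4 * F.m b - 3 := by
    rw [cornerAt_special hm, Nat.cast_sub (by omega)]
    push_cast
    ring
  have hc' : (cornerAt (4 * F.m b) : ℝ) = 4 * F.m b := by
    rw [cornerAt_end]
    push_cast
    ring
  have key1 : u ∈ Icc (4 * F.m b - 3 : ℝ) (4 * F.m b - 3 + 1 / 4) →
      k = 4 * F.m b - 1 ∧ u < 4 * F.m b - 3 + 1 / 4 := by
    rintro ⟨h1, h2⟩
    have h2' : k = 4 * F.m b - 1 ∨ u = 4 * F.m b - 3 + 1 / 4 := by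
      rcases h2.lt_or_eq with h2 | h2
      · left
        refine sector_unique h ?_
        rw [hc, abs_lt]
        constructor <;> linarith
      · exact Or.inr h2
    rcases h2' with h3 | h3
    · subst h3
      rw [hc, abs_lt] at h
      exact ⟨rfl, by linarith [h.2]⟩
    · exfalso
      obtain ⟨-, K, hK⟩ := hu
      rw [h3, abs_lt] at hK
      have e1 : (4 * F.m b - 3 : ℝ) < K := by linarith [hK.2]
      have e2 : (K : ℝ) < 4 * F.m b - 3 + 1 := by linarith [hK.1]
      have e1 : (4 * F.m b - 3 : ℤ) < K := by exact_mod_cast e1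
      have e2 : K < (4 * F.m b - 3 + 1 : ℤ) := by exact_mod_cast e2
      omega
  have key2 : u ∈ Icc (4 * F.m b - 1 / 4 : ℝ) (4 * F.m b) →
      k = 4 * F.m b ∧ 4 * F.m b - 1 / 4 < u := by
    rintro ⟨h1, h2⟩
    have h1' : k = 4 * F.m b ∨ u = 4 * F.m b - 1 / 4 := by
      rcases h1.lt_or_eq with h1 | h1
      · left
        refine sector_unique h ?_
        rw [hc', abs_lt]
        constructor <;> linarith
      · exact Or.inr h1.symm
    rcases h1' with h3 | h3
    · subst h3
      rw [hc', abs_lt] at h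
      exact ⟨rfl, by linarith [h.1]⟩
    · exfalso
      obtain ⟨-, K, hK⟩ := hu
      rw [h3, abs_lt] at hK
      have e1 : (4 * F.m b - 1 : ℝ) < K := by linarith [hK.2]
      have e2 : (K : ℝ) < 4 * F.m b := by linarith [hK.1]
      have e1 : (4 * F.m b - 1 : ℤ) < K := by exact_mod_cast e1
      have e2 : K < (4 * F.m b : ℤ) := by exact_mod_cast e2
      omega
  constructor
  · constructor
    · rintro (h1 | h1)
      · exact Or.inr ⟨(key1 ⟨h1.1.le, h1.2.le⟩).1, h1.1⟩
      · exact Or.inl (key2 ⟨h1.1.le, h1.2.le⟩).1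
    · rintro (rfl | ⟨rfl, h1⟩)
      · right
        rw [hc', abs_lt] at h
        exact ⟨by linarith [h.1], hu.1.2⟩
      · left
        rw [hc, abs_lt] at h
        exact ⟨h1, by linarith [h.2]⟩
  · constructor
    · rintro ⟨-, h1⟩
      by_contra hcon
      rw [not_or, not_and, not_lt, not_lt] at hcon
      apply h1
      have : k = 4 * F.m b ∨ k = 4 * F.m b - 1 := by omega
      rcases this with rfl | rfl
      · right
        rw [hc', abs_lt] at h
        exact ⟨by linarith [h.1], hu.1.2.le⟩
      · left
        rw [hc, abs_lt] at h
        exact ⟨hcon.2 rfl, by linarith [h.2]⟩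
    · intro h1
      refine ⟨hu, ?_⟩
      rintro (h2 | h2)
      · obtain ⟨rfl, -⟩ := key1 h2
        rcases h1 with h1 | h1
        · omega
        · linarith [h2.1, h1.2]
      · obtain ⟨rfl, -⟩ := key2 h2
        rcases h1 with h1 | h1
        · omega
        · omega

/-- The two complementary disks around the vertex in one half. -/
theorem isOpenDisk_fan (Λ : F.Lines) {R : Set ℝ} (hR : R = longSet F b ∨ R = shortSet F b) :
    IsDiskComponent (Q.lineSet ∪ Q.chordSet) (Q.faceSet b R) := by
  obtain ⟨f, hf, hf'⟩ := Q.exists_fan b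
  have hm := F.m_pos b
  have hm1 := one_le_m F b
  have hreg : IsRegion (F := F) b R := by
    rcases hR with rfl | rfl
    · exact isRegion_longSet Λ
    · exact isRegion_shortSet Λ
  -- the sector of an angle
  have hcut : ∀ θ ∈ Ico 0 (4 * F.m b + 1 : ℝ), ∃ k ≤ 4 * F.m b, ∃ φ ∈ Ico (0 : ℝ) 1, θ = k + φ := by
    intro θ hθ
    have h1 := Nat.floor_le hθ.1
    have h2 := Nat.lt_floor_add_one θ
    refine ⟨⌊θ⌋₊, ?_, θ - ⌊θ⌋₊, ⟨by linarith, by linarith⟩, by ring⟩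
    have h3 : ((⌊θ⌋₊ : ℕ) : ℝ) < 4 * F.m b + 1 := by linarith [hθ.2]
    have h3 : ⌊θ⌋₊ < 4 * F.m b + 1 := by exact_mod_cast h3
    omega
  have hI : ∀ {x : ℝ}, x ∈ Ico (0 : ℝ) 1 → x ∈ Icc (0 : ℝ) 1 := fun h => ⟨h.1, h.2.le⟩
  have hO : ∀ {x : ℝ}, x ∈ Ioo (0 : ℝ) 1 → x ∈ Icc (0 : ℝ) 1 := fun h => ⟨h.1.le, h.2.le⟩
  -- properties of points with angle in the open range
  have hmem : ∀ {k : ℕ} {φ ρ : ℝ}, k ≤ 4 * F.m b → φ ∈ Icc (0 : ℝ) 1 → ρ ∈ Ioo (0 : ℝ) 1 →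
      (k = 0 → 0 < φ) → (k = 4 * F.m b → φ < 1) →
      fanPt (F.m b) k φ ρ ∈ F.dom b ∧ ¬ F.IsVertex b (fanPt (F.m b) k φ ρ) ∧
        ((fanPt (F.m b) k φ ρ).2 < 1 ∨ ∀ i : ℤ, (fanPt (F.m b) k φ ρ).1 ≠ i) := by
    intro k φ ρ hk hφ hρ h0 h1
    obtain ⟨e1, e2, e3, e4⟩ := fanPt_mem hm hk hφ hρ h0 h1
    have h5 : (fanPt (F.m b) k φ ρ).2 < 1 ∨ ∀ i : ℤ, (fanPt (F.m b) k φ ρ).1 ≠ i := by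
      rcases e4 with h | h
      · exact Or.inl h
      · right
        intro i hi
        rw [hi] at e2 h
        obtain ⟨h6, h7⟩ := abs_lt.1 e2
        have h6 : ((cornerAt k : ℤ) : ℝ) < i + 1 := by push_cast; linarith
        have h7 : (i : ℝ) < ((cornerAt k : ℤ) : ℝ) + 1 := by push_cast; linarith
        have h6 : (cornerAt k : ℤ) < i + 1 := by exact_mod_cast h6
        have h7 : i < (cornerAt k : ℤ) + 1 := by exact_mod_cast h7
        apply h
        have : i = cornerAt k := by omega
        rw [this]
        push_cast
        rfl
    exact ⟨⟨⟨e1.1.le, e1.2.le⟩, e3.1.le, e3.2⟩, not_isVertex e1 h5, h5⟩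
  have hinj : InjOn f (Ioo 0 (4 * F.m b + 1 : ℝ) ×ˢ Ioo 0 1) := by
    rintro ⟨θ, ρ⟩ ⟨hθ, hρ⟩ ⟨θ', ρ'⟩ ⟨hθ', hρ'⟩ heq
    dsimp only at hθ hρ hθ' hρ'
    obtain ⟨k, hk, φ, hφ, rfl⟩ := hcut θ ⟨hθ.1.le, hθ.2⟩
    obtain ⟨k', hk', φ', hφ', rfl⟩ := hcut θ' ⟨hθ'.1.le, hθ'.2⟩
    rw [hf' k hk φ (hI hφ) ρ (hO hρ), hf' k' hk' φ' (hI hφ') ρ' (hO hρ')] at heq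
    have c0 : k = 0 → 0 < φ := by rintro rfl; simpa using hθ.1
    have c0' : k' = 0 → 0 < φ' := by rintro rfl; simpa using hθ'.1
    obtain ⟨d1, d2, d3⟩ := hmem hk (hI hφ) hρ c0 (fun _ => hφ.2)
    obtain ⟨d1', d2', d3'⟩ := hmem hk' (hI hφ') hρ' c0' (fun _ => hφ'.2)
    obtain ⟨e1, e2, e3, e4⟩ := fanPt_mem hm hk (hI hφ) hρ c0 (fun _ => hφ.2)
    obtain ⟨e1', e2', e3', e4'⟩ := fanPt_mem hm hk' (hI hφ') hρ' c0' (fun _ => hφ'.2)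
    rcases (Q.q_eq_iff d1 d1').1 heq with h | h | h | h
    · have hP := h.2
      rw [← hP] at e2'
      obtain rfl := sector_unique e2 e2'
      obtain ⟨rfl, rfl⟩ := fanPt_inj (hI hφ) (hI hφ') hρ.1 hρ'.1 hP
      rfl
    · exact absurd h.1 e3.1.ne'
    · exact absurd h.1 d2
    · exfalso
      obtain ⟨-, h1, h2, h3⟩ := h
      -- With half-open sectors, a point on a side always lies just before its corner. Two such
      -- coordinates have a non-integral sum, whereas partners have an integral one.
      have key : ∀ {k : ℕ} {φ ρ : ℝ}, k ≤ 4 * F.m b → φ ∈ Ico (0 : ℝ) 1 → ρ ∈ Ioo (0 : ℝ) 1 →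
          (fanPt (F.m b) k φ ρ).2 = 1 → (fanPt (F.m b) k φ ρ).1 = cornerAt k - ρ / 4 := by
        intro k φ ρ hk hφ hρ h
        have hk0 : 0 < k := by
          refine Nat.pos_of_ne_zero fun h0 => ?_
          rw [fanPt, if_pos h0] at h
          exact hφ.2.ne h
        have hφ0 : φ = 0 := by
          rw [fanPt, if_neg hk0.ne'] at h
          split_ifs at h with h4
          · dsimp only at h
            linarith
          · dsimp only at h
            have h5 : fanY φ = 0 := by
              have : ρ * fanY φ = 0 := by linarith
              exact (mul_eq_zero.1 this).resolve_left hρ.1.ne'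
            rcases fan_cases (hI hφ) with h6 | h6 | h6
            · linarith [h6.2.2]
            · linarith [h6.2.2.2]
            · linarith [h6.2.2, hφ.2]
        rw [hφ0, fanPt_zero hk0]
      rw [key hk hφ hρ h1, key hk' hφ' hρ' h2] at h3
      obtain ⟨j, -, e, -, -, h4⟩ := h3
      have h5 : ((cornerAt k + cornerAt k' : ℤ) : ℝ) < ((8 * j + 2 * e + 3 + 1 : ℤ) : ℝ) := by
        push_cast
        linarith [hρ.2, hρ'.2]
      have h6 : ((8 * j + 2 * e + 3 : ℤ) : ℝ) < ((cornerAt k + cornerAt k' : ℤ) : ℝ) := by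
        push_cast
        linarith [hρ.1, hρ'.1]
      have h5 : (cornerAt k + cornerAt k' : ℤ) < (8 * j + 2 * e + 3 + 1 : ℤ) := by exact_mod_cast h5
      have h6 : (8 * j + 2 * e + 3 : ℤ) < (cornerAt k + cornerAt k' : ℤ) := by exact_mod_cast h6
      omega
  have hchord : ∀ {u : ℝ}, u ∈ Icc 0 (4 * F.m b : ℝ) → Q.q b (u, 0) ∈ Q.chordSet := fun {u} hu =>
    ⟨b, u, ⟨hu, by simp⟩, rfl⟩
  have hquart : ∀ c : ℕ, (c < 4 * F.m b → ∃ j : ℕ, F.chord b (c + 1 / 4) = j) ∧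
      (0 < c → c ≤ 4 * F.m b → ∃ j : ℕ, F.chord b (c - 1 / 4) = j) := by
    intro c
    constructor
    · intro hc
      obtain ⟨⟨j, -, -, hj⟩, -⟩ := Λ.exists_quarter b c (by omega) (by omega)
      exact ⟨j, by rw [show (c : ℝ) + 1 / 4 = ((c : ℤ) : ℝ) + 1 / 4 by push_cast; rfl, ← hj,
        F.chord_bdry]⟩
    · intro h0 hc
      obtain ⟨-, j, -, -, hj⟩ := Λ.exists_quarter b (c - 1) (by omega) (by omega)
      exact ⟨j, by rw [show (c : ℝ) - 1 / 4 = ((c - 1 : ℤ) : ℝ) + 3 / 4 by push_cast; ring, ← hj,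
        F.chord_bdry]⟩
  -- boundary behaviour
  have hbd0 : ∀ θ ∈ Icc 0 (4 * F.m b + 1 : ℝ), ∀ ρ ∈ Icc (0 : ℝ) 1,
      (ρ = 0 ∨ ρ = 1 ∨ θ = 0 ∨ θ = 4 * F.m b - 1 / 2 ∨ θ = 4 * F.m b + 1) →
      f (θ, ρ) ∈ Q.lineSet ∪ Q.chordSet := by
    intro θ hθ ρ hρ h
    obtain ⟨k, hk, φ, hφ, rfl⟩ : ∃ k ≤ 4 * F.m b, ∃ φ ∈ Icc (0 : ℝ) 1, θ = k + φ := by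
      rcases hθ.2.lt_or_eq with h1 | h1
      · obtain ⟨k, hk, φ, hφ, h2⟩ := hcut θ ⟨hθ.1, h1⟩
        exact ⟨k, hk, φ, hI hφ, h2⟩
      · exact ⟨4 * F.m b, le_rfl, 1, by simp, by rw [h1]; push_cast; rfl⟩
    rw [hf' k hk φ hφ ρ hρ]
    have hkr : (k : ℝ) ≤ 4 * F.m b := by exact_mod_cast hk
    by_cases hk0 : k = 0
    · subst hk0
      rw [fanPt, if_pos rfl]
      have hd : ((ρ / 4, φ) : ℝ × ℝ) ∈ F.dom b :=
        ⟨⟨by dsimp only; linarith [hρ.1], by dsimp only; linarith [hρ.2]⟩, hφ⟩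
      rcases h with h | h | h | h | h
      · subst h
        exact Or.inl (Λ.mem_lineSet Q hd (Or.inl (Or.inl (by simp))))
      · subst h
        obtain ⟨j, hj⟩ := (hquart 0).1 (by omega)
        exact Or.inl (Λ.mem_lineSet Q hd (Or.inr ⟨j, by rw [← hj]; norm_num⟩))
      · right
        have : φ = 0 := by simpa using h
        subst this
        exact hchord hd.1
      · exfalso
        push_cast at h
        linarith [hφ.2]
      · exfalso
        push_cast at h
        linarith [hφ.2]
    by_cases hk4 : k = 4 * F.m b
    · subst hk4
      rw [fanPt, if_neg hk0, if_pos rfl]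
      have hd : ((4 * F.m b - ρ / 4, 1 - φ) : ℝ × ℝ) ∈ F.dom b :=
        ⟨⟨by dsimp only; linarith [hρ.2], by dsimp only; linarith [hρ.1]⟩,
          by dsimp only; linarith [hφ.2], by dsimp only; linarith [hφ.1]⟩
      push_cast at h
      rcases h with h | h | h | h | h
      · subst h
        exact Or.inl (Λ.mem_lineSet Q hd (Or.inl (Or.inr (Or.inl (by simp)))))
      · subst h
        obtain ⟨j, hj⟩ := (hquart (4 * F.m b)).2 (by omega) le_rfl
        exact Or.inl (Λ.mem_lineSet Q hd (Or.inr ⟨j, by rw [← hj]; push_cast; rfl⟩))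
      · exfalso
        linarith [hφ.1]
      · exfalso
        linarith [hφ.1]
      · right
        have : φ = 1 := by linarith
        subst this
        rw [sub_self]
        exact hchord hd.1
    have hcm := cornerAt_mid (Nat.pos_of_ne_zero hk0) (lt_of_le_of_ne hk hk4)
    have hc0r : (1 : ℝ) ≤ cornerAt k := by exact_mod_cast hcm.1
    have hcmr : (cornerAt k : ℝ) + 1 ≤ 4 * F.m b := by exact_mod_cast hcm.2
    have hk0r : (1 : ℝ) ≤ k := by exact_mod_cast Nat.pos_of_ne_zero hk0
    have hk4r : (k : ℝ) + 1 ≤ 4 * F.m b := by exact_mod_cast lt_of_le_of_ne hk hk4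
    rw [fanPt, if_neg hk0, if_neg hk4]
    obtain ⟨hX0, hX1⟩ := fanX_mem φ
    obtain ⟨hY0, hY1⟩ := fanY_mem hφ
    have hb1 : -1 / 4 ≤ ρ * fanX φ := by nlinarith [hρ.1, hρ.2]
    have hb2 : ρ * fanX φ ≤ 1 / 4 := by nlinarith [hρ.1, hρ.2]
    have hb3 : 0 ≤ ρ * fanY φ := mul_nonneg hρ.1 hY0
    have hb4 : ρ * fanY φ ≤ 1 := by nlinarith [hρ.1, hρ.2]
    have hd : ((cornerAt k + ρ * fanX φ, 1 - ρ * fanY φ) : ℝ × ℝ) ∈ F.dom b :=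
      ⟨⟨by dsimp only; linarith, by dsimp only; linarith⟩, by dsimp only; linarith,
        by dsimp only; linarith⟩
    rcases h with h | h | h | h | h
    · subst h
      refine Or.inl (Λ.mem_lineSet Q hd (Or.inl (Or.inr (Or.inr ⟨by simp, cornerAt k, ?_⟩))))
      push_cast
      ring
    · subst h
      rcases fan_cases hφ with h1 | h1 | h1
      · obtain ⟨j, hj⟩ := (hquart (cornerAt k)).2 hcm.1 hcm.2.le
        refine Or.inl (Λ.mem_lineSet Q hd (Or.inr ⟨j, ?_⟩))
        rw [← hj, h1.2.1]
        congr 1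
        ring
      · right
        rw [h1.2.2.2] at hd ⊢
        norm_num
        exact hchord (by simpa using hd.1)
      · obtain ⟨j, hj⟩ := (hquart (cornerAt k)).1 hcm.2
        refine Or.inl (Λ.mem_lineSet Q hd (Or.inr ⟨j, ?_⟩))
        rw [← hj, h1.2.1]
        congr 1
        ring
    · exfalso
      linarith [hφ.1]
    · left
      -- The common edge of the long and the short rectangle is the line through the corner.
      have hks : k = 4 * F.m b - 1 ∧ φ = 1 / 2 := by
        have h1 : (k : ℝ) < ((4 * F.m b : ℕ) : ℝ) := by push_cast; linarith [hφ.1]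
        have h2 : ((4 * F.m b : ℕ) : ℝ) < ((k + 2 : ℕ) : ℝ) := by push_cast; linarith [hφ.2]
        have h1 : k < 4 * F.m b := by exact_mod_cast h1
        have h2 : 4 * F.m b < k + 2 := by exact_mod_cast h2
        have h3 : k = 4 * F.m b - 1 := by omega
        refine ⟨h3, ?_⟩
        have h4 : (k : ℝ) = 4 * F.m b - 1 := by
          rw [h3, Nat.cast_sub (by omega)]
          push_cast
          ring
        linarith
      obtain ⟨j, -, -, hj⟩ := Λ.exists_corner b
      refine Λ.mem_lineSet Q hd (Or.inr ⟨j, ?_⟩)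
      have hX : fanX φ = 0 := by
        rw [hks.2, fanX]
        norm_num
      rw [hX, hks.1, cornerAt_special hm, Nat.cast_sub (by omega)]
      push_cast
      rw [mul_zero, add_zero, ← hj, F.chord_bdry]
    · exfalso
      linarith [hφ.2]
  -- the image
  have himg : ∀ θ₀ θ₁ : ℝ, 0 ≤ θ₀ → θ₁ ≤ 4 * F.m b + 1 → R ⊆ starSet F b →
      (∀ k ≤ 4 * F.m b, ∀ φ ∈ Icc (0 : ℝ) 1, ∀ ρ ∈ Ioo (0 : ℝ) 1, (k = 0 → 0 < φ) →
        (k = 4 * F.m b → φ < 1) →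
        (fanPt (F.m b) k φ ρ).1 ∈ starSet F b → |(fanPt (F.m b) k φ ρ).1 - cornerAt k| < 1 / 4 →
        ((k + φ : ℝ) ∈ Ioo θ₀ θ₁ ↔ (fanPt (F.m b) k φ ρ).1 ∈ R)) →
      f '' (Ioo θ₀ θ₁ ×ˢ Ioo 0 1) = Q.faceSet b R := by
    intro θ₀ θ₁ h0 h1 hRs hiff
    ext y
    constructor
    · rintro ⟨⟨θ, ρ⟩, ⟨hθ, hρ⟩, rfl⟩
      dsimp only at hθ hρ
      obtain ⟨k, hk, φ, hφ, rfl⟩ := hcut θ ⟨h0.trans hθ.1.le, hθ.2.trans_le h1⟩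
      rw [hf' k hk φ (hI hφ) ρ (hO hρ)]
      have c0 : k = 0 → 0 < φ := by
        rintro rfl
        have := h0.trans_lt hθ.1
        simpa using this
      obtain ⟨d1, d2, d3⟩ := hmem hk (hI hφ) hρ c0 (fun _ => hφ.2)
      obtain ⟨e1, e2, e3, e4⟩ := fanPt_mem hm hk (hI hφ) hρ c0 (fun _ => hφ.2)
      exact ⟨_, (hiff k hk φ (hI hφ) ρ hρ c0 (fun _ => hφ.2) ⟨e1, cornerAt k, by exact_mod_cast e2⟩
        e2).1 hθ, _, e3, d3, rfl⟩
    · rintro ⟨u, hu, t, ht, h, rfl⟩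
      obtain ⟨k, hk, huk⟩ := exists_sector (hRs hu)
      obtain ⟨φ, hφ, ρ, hρ, c0, c1, e⟩ := fanPt_surj hm hk (hRs hu).1 huk ht (by
        rcases h with h | h
        · exact Or.inl h
        · exact Or.inr fun h1 => h (cornerAt k) (by rw [h1]; push_cast; rfl))
      have hθ := (hiff k hk φ hφ ρ hρ c0 c1 (by rw [e]; exact hRs hu) (by rw [e]; exact huk)).2
        (by rw [e]; exact hu)
      exact ⟨(k + φ, ρ), ⟨hθ, hρ⟩, by rw [hf' k hk φ hφ ρ (hO hρ), e]⟩
  have hhalf : ∀ {k : ℕ}, k ≤ 4 * F.m b → k = 4 * F.m b ∨ k = 4 * F.m b - 1 ∨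
      k + 2 ≤ 4 * F.m b := by omega
  have hspr : ((4 * F.m b - 1 : ℕ) : ℝ) = 4 * F.m b - 1 := by
    rw [Nat.cast_sub (by omega)]
    push_cast
    ring
  rcases hR with rfl | rfl
  · refine Λ.isOpenDisk_faceSet Q hreg (x₀ := 0) (x₁ := 4 * F.m b - 1 / 2) (y₀ := 0) (y₁ := 1)
      (by linarith) one_pos (hf.mono (prod_mono (Icc_subset_Icc le_rfl (by linarith)) subset_rfl))
      (hinj.mono (prod_mono (Ioo_subset_Ioo le_rfl (by linarith)) subset_rfl)) ?_
      (himg _ _ le_rfl (by linarith) (fun u hu => hu.1) ?_)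
    · rintro ⟨θ, ρ⟩ ⟨hθ, hρ⟩ hnot
      dsimp only at hθ hρ
      refine hbd0 θ ⟨hθ.1, by linarith [hθ.2]⟩ ρ hρ ?_
      by_contra hcon
      simp only [not_or] at hcon
      exact hnot ⟨⟨lt_of_le_of_ne hθ.1 (Ne.symm hcon.2.2.1), lt_of_le_of_ne hθ.2 hcon.2.2.2.1⟩,
        lt_of_le_of_ne hρ.1 (Ne.symm hcon.1), lt_of_le_of_ne hρ.2 hcon.2.1⟩
    · intro k hk φ hφ ρ hρ c0 c1 hst hab
      rw [(sector_of_short hk hst hab).2]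
      rcases hhalf hk with rfl | rfl | h
      · push_cast
        constructor
        · intro h1
          linarith [h1.2, hφ.1]
        · intro h1
          omega
      · rw [hspr]
        have := (fanPt_special hm hφ hρ.1).1
        constructor
        · intro h1
          exact Or.inr ⟨rfl, this.1 (by linarith [h1.2])⟩
        · rintro (h1 | h1)
          · omega
          · have h2 := this.2 h1.2
            exact ⟨by linarith [hφ.1], by linarith⟩
      · have hr : (k : ℝ) + 2 ≤ 4 * F.m b := by exact_mod_cast h
        have hk0 : (0 : ℝ) ≤ k := by positivity
        constructor
        · intro h1
          left
          omega
        · intro h1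
          refine ⟨?_, by linarith [hφ.2]⟩
          rcases Nat.eq_zero_or_pos k with h2 | h2
          · have := c0 h2
            linarith
          · have : (0 : ℝ) < k := by exact_mod_cast h2
            linarith [hφ.1]
  · refine Λ.isOpenDisk_faceSet Q hreg (x₀ := 4 * F.m b - 1 / 2) (x₁ := 4 * F.m b + 1) (y₀ := 0)
      (y₁ := 1) (by linarith) one_pos
      (hf.mono (prod_mono (Icc_subset_Icc (by linarith) le_rfl) subset_rfl))
      (hinj.mono (prod_mono (Ioo_subset_Ioo (by linarith) le_rfl) subset_rfl)) ?_
      (himg _ _ (by linarith) le_rfl shortSet_subset ?_)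
    · rintro ⟨θ, ρ⟩ ⟨hθ, hρ⟩ hnot
      dsimp only at hθ hρ
      refine hbd0 θ ⟨by linarith [hθ.1], hθ.2⟩ ρ hρ ?_
      by_contra hcon
      simp only [not_or] at hcon
      exact hnot ⟨⟨lt_of_le_of_ne hθ.1 (Ne.symm hcon.2.2.2.1), lt_of_le_of_ne hθ.2 hcon.2.2.2.2⟩,
        lt_of_le_of_ne hρ.1 (Ne.symm hcon.1), lt_of_le_of_ne hρ.2 hcon.2.1⟩
    · intro k hk φ hφ ρ hρ c0 c1 hst hab
      rw [(sector_of_short hk hst hab).1]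
      rcases hhalf hk with rfl | rfl | h
      · push_cast
        constructor
        · intro h1
          exact Or.inl rfl
        · intro h1
          exact ⟨by linarith [hφ.1], by linarith [c1 rfl]⟩
      · rw [hspr]
        have := (fanPt_special hm hφ hρ.1).2
        constructor
        · intro h1
          exact Or.inr ⟨rfl, this.1 (by linarith [h1.1])⟩
        · rintro (h1 | h1)
          · omega
          · have h2 := this.2 h1.2
            exact ⟨by linarith, by linarith [hφ.2]⟩
      · have hr : (k : ℝ) + 2 ≤ 4 * F.m b := by exact_mod_cast h
        constructor
        · intro h1
          linarith [h1.1, hφ.2]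
        · intro h1
          omega

/-- The complementary components of the two curves are open disks. -/
theorem exists_face (Λ : F.Lines) {y : ClosedSurface F.g} (hy : y ∉ Q.lineSet ∪ Q.chordSet) :
    IsOpen (connectedComponentIn (Q.lineSet ∪ Q.chordSet)ᶜ y) ∧
      IsOpenDisk (connectedComponentIn (Q.lineSet ∪ Q.chordSet)ᶜ y) := by
  obtain ⟨b, ⟨u, t⟩, hp, rfl⟩ := Q.exists_q_eq y
  rw [mem_union, not_or] at hy
  have ht0 : t ≠ 0 := by
    rintro rfl
    exact hy.2 ⟨b, u, hp, rfl⟩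
  have hv : ¬ F.IsVertex b (u, t) := fun h => hy.1 (Λ.mem_lineSet Q hp (Or.inl h))
  have hl : ∀ j : ℕ, F.chord b u ≠ j := fun j h => hy.1 (Λ.mem_lineSet Q hp (Or.inr ⟨j, h⟩))
  have hu : u ∈ Ioo 0 (4 * F.m b : ℝ) := by
    refine ⟨lt_of_le_of_ne hp.1.1 fun h => hv (Or.inl h.symm),
      lt_of_le_of_ne hp.1.2 fun h => hv (Or.inr (Or.inl h))⟩
  have ht : t ∈ Ioc (0 : ℝ) 1 := ⟨lt_of_le_of_ne hp.2.1 (Ne.symm ht0), hp.2.2⟩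
  have hti : t < 1 ∨ ∀ k : ℤ, u ≠ k := by
    rcases hp.2.2.lt_or_eq with h | h
    · exact Or.inl h
    · exact Or.inr fun k hk => hv (Or.inr (Or.inr ⟨h, k, hk⟩))
  have key : ∀ R : Set ℝ, u ∈ R → IsDiskComponent (Q.lineSet ∪ Q.chordSet) (Q.faceSet b R) →
      IsOpen (connectedComponentIn (Q.lineSet ∪ Q.chordSet)ᶜ (Q.q b (u, t))) ∧
      IsOpenDisk (connectedComponentIn (Q.lineSet ∪ Q.chordSet)ᶜ (Q.q b (u, t))) := by
    rintro R hR ⟨h1, h2, h3⟩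
    rw [h3 _ ⟨u, hR, t, ht, hti, rfl⟩]
    exact ⟨h1, h2⟩
  by_cases hst : u ∈ starSet F b
  · by_cases hsh : u ∈ shortSet F b
    · exact key _ hsh (isOpenDisk_fan Q Λ (Or.inr rfl))
    · refine key (longSet F b) ⟨hst, ?_⟩ (isOpenDisk_fan Q Λ (Or.inl rfl))
      obtain ⟨k, hk, huk⟩ := exists_sector hst
      have h1 := sector_of_short hk hst huk
      have hm := F.m_pos b
      rintro h2
      have hlong : u ∉ longSet F b := fun h => h.2 h2
      rw [h1.1] at hsh
      rw [h1.2] at hlong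
      have h3 : u = 4 * F.m b - 3 := by
        have : k = 4 * F.m b - 1 := by omega
        refine le_antisymm ?_ ?_
        · by_contra h4
          exact hsh (Or.inr ⟨this, not_le.1 h4⟩)
        · by_contra h4
          exact hlong (Or.inr ⟨this, not_le.1 h4⟩)
      obtain ⟨j, -, -, hj⟩ := Λ.exists_corner b
      exact hl j (by rw [h3, ← hj, F.chord_bdry])
  · have hK0 : 0 ≤ ⌊u⌋ := Int.floor_nonneg.2 hu.1.le
    have hK1 : ⌊u⌋ < 4 * F.m b := by
      have : (⌊u⌋ : ℝ) < 4 * F.m b := (Int.floor_le u).trans_lt hu.2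
      exact_mod_cast this
    have h1 := Int.floor_le u
    have h2 := Int.lt_floor_add_one u
    obtain ⟨⟨j₁, -, -, hj₁⟩, j₂, -, -, hj₂⟩ := Λ.exists_quarter b ⌊u⌋ hK0 hK1
    have hlo : (⌊u⌋ : ℝ) + 1 / 4 < u := by
      refine lt_of_le_of_ne ?_ fun h => hl j₁ (by rw [← h, ← hj₁, F.chord_bdry])
      by_contra h
      exact hst ⟨hu, ⌊u⌋, by rw [abs_lt]; constructor <;> linarith⟩
    have hhi : u < (⌊u⌋ : ℝ) + 3 / 4 := by
      refine lt_of_le_of_ne ?_ fun h => hl j₂ (by rw [h, ← hj₂, F.chord_bdry])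
      by_contra h
      exact hst ⟨hu, ⌊u⌋ + 1, by rw [abs_lt]; push_cast; constructor <;> linarith⟩
    obtain ⟨R, hR, h3⟩ := exists_strip Q Λ hK0 hK1 ⟨hlo, hhi⟩ hl
    exact key R hR h3

end Lines

end Frame

/-! ### Curves on the punctured surface -/

section Transfer

variable {g p : ℕ}

/-- A curve on the closed surface that avoids the punctures. -/
def restrictCurve (V : ClosedCurve (ClosedSurface g)) (h : ∀ t, V t ∉ punctures g p) :
    ClosedCurve (Surface g p) := ⟨fun t => ⟨V t, h t⟩, by fun_prop⟩

theorem range_restrictCurve {V : ClosedCurve (ClosedSurface g)} (h : ∀ t, V t ∉ punctures g p) :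
    range (restrictCurve V h) = Subtype.val ⁻¹' range V := by
  ext x
  constructor
  · rintro ⟨t, rfl⟩
    exact ⟨t, rfl⟩
  · rintro ⟨t, ht⟩
    exact ⟨t, Subtype.ext ht⟩

/-- A closed curve in an open disk is homotopically trivial. -/
theorem nullhomotopic_of_isOpenDisk {X : Type} [TopologicalSpace X] {W : Set X} (hW : IsOpenDisk W)
    {c : ClosedCurve X} (hc : ∀ t, c t ∈ W) : ContinuousMap.Nullhomotopic c := by
  obtain ⟨e⟩ := hW
  have e' : W ≃ₜ ℂ := e.trans Homeomorph.unitBall.symm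
  have : ContractibleSpace W := e'.contractibleSpace
  let c' : C(Circle, W) := ⟨fun t => ⟨c t, hc t⟩, by fun_prop⟩
  have h1 : c'.Nullhomotopic := by
    have h2 := (id_nullhomotopic W).comp_left c'
    simpa using h2
  exact h1.comp_right ⟨Subtype.val, continuous_subtype_val⟩

/-- A peripheral curve can be pushed into a disk around the puncture, and there it contracts once
the puncture is filled in. Both ways of being inessential thus make the curve null-homotopic in the
closed surface. -/
theorem isEssential_restrictCurve {V : ClosedCurve (ClosedSurface g)}
    (h : ∀ t, V t ∉ punctures g p) (hV : ¬ ContinuousMap.Nullhomotopic V)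
    (hP : ∀ z ∈ punctures g p, ∃ W ∈ 𝓝 z, IsOpenDisk W) : IsEssential (restrictCurve V h) := by
  let i : C(Surface g p, ClosedSurface g) := ⟨Subtype.val, continuous_subtype_val⟩
  constructor
  · intro hn
    exact hV (hn.comp_right i)
  · rintro ⟨z, hz, hz'⟩
    obtain ⟨W, hW, hWd⟩ := hP z hz
    obtain ⟨c, hc, hcW⟩ := hz' W hW
    obtain ⟨y, hy⟩ := nullhomotopic_of_isOpenDisk hWd (c := i.comp c) hcW
    exact hV ⟨y, ((ContinuousMap.Homotopic.refl i).comp hc).trans hy⟩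

/-- A separation of the closed surface by two closed sets restricts to the punctured one, provided
each side has a witness that is not a puncture. -/
theorem isSeparating_restrictCurve {V : ClosedCurve (ClosedSurface g)}
    (h : ∀ t, V t ∉ punctures g p) {C D : Set (ClosedSurface g)} (hC : IsClosed C)
    (hD : IsClosed D) (hCD : C ∪ D = univ) (hV : C ∩ D ⊆ range V) {y z : ClosedSurface g}
    (hy : y ∈ C \ range V) (hy' : y ∉ punctures g p) (hz : z ∈ D \ range V)
    (hz' : z ∉ punctures g p) : IsSeparating (restrictCurve V h) := by
  intro hpre
  rw [isPreconnected_closed_iff] at hpre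
  obtain ⟨x, hx, hxC, hxD⟩ := hpre (Subtype.val ⁻¹' C) (Subtype.val ⁻¹' D)
    (hC.preimage continuous_subtype_val) (hD.preimage continuous_subtype_val)
    (fun x _ => by
      have : (x : ClosedSurface g) ∈ C ∪ D := by rw [hCD]; trivial
      exact this)
    ⟨⟨y, hy'⟩, by rw [range_restrictCurve]; exact hy.2, hy.1⟩
    ⟨⟨z, hz'⟩, by rw [range_restrictCurve]; exact hz.2, hz.1⟩
  rw [range_restrictCurve] at hx
  exact hx (hV ⟨hxC, hxD⟩)

theorem isPreconnected_diff_singleton {X : Type} [TopologicalSpace X] {W : Set X}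
    (hW : IsOpenDisk W) {z : X} (hz : z ∈ W) : IsPreconnected (W \ {z}) := by
  obtain ⟨e⟩ := hW
  let e' : W ≃ₜ ℂ := e.trans Homeomorph.unitBall.symm
  have h1 : IsPreconnected ({e' ⟨z, hz⟩}ᶜ : Set ℂ) :=
    (isConnected_compl_singleton_of_one_lt_rank
      (by rw [Complex.rank_real_complex]; exact Nat.one_lt_ofNat) _).isPreconnected
  have h2 := h1.image (fun x => (e'.symm x : X)) (by fun_prop)
  convert h2 using 1
  ext y
  constructor
  · rintro ⟨hy, hyz⟩
    refine ⟨e' ⟨y, hy⟩, ?_, by simp⟩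
    intro h3
    have := congr_arg Subtype.val (e'.injective h3)
    exact hyz this
  · rintro ⟨x, hx, rfl⟩
    refine ⟨(e'.symm x).2, fun h3 => hx ?_⟩
    rw [mem_singleton_iff] at h3 ⊢
    have h4 : e'.symm x = ⟨z, hz⟩ := Subtype.ext h3
    rw [← h4, Homeomorph.apply_symm_apply]

/-- An open disk stays connected when a point is removed, so removing the only possible puncture
does not split the component: it loses at most that point. -/
theorem component_restrict {A : Set (ClosedSurface g)} {z₀ : ClosedSurface g}
    (hP : punctures g p ⊆ {z₀}) (x : Surface g p) (hx : (x : ClosedSurface g) ∉ A)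
    (hd : IsOpenDisk (connectedComponentIn Aᶜ (x : ClosedSurface g))) :
    IsOpenDisk (connectedComponentIn (Subtype.val ⁻¹' A)ᶜ x) ∨
      IsOncePuncturedDisk (connectedComponentIn (Subtype.val ⁻¹' A)ᶜ x) := by
  set W := connectedComponentIn Aᶜ (x : ClosedSurface g) with hW
  set C := connectedComponentIn (Subtype.val ⁻¹' A)ᶜ x with hC
  have hxC : x ∈ C := mem_connectedComponentIn hx
  have hemb : IsEmbedding (Subtype.val : Surface g p → ClosedSurface g) := IsEmbedding.subtypeVal
  have hCW : Subtype.val '' C = W \ punctures g p := by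
    apply Subset.antisymm
    · rintro _ ⟨y, hy, rfl⟩
      refine ⟨?_, y.2⟩
      have h1 : IsPreconnected (Subtype.val '' C) :=
        isPreconnected_connectedComponentIn.image _ continuous_subtype_val.continuousOn
      refine h1.subset_connectedComponentIn ⟨x, hxC, rfl⟩ ?_ ⟨y, hy, rfl⟩
      rintro _ ⟨w, hw, rfl⟩
      have h2 := connectedComponentIn_subset _ _ hw
      exact h2
    · have h1 : IsPreconnected (W \ punctures g p) := by
        by_cases h : ∃ z ∈ punctures g p, z ∈ W
        · obtain ⟨z, hz, hzW⟩ := h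
          have : punctures g p = {z} := by
            have h2 : z = z₀ := hP hz
            rw [← h2] at hP
            exact Subset.antisymm hP (singleton_subset_iff.2 hz)
          rw [this]
          exact isPreconnected_diff_singleton hd hzW
        · push Not at h
          have : W \ punctures g p = W := by
            rw [sdiff_eq_left, disjoint_left]
            exact fun z hz hz' => h z hz' hz
          rw [this]
          exact isPreconnected_connectedComponentIn
      have himg : Subtype.val '' (Subtype.val ⁻¹' W : Set (Surface g p)) = W \ punctures g p := by
        ext y
        constructor
        · rintro ⟨w, hw, rfl⟩
          exact ⟨hw, w.2⟩
        · rintro ⟨h2, h3⟩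
          exact ⟨⟨y, h3⟩, h2, rfl⟩
      rw [← himg] at h1 ⊢
      rw [hemb.isInducing.isPreconnected_image] at h1
      refine image_mono (h1.subset_connectedComponentIn (mem_connectedComponentIn hx) ?_)
      intro w hw
      have h2 := connectedComponentIn_subset _ _ hw
      exact h2
  by_cases h : ∃ z ∈ punctures g p, z ∈ W
  · right
    obtain ⟨z, hz, hzW⟩ := h
    refine ⟨z, hz, ?_⟩
    have : insert z (Subtype.val '' C) = W := by
      rw [hCW]
      ext y
      constructor
      · rintro (rfl | h)
        · exact hzW
        · exact h.1
      · intro hy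
        by_cases hyz : y = z
        · exact Or.inl hyz
        · refine Or.inr ⟨hy, fun hyP => hyz ?_⟩
          have h1 : y = z₀ := hP hyP
          have h2 : z = z₀ := hP hz
          rw [h1, h2]
    change IsOpenDisk (insert z (Subtype.val '' C))
    rw [this]
    exact hd
  · left
    push Not at h
    have : Subtype.val '' C = W := by
      rw [hCW, sdiff_eq_left, disjoint_left]
      exact fun z hz hz' => h z hz' hz
    rw [← this] at hd
    obtain ⟨e⟩ := hd
    exact ⟨(hemb.homeomorphImage C).trans e⟩

end Transfer

/-! ### Assembling the filling pair -/

namespace Frame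

variable {F : Frame}

/-- The lower bound from the Klein bottle and the count of intersection points coincide, which gives
both minimal position and the exact value of the intersection number. -/
theorem exists_filling_pair (Λ : F.Lines) (hm : F.m true = 1) {p : ℕ} (hp : p = 0 ∨ p = 1) :
    ∃ α β : ClosedCurve (Surface F.g p), IsFillingPair α β ∧ IsSeparating α ∧ IsSeparating β ∧
      geomInt α β = F.N := by
  obtain ⟨q, hq1, hq2, hq3, hq4⟩ := F.exists_chart
  let Q : F.Chart := ⟨q, hq1, hq2, fun {b b' p p'} hp hp' => hq3 b b' p hp p' hp'⟩
  obtain ⟨V, hVs, hVp, hVr⟩ := Λ.exists_lineLoop Q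
  obtain ⟨H, hHs, hHp, hHr⟩ := Q.exists_chordLoop
  change range H = Q.chordSet at hHr
  obtain ⟨Φ, hΦ⟩ := Q.exists_height
  obtain ⟨a, ha, ha0, ha1⟩ := Λ.exists_lift Q hΦ hVp
  have hNr : (2 : ℝ) ≤ F.N := by exact_mod_cast Λ.two_le_N
  -- the puncture
  set z₀ : ClosedSurface F.g := Q.q true (1 / 8, 1 / 2) with hz₀
  have hmr : (F.m true : ℝ) = 1 := by rw [hm]; simp
  have hzd : ((1 / 8, 1 / 2) : ℝ × ℝ) ∈ F.dom true := by
    refine ⟨⟨by norm_num, ?_⟩, by norm_num, by norm_num⟩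
    rw [hmr]
    norm_num
  have hzv : ¬ F.IsVertex true (1 / 8, 1 / 2) := by
    rintro (h | h | h)
    · norm_num at h
    · rw [hmr] at h
      norm_num at h
    · norm_num at h
  have hPz : punctures F.g p ⊆ {z₀} := by
    rintro _ ⟨k, rfl⟩
    rcases hp with rfl | rfl
    · exact k.elim0
    · change toSurface F.g (interiorPt 1 k) = q true (1 / 8, 1 / 2)
      rw [← hq4]
      have : interiorPt 1 k = ⟨0, by simp⟩ := by
        apply Subtype.ext
        obtain rfl : k = 0 := Subsingleton.elim _ _
        simp [interiorPt]
      rw [this]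
  -- The possible puncture has height `1/2`, so points of height `1/4` can serve as witnesses for
  -- separation.
  have hne : ∀ b x t, (x, t) ∈ F.dom b → ¬ F.IsVertex b (x, t) → 0 < t → t < 1 / 2 →
      Q.q b (x, t) ∉ punctures F.g p := by
    intro b x t hd hv h0 h1 hmem
    have h := hPz hmem
    rcases (Q.q_eq_iff hd hzd).1 h with h | h | h | h
    · exact h1.ne (Prod.ext_iff.1 h.2).2
    · exact h0.ne' h.1
    · exact hv h.1
    · have := h.2.1
      dsimp only at this
      linarith
  -- The boundary coordinate `1/8` is closer than `1/4` to the corner `0`, and in that range the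
  -- only line would be the one at the corner `1`.
  have hzA : z₀ ∉ Q.lineSet ∪ Q.chordSet := by
    rintro (h | ⟨b, u, hu, h⟩)
    · refine Λ.not_mem_lineSet Q hzd hzv (fun j hj => ?_) h
      have hst : (1 / 8 : ℝ) ∈ Lines.starSet F true := by
        refine ⟨⟨by norm_num, ?_⟩, 0, by rw [abs_lt]; norm_num⟩
        rw [hmr]
        norm_num
      have := Lines.starSet_line Λ hst hj
      rw [hmr] at this
      norm_num at this
    · rcases (Q.q_eq_iff hu hzd).1 h with h | h | h | h
      · have := (Prod.ext_iff.1 h.2).2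
        norm_num at this
      · have := h.2.1
        norm_num at this
      · exact hzv h.2
      · exact zero_ne_one h.2.1
  have hV : ∀ t, V t ∉ punctures F.g p := fun t ht => hzA (Or.inl (by
    rw [← hVr]
    exact ⟨t, hPz ht⟩))
  have hH : ∀ t, H t ∉ punctures F.g p := fun t ht => hzA (Or.inr (by
    rw [← hHr]
    exact ⟨t, hPz ht⟩))
  have hnbhd : ∀ z ∈ punctures F.g p, ∃ W ∈ 𝓝 z, IsOpenDisk W := by
    intro z hz
    obtain rfl : z = z₀ := hPz hz
    obtain ⟨h1, h2⟩ := Lines.exists_face Q Λ hzA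
    exact ⟨_, h1.mem_nhds (mem_connectedComponentIn hzA), h2⟩
  have hVn : ¬ ContinuousMap.Nullhomotopic V := by
    refine not_nullhomotopic_of_lift Φ a ha fun h => ?_
    rw [h, ha0] at ha1
    linarith
  have hHn := Q.not_nullhomotopic_chordLoop hm hHp
  set α := restrictCurve V hV with hα
  set β := restrictCurve H hH with hβ
  have hrα : range α = Subtype.val ⁻¹' Q.lineSet := by rw [hα, range_restrictCurve, hVr]
  have hrβ : range β = Subtype.val ⁻¹' Q.chordSet := by rw [hβ, range_restrictCurve, hHr]
  have hαs : IsSimple α := fun s t h => hVs (congr_arg Subtype.val h)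
  have hβs : IsSimple β := fun s t h => hHs (congr_arg Subtype.val h)
  have hlow : (F.N : ℕ∞) ≤ geomInt α β := by
    refine le_geomInt_of_lift (Φ.comp ⟨Subtype.val, continuous_subtype_val⟩) Λ.even_N ?_ a ha ha0 ha1
    intro x y h hy
    rw [hrβ]
    exact Q.mem_chordSet_of_half_int hΦ h hy
  have hup : geomInt α β ≤ (range α ∩ range β).encard :=
    iInf_le_of_le α (iInf_le_of_le hαs (iInf_le _ (ContinuousMap.Homotopic.refl α)))
  have hcard : (range α ∩ range β).encard ≤ F.N := by
    rw [hrα, hrβ, ← preimage_inter, ← Subtype.val_injective.encard_image]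
    exact (encard_le_encard (image_preimage_subset _ _)).trans Q.encard_lineSet_inter_chordSet
  have hgeom : geomInt α β = F.N := le_antisymm (hup.trans hcard) hlow
  have hdom : ∀ b, ∀ x ∈ Ioo 0 (F.N : ℝ), (F.bdry b x, 1 / 4) ∈ F.dom b ∧
      ¬ F.IsVertex b (F.bdry b x, 1 / 4) := by
    intro b x hx
    refine ⟨⟨F.bdry_mem b ⟨hx.1.le, hx.2.le⟩, by norm_num, by norm_num⟩, ?_⟩
    have := bdry_ne_end (F := F) (b := b) hx.1 hx.2
    rintro (h | h | h)
    · exact this.1 h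
    · exact this.2 h
    · norm_num at h
  have hnp : ∀ b, ∀ x ∈ Ioo 0 (F.N : ℝ), Q.q b (F.bdry b x, 1 / 4) ∉ punctures F.g p :=
    fun b x hx => hne b _ _ (hdom b x hx).1 (hdom b x hx).2 (by norm_num) (by norm_num)
  have hx1 : (1 / 2 : ℝ) ∈ Ioo 0 (F.N : ℝ) := ⟨by norm_num, by linarith⟩
  have hx2 : (3 / 2 : ℝ) ∈ Ioo 0 (F.N : ℝ) := ⟨by norm_num, by linarith⟩
  refine ⟨α, β, ⟨hαs, hβs, isEssential_restrictCurve hV hVn hnbhd,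
    isEssential_restrictCurve hH hHn hnbhd, ?_, ?_⟩, ?_, ?_, hgeom⟩
  · exact le_antisymm (hcard.trans hlow) hup
  · intro x hx
    rw [hrα, hrβ, ← preimage_union] at hx ⊢
    exact component_restrict hPz x hx (Lines.exists_face Q Λ hx).2
  · obtain ⟨C, hC, hC1, hC2, hC3⟩ := Λ.lineSet_separates Q
    obtain ⟨h1, h2⟩ := hC3 (1 / 4) ⟨by norm_num, by norm_num⟩
    rw [← hVr] at hC2 h1 h2
    exact isSeparating_restrictCurve hV (hC true) (hC false) hC1 hC2 h1 (hnp true _ hx1) h2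
      (hnp true _ hx2)
  · obtain ⟨h1, h2, h3, h4⟩ := Q.chordSet_separates
    have hnc : ∀ b, Q.q b (F.bdry b (1 / 2), 1 / 4) ∉ Q.chordSet := by
      rintro b ⟨b', u, hu, h⟩
      rcases (Q.q_eq_iff hu (hdom b _ hx1).1).1 h with h | h | h | h
      · have := (Prod.ext_iff.1 h.2).2
        norm_num at this
      · have := h.2.1
        norm_num at this
      · exact (hdom b _ hx1).2 h.2
      · exact zero_ne_one h.2.1
    rw [← hHr] at h4 hnc
    exact isSeparating_restrictCurve hH h1 h2 h3 h4 ⟨⟨_, (hdom true _ hx1).1, rfl⟩, hnc true⟩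
      (hnp true _ hx1) ⟨⟨_, (hdom false _ hx1).1, rfl⟩, hnc false⟩ (hnp false _ hx1)

end Frame

/-! ### Alternating cycles -/

/-- Two parity reversing involutions that act transitively on `{0, …, N - 1}` traverse all points
alternately. -/
theorem exists_alternating {N : ℕ} (hN : 0 < N) {τ β : ℕ → ℕ}
    (hτ : ∀ j < N, τ j < N ∧ τ (τ j) = j ∧ (Even (τ j) ↔ ¬ Even j))
    (hβ : ∀ j < N, β j < N ∧ β (β j) = j ∧ (Even (β j) ↔ ¬ Even j))
    (htrans : ∀ P : ℕ → Prop, P 0 → (∀ j < N, P j → P (τ j)) → (∀ j < N, P j → P (β j)) →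
      ∀ j < N, P j) :
    ∃ p : ℕ → ℕ, p 0 = 0 ∧ p N = 0 ∧ (∀ k, p k < N) ∧ (∀ k, Even k → p (k + 1) = τ (p k)) ∧
      (∀ k, ¬ Even k → p (k + 1) = β (p k)) ∧ InjOn p (Iio N) := by
  let p : ℕ → ℕ := fun k => Nat.rec 0 (fun k x => if Even k then τ x else β x) k
  have hp0 : p 0 = 0 := rfl
  have hps : ∀ k, p (k + 1) = if Even k then τ (p k) else β (p k) := fun k => rfl
  have hlt : ∀ k, p k < N := by
    intro k
    induction k with
    | zero => exact hN
    | succ k ih =>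
      rw [hps]
      split_ifs
      · exact (hτ _ ih).1
      · exact (hβ _ ih).1
  have hpar : ∀ k, Even (p k) ↔ Even k := by
    intro k
    induction k with
    | zero => simp [hp0]
    | succ k ih =>
      rw [hps, Nat.even_add_one]
      split_ifs
      · rw [(hτ _ (hlt k)).2.2, ih]
      · rw [(hβ _ (hlt k)).2.2, ih]
  have hback : ∀ k, p k = if Even k then τ (p (k + 1)) else β (p (k + 1)) := by
    intro k
    rw [hps]
    split_ifs
    · exact (hτ _ (hlt k)).2.1.symm
    · exact (hβ _ (hlt k)).2.1.symm
  -- Equal points have times of equal parity, so the last steps used the same involution and can be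
  -- undone together, down to time `0`.
  have hdown : ∀ a d, p a = p (a + d) → p d = 0 := by
    intro a
    induction a with
    | zero =>
      intro d h
      rw [zero_add] at h
      rw [← h, hp0]
    | succ a ih =>
      intro d h
      apply ih
      have h1 : Even (a + 1) ↔ Even (a + 1 + d) := by
        rw [← hpar (a + 1), ← hpar (a + 1 + d), h]
      have h2 : Even a ↔ Even (a + d) := by
        rw [show a + 1 + d = a + d + 1 by ring, Nat.even_add_one, Nat.even_add_one] at h1
        tauto
      rw [hback a, hback (a + d), h, show a + 1 + d = a + d + 1 by ring]
      by_cases h3 : Even a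
      · rw [if_pos h3, if_pos (h2.1 h3)]
      · rw [if_neg h3, if_neg fun h4 => h3 (h2.2 h4)]
  have hex : ∃ d, 0 < d ∧ p d = 0 ∧ d ≤ N := by
    obtain ⟨a, ha, b, hb, hne, hab⟩ := Finset.exists_ne_map_eq_of_card_lt_of_maps_to
      (s := Finset.range (N + 1)) (t := Finset.range N) (by simp) (f := p)
      (fun k _ => by simpa using hlt k)
    rw [Finset.mem_range] at ha hb
    rcases lt_or_gt_of_ne hne with h | h
    · exact ⟨b - a, by omega, hdown a _ (by rw [hab]; congr 1; omega), by omega⟩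
    · exact ⟨a - b, by omega, hdown b _ (by rw [← hab]; congr 1; omega), by omega⟩
  obtain ⟨L, hL0, hL, hLN⟩ := hex
  have hLe : Even L := by rw [← hpar, hL]; exact Even.zero
  -- The points visited before the first known return to `0` are closed under both involutions;
  -- transitivity makes them everything, so the return time is at least `N`.
  have hcover : ∀ j < N, ∃ k < L, p k = j := by
    refine htrans _ ⟨0, hL0, hp0⟩ ?_ ?_
    · rintro j hj ⟨k, hk, rfl⟩
      by_cases hke : Even k
      · refine ⟨k + 1, ?_, by rw [hps, if_pos hke]⟩
        rcases (Nat.succ_le_of_lt hk).lt_or_eq with h | h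
        · exact h
        · rw [← h, Nat.succ_eq_add_one, Nat.even_add_one] at hLe
          exact absurd hke hLe
      · obtain ⟨l, rfl⟩ : ∃ l, k = l + 1 := by
          refine ⟨k - 1, ?_⟩
          have : k ≠ 0 := by
            rintro rfl
            exact hke Even.zero
          omega
        rw [Nat.even_add_one, not_not] at hke
        exact ⟨l, by omega, by rw [hback l, if_pos hke]⟩
    · rintro j hj ⟨k, hk, rfl⟩
      by_cases hke : Even k
      · rcases Nat.eq_zero_or_pos k with rfl | h0
        · obtain ⟨l, rfl⟩ : ∃ l, L = l + 1 := ⟨L - 1, by omega⟩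
          have hl : ¬ Even l := by rwa [Nat.even_add_one] at hLe
          exact ⟨l, by omega, by rw [hback l, if_neg hl, hL, hp0]⟩
        · obtain ⟨l, rfl⟩ : ∃ l, k = l + 1 := ⟨k - 1, by omega⟩
          rw [Nat.even_add_one] at hke
          exact ⟨l, by omega, by rw [hback l, if_neg hke]⟩
      · have hk1 : p (k + 1) = β (p k) := by rw [hps, if_neg hke]
        rcases (Nat.succ_le_of_lt hk).lt_or_eq with h | h
        · exact ⟨k + 1, h, hk1⟩
        · refine ⟨0, hL0, ?_⟩
          rw [← hk1, hp0, ← hL, ← h]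
  have hsurj : Set.SurjOn p (Finset.range L : Finset ℕ) (Finset.range N : Finset ℕ) := by
    intro j hj
    obtain ⟨k, hk, h⟩ := hcover j (by simpa using hj)
    exact ⟨k, by simpa using hk, h⟩
  obtain rfl : L = N := le_antisymm hLN (by
    have := Finset.card_le_card_of_surjOn p hsurj
    simpa using this)
  refine ⟨p, hp0, hL, hlt, fun k hk => by rw [hps, if_pos hk], fun k hk => by rw [hps, if_neg hk], ?_⟩
  have := Finset.injOn_of_surjOn_of_card_le p (fun k _ => by simpa using hlt k) hsurj le_rfl
  simpa using this

/-! ### Position and pairing of the lines in one half -/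

/-- The positions of the lines in a half with `t + 1` handles. There are two lines on each side of
the first `t` handles, `n` and `m` lines on the sides of the last handle, and one line at a corner. -/
def linePos (t n m i : ℕ) : ℝ :=
  if i = 0 then 0 else if i ≤ 8 * t then i / 2 - 1 / 4
  else if i < 8 * t + 1 + n then 4 * t + 1 / 4 + ((i : ℝ) - (8 * t + 1)) * (1 / (2 * (n - 1)))
  else if i = 8 * t + n + 1 then 4 * t + 1
  else if i < 8 * t + n + 2 + m then
    4 * t + 5 / 4 + ((i : ℝ) - (8 * t + n + 2)) * (1 / (2 * (m - 1)))
  else if i < 8 * t + 2 * n + 2 + m then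
    4 * t + 9 / 4 + ((i : ℝ) - (8 * t + n + m + 2)) * (1 / (2 * (n - 1)))
  else if i < 8 * t + 2 * n + 2 * m + 2 then
    4 * t + 13 / 4 + ((i : ℝ) - (8 * t + 2 * n + m + 2)) * (1 / (2 * (m - 1)))
  else 4 * t + 4

/-- The index of the line that is glued to the line `i`, where `0` stands for the vertex. -/
def linePair (t n m i : ℕ) : ℕ :=
  if i = 0 then 8 * t + n + 1 else if i = 8 * t + n + 1 then 0
  else if i ≤ 8 * t then
    if (i - 1) % 8 = 0 ∨ (i - 1) % 8 = 1 ∨ (i - 1) % 8 = 4 ∨ (i - 1) % 8 = 5 then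
      8 * ((i - 1) / 8) + 6 - (i - 1) % 8
    else 8 * ((i - 1) / 8) + 10 - (i - 1) % 8
  else if i < 8 * t + 1 + n ∨ (8 * t + n + m + 2 ≤ i ∧ i < 8 * t + 2 * n + m + 2) then
    16 * t + 2 * n + m + 2 - i
  else 16 * t + 3 * n + 2 * m + 3 - i

section Half

variable {t n m : ℕ}

theorem linePos_zero : linePos t n m 0 = 0 := by simp [linePos]

theorem linePos_end : linePos t n m (8 * t + 2 * n + 2 * m + 2) = 4 * t + 4 := by
  unfold linePos
  rw [if_neg (by omega), if_neg (by omega), if_neg (by omega), if_neg (by omega), if_neg (by omega),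
    if_neg (by omega), if_neg (by omega)]

theorem linePos_low {i : ℕ} (h0 : 0 < i) (h : i ≤ 8 * t) :
    linePos t n m i = i / 2 - 1 / 4 := by
  unfold linePos
  rw [if_neg h0.ne', if_pos h]

theorem linePos_fst {k : ℕ} (h : k < n) :
    linePos t n m (8 * t + 1 + k) = 4 * t + 1 / 4 + k * (1 / (2 * (n - 1))) := by
  unfold linePos
  rw [if_neg (by omega), if_neg (by omega), if_pos (by omega)]
  push_cast
  ring

theorem linePos_corner : linePos t n m (8 * t + n + 1) = 4 * t + 1 := by
  unfold linePos
  rw [if_neg (by omega), if_neg (by omega), if_neg (by omega), if_pos rfl]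

theorem linePos_snd {k : ℕ} (h : k < m) :
    linePos t n m (8 * t + n + 2 + k) = 4 * t + 5 / 4 + k * (1 / (2 * (m - 1))) := by
  unfold linePos
  rw [if_neg (by omega), if_neg (by omega), if_neg (by omega), if_neg (by omega), if_pos (by omega)]
  push_cast
  ring

theorem linePos_trd {k : ℕ} (h : k < n) :
    linePos t n m (8 * t + n + m + 2 + k) = 4 * t + 9 / 4 + k * (1 / (2 * (n - 1))) := by
  unfold linePos
  rw [if_neg (by omega), if_neg (by omega), if_neg (by omega), if_neg (by omega), if_neg (by omega),
    if_pos (by omega)]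
  push_cast
  ring

theorem linePos_fth {k : ℕ} (h : k < m) :
    linePos t n m (8 * t + 2 * n + m + 2 + k) = 4 * t + 13 / 4 + k * (1 / (2 * (m - 1))) := by
  unfold linePos
  rw [if_neg (by omega), if_neg (by omega), if_neg (by omega), if_neg (by omega), if_neg (by omega),
    if_neg (by omega), if_pos (by omega)]
  push_cast
  ring

theorem line_cases {i : ℕ} (hN : i < 8 * t + 2 * n + 2 * m + 2) :
    i ≤ 8 * t ∨ (∃ k < n, i = 8 * t + 1 + k) ∨ i = 8 * t + n + 1 ∨
    (∃ k < m, i = 8 * t + n + 2 + k) ∨ (∃ k < n, i = 8 * t + n + m + 2 + k) ∨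
    ∃ k < m, i = 8 * t + 2 * n + m + 2 + k := by
  by_cases h1 : i ≤ 8 * t
  · exact Or.inl h1
  by_cases h2 : i < 8 * t + 1 + n
  · exact Or.inr (Or.inl ⟨i - (8 * t + 1), by omega, by omega⟩)
  by_cases h3 : i = 8 * t + n + 1
  · exact Or.inr (Or.inr (Or.inl h3))
  by_cases h4 : i < 8 * t + n + 2 + m
  · exact Or.inr (Or.inr (Or.inr (Or.inl ⟨i - (8 * t + n + 2), by omega, by omega⟩)))
  by_cases h5 : i < 8 * t + 2 * n + 2 + m
  · exact Or.inr (Or.inr (Or.inr (Or.inr (Or.inl ⟨i - (8 * t + n + m + 2), by omega, by omega⟩))))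
  · exact Or.inr (Or.inr (Or.inr (Or.inr (Or.inr ⟨i - (8 * t + 2 * n + m + 2), by omega, by omega⟩))))

theorem step_pos (hn : 2 ≤ n) : (0 : ℝ) < 1 / (2 * (n - 1)) ∧
    ∀ k : ℕ, k < n → (k : ℝ) * (1 / (2 * (n - 1))) ∈ Icc (0 : ℝ) (1 / 2) := by
  have h1 : (2 : ℝ) ≤ n := by exact_mod_cast hn
  have h2 : (0 : ℝ) < 1 / (2 * (n - 1)) := by
    apply one_div_pos.2
    linarith
  refine ⟨h2, fun k hk => ⟨by positivity, ?_⟩⟩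
  have h3 : (k : ℝ) + 1 ≤ n := by exact_mod_cast hk
  rw [mul_one_div, div_le_div_iff₀ (by linarith) two_pos]
  linarith

theorem step_last (hn : 2 ≤ n) : ((n - 1 : ℕ) : ℝ) * (1 / (2 * (n - 1))) = 1 / 2 := by
  have h1 : (2 : ℝ) ≤ n := by exact_mod_cast hn
  rw [Nat.cast_sub (by omega)]
  have : (n : ℝ) - 1 ≠ 0 := by linarith
  push_cast
  field_simp

/-- Equal spacing between `1/4` and `3/4` is symmetric about the midpoint of the side, so the gluing
matches the `k`-th line on a side with the `k`-th from the end on its partner side. -/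
theorem step_reflect (hn : 2 ≤ n) {k : ℕ} (hk : k < n) :
    (k : ℝ) * (1 / (2 * (n - 1))) + ((n - 1 - k : ℕ) : ℝ) * (1 / (2 * (n - 1))) = 1 / 2 := by
  rw [← step_last hn, ← add_mul, ← Nat.cast_add]
  congr 3
  omega

theorem linePos_lt (hn : 2 ≤ n) (hm : 2 ≤ m) {i : ℕ} (hi : i < 8 * t + 2 * n + 2 * m + 2) :
    linePos t n m i < linePos t n m (i + 1) := by
  obtain ⟨hx, hX⟩ := step_pos hn
  obtain ⟨hy, hY⟩ := step_pos hm
  have hlast : ∀ {n k : ℕ}, 2 ≤ n → k < n → ¬ k + 1 < n → (k : ℝ) * (1 / (2 * (n - 1))) = 1 / 2 := by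
    intro n k hn hk hk'
    obtain rfl : k = n - 1 := by omega
    exact step_last hn
  have ht : (0 : ℝ) ≤ t := by positivity
  rcases Nat.eq_zero_or_pos i with rfl | h0
  · rw [linePos_zero]
    by_cases h : 1 ≤ 8 * t
    · rw [linePos_low (by omega) (by omega)]
      norm_num
    · have := linePos_fst (t := t) (n := n) (m := m) (k := 0) (by omega)
      rw [show 0 + 1 = 8 * t + 1 + 0 by omega, this]
      push_cast
      linarith
  rcases line_cases hi with h | ⟨k, hk, rfl⟩ | rfl | ⟨k, hk, rfl⟩ | ⟨k, hk, rfl⟩ | ⟨k, hk, rfl⟩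
  · rw [linePos_low h0 h]
    by_cases h' : i + 1 ≤ 8 * t
    · rw [linePos_low (by omega) h']
      push_cast
      linarith
    · have := linePos_fst (t := t) (n := n) (m := m) (k := 0) (by omega)
      obtain rfl : i = 8 * t := by omega
      rw [show 8 * t + 1 = 8 * t + 1 + 0 by omega, this]
      push_cast
      linarith
  · rw [linePos_fst hk]
    by_cases h' : k + 1 < n
    · rw [add_assoc (8 * t + 1) k 1, linePos_fst h']
      push_cast
      linarith
    · rw [show 8 * t + 1 + k + 1 = 8 * t + n + 1 by omega, linePos_corner]
      linarith [(hX k hk).2]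
  · have := linePos_snd (t := t) (n := n) (m := m) (k := 0) (by omega)
    rw [linePos_corner, show 8 * t + n + 1 + 1 = 8 * t + n + 2 + 0 by omega, this]
    push_cast
    linarith
  · rw [linePos_snd hk]
    by_cases h' : k + 1 < m
    · rw [add_assoc _ k 1, linePos_snd h']
      push_cast
      linarith
    · have := linePos_trd (t := t) (n := n) (m := m) (k := 0) (by omega)
      rw [show 8 * t + n + 2 + k + 1 = 8 * t + n + m + 2 + 0 by omega, this]
      push_cast
      linarith [(hY k hk).2]
  · rw [linePos_trd hk]
    by_cases h' : k + 1 < n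
    · rw [add_assoc _ k 1, linePos_trd h']
      push_cast
      linarith
    · have := linePos_fth (t := t) (n := n) (m := m) (k := 0) (by omega)
      rw [show 8 * t + n + m + 2 + k + 1 = 8 * t + 2 * n + m + 2 + 0 by omega, this]
      push_cast
      linarith [(hX k hk).2]
  · rw [linePos_fth hk]
    by_cases h' : k + 1 < m
    · rw [add_assoc _ k 1, linePos_fth h']
      push_cast
      linarith
    · rw [show 8 * t + 2 * n + m + 2 + k + 1 = 8 * t + 2 * n + 2 * m + 2 by omega, linePos_end]
      linarith [(hY k hk).2]

theorem linePos_quarter (hn : 2 ≤ n) (hm : 2 ≤ m) {i : ℕ} (h0 : 0 < i)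
    (hi : i < 8 * t + 2 * n + 2 * m + 2) :
    linePos t n m i = 4 * t + 1 ∨
      ∃ k : ℤ, k + 1 / 4 ≤ linePos t n m i ∧ linePos t n m i ≤ k + 3 / 4 := by
  obtain ⟨hx, hX⟩ := step_pos hn
  obtain ⟨hy, hY⟩ := step_pos hm
  rcases line_cases hi with h | ⟨k, hk, rfl⟩ | rfl | ⟨k, hk, rfl⟩ | ⟨k, hk, rfl⟩ | ⟨k, hk, rfl⟩
  · right
    rw [linePos_low h0 h]
    obtain ⟨j, rfl | rfl⟩ : ∃ j, i = 2 * j + 1 ∨ i = 2 * j + 2 := ⟨(i - 1) / 2, by omega⟩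
    · exact ⟨j, by push_cast; linarith, by push_cast; linarith⟩
    · exact ⟨j, by push_cast; linarith, by push_cast; linarith⟩
  · have := hX k hk
    rw [linePos_fst hk]
    exact Or.inr ⟨4 * t, by push_cast; linarith [this.1], by push_cast; linarith [this.2]⟩
  · exact Or.inl linePos_corner
  · have := hY k hk
    rw [linePos_snd hk]
    exact Or.inr ⟨4 * t + 1, by push_cast; linarith [this.1], by push_cast; linarith [this.2]⟩
  · have := hX k hk
    rw [linePos_trd hk]
    exact Or.inr ⟨4 * t + 2, by push_cast; linarith [this.1], by push_cast; linarith [this.2]⟩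
  · have := hY k hk
    rw [linePos_fth hk]
    exact Or.inr ⟨4 * t + 3, by push_cast; linarith [this.1], by push_cast; linarith [this.2]⟩

theorem exists_linePos_quarter (hn : 2 ≤ n) (hm : 2 ≤ m) {k : ℤ} (h0 : 0 ≤ k) (hk : k < 4 * t + 4) :
    (∃ i : ℕ, 0 < i ∧ i < 8 * t + 2 * n + 2 * m + 2 ∧ linePos t n m i = k + 1 / 4) ∧
    ∃ i : ℕ, 0 < i ∧ i < 8 * t + 2 * n + 2 * m + 2 ∧ linePos t n m i = k + 3 / 4 := by
  obtain ⟨k, rfl⟩ := Int.eq_ofNat_of_zero_le h0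
  have hN := step_last hn
  have hM := step_last hm
  by_cases h : k < 4 * t
  · refine ⟨⟨2 * k + 1, by omega, by omega, ?_⟩, 2 * k + 2, by omega, by omega, ?_⟩
    · rw [linePos_low (by omega) (by omega)]
      push_cast
      ring
    · rw [linePos_low (by omega) (by omega)]
      push_cast
      ring
  have hk' : k = 4 * t ∨ k = 4 * t + 1 ∨ k = 4 * t + 2 ∨ k = 4 * t + 3 := by omega
  rcases hk' with rfl | rfl | rfl | rfl
  · refine ⟨⟨8 * t + 1 + 0, by omega, by omega, ?_⟩, 8 * t + 1 + (n - 1), by omega, by omega, ?_⟩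
    · rw [linePos_fst (by omega)]
      push_cast
      ring
    · rw [linePos_fst (by omega), hN]
      push_cast
      ring
  · refine ⟨⟨8 * t + n + 2 + 0, by omega, by omega, ?_⟩, 8 * t + n + 2 + (m - 1), by omega,
      by omega, ?_⟩
    · rw [linePos_snd (by omega)]
      push_cast
      ring
    · rw [linePos_snd (by omega), hM]
      push_cast
      ring
  · refine ⟨⟨8 * t + n + m + 2 + 0, by omega, by omega, ?_⟩, 8 * t + n + m + 2 + (n - 1), by omega,
      by omega, ?_⟩
    · rw [linePos_trd (by omega)]
      push_cast
      ring
    · rw [linePos_trd (by omega), hN]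
      push_cast
      ring
  · refine ⟨⟨8 * t + 2 * n + m + 2 + 0, by omega, by omega, ?_⟩, 8 * t + 2 * n + m + 2 + (m - 1),
      by omega, by omega, ?_⟩
    · rw [linePos_fth (by omega)]
      push_cast
      ring
    · rw [linePos_fth (by omega), hM]
      push_cast
      ring

theorem linePair_lt (hn : 2 ≤ n) (hm : 2 ≤ m) {i : ℕ} (hi : i < 8 * t + 2 * n + 2 * m + 2) :
    linePair t n m i < 8 * t + 2 * n + 2 * m + 2 := by
  unfold linePair
  split_ifs <;> omega

theorem linePair_pos (hn : 2 ≤ n) (hm : 2 ≤ m) {i : ℕ} (hc : i ≠ 8 * t + n + 1)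
    (hi : i < 8 * t + 2 * n + 2 * m + 2) : 0 < linePair t n m i := by
  unfold linePair
  split_ifs <;> omega

theorem linePair_low {s r : ℕ} (hs : s < t) (hr : r < 8) : linePair t n m (8 * s + r + 1) =
    if r = 0 ∨ r = 1 ∨ r = 4 ∨ r = 5 then 8 * s + 6 - r else 8 * s + 10 - r := by
  have e1 : 8 * s + r + 1 - 1 = 8 * s + r := by omega
  have e2 : (8 * s + r) % 8 = r := by omega
  have e3 : (8 * s + r) / 8 = s := by omega
  unfold linePair
  rw [if_neg (by omega), if_neg (by omega), if_pos (by omega), e1, e2, e3]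

theorem linePair_linePair (hn : 2 ≤ n) (hm : 2 ≤ m) {i : ℕ} (hi : i < 8 * t + 2 * n + 2 * m + 2) :
    linePair t n m (linePair t n m i) = i := by
  by_cases h0 : i = 0
  · subst h0
    simp [linePair]
  by_cases hc : i = 8 * t + n + 1
  · subst hc
    simp [linePair]
  by_cases h : i ≤ 8 * t
  · obtain ⟨s, r, hr, hs⟩ : ∃ s r, r < 8 ∧ i = 8 * s + r + 1 := ⟨(i - 1) / 8, (i - 1) % 8,
      by omega, by omega⟩
    rw [hs, linePair_low (by omega) hr]
    by_cases h5 : r = 0 ∨ r = 1 ∨ r = 4 ∨ r = 5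
    · rw [if_pos h5, show 8 * s + 6 - r = 8 * s + (5 - r) + 1 by omega,
        linePair_low (by omega) (by omega), if_pos (by omega)]
      omega
    · rw [if_neg h5, show 8 * s + 10 - r = 8 * s + (9 - r) + 1 by omega,
        linePair_low (by omega) (by omega), if_neg (by omega)]
      omega
  · unfold linePair
    split_ifs <;> omega

/-- Each pairing is a reflection `i ↦ c - i` on a block. The constants `16t + 2n + m + 2` and `16t +
3n + 2m + 3` are odd for these parities of `n` and `m`; so are the constants of the first handles
and the index of the corner line. -/
theorem even_linePair (hn : Even n) (hm : Odd m) {i : ℕ} (hi : i < 8 * t + 2 * n + 2 * m + 2) :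
    Even (linePair t n m i) ↔ ¬ Even i := by
  obtain ⟨a, rfl⟩ := hn
  obtain ⟨b, rfl⟩ := hm
  rw [Nat.even_iff, Nat.even_iff]
  unfold linePair
  split_ifs <;> omega

theorem partner_linePair (hn : 2 ≤ n) (hm : 2 ≤ m) {i : ℕ} (h0 : 0 < i)
    (hi : i < 8 * t + 2 * n + 2 * m + 2) (hc : i ≠ 8 * t + n + 1) :
    Partner (t + 1) (linePos t n m i) (linePos t n m (linePair t n m i)) := by
  obtain ⟨hx, hX⟩ := step_pos hn
  obtain ⟨hy, hY⟩ := step_pos hm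
  rcases line_cases hi with h | ⟨k, hk, rfl⟩ | rfl | ⟨k, hk, rfl⟩ | ⟨k, hk, rfl⟩ | ⟨k, hk, rfl⟩
  · obtain ⟨s, r, hr, hs⟩ : ∃ s r, r < 8 ∧ i = 8 * s + r + 1 := ⟨(i - 1) / 8, (i - 1) % 8,
      by omega, by omega⟩
    have hst : s < t := by omega
    by_cases h5 : r = 0 ∨ r = 1 ∨ r = 4 ∨ r = 5
    · have hp : linePair t n m i = 8 * s + 6 - r := by
        rw [hs, linePair_low hst hr, if_pos h5]
      rw [hp, linePos_low h0 h, linePos_low (by omega) (by omega), Nat.cast_sub (by omega), hs]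
      push_cast
      refine ⟨s, by omega, 0, by omega, ?_, by push_cast; ring⟩
      rcases h5 with rfl | rfl | rfl | rfl
      · exact Or.inl ⟨by push_cast; linarith, by push_cast; linarith⟩
      · exact Or.inl ⟨by push_cast; linarith, by push_cast; linarith⟩
      · exact Or.inr ⟨by push_cast; linarith, by push_cast; linarith⟩
      · exact Or.inr ⟨by push_cast; linarith, by push_cast; linarith⟩
    · have hp : linePair t n m i = 8 * s + 10 - r := by
        rw [hs, linePair_low hst hr, if_neg h5]
      rw [hp, linePos_low h0 h, linePos_low (by omega) (by omega), Nat.cast_sub (by omega), hs]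
      push_cast
      refine ⟨s, by omega, 1, by omega, ?_, by push_cast; ring⟩
      have h6 : r = 2 ∨ r = 3 ∨ r = 6 ∨ r = 7 := by omega
      rcases h6 with rfl | rfl | rfl | rfl
      · exact Or.inl ⟨by push_cast; linarith, by push_cast; linarith⟩
      · exact Or.inl ⟨by push_cast; linarith, by push_cast; linarith⟩
      · exact Or.inr ⟨by push_cast; linarith, by push_cast; linarith⟩
      · exact Or.inr ⟨by push_cast; linarith, by push_cast; linarith⟩
  · have hp : linePair t n m (8 * t + 1 + k) = 8 * t + n + m + 2 + (n - 1 - k) := by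
      unfold linePair
      rw [if_neg (by omega), if_neg hc, if_neg (by omega), if_pos (by omega)]
      omega
    have h1 := step_reflect hn hk
    have h2 := hX k hk
    rw [hp, linePos_fst hk, linePos_trd (by omega)]
    exact ⟨t, by omega, 0, by omega, Or.inl ⟨by push_cast; linarith [h2.1],
      by push_cast; linarith [h2.2]⟩, by push_cast; linarith⟩
  · exact absurd rfl hc
  · have hp : linePair t n m (8 * t + n + 2 + k) = 8 * t + 2 * n + m + 2 + (m - 1 - k) := by
      unfold linePair
      rw [if_neg (by omega), if_neg hc, if_neg (by omega), if_neg (by omega)]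
      omega
    have h1 := step_reflect hm hk
    have h2 := hY k hk
    rw [hp, linePos_snd hk, linePos_fth (by omega)]
    exact ⟨t, by omega, 1, by omega, Or.inl ⟨by push_cast; linarith [h2.1],
      by push_cast; linarith [h2.2]⟩, by push_cast; linarith⟩
  · have hp : linePair t n m (8 * t + n + m + 2 + k) = 8 * t + 1 + (n - 1 - k) := by
      unfold linePair
      rw [if_neg (by omega), if_neg hc, if_neg (by omega), if_pos (by omega)]
      omega
    have h1 := step_reflect hn hk
    have h2 := hX k hk
    rw [hp, linePos_trd hk, linePos_fst (by omega)]
    exact ⟨t, by omega, 0, by omega, Or.inr ⟨by push_cast; linarith [h2.1],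
      by push_cast; linarith [h2.2]⟩, by push_cast; linarith⟩
  · have hp : linePair t n m (8 * t + 2 * n + m + 2 + k) = 8 * t + n + 2 + (m - 1 - k) := by
      unfold linePair
      rw [if_neg (by omega), if_neg hc, if_neg (by omega), if_neg (by omega)]
      omega
    have h1 := step_reflect hm hk
    have h2 := hY k hk
    rw [hp, linePos_fth hk, linePos_snd (by omega)]
    exact ⟨t, by omega, 1, by omega, Or.inr ⟨by push_cast; linarith [h2.1],
      by push_cast; linarith [h2.2]⟩, by push_cast; linarith⟩

end Half

/-! ### The two pairings act transitively -/

/-- A set `P` of points on the chord which is invariant under the pairing of the half with one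
handle, and under the pairing of the blocks with index at least `d` of the other half. -/
structure InvariantSet (q s d : ℕ) (P : ℕ → Prop) : Prop where
  odd : q = 2 * s + 1
  pos : 0 < d
  le : 2 * d ≤ q
  one : P 1 ↔ P (4 * q + 2)
  two : P 2 ↔ P (4 * q + 1)
  refl : ∀ i j, 4 ≤ i → i < 8 * q → i ≠ 4 * q + 1 → i ≠ 4 * q + 2 → i + j = 8 * q + 3 → (P i ↔ P j)
  block0 : ∀ k, d ≤ k → k < q → (P (8 * k) ↔ P (8 * k + 5))
  block1 : ∀ k, d ≤ k → k < q → (P (8 * k + 1) ↔ P (8 * k + 4))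
  block2 : ∀ k, d ≤ k → k < q → (P (8 * k + 2) ↔ P (8 * k + 7))
  block3 : ∀ k, d ≤ k → k < q → (P (8 * k + 3) ↔ P (8 * k + 6))

namespace InvariantSet

variable {q s d : ℕ} {P : ℕ → Prop}

/-- Two applications of each pairing shift by one block of eight: `8k`, `8k + 5`, `8(q - k - 1) +
6`, `8(q - k - 1) + 3`, `8(k + 1)`. The middle block `k = s` is excluded because `8s + 5 = 4q + 1`
is an exceptional point of the first half. -/
theorem step_zero (h : InvariantSet q s d P) {k : ℕ} (h0 : d ≤ k) (h1 : k + d < q) (h2 : k ≠ s) :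
    P (8 * k) ↔ P (8 * (k + 1)) := by
  have hq := h.odd
  have hd := h.pos
  rw [h.block0 k h0 (by omega),
    h.refl _ (8 * (q - k - 1) + 6) (by omega) (by omega) (by omega) (by omega) (by omega),
    ← h.block3 _ (by omega) (by omega),
    h.refl _ (8 * (k + 1)) (by omega) (by omega) (by omega) (by omega) (by omega)]

theorem step_one (h : InvariantSet q s d P) {k : ℕ} (h0 : d ≤ k) (h1 : k + d < q) :
    P (8 * k + 1) ↔ P (8 * (k + 1) + 1) := by
  have hq := h.odd
  have hd := h.pos
  rw [h.block1 k h0 (by omega),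
    h.refl _ (8 * (q - k - 1) + 7) (by omega) (by omega) (by omega) (by omega) (by omega),
    ← h.block2 _ (by omega) (by omega),
    h.refl _ (8 * (k + 1) + 1) (by omega) (by omega) (by omega) (by omega) (by omega)]

theorem chain_left (h : InvariantSet q s d P) {k : ℕ} (h0 : d ≤ k) (h1 : k ≤ s) :
    P (8 * d) ↔ P (8 * k) := by
  have hq := h.odd
  have hle := h.le
  induction k, h0 using Nat.le_induction with
  | base => rfl
  | succ k hk ih => exact (ih (by omega)).trans (h.step_zero hk (by omega) (by omega))

theorem chain_right (h : InvariantSet q s d P) {k : ℕ} (h0 : s < k) (h1 : k + d ≤ q) :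
    P (8 * (s + 1)) ↔ P (8 * k) := by
  have hq := h.odd
  have hle := h.le
  induction k, (show s + 1 ≤ k from h0) using Nat.le_induction with
  | base => rfl
  | succ k hk ih => exact (ih (by omega) (by omega)).trans (h.step_zero (by omega) (by omega) (by omega))

theorem chain_one (h : InvariantSet q s d P) {k : ℕ} (h0 : d ≤ k) (h1 : k + d ≤ q) :
    P (8 * d + 1) ↔ P (8 * k + 1) := by
  induction k, h0 using Nat.le_induction with
  | base => rfl
  | succ k hk ih => exact (ih (by omega)).trans (h.step_one hk (by omega))

/-- The reflection sends the low block `k` to the high block `q - 1 - k`, where the pairing is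
regular, and a second reflection comes back. The lemmas of this kind bypass the unknown pairing on
the first `d` blocks. -/
theorem next_five (h : InvariantSet q s d P) {k : ℕ} (h0 : k < d) :
    P (8 * k + 5) ↔ P (8 * k + 8) := by
  have hq := h.odd
  have hle := h.le
  rw [h.refl _ (8 * (q - 1 - k) + 6) (by omega) (by omega) (by omega) (by omega) (by omega),
    ← h.block3 _ (by omega) (by omega),
    h.refl _ (8 * k + 8) (by omega) (by omega) (by omega) (by omega) (by omega)]

theorem next_six (h : InvariantSet q s d P) {k : ℕ} (h0 : k < d) :
    P (8 * k + 6) ↔ P (8 * (q - 1 - k)) := by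
  have hq := h.odd
  have hle := h.le
  rw [h.refl _ (8 * (q - 1 - k) + 5) (by omega) (by omega) (by omega) (by omega) (by omega),
    ← h.block0 _ (by omega) (by omega)]

theorem next_six' (h : InvariantSet q s d P) {k : ℕ} (h0 : k < d) :
    P (8 * k + 6) ↔ P (8 * k + 11) := by
  have hq := h.odd
  have hle := h.le
  rw [h.next_six h0,
    h.refl _ (8 * k + 11) (by omega) (by omega) (by omega) (by omega) (by omega)]

theorem next_four (h : InvariantSet q s d P) {k : ℕ} (h0 : k < d) :
    P (8 * k + 4) ↔ P (8 * k + 9) := by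
  have hq := h.odd
  have hle := h.le
  rw [h.refl _ (8 * (q - 1 - k) + 7) (by omega) (by omega) (by omega) (by omega) (by omega),
    ← h.block2 _ (by omega) (by omega),
    h.refl _ (8 * k + 9) (by omega) (by omega) (by omega) (by omega) (by omega)]

theorem next_seven (h : InvariantSet q s d P) {k : ℕ} (h0 : k < d) :
    P (8 * k + 7) ↔ P (8 * (q - 1 - k) + 1) := by
  have hq := h.odd
  have hle := h.le
  rw [h.refl _ (8 * (q - 1 - k) + 4) (by omega) (by omega) (by omega) (by omega) (by omega),
    ← h.block1 _ (by omega) (by omega)]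

theorem next_seven' (h : InvariantSet q s d P) {k : ℕ} (h0 : k < d) :
    P (8 * k + 7) ↔ P (8 * k + 10) := by
  have hq := h.odd
  have hle := h.le
  rw [h.next_seven h0,
    h.refl _ (8 * k + 10) (by omega) (by omega) (by omega) (by omega) (by omega)]

/-- Leaving the last low block, the orbit runs along the chain of blocks to the middle, where the
exceptional pairing of `4q + 1` with `2` brings it back to the start. The results for the other
residues likewise do not depend on `q`. -/
theorem last_five (h : InvariantSet q s d P) {k : ℕ} (hk : d = k + 1) : P (8 * k + 5) ↔ P 2 := by
  have hq := h.odd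
  have hle := h.le
  rw [h.next_five (by omega), show 8 * k + 8 = 8 * d by omega, h.chain_left (k := s) (by omega) le_rfl,
    h.block0 _ (by omega) (by omega), h.two, show 8 * s + 5 = 4 * q + 1 by omega]

theorem last_six (h : InvariantSet q s d P) {k : ℕ} (hk : d = k + 1) : P (8 * k + 6) ↔ P 1 := by
  have hq := h.odd
  have hle := h.le
  rw [h.next_six (by omega), ← h.chain_right (by omega) (by omega),
    h.refl _ (8 * s + 3) (by omega) (by omega) (by omega) (by omega) (by omega),
    h.block3 _ (by omega) (by omega), h.one, show 8 * s + 6 = 4 * q + 2 by omega]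

theorem last_four (h : InvariantSet q s d P) {k : ℕ} (hk : d = k + 1) :
    P (8 * k + 4) ↔ P (8 * k + 7) := by
  have hq := h.odd
  have hle := h.le
  rw [h.next_four (by omega), h.next_seven (by omega), show 8 * k + 9 = 8 * d + 1 by omega,
    h.chain_one (k := q - 1 - k) (by omega) (by omega)]

/-- The chains reach residues `0` and `1` of all blocks from the first `d` blocks, the reflection
then gives residues `2` and `3`, and the block pairing the rest. Only a problem on `8d` points
remains. -/
theorem of_initial (h : InvariantSet q s d P) (hP : ∀ j < 8 * d, P j) : ∀ j < 8 * q, P j := by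
  have hq := h.odd
  have hle := h.le
  have hd := h.pos
  obtain ⟨e, he⟩ : ∃ e, d = e + 1 := ⟨d - 1, by omega⟩
  have h0 : ∀ k < q, P (8 * k) := by
    intro k hk
    rcases lt_or_ge k d with h1 | h1
    · exact hP _ (by omega)
    by_cases h2 : k ≤ s
    · rw [← h.chain_left h1 h2, show 8 * d = 8 * e + 8 by omega, ← h.next_five (by omega)]
      exact hP _ (by omega)
    by_cases h3 : k + d ≤ q
    · rw [← h.chain_right (by omega) h3, h.chain_right (k := q - 1 - e) (by omega) (by omega),
        ← h.next_six (by omega)]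
      exact hP _ (by omega)
    · rw [h.refl _ (8 * (q - k) + 3) (by omega) (by omega) (by omega) (by omega) (by omega)]
      exact hP _ (by omega)
  have h1 : ∀ k < q, P (8 * k + 1) := by
    intro k hk
    rcases lt_or_ge k d with h1 | h1
    · exact hP _ (by omega)
    by_cases h3 : k + d ≤ q
    · rw [← h.chain_one h1 h3, show 8 * d + 1 = 8 * e + 9 by omega, ← h.next_four (by omega)]
      exact hP _ (by omega)
    · rw [h.refl _ (8 * (q - k) + 2) (by omega) (by omega) (by omega) (by omega) (by omega)]
      exact hP _ (by omega)
  have h3 : ∀ k, d ≤ k → k < q → P (8 * k + 3) := by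
    intro k hk hk'
    rw [h.refl _ (8 * (q - k)) (by omega) (by omega) (by omega) (by omega) (by omega)]
    exact h0 _ (by omega)
  have h2 : ∀ k, d ≤ k → k < q → P (8 * k + 2) := by
    intro k hk hk'
    rw [h.refl _ (8 * (q - k) + 1) (by omega) (by omega) (by omega) (by omega) (by omega)]
    exact h1 _ (by omega)
  intro j hj
  obtain ⟨k, r, hr, rfl⟩ : ∃ k r, r < 8 ∧ j = 8 * k + r := ⟨j / 8, j % 8, by omega, by omega⟩
  rcases lt_or_ge k d with hk | hk
  · exact hP _ (by omega)
  have hk' : k < q := by omega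
  interval_cases r
  · exact h0 k hk'
  · exact h1 k hk'
  · exact h2 k hk hk'
  · exact h3 k hk hk'
  · exact (h.block1 k hk hk').1 (h1 k hk')
  · exact (h.block0 k hk hk').1 (h0 k hk')
  · exact (h.block3 k hk hk').1 (h3 k hk hk')
  · exact (h.block2 k hk hk').1 (h2 k hk hk')

/-- The hypotheses are the pairing of the last handle for `n = 4`, `m = 3`; an explicit chase visits
all `16` initial points. -/
theorem of_two_blocks (h : InvariantSet q s 2 P) (h0 : P 0) (ha : P 0 ↔ P 11)
    (hb : ∀ i j, 12 ≤ i → i < 16 → i + j = 19 → (P i ↔ P j))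
    (hc : ∀ i j, 8 ≤ i → i < 11 → i + j = 11 → (P i ↔ P j)) : ∀ j < 8 * q, P j := by
  apply h.of_initial
  have p11 := ha.1 h0
  have p6 := (h.next_six' (k := 0) (by omega)).2 p11
  have p13 := (hb 13 6 (by omega) (by omega) rfl).2 p6
  have p2 := (h.last_five (k := 1) rfl).1 p13
  have p9 := (hc 9 2 (by omega) (by omega) rfl).2 p2
  have p4 := (h.next_four (k := 0) (by omega)).2 p9
  have p15 := (hb 15 4 (by omega) (by omega) rfl).2 p4
  have p12 := (h.last_four (k := 1) rfl).2 p15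
  have p7 := (hb 12 7 (by omega) (by omega) rfl).1 p12
  have p10 := (h.next_seven' (k := 0) (by omega)).1 p7
  have p1 := (hc 10 1 (by omega) (by omega) rfl).1 p10
  have p14 := (h.last_six (k := 1) rfl).2 p1
  have p5 := (hb 14 5 (by omega) (by omega) rfl).1 p14
  have p8 := (h.next_five (k := 0) (by omega)).1 p5
  have p3 := (hc 8 3 (by omega) (by omega) rfl).1 p8
  intro j hj
  interval_cases j <;> assumption

/-- The same chase for `n = 6`, `m = 5`, with `24` initial points. -/
theorem of_three_blocks (h : InvariantSet q s 3 P) (h0 : P 0) (ha : P 0 ↔ P 17)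
    (hb : ∀ i j, 18 ≤ i → i < 24 → i + j = 29 → (P i ↔ P j))
    (hc : ∀ i j, 12 ≤ i → i < 17 → i + j = 17 → (P i ↔ P j)) : ∀ j < 8 * q, P j := by
  apply h.of_initial
  have p17 := ha.1 h0
  have p12 := (h.next_four (k := 1) (by omega)).2 p17
  have p5 := (hc 12 5 (by omega) (by omega) rfl).1 p12
  have p8 := (h.next_five (k := 0) (by omega)).1 p5
  have p21 := (hb 21 8 (by omega) (by omega) rfl).2 p8
  have p2 := (h.last_five (k := 2) rfl).1 p21
  have p15 := (hc 15 2 (by omega) (by omega) rfl).2 p2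
  have p18 := (h.next_seven' (k := 1) (by omega)).1 p15
  have p11 := (hb 18 11 (by omega) (by omega) rfl).1 p18
  have p6 := (h.next_six' (k := 0) (by omega)).2 p11
  have p23 := (hb 23 6 (by omega) (by omega) rfl).2 p6
  have p20 := (h.last_four (k := 2) rfl).2 p23
  have p9 := (hb 20 9 (by omega) (by omega) rfl).1 p20
  have p4 := (h.next_four (k := 0) (by omega)).2 p9
  have p13 := (hc 13 4 (by omega) (by omega) rfl).2 p4
  have p16 := (h.next_five (k := 1) (by omega)).1 p13
  have p1 := (hc 16 1 (by omega) (by omega) rfl).1 p16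
  have p22 := (h.last_six (k := 2) rfl).2 p1
  have p7 := (hb 22 7 (by omega) (by omega) rfl).1 p22
  have p10 := (h.next_seven' (k := 0) (by omega)).1 p7
  have p19 := (hb 19 10 (by omega) (by omega) rfl).2 p10
  have p14 := (h.next_six' (k := 1) (by omega)).2 p19
  have p3 := (hc 14 3 (by omega) (by omega) rfl).1 p14
  intro j hj
  interval_cases j <;> assumption

end InvariantSet

/-- The pairing `linePair` in terms of the coordinate on the chord, which runs backwards. -/
def chordPair (t n m j : ℕ) : ℕ :=
  (8 * t + 2 * n + 2 * m + 2 - linePair t n m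
    ((8 * t + 2 * n + 2 * m + 2 - j) % (8 * t + 2 * n + 2 * m + 2))) % (8 * t + 2 * n + 2 * m + 2)

section Half

variable {t n m : ℕ}

theorem chordPair_zero (hn : 2 ≤ n) : chordPair t n m 0 = n + 2 * m + 1 := by
  unfold chordPair
  rw [Nat.sub_zero, Nat.mod_self]
  unfold linePair
  rw [if_pos rfl, Nat.mod_eq_of_lt (by omega)]
  omega

theorem chordPair_eq {i j : ℕ} (hi : 0 < i) (hj : 0 < j)
    (hij : i + j = 8 * t + 2 * n + 2 * m + 2) :
    chordPair t n m j =
      (8 * t + 2 * n + 2 * m + 2 - linePair t n m i) % (8 * t + 2 * n + 2 * m + 2) := by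
  unfold chordPair
  rw [Nat.mod_eq_of_lt (a := 8 * t + 2 * n + 2 * m + 2 - j) (by omega),
    show 8 * t + 2 * n + 2 * m + 2 - j = i by omega]

theorem chordPair_involutive (hn : 2 ≤ n) (hm : 2 ≤ m) {j : ℕ}
    (hj : j < 8 * t + 2 * n + 2 * m + 2) : chordPair t n m (chordPair t n m j) = j := by
  have key : ∀ i < 8 * t + 2 * n + 2 * m + 2, (8 * t + 2 * n + 2 * m + 2 -
      (8 * t + 2 * n + 2 * m + 2 - i) % (8 * t + 2 * n + 2 * m + 2)) %
        (8 * t + 2 * n + 2 * m + 2) = i := by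
    intro i hi
    rcases Nat.eq_zero_or_pos i with rfl | h
    · simp
    · rw [Nat.mod_eq_of_lt (a := 8 * t + 2 * n + 2 * m + 2 - i) (by omega),
        Nat.sub_sub_self hi.le, Nat.mod_eq_of_lt hi]
  have hi : (8 * t + 2 * n + 2 * m + 2 - j) % (8 * t + 2 * n + 2 * m + 2) <
      8 * t + 2 * n + 2 * m + 2 := Nat.mod_lt _ (by omega)
  unfold chordPair
  rw [key _ (linePair_lt hn hm hi), linePair_linePair hn hm hi, key _ hj]

theorem even_chordPair (hn : Even n) (hm : Odd m) (hn2 : 2 ≤ n) (hm2 : 2 ≤ m) {j : ℕ}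
    (hj : j < 8 * t + 2 * n + 2 * m + 2) : Even (chordPair t n m j) ↔ ¬ Even j := by
  have hi : (8 * t + 2 * n + 2 * m + 2 - j) % (8 * t + 2 * n + 2 * m + 2) <
      8 * t + 2 * n + 2 * m + 2 := Nat.mod_lt _ (by omega)
  have h1 := even_linePair hn hm hi
  have h2 := linePair_lt hn2 hm2 hi
  unfold chordPair
  generalize linePair t n m _ = l at *
  have hd : 2 ∣ 8 * t + 2 * n + 2 * m + 2 := by omega
  rw [Nat.even_iff, Nat.even_iff, Nat.mod_mod_of_dvd _ hd] at *
  omega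

theorem chordPair_block {q k r : ℕ} (hq : 8 * t + 2 * n + 2 * m + 2 = 8 * q) (hk : q ≤ k + t)
    (hk' : k < q) (hk0 : 0 < k) (hr : r < 8) : chordPair t n m (8 * k + r) =
      if r = 0 ∨ r = 1 ∨ r = 4 ∨ r = 5 then 8 * k + 5 - r else 8 * k + 9 - r := by
  rw [chordPair_eq (i := 8 * (q - k - 1) + (7 - r) + 1) (by omega) (by omega) (by omega), hq,
    linePair_low (by omega) (by omega), Nat.mod_eq_of_lt (by split_ifs <;> omega)]
  split_ifs <;> omega

theorem chordPair_snd {i j : ℕ} (hi : n + m + 1 ≤ i) (hi' : i ≤ n + 2 * m)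
    (hij : i + j = n + 2 * m + 1) : chordPair t n m i = j := by
  rw [chordPair_eq (i := 8 * t + 2 * n + 2 * m + 2 - i) (by omega) (by omega) (by omega)]
  unfold linePair
  rw [if_neg (by omega), if_neg (by omega), if_neg (by omega), if_neg (by omega),
    Nat.mod_eq_of_lt (by omega)]
  omega

theorem chordPair_fst {i j : ℕ} (hi : n + 2 * m + 2 ≤ i) (hi' : i ≤ 2 * n + 2 * m + 1)
    (hij : i + j = 2 * n + 3 * m + 2) : chordPair t n m i = j := by
  rw [chordPair_eq (i := 8 * t + 2 * n + 2 * m + 2 - i) (by omega) (by omega) (by omega)]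
  unfold linePair
  rw [if_neg (by omega), if_neg (by omega), if_neg (by omega), if_pos (by omega),
    Nat.mod_eq_of_lt (by omega)]
  omega

end Half

theorem InvariantSet.of_pairs {t n m q s d : ℕ} {P : ℕ → Prop} (hs : q = 2 * s + 1) (hd : 0 < d)
    (hdq : 2 * d ≤ q) (ht : q = d + t) (hq : 8 * t + 2 * n + 2 * m + 2 = 8 * q)
    (hτ : ∀ j < 8 * q, (P (linePair 0 2 (4 * q - 3) j) ↔ P j))
    (hβ : ∀ j < 8 * q, (P (chordPair t n m j) ↔ P j)) : InvariantSet q s d P := by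
  have hb : ∀ k, d ≤ k → k < q → ∀ r < 8, (P (8 * k + r) ↔
      P (if r = 0 ∨ r = 1 ∨ r = 4 ∨ r = 5 then 8 * k + 5 - r else 8 * k + 9 - r)) := by
    intro k hk hk' r hr
    rw [← hβ _ (by omega), chordPair_block hq (by omega) hk' (by omega) hr]
  refine ⟨hs, hd, hdq, ?_, ?_, ?_, ?_, ?_, ?_, ?_⟩
  · rw [← hτ 1 (by omega)]
    unfold linePair
    rw [if_neg (by omega), if_neg (by omega), if_neg (by omega), if_pos (by omega)]
    rw [show 16 * 0 + 2 * 2 + (4 * q - 3) + 2 - 1 = 4 * q + 2 by omega]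
  · rw [← hτ 2 (by omega)]
    unfold linePair
    rw [if_neg (by omega), if_neg (by omega), if_neg (by omega), if_pos (by omega)]
    rw [show 16 * 0 + 2 * 2 + (4 * q - 3) + 2 - 2 = 4 * q + 1 by omega]
  · intro i j h1 h2 h3 h4 h5
    rw [← hτ i h2]
    unfold linePair
    rw [if_neg (by omega), if_neg (by omega), if_neg (by omega), if_neg (by omega),
      show 16 * 0 + 3 * 2 + 2 * (4 * q - 3) + 3 - i = j by omega]
  · intro k h1 h2
    exact hb k h1 h2 0 (by norm_num)
  · intro k h1 h2
    exact hb k h1 h2 1 (by norm_num)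
  · intro k h1 h2
    exact hb k h1 h2 2 (by norm_num)
  · intro k h1 h2
    exact hb k h1 h2 3 (by norm_num)

/-- The two pairings act transitively for a suitable number of lines. -/
theorem exists_transitive (t : ℕ) : ∃ n m q : ℕ, Even n ∧ Odd m ∧ 2 ≤ n ∧ 2 ≤ m ∧ 3 ≤ q ∧
    q ≤ t + 3 ∧ 8 * t + 2 * n + 2 * m + 2 = 8 * q ∧
    ∀ P : ℕ → Prop, P 0 → (∀ j < 8 * q, P j → P (linePair 0 2 (4 * q - 3) j)) →
      (∀ j < 8 * q, P j → P (chordPair t n m j)) → ∀ j < 8 * q, P j := by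
  -- Finite verification: the orbit of `0` under the composite of the two involutions, together with
  -- its image under the first one, exhausts all points.
  have small : ∀ t n m N c K : ℕ, ∀ f : ℕ → ℕ,
      f = (fun j => chordPair t n m (linePair 0 2 c j)) →
      (∀ k < K, f^[k] 0 < N ∧ linePair 0 2 c (f^[k] 0) < N) →
      (∀ j < N, ∃ k < K, f^[k] 0 = j ∨ linePair 0 2 c (f^[k] 0) = j) →
      ∀ P : ℕ → Prop, P 0 → (∀ j < N, P j → P (linePair 0 2 c j)) →
        (∀ j < N, P j → P (chordPair t n m j)) → ∀ j < N, P j := by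
    intro t n m N c K f hf hlt hall P h0 hτ hβ
    have h : ∀ k < K, P (f^[k] 0) := by
      intro k
      induction k with
      | zero => exact fun _ => h0
      | succ k ih =>
        intro hk
        rw [Function.iterate_succ_apply', congrFun hf (f^[k] 0)]
        obtain ⟨h1, h2⟩ := hlt k (by omega)
        exact hβ _ h2 (hτ _ h1 (ih (by omega)))
    intro j hj
    obtain ⟨k, hk, h1 | h1⟩ := hall j hj
    · exact h1 ▸ h k hk
    · exact h1 ▸ hτ _ (hlt k hk).1 (h k hk)
  have iffs : ∀ {N : ℕ} {f : ℕ → ℕ} {P : ℕ → Prop}, (∀ j < N, f j < N ∧ f (f j) = j) →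
      (∀ j < N, P j → P (f j)) → ∀ j < N, (P (f j) ↔ P j) := by
    intro N f P hf h j hj
    exact ⟨fun h' => (hf j hj).2 ▸ h _ (hf j hj).1 h', h j hj⟩
  have hτ : ∀ q, 3 ≤ q → ∀ j < 8 * q, linePair 0 2 (4 * q - 3) j < 8 * q ∧
      linePair 0 2 (4 * q - 3) (linePair 0 2 (4 * q - 3) j) = j := by
    intro q hq j hj
    have h1 : 8 * 0 + 2 * 2 + 2 * (4 * q - 3) + 2 = 8 * q := by omega
    rw [← h1] at hj ⊢
    exact ⟨linePair_lt le_rfl (by omega) hj, linePair_linePair le_rfl (by omega) hj⟩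
  rcases Nat.even_or_odd' t with ⟨a, rfl | rfl⟩
  -- The last handle and the corner line fill three blocks for `(6, 5)` and two for `(4, 3)`; the
  -- parity of `t` decides which choice makes the number of blocks `q` odd. The block argument needs
  -- `2 * d ≤ q`, and the smaller values of `a` are computed directly.
  · refine ⟨6, 5, 2 * a + 3, by decide, by decide, by omega, by omega, by omega, by omega,
      by omega, ?_⟩
    rcases lt_or_ge a 2 with ha | ha
    · interval_cases a
      · exact small 0 6 5 24 9 12 _ rfl (by decide +kernel) (by decide +kernel)
      · exact small 2 6 5 40 17 20 _ rfl (by decide +kernel) (by decide +kernel)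
    · intro P h0 h1 h2
      have hβ := iffs (f := chordPair (2 * a) 6 5) (N := 8 * (2 * a + 3)) (fun j hj =>
        ⟨(Nat.mod_lt _ (by omega)).trans_eq (by omega), chordPair_involutive (by omega) (by omega) (by omega)⟩) h2
      refine (InvariantSet.of_pairs (t := 2 * a) (n := 6) (m := 5) (s := a + 1) (d := 3) (by omega)
        (by omega) (by omega) (by omega) (by omega) (iffs (hτ _ (by omega)) h1) hβ).of_three_blocks
          h0 ?_ ?_ ?_
      · rw [← hβ 0 (by omega), chordPair_zero (by omega)]
      · intro i j hi hi' hij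
        rw [← hβ i (by omega), chordPair_fst (by omega) (by omega) (by omega)]
      · intro i j hi hi' hij
        rw [← hβ i (by omega), chordPair_snd (by omega) (by omega) (by omega)]
  · refine ⟨4, 3, 2 * a + 3, by decide, by decide, by omega, by omega, by omega, by omega,
      by omega, ?_⟩
    rcases lt_or_ge a 1 with ha | ha
    · interval_cases a
      exact small 1 4 3 24 9 12 _ rfl (by decide +kernel) (by decide +kernel)
    · intro P h0 h1 h2
      have hβ := iffs (f := chordPair (2 * a + 1) 4 3) (N := 8 * (2 * a + 3)) (fun j hj =>
        ⟨(Nat.mod_lt _ (by omega)).trans_eq (by omega), chordPair_involutive (by omega) (by omega) (by omega)⟩) h2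
      refine (InvariantSet.of_pairs (t := 2 * a + 1) (n := 4) (m := 3) (s := a + 1) (d := 2)
        (by omega) (by omega) (by omega) (by omega) (by omega) (iffs (hτ _ (by omega)) h1)
          hβ).of_two_blocks h0 ?_ ?_ ?_
      · rw [← hβ 0 (by omega), chordPair_zero (by omega)]
      · intro i j hi hi' hij
        rw [← hβ i (by omega), chordPair_fst (by omega) (by omega) (by omega)]
      · intro i j hi hi' hij
        rw [← hβ i (by omega), chordPair_snd (by omega) (by omega) (by omega)]

/-! ### Existence of suitable lines -/

/-- The index in a half of the point `j` on the chord. -/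
def lineIndex (N : ℕ) (b : Bool) (j : ℕ) : ℕ := cond b j (N - j)

theorem chordPair_eq_lineIndex {t n m j : ℕ} (hn : 2 ≤ n) (hm : 2 ≤ m) (h0 : 0 < j)
    (hj : j < 8 * t + 2 * n + 2 * m + 2) (hc : 8 * t + 2 * n + 2 * m + 2 - j ≠ 8 * t + n + 1) :
    chordPair t n m j = 8 * t + 2 * n + 2 * m + 2 -
      linePair t n m (8 * t + 2 * n + 2 * m + 2 - j) := by
  rw [chordPair_eq (i := 8 * t + 2 * n + 2 * m + 2 - j) (by omega) h0 (by omega)]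
  have := linePair_pos hn hm hc (by omega)
  exact Nat.mod_eq_of_lt (by omega)

/-- The half with one handle has `2` and `4q - 3` lines on its sides, so that both halves have the
same number of lines. The homeomorphisms `E` place them at the positions `linePos` over the integers
of the chord. -/
theorem exists_frame_lines (t : ℕ) : ∃ F : Frame, F.m true = 1 ∧ F.m false = t + 1 ∧
    F.N ≤ 8 * (t + 1) + 16 ∧ Nonempty F.Lines := by
  obtain ⟨n, m, q, hn, hm, hn2, hm2, hq3, hqt, hq, htrans⟩ := exists_transitive t
  obtain ⟨T, hT1, hT2⟩ : ∃ T : Bool → ℕ, T true = 0 ∧ T false = t := ⟨(cond · 0 t), rfl, rfl⟩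
  obtain ⟨A, hA1, hA2⟩ : ∃ A : Bool → ℕ, A true = 2 ∧ A false = n := ⟨(cond · 2 n), rfl, rfl⟩
  obtain ⟨B, hB1, hB2⟩ : ∃ B : Bool → ℕ, B true = 4 * q - 3 ∧ B false = m :=
    ⟨(cond · (4 * q - 3) m), rfl, rfl⟩
  have hN : ∀ b, 8 * T b + 2 * A b + 2 * B b + 2 = 8 * q := by
    rintro (_ | _) <;> omega
  have hA : ∀ b, 2 ≤ A b := by rintro (_ | _) <;> omega
  have hB : ∀ b, 2 ≤ B b := by rintro (_ | _) <;> omega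
  have hAe : ∀ b, Even (A b) := by
    rintro (_ | _)
    · rwa [hA2]
    · rw [hA1]
      decide
  have hBo : ∀ b, Odd (B b) := by
    rintro (_ | _)
    · rwa [hB2]
    · rw [hB1, Nat.odd_iff]
      omega
  have hE : ∀ b, ∃ E : ℝ ≃o ℝ, ∀ j ≤ 8 * q, E (j : ℕ) = linePos (T b) (A b) (B b) j := fun b =>
    exists_orderIso_interpolating _ _ fun j hj => linePos_lt (hA b) (hB b) (by rwa [hN b])
  choose E hE using hE
  let F : Frame :=
    { m := fun b => T b + 1
      N := 8 * q
      E := E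
      m_pos := fun b => Nat.succ_pos _
      N_pos := by omega
      E_zero := fun b => by simpa [linePos_zero] using hE b 0 (Nat.zero_le _)
      E_N := fun b => by
        rw [hE b _ le_rfl, ← hN b, linePos_end]
        push_cast
        ring }
  have hFN : F.N = 8 * q := rfl
  have hFm : ∀ b, (4 * F.m b - 3 : ℝ) = 4 * T b + 1 := by
    intro b
    change (4 * ((T b + 1 : ℕ) : ℝ) - 3 : ℝ) = _
    push_cast
    ring
  have hbdry : ∀ b, ∀ j ≤ 8 * q,
      F.bdry b (j : ℕ) = linePos (T b) (A b) (B b) (lineIndex (8 * q) b j) := by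
    rintro (_ | _) j hj
    · change E false (((8 * q : ℕ) : ℝ) - j) = _
      rw [← Nat.cast_sub hj]
      exact hE false _ (Nat.sub_le _ _)
    · exact hE true j hj
  have hidx : ∀ b, ∀ j, 0 < j → j < 8 * q →
      0 < lineIndex (8 * q) b j ∧ lineIndex (8 * q) b j < 8 * q := by
    rintro (_ | _) j h0 hj
    · exact ⟨Nat.sub_pos_of_lt hj, Nat.sub_lt (by omega) h0⟩
    · exact ⟨h0, hj⟩
  have hinv : ∀ b, ∀ i ≤ 8 * q, lineIndex (8 * q) b (lineIndex (8 * q) b i) = i := by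
    rintro (_ | _) i hi
    · exact Nat.sub_sub_self hi
    · rfl
  have hodd : ∀ b i i', i ≤ 8 * q → i' ≤ 8 * q → (Even i' ↔ ¬ Even i) →
      Odd (lineIndex (8 * q) b i + lineIndex (8 * q) b i') := by
    rintro (_ | _) i i' hi hi' h
    · rw [Nat.even_iff, Nat.even_iff] at h
      rw [Nat.odd_iff]
      change (8 * q - i + (8 * q - i')) % 2 = 1
      omega
    · rw [Nat.even_iff, Nat.even_iff] at h
      rw [Nat.odd_iff]
      change (i + i') % 2 = 1
      omega
  have hpart : ∀ b j, 0 < j → j < 8 * q →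
      lineIndex (8 * q) b j ≠ 8 * T b + A b + 1 → ∃ j', j' = lineIndex (8 * q) b
        (linePair (T b) (A b) (B b) (lineIndex (8 * q) b j)) ∧ 0 < j' ∧ j' < 8 * q ∧
        Odd (j + j') ∧ Partner (F.m b) (F.bdry b j) (F.bdry b j') := by
    intro b j h0 hj hc
    obtain ⟨h1, h2'⟩ := hidx b j h0 hj
    have h2 := h2'.trans_eq (hN b).symm
    have h3 := (linePair_lt (hA b) (hB b) h2).trans_eq (hN b)
    have h4 := linePair_pos (hA b) (hB b) hc h2
    have h5 := even_linePair (hAe b) (hBo b) h2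
    have h6 := partner_linePair (hA b) (hB b) h1 h2 hc
    obtain ⟨h7, h8⟩ := hidx b _ h4 h3
    refine ⟨_, rfl, h7, h8, ?_, ?_⟩
    · have := hodd b _ _ h2'.le h3.le h5
      rwa [hinv b j hj.le] at this
    · rw [hbdry b _ hj.le, hbdry b _ h8.le, hinv b _ h3.le]
      exact h6
  have hne : ∀ b j, j ≤ 8 * q → F.bdry b (j : ℕ) ≠ 4 * F.m b - 3 →
      lineIndex (8 * q) b j ≠ 8 * T b + A b + 1 := by
    intro b j hj h h'
    rw [hbdry b j hj, h', linePos_corner, hFm] at h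
    exact h rfl
  have htop : ∀ j < 8 * q, linePair 0 2 (4 * q - 3) j < 8 * q ∧
      linePair 0 2 (4 * q - 3) (linePair 0 2 (4 * q - 3) j) = j ∧
      (Even (linePair 0 2 (4 * q - 3) j) ↔ ¬ Even j) := by
    intro j hj
    have h1 := hN true
    have h2 := hAe true
    have h3 := hBo true
    rw [hT1, hA1, hB1] at h1
    rw [hA1] at h2
    rw [hB1] at h3
    rw [← h1] at hj
    exact ⟨(linePair_lt le_rfl (by omega) hj).trans_eq h1, linePair_linePair le_rfl (by omega) hj,
      even_linePair h2 h3 hj⟩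
  have hbot : ∀ j < 8 * q, chordPair t n m j < 8 * q ∧ chordPair t n m (chordPair t n m j) = j ∧
      (Even (chordPair t n m j) ↔ ¬ Even j) := by
    intro j hj
    rw [← hq] at hj
    exact ⟨(Nat.mod_lt _ (by omega)).trans_eq hq, chordPair_involutive hn2 hm2 hj,
      even_chordPair hn hm hn2 hm2 hj⟩
  -- The cycle starts and ends at `0`, the vertex. Hence its first and last lines are the ones
  -- paired with the vertex, namely those ending at a corner of the half `true` and of the half
  -- `false`.
  obtain ⟨p, hp0, hpN, hplt, hpe, hpo, hpi⟩ := exists_alternating (by omega) htop hbot htrans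
  have hp1 : p 1 = 3 := by
    rw [hpe 0 Even.zero, hp0]
    simp [linePair]
  have hpl : p (8 * q - 1) = n + 2 * m + 1 := by
    have h1 := hpo (8 * q - 1) (by rw [Nat.even_iff]; omega)
    rw [Nat.sub_add_cancel (by omega), hpN] at h1
    rw [← (hbot _ (hplt (8 * q - 1))).2.1, ← h1, chordPair_zero hn2]
  have hp_pos : ∀ k, 0 < k → k < 8 * q → 0 < p k := by
    intro k h0 hk
    refine Nat.pos_of_ne_zero fun h => h0.ne' ?_
    exact hpi hk (show 0 < 8 * q by omega) (h.trans hp0.symm)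
  have hpnext : ∀ b k, (b = true ↔ Even k) → 0 < k → k + 1 < 8 * q →
      lineIndex (8 * q) b (p k) ≠ 8 * T b + A b + 1 ∧ p (k + 1) = lineIndex (8 * q) b
        (linePair (T b) (A b) (B b) (lineIndex (8 * q) b (p k))) := by
    intro b k hb h0 hk
    have h1 := hp_pos (k + 1) (by omega) hk
    have h2 := hp_pos k h0 (by omega)
    cases b
    · have hk' : ¬ Even k := fun h => by simpa using hb.2 h
      rw [hT2, hA2, hB2]
      change 8 * q - p k ≠ _ ∧ p (k + 1) = 8 * q - linePair t n m (8 * q - p k)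
      have hc : 8 * q - p k ≠ 8 * t + n + 1 := by
        intro hc
        have h3 : p k = n + 2 * m + 1 := by omega
        rw [hpo k hk', h3, ← chordPair_zero (t := t) (m := m) hn2, (hbot 0 (by omega)).2.1] at h1
        exact h1.false
      refine ⟨hc, ?_⟩
      rw [hpo k hk', chordPair_eq_lineIndex hn2 hm2 h2 (by rw [hq]; exact hplt k)
        (by rw [hq]; exact hc), hq]
    · rw [hT1, hA1, hB1]
      change p k ≠ _ ∧ p (k + 1) = linePair 0 2 (4 * q - 3) (p k)
      refine ⟨fun hc => ?_, hpe k (hb.1 rfl)⟩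
      rw [hpe k (hb.1 rfl), hc] at h1
      simp [linePair] at h1
  refine ⟨F, by change T true + 1 = 1; omega, by change T false + 1 = t + 1; omega,
    by omega, ⟨?_⟩⟩
  exact
    { even_N := by rw [hFN, Nat.even_iff]; omega
      quarter := fun b j h0 hj => by
        obtain ⟨h1, h2⟩ := hidx b j h0 hj
        rw [hFm, hbdry b j (le_of_lt hj)]
        exact linePos_quarter (hA b) (hB b) h1 (by rwa [hN b])
      exists_quarter := fun b k h0 hk => by
        have h1 : k < 4 * T b + 4 := by
          change k < 4 * ((T b + 1 : ℕ) : ℤ) at hk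
          push_cast at hk
          linarith
        obtain ⟨⟨i, h2, h3, h4⟩, i', h5, h6, h7⟩ := exists_linePos_quarter (hA b) (hB b) h0 h1
        rw [hN b] at h3 h6
        obtain ⟨h8, h9⟩ := hidx b i h2 h3
        obtain ⟨h10, h11⟩ := hidx b i' h5 h6
        exact ⟨⟨_, h8, h9, by rw [hbdry b _ h9.le, hinv b _ h3.le, h4]⟩, _, h10, h11,
          by rw [hbdry b _ h11.le, hinv b _ h6.le, h7]⟩
      exists_corner := fun b => by
        have h1 := hN b
        have h2 := hA b
        obtain ⟨h3, h4⟩ := hidx b (8 * T b + A b + 1) (by omega) (by omega)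
        exact ⟨_, h3, h4, by rw [hbdry b _ h4.le, hinv b _ (by omega), linePos_corner, hFm]⟩
      exists_partner := fun b j h0 hj hc => by
        obtain ⟨j', -, h⟩ := hpart b j h0 hj (hne b j (le_of_lt hj) hc)
        exact ⟨j', h⟩
      p := p
      p_mem := fun k h0 hk => ⟨hp_pos k h0 hk, hplt k⟩
      p_inj := fun k l _ hk _ hl h => hpi hk hl h
      p_first := by
        rw [hp1, hbdry true 3 (by omega), hFm, hT1, hA1, hB1]
        exact linePos_corner
      p_last := by
        rw [hFN, hpl, hbdry false _ (by omega), hFm, hT2, hA2, hB2]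
        change linePos t n m (8 * q - (n + 2 * m + 1)) = _
        rw [show 8 * q - (n + 2 * m + 1) = 8 * t + n + 1 by omega, linePos_corner]
      p_partner := fun b k hb h0 hk => by
        obtain ⟨h1, h2⟩ := hpnext b k hb h0 hk
        obtain ⟨j', h3, -, -, -, h4⟩ :=
          hpart b (p k) (hp_pos k h0 (Nat.lt_of_succ_lt hk)) (hplt k) h1
        rwa [h2, ← h3] }

end SurfaceCurves

end

/-! ### The uniform constant -/

theorem mainTheorem8 :
    ∃ C : ℝ, 0 ≤ C ∧ ∀ g p : ℕ, 2 ≤ g → (p = 0 ∨ p = 1) →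
      ∃ α β : SurfaceCurves.ClosedCurve (SurfaceCurves.Surface g p),
        SurfaceCurves.IsFillingPair α β ∧
        SurfaceCurves.IsSeparating α ∧ SurfaceCurves.IsSeparating β ∧
        ∃ n : ℕ, SurfaceCurves.geomInt α β = n ∧
          (n : ℝ) ≤ C * (SurfaceCurves.complexity g p : ℝ) := by
  -- The bound on the lines gives `N ≤ 8g + 8`, and `8g + 8 ≤ 12 (3g - 4)` holds exactly for `g ≥
  -- 2`, with equality at `g = 2`.
  refine ⟨12, by norm_num, fun g p hg hp => ?_⟩
  obtain ⟨F, h1, h2, hN, ⟨Λ⟩⟩ := SurfaceCurves.exists_frame_lines (g - 2)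
  obtain rfl : F.g = g := by
    rw [SurfaceCurves.Frame.g, h1, h2]
    omega
  obtain ⟨α, β, hf, hα, hβ, hi⟩ := SurfaceCurves.Frame.exists_filling_pair Λ h1 hp
  refine ⟨α, β, hf, hα, hβ, F.N, hi, ?_⟩
  have h3 : (F.N : ℤ) ≤ 12 * SurfaceCurves.complexity F.g p := by
    unfold SurfaceCurves.complexity
    omega
  exact_mod_cast h3
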